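/- Let $G=(V,E)$ be an undirected graph with $n\ge 1$ vertices and $m$ edges and with edge lengths $w:E\to\mathbb R_{\ge 0}$, and let $f,k\ge 1$ be integers. For a subgraph $X$ of $G$ let $d_X$ be the shortest-path distance in $X$ with respect to $w$ (infinite between disconnected vertices). A subgraph $H$ of $G$ on the vertex set $V$ is an $f$-vertex fault tolerant ($f$-VFT) $t$-spanner of $G$ if $d_{H\setminus F}(u,v)\le t\cdot d_{G\setminus F}(u,v)$ for all $u,v\in V$ and all $F\subseteq V\setminus\{u,v\}$ with $|F|\le f$. There is a deterministic algorithm which, given $(G,w)$, $f$ and $k$, constructs an $f$-VFT $(2k-1)$-spanner of $G$ with at most $O(f^{1-1/k}n^{1+1/k})$ edges in time $$\tilde O\left(f^{4-1/k}n^{2+1/k}+mf^5\right).$$ Moreover, for every constant $c>0$ there is such a deterministic algorithm whose running time improves to $$\tilde O\left(f^{1-1/k}n^{2+1/k}+mf^2\right)$$ on all inputs with $f\ge n^c$; here the constants hidden in the size bound and in the running time may depend on $c$. In all other cases the hidden constants are absolute (independent of $G,w,n,m,f,k$), and $\tilde O$ hides a factor polylogarithmic in $n$. Running time is the number of steps on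 a word RAM with words of $\Theta(\log n)$ bits or more, in which $f$ and $k$ fit into words; the edge lengths are accessed only by comparing two of them in one step. -/

import Mathlib

open scoped NNReal ENNReal

/-! ## Fault-tolerant spanners of weighted graphs -/

namespace VFTSpanner

/-- The shortest-path distance `d_G(u,v)` with respect to nonnegative edge lengths `w`;
it is `⊤` when `u` and `v` are not connected. Only the values of `w` on edges of `G` matter. -/
noncomputable def wdist {V : Type*} (G : SimpleGraph V) (w : Sym2 V → ℝ≥0) (u v : V) : ℝ≥0∞ :=
  ⨅ p : G.Walk u v, (p.edges.map fun e => (w e : ℝ≥0∞)).sum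

/-- `G ∖ F`, presented on the old vertex set: every edge with an endpoint in `F` is deleted.
It is only used for distances between vertices outside `F`. -/
def removeVerts {V : Type*} (G : SimpleGraph V) (F : Finset V) : SimpleGraph V where
  Adj u v := G.Adj u v ∧ u ∉ F ∧ v ∉ F
  symm := ⟨fun _ _ h => ⟨h.1.symm, h.2.2, h.2.1⟩⟩
  loopless := ⟨fun _ h => h.1.ne rfl⟩

/-- `H` is an `f`-vertex fault tolerant `t`-spanner of the weighted graph `(G, w)`. -/
def IsVFTSpanner {V : Type*} (f t : ℕ) (G : SimpleGraph V) (w : Sym2 V → ℝ≥0)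
    (H : SimpleGraph V) : Prop :=
  H ≤ G ∧ ∀ (u v : V) (F : Finset V), u ∉ F → v ∉ F → F.card ≤ f →
    wdist (removeVerts H F) w u v ≤ (t : ℝ≥0∞) * wdist (removeVerts G F) w u v

/-! ## A word RAM with a step count

Words have `W` bits; registers and memory cells hold words and memory is addressed by words.
The real edge lengths are a read-only input that can only be compared with each other. -/

/-- The unit-cost operations on words. -/
inductive WordOp
  | add | sub | mul | div | mod | and | or | xor | shl | shr | eq | lt

/-- The value of a word operation, reduced modulo `2 ^ W`. -/
def WordOp.eval (W : ℕ) (o : WordOp) (x y : ℕ) : ℕ :=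
  (match o with
    | .add => x + y
    | .sub => x + (2 ^ W - y)
    | .mul => x * y
    | .div => x / y
    | .mod => x % y
    | .and => x &&& y
    | .or => x ||| y
    | .xor => x ^^^ y
    | .shl => x <<< y
    | .shr => x >>> y
    | .eq => if x = y then 1 else 0
    | .lt => if x < y then 1 else 0) % 2 ^ W

/-- Programs. The natural numbers `d`, `a`, `b` are names of registers. -/
inductive Prog
  /-- `d := v`, a constant -/
  | const (d v : ℕ)
  /-- `d := a o b` -/
  | op (o : WordOp) (d a b : ℕ)
  /-- `d := mem[a]` -/
  | load (d a : ℕ)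
  /-- `mem[a] := b` -/
  | store (a b : ℕ)
  /-- `d := 1` if (length of edge number `a`) `≤` (length of edge number `b`), else `d := 0` -/
  | cmp (d a b : ℕ)
  /-- sequential composition -/
  | seq (p q : Prog)
  /-- if `a ≠ 0` then `p` else `q` -/
  | ite (a : ℕ) (p q : Prog)
  /-- while `a ≠ 0` do `p` -/
  | loop (a : ℕ) (p : Prog)

/-- The contents of the registers and of the memory. -/
structure State where
  reg : ℕ → ℕ
  mem : ℕ → ℕ

/-- Write the value `v` to register `d`. -/
def State.setReg (s : State) (d v : ℕ) : State := ⟨Function.update s.reg d v, s.mem⟩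

/-- Write the value `v` to memory cell `a`. -/
def State.setMem (s : State) (a v : ℕ) : State := ⟨s.reg, Function.update s.mem a v⟩

/-- `Exec W len p s t s'`: on words of `W` bits and with edge lengths `len`, the program `p`,
started in the state `s`, halts in the state `s'` after exactly `t` steps. Each basic
instruction and each evaluation of a branch or loop condition is one step. -/
inductive Exec (W : ℕ) (len : ℕ → ℝ≥0) : Prog → State → ℕ → State → Prop
  | const (d v : ℕ) (s : State) : Exec W len (.const d v) s 1 (s.setReg d (v % 2 ^ W))
  | op (o : WordOp) (d a b : ℕ) (s : State) :
      Exec W len (.op o d a b) s 1 (s.setReg d (o.eval W (s.reg a) (s.reg b)))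
  | load (d a : ℕ) (s : State) : Exec W len (.load d a) s 1 (s.setReg d (s.mem (s.reg a)))
  | store (a b : ℕ) (s : State) : Exec W len (.store a b) s 1 (s.setMem (s.reg a) (s.reg b))
  | cmp_le (d a b : ℕ) (s : State) (h : len (s.reg a) ≤ len (s.reg b)) :
      Exec W len (.cmp d a b) s 1 (s.setReg d (1 % 2 ^ W))
  | cmp_gt (d a b : ℕ) (s : State) (h : ¬ len (s.reg a) ≤ len (s.reg b)) :
      Exec W len (.cmp d a b) s 1 (s.setReg d 0)
  | seq {p q : Prog} {s₀ s₁ s₂ : State} {t₁ t₂ : ℕ} (hp : Exec W len p s₀ t₁ s₁)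
      (hq : Exec W len q s₁ t₂ s₂) : Exec W len (.seq p q) s₀ (t₁ + t₂) s₂
  | ite_true {a : ℕ} {p q : Prog} {s s' : State} {t : ℕ} (h : s.reg a ≠ 0)
      (hp : Exec W len p s t s') : Exec W len (.ite a p q) s (t + 1) s'
  | ite_false {a : ℕ} {p q : Prog} {s s' : State} {t : ℕ} (h : s.reg a = 0)
      (hq : Exec W len q s t s') : Exec W len (.ite a p q) s (t + 1) s'
  | loop_stop {a : ℕ} {p : Prog} {s : State} (h : s.reg a = 0) : Exec W len (.loop a p) s 1 s
  | loop_step {a : ℕ} {p : Prog} {s₀ s₁ s₂ : State} {t₁ t₂ : ℕ} (h : s₀.reg a ≠ 0)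
      (hp : Exec W len p s₀ t₁ s₁) (hl : Exec W len (.loop a p) s₁ t₂ s₂) :
      Exec W len (.loop a p) s₀ (t₁ + t₂ + 1) s₂

/-- Programs are deterministic: the running time and the final state are determined by the
initial state. -/
theorem Exec.deterministic {W : ℕ} {len : ℕ → ℝ≥0} {p : Prog} {s s₁ : State} {t₁ : ℕ}
    (h₁ : Exec W len p s t₁ s₁) :
    ∀ {t₂ : ℕ} {s₂ : State}, Exec W len p s t₂ s₂ → t₁ = t₂ ∧ s₁ = s₂ := by
  induction h₁ with
  | const | op | load | store => intro _ _ h; cases h; exact ⟨rfl, rfl⟩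
  | cmp_le _ _ _ _ h => intro _ _ h'; cases h' <;> simp_all
  | cmp_gt _ _ _ _ h => intro _ _ h'; cases h' <;> simp_all
  | seq _ _ ihp ihq =>
    intro _ _ h'
    cases h' with
    | seq hp hq =>
      obtain ⟨rfl, rfl⟩ := ihp hp
      obtain ⟨rfl, rfl⟩ := ihq hq
      exact ⟨rfl, rfl⟩
  | ite_true h _ ih =>
    intro _ _ h'
    cases h' with
    | ite_true _ hp => obtain ⟨rfl, rfl⟩ := ih hp; exact ⟨rfl, rfl⟩
    | ite_false h0 _ => exact absurd h0 h
  | ite_false h _ ih =>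
    intro _ _ h'
    cases h' with
    | ite_true h0 _ => exact absurd h h0
    | ite_false _ hq => obtain ⟨rfl, rfl⟩ := ih hq; exact ⟨rfl, rfl⟩
  | loop_stop h =>
    intro _ _ h'
    cases h' with
    | loop_stop => exact ⟨rfl, rfl⟩
    | loop_step h0 _ _ => exact absurd h h0
  | loop_step h _ _ ihp ihl =>
    intro _ _ h'
    cases h' with
    | loop_stop h0 => exact absurd h0 h
    | loop_step _ hp hl =>
      obtain ⟨rfl, rfl⟩ := ihp hp
      obtain ⟨rfl, rfl⟩ := ihl hl
      exact ⟨rfl, rfl⟩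

/-! ## Inputs, outputs and algorithms -/

/-- An input of the spanner problem: a weighted undirected graph `G` with `n ≥ 1` vertices and
`m` edges, given by a list of its edges in any order (and with the two endpoints of each edge in
any order), and integers `f, k ≥ 1`. -/
structure Input where
  n : ℕ
  m : ℕ
  f : ℕ
  k : ℕ
  n_pos : 1 ≤ n
  f_pos : 1 ≤ f
  k_pos : 1 ≤ k
  G : SimpleGraph (Fin n)
  w : Sym2 (Fin n) → ℝ≥0
  e : Fin m → Fin n × Fin n
  e_injective : Function.Injective fun i => s((e i).1, (e i).2)
  e_range : (Set.range fun i => s((e i).1, (e i).2)) = G.edgeSet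

/-- The length of edge number `i` (and `0` if there is no such edge). -/
def Input.len (I : Input) (i : ℕ) : ℝ≥0 :=
  if h : i < I.m then I.w s((I.e ⟨i, h⟩).1, (I.e ⟨i, h⟩).2) else 0

/-- The initial state: `n, m, f, k` are in registers `0, 1, 2, 3`, the endpoints of edge number
`i < m` are in the memory cells `2 * i` and `2 * i + 1`, and everything else is `0`. -/
def Input.init (I : Input) : State where
  reg r := if r = 0 then I.n else if r = 1 then I.m else if r = 2 then I.f
    else if r = 3 then I.k else 0
  mem a := if h : a / 2 < I.m then
      (if a % 2 = 0 then ((I.e ⟨a / 2, h⟩).1 : ℕ) else ((I.e ⟨a / 2, h⟩).2 : ℕ))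
    else 0

/-- The final state `s` presents the subgraph `H` of the input graph: register `0` holds a length
`l`, register `1` holds an address `p`, and the memory cells `p, …, p + l - 1` list the numbers of
the edges of `H`. -/
def Input.Outputs (I : Input) (s : State) (H : SimpleGraph (Fin I.n)) : Prop :=
  (∀ j < s.reg 0, s.mem (s.reg 1 + j) < I.m) ∧
  H.edgeSet = {x | ∃ j < s.reg 0, ∃ i : Fin I.m,
    s.mem (s.reg 1 + j) = i ∧ x = s((I.e i).1, (I.e i).2)}

/-- The program `P` is an algorithm that constructs `f`-VFT `(2k-1)`-spanners with at most
`size I` edges in at most `time I` steps, on all inputs `I` and for every word length `W` of at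
least `b * log₂ (n + 2)` bits in which the parameters `f` and `k` fit into words. -/
def ConstructsSpanners (P : Prog) (b : ℕ) (size time : Input → ℝ) : Prop :=
  ∀ (I : Input) (W : ℕ), (I.n + 2) ^ b ≤ 2 ^ W → I.f < 2 ^ W → I.k < 2 ^ W →
    ∃ (t : ℕ) (s : State) (H : SimpleGraph (Fin I.n)),
      Exec W I.len P I.init t s ∧ I.Outputs s H ∧
      IsVFTSpanner I.f (2 * I.k - 1) I.G I.w H ∧
      (H.edgeSet.ncard : ℝ) ≤ size I ∧ (t : ℝ) ≤ time I

/-- `f^(1 - 1/k) n^(1 + 1/k)` -/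
noncomputable def sizeBound (I : Input) : ℝ :=
  (I.f : ℝ) ^ (1 - 1 / (I.k : ℝ)) * (I.n : ℝ) ^ (1 + 1 / (I.k : ℝ))

/-- `f^(4 - 1/k) n^(2 + 1/k) + m f^5` -/
noncomputable def timeBoundGeneral (I : Input) : ℝ :=
  (I.f : ℝ) ^ (4 - 1 / (I.k : ℝ)) * (I.n : ℝ) ^ (2 + 1 / (I.k : ℝ)) + (I.m : ℝ) * (I.f : ℝ) ^ 5

/-- `f^(1 - 1/k) n^(2 + 1/k) + m f^2` -/
noncomputable def timeBoundPoly (I : Input) : ℝ :=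
  (I.f : ℝ) ^ (1 - 1 / (I.k : ℝ)) * (I.n : ℝ) ^ (2 + 1 / (I.k : ℝ)) + (I.m : ℝ) * (I.f : ℝ) ^ 2

/-- A polylogarithmic factor `(log (n + 2))^d`. -/
noncomputable def polylog (d : ℕ) (I : Input) : ℝ := Real.log ((I.n : ℝ) + 2) ^ d

end VFTSpanner

/-! The algorithm is a greedy procedure over the edges by increasing length, in which an explicit
family of hash functions replaces the search over fault sets. For a fixed seed `sg` and an unordered
pair of hash values, the vertices having one of these values form a class, and every class carries
its own auxiliary graph; a vertex inside a class is a `place`. An edge `uv` falls, for each seed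
separating `u` from `v`, into one class, and the seed requires the edge if there is no walk of
length at most `K = 2k' - 1` between the two places, where `k' = min k (log₂ n + 2)`. An edge is
chosen iff at least a quarter of the seeds require it, and it is then inserted into exactly the
classes of these seeds.

Stretch. Two vertices collide under so few seeds that, for any `u, v` and `f` faults, at most three
quarters of the seeds let `u` and `v` collide with each other or with a fault
(`ParamOK.coll_small`). If `uv` is rejected, fewer than a quarter of the seeds require it. So some
seed has no fault in the class of `u, v` and a walk of length at most `K` in it (`exists_seed`).
This walk projects to chosen edges that are no longer than `uv` and avoid the faults
(`wdist_le_of_reach`).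

Size. By construction an auxiliary graph has no cycle of length at most `K + 1 = 2k'`. The Moore
bound, in a form that uses the component size instead of the number of vertices
(`Spread.length_le`), bounds the number of joined pairs by `t` times the number of places as soon as
`t ^ k'` exceeds the size `O(n/f)` of a class; thus `t = O((n/f)^(1/k))`. There are `seeds * n *
O(f)` places and every chosen edge joins at least `seeds / 4` pairs, so the number of seeds cancels
and `O(f n (n/f)^(1/k))` edges remain.

Hash functions. The digits of a vertex in base `q` are the coefficients of a polynomial over `ℤ/q`
of degree below `D`, where `q = O(f D)` is prime and `D` is the least degree with `(2f)^D ≥ n`. A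
seed selects the evaluation point. If `D` is bounded, which is the case for `f ≥ n^c`, this gives
`O(f)` hash values and `O(f)` seeds. Otherwise the value is multiplied by a second part of the seed
and divided by `D` with rounding, which restores `O(f)` hash values at the price of `O(f² log² n)`
seeds.

Time. Reachability within `K` steps is maintained incrementally by a table of marks (source, place,
length). Each mark is followed once along each edge, so the total work is the number of joined pairs
times `(K + 1) * O(n/f)` (`DSE.work_le`). With the tests of all seeds for all edges this gives
`seeds * (t n² + m)` up to logarithms, which lies within both time bounds. A tournament tree
delivers the edges in order of length using comparisons only.

Programs are verified by a small calculus of weakest preconditions (`WP`) for abstract states with a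
clock that dominates the number of machine steps. `Greedy` describes the runs abstractly, so that
the combinatorial analysis is independent of the machine. -/

namespace VFTSpanner

set_option linter.constructorNameAsVariable false

/-! ## A layer of named variables, arrays and expressions over the word RAM -/

/-- Names of the program variables; the first four hold the input parameters. -/
inductive Var
  | n | m | f | k | lg | bigK | dig | tmp | q | s | amax | seeds | base | pbase | i | j | d | flag
  | x | ed | u | v | cnt | sg | al | am | y | pw | hu | hv | pu | pv | nout
  | head | tail | ecnt | la | lb | src | dst | len | node | p1 | p2 | c1
  deriving DecidableEq

/-- Names of the arrays. The array `raw` is the initial block of the memory, holding the input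
and the output. -/
inductive Arr
  | raw | tree | mark | src | plc | len | rnext | rhead | afr | ato | anext | ahead | tp | tq
  deriving DecidableEq

/-- The register of a variable. -/
def Var.idx (x : Var) : ℕ := x.ctorIdx

theorem Var.idx_inj {x y : Var} : x.idx = y.idx ↔ x = y := by
  constructor
  · intro h
    have := congrArg Var.ofNat h
    simpa [Var.idx, Var.ofNat_ctorIdx] using this
  · rintro rfl; rfl

theorem Var.idx_lt (x : Var) : x.idx < 99 := by cases x <;> decide

theorem Arr.ctorIdx_inj {x y : Arr} : x.ctorIdx = y.ctorIdx ↔ x = y := by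
  constructor
  · intro h
    have := congrArg Arr.ofNat h
    simpa [Arr.ofNat_ctorIdx] using this
  · rintro rfl; rfl

theorem Arr.ctorIdx_lt (x : Arr) : x.ctorIdx < 16 := by cases x <;> decide

/-- The memory cell of an array entry; the block `raw` has length `B`. -/
def cell (B : ℕ) (A : Arr) (i : ℕ) : ℕ := if A = .raw then i else i * 16 + A.ctorIdx + B

/-- Beyond the first `B` cells the arrays are interleaved with stride 16, so residue and quotient of
the offset recover the array and the index. The block `raw` keeps its addresses, so the input need
not be copied. -/
theorem cell_inj {B : ℕ} {A A' : Arr} {i i' : ℕ} (h : A = .raw → i < B) (h' : A' = .raw → i' < B) :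
    cell B A i = cell B A' i' ↔ A = A' ∧ i = i' := by
  have h1 := A.ctorIdx_lt
  have h2 := A'.ctorIdx_lt
  have h3 := @Arr.ctorIdx_inj A A'
  unfold cell
  split_ifs with ha hb hb
  · simp [ha, hb]
  · have := h ha
    have : A ≠ A' := by rintro rfl; exact hb ha
    simp only [this, false_and, iff_false]; omega
  · have := h' hb
    have : A ≠ A' := by rintro rfl; exact ha hb
    simp only [this, false_and, iff_false]; omega
  · rw [← h3]; omega

/-- An abstract state: variables, arrays, and a clock. -/
structure St where
  v : Var → ℕ
  a : Arr → ℕ → ℕ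
  t : ℕ

/-- Assign a variable, at the given cost. -/
def St.set (σ : St) (x : Var) (y c : ℕ) : St := ⟨Function.update σ.v x y, σ.a, σ.t + c⟩
/-- Assign an array entry, at the given cost. -/
def St.put (σ : St) (A : Arr) (i y c : ℕ) : St :=
  ⟨σ.v, Function.update σ.a A (Function.update (σ.a A) i y), σ.t + c⟩
/-- Advance the clock. -/
def St.tick (σ : St) (c : ℕ) : St := ⟨σ.v, σ.a, σ.t + c⟩

section
variable (σ : St) (x z : Var) (A A' : Arr) (i y c : ℕ)
@[simp] theorem St.set_v : (σ.set x y c).v z = if z = x then y else σ.v z := by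
  simp [St.set, Function.update_apply]
@[simp] theorem St.set_a : (σ.set x y c).a = σ.a := rfl
@[simp] theorem St.set_t : (σ.set x y c).t = σ.t + c := rfl
@[simp] theorem St.put_v : (σ.put A i y c).v = σ.v := rfl
@[simp] theorem St.put_a :
    (σ.put A i y c).a A' = if A' = A then Function.update (σ.a A) i y else σ.a A' := by
  by_cases h : A' = A
  · subst h; simp [St.put]
  · simp [St.put, h]
@[simp] theorem St.put_t : (σ.put A i y c).t = σ.t + c := rfl
@[simp] theorem St.tick_v : (σ.tick c).v = σ.v := rfl
@[simp] theorem St.tick_a : (σ.tick c).a = σ.a := rfl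
@[simp] theorem St.tick_t : (σ.tick c).t = σ.t + c := rfl
end

/-! ### Representation of abstract states on the machine -/

/-- The machine: word length, edge lengths, and the size of the `raw` block. -/
structure Mach where
  W : ℕ
  len : ℕ → ℝ≥0
  B : ℕ

/-- The number of words. -/
def Mach.U (M : Mach) : ℕ := 2 ^ M.W

/-- The machine state `s` represents the abstract state `σ`. -/
structure Rep (M : Mach) (s : State) (σ : St) : Prop where
  v : ∀ x : Var, s.reg x.idx = σ.v x
  a : ∀ A i, (A = .raw → i < M.B) → s.mem (cell M.B A i) = σ.a A i
  base : s.reg 99 = M.B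
  pw : 10000 < M.U
  bv : ∀ x, σ.v x < M.U
  ba : ∀ A i, σ.a A i < M.U

/-- Binary operations of expressions. -/
inductive Bop | add | sub | mul | div | mod | lt | eq

def Bop.toWord : Bop → WordOp
  | add => .add | sub => .sub | mul => .mul | div => .div | mod => .mod | lt => .lt | eq => .eq

def Bop.eval (o : Bop) (x y : ℕ) : ℕ :=
  match o with
  | add => x + y | sub => x - y | mul => x * y | div => x / y | mod => x % y
  | lt => if x < y then 1 else 0
  | eq => if x = y then 1 else 0

def Bop.ok (U : ℕ) (o : Bop) (x y : ℕ) : Prop :=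
  match o with
  | add => x + y < U
  | sub => y ≤ x
  | mul => x * y < U
  | _ => True

/-- Expressions. -/
inductive Ex
  | v (x : Var)
  | c (n : ℕ)
  | o (o : Bop) (a b : Ex)
  | g (A : Arr) (i : Ex)

instance : Coe Var Ex := ⟨Ex.v⟩
instance : Add Ex := ⟨Ex.o .add⟩
instance : Sub Ex := ⟨Ex.o .sub⟩
instance : Mul Ex := ⟨Ex.o .mul⟩
instance : Div Ex := ⟨Ex.o .div⟩
instance : Mod Ex := ⟨Ex.o .mod⟩
instance (n : ℕ) : OfNat Ex n := ⟨Ex.c n⟩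
/-- Comparison as an expression. -/
def Ex.lt (a b : Ex) : Ex := .o .lt a b
/-- Equality test as an expression. -/
def Ex.eq (a b : Ex) : Ex := .o .eq a b

def Ex.eval (σ : St) : Ex → ℕ
  | v x => σ.v x
  | c n => n
  | o p a b => p.eval (a.eval σ) (b.eval σ)
  | g A i => σ.a A (i.eval σ)

/-- An array index is legal. -/
def Mach.okIdx (M : Mach) (A : Arr) (i : ℕ) : Prop :=
  if A = .raw then i < M.B else i * 16 + 16 + M.B < M.U

/-- The evaluation of an expression does not overflow. -/
def Ex.ok (M : Mach) (σ : St) : Ex → Prop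
  | v _ => True
  | c n => n < M.U
  | o p a b => (a.ok M σ ∧ b.ok M σ) ∧ p.ok M.U (a.eval σ) (b.eval σ)
  | g A i => i.ok M σ ∧ M.okIdx A (i.eval σ)

/-- An upper bound on the number of steps of an evaluation. -/
def Ex.cost : Ex → ℕ
  | v _ => 1
  | c _ => 1
  | o _ a b => a.cost + b.cost + 1
  | g _ i => i.cost + 6

section
variable (σ : St) (M : Mach) (a b : Ex) (A : Arr) (x : Var) (n : ℕ)
@[simp] theorem Ex.eval_v : (Ex.v x).eval σ = σ.v x := rfl
@[simp] theorem Ex.eval_c : (Ex.c n).eval σ = n := rfl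
@[simp] theorem Ex.eval_ofNat : Ex.eval σ (ofNat(n) : Ex) = OfNat.ofNat n := rfl
@[simp] theorem Ex.eval_g : (Ex.g A a).eval σ = σ.a A (a.eval σ) := rfl
@[simp] theorem Ex.eval_add : (a + b).eval σ = a.eval σ + b.eval σ := rfl
@[simp] theorem Ex.eval_sub : (a - b).eval σ = a.eval σ - b.eval σ := rfl
@[simp] theorem Ex.eval_mul : (a * b).eval σ = a.eval σ * b.eval σ := rfl
@[simp] theorem Ex.eval_div : (a / b).eval σ = a.eval σ / b.eval σ := rfl
@[simp] theorem Ex.eval_mod : (a % b).eval σ = a.eval σ % b.eval σ := rfl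
theorem Ex.eval_lt : (a.lt b).eval σ = if a.eval σ < b.eval σ then 1 else 0 := rfl
theorem Ex.eval_eq : (a.eq b).eval σ = if a.eval σ = b.eval σ then 1 else 0 := rfl
@[simp] theorem Ex.eval_lt_eq_zero : (a.lt b).eval σ = 0 ↔ b.eval σ ≤ a.eval σ := by
  rw [Ex.eval_lt]; split_ifs with h
  · simpa using h
  · simpa using h
@[simp] theorem Ex.eval_eq_eq_zero : (a.eq b).eval σ = 0 ↔ a.eval σ ≠ b.eval σ := by
  rw [Ex.eval_eq]; split_ifs <;> simp_all
@[simp] theorem Ex.ok_v : (Ex.v x).ok M σ ↔ True := Iff.rfl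
@[simp] theorem Ex.ok_c : (Ex.c n).ok M σ ↔ n < M.U := Iff.rfl
@[simp] theorem Ex.ok_ofNat : Ex.ok M σ (ofNat(n) : Ex) ↔ OfNat.ofNat n < M.U := Iff.rfl
@[simp] theorem Ex.ok_g : (Ex.g A a).ok M σ ↔ a.ok M σ ∧ M.okIdx A (a.eval σ) := Iff.rfl
@[simp] theorem Ex.ok_add :
    (a + b).ok M σ ↔ (a.ok M σ ∧ b.ok M σ) ∧ a.eval σ + b.eval σ < M.U := Iff.rfl
@[simp] theorem Ex.ok_sub :
    (a - b).ok M σ ↔ (a.ok M σ ∧ b.ok M σ) ∧ b.eval σ ≤ a.eval σ := Iff.rfl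
@[simp] theorem Ex.ok_mul :
    (a * b).ok M σ ↔ (a.ok M σ ∧ b.ok M σ) ∧ a.eval σ * b.eval σ < M.U := Iff.rfl
@[simp] theorem Ex.ok_div : (a / b).ok M σ ↔ a.ok M σ ∧ b.ok M σ := and_iff_left trivial
@[simp] theorem Ex.ok_mod : (a % b).ok M σ ↔ a.ok M σ ∧ b.ok M σ := and_iff_left trivial
@[simp] theorem Ex.ok_lt : (a.lt b).ok M σ ↔ a.ok M σ ∧ b.ok M σ := and_iff_left trivial
@[simp] theorem Ex.ok_eq : (a.eq b).ok M σ ↔ a.ok M σ ∧ b.ok M σ := and_iff_left trivial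
@[simp] theorem Ex.cost_v : (Ex.v x).cost = 1 := rfl
@[simp] theorem Ex.cost_c : (Ex.c n).cost = 1 := rfl
@[simp] theorem Ex.cost_ofNat : Ex.cost (ofNat(n) : Ex) = 1 := rfl
@[simp] theorem Ex.cost_g : (Ex.g A a).cost = a.cost + 6 := rfl
@[simp] theorem Ex.cost_add : (a + b).cost = a.cost + b.cost + 1 := rfl
@[simp] theorem Ex.cost_sub : (a - b).cost = a.cost + b.cost + 1 := rfl
@[simp] theorem Ex.cost_mul : (a * b).cost = a.cost + b.cost + 1 := rfl
@[simp] theorem Ex.cost_div : (a / b).cost = a.cost + b.cost + 1 := rfl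
@[simp] theorem Ex.cost_mod : (a % b).cost = a.cost + b.cost + 1 := rfl
@[simp] theorem Ex.cost_lt : (a.lt b).cost = a.cost + b.cost + 1 := rfl
@[simp] theorem Ex.cost_eq : (a.eq b).cost = a.cost + b.cost + 1 := rfl
end

/-! ### Compilation of expressions -/

/-- Turn the array index in register `d` into an address; register `99` holds the length of the
`raw` block. -/
def toCell (A : Arr) (d : ℕ) : Prog :=
  if A = .raw then .const (d + 1) 0 else
    .seq (.const (d + 1) 16) (.seq (.op .mul d d (d + 1)) (.seq (.const (d + 1) A.ctorIdx)
      (.seq (.op .add d d (d + 1)) (.op .add d d 99))))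

/-- Evaluate an expression into register `d`, using the registers from `d` on. -/
def Ex.code : Ex → ℕ → Prog
  -- The `and` of a register with itself serves as a move instruction.
  | v x, d => .op .and d x.idx x.idx
  | c n, d => .const d n
  | o p a b, d => .seq (a.code d) (.seq (b.code (d + 1)) (.op p.toWord d d (d + 1)))
  | g A i, d => .seq (i.code d) (.seq (toCell A d) (.load d d))

/-- Values computed without overflow are words, so the reduction modulo `2 ^ W` in each machine
instruction acts as the identity on them. -/
theorem Rep.eval_lt {M : Mach} {s : State} {σ : St} (h : Rep M s σ) {e : Ex} (he : e.ok M σ) :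
    e.eval σ < M.U := by
  induction e with
  | v x => exact h.bv x
  | c n => exact he
  | g A i ih => exact h.ba A _
  | o p a b iha ihb =>
    have ha := iha he.1.1
    have hb := ihb he.1.2
    have := he.2
    have h1 := h.pw
    rcases p with _ | _ | _ | _ | _ | _ | _ <;> simp only [Ex.eval, Bop.eval, Bop.ok] at this ⊢
    · exact this
    · omega
    · exact this
    · exact lt_of_le_of_lt (Nat.div_le_self _ _) ha
    · exact lt_of_le_of_lt (Nat.mod_le _ _) ha
    · split_ifs <;> omega
    · split_ifs <;> omega

theorem Bop.toWord_eval {W x y : ℕ} {o : Bop} (h : o.ok (2 ^ W) x y) (hx : x < 2 ^ W)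
    (h1 : 10000 < 2 ^ W) : o.toWord.eval W x y = o.eval x y := by
  rcases o with _ | _ | _ | _ | _ | _ | _ <;>
    simp only [WordOp.eval, Bop.eval, Bop.ok, Bop.toWord] at h ⊢
  · exact Nat.mod_eq_of_lt h
  -- The machine subtracts by adding `2 ^ W - y`; since `y ≤ x`, the sum wraps around exactly once.
  · rw [show x + (2 ^ W - y) = (x - y) + 2 ^ W by omega, Nat.add_mod_right]
    exact Nat.mod_eq_of_lt (by omega)
  · exact Nat.mod_eq_of_lt h
  · exact Nat.mod_eq_of_lt (lt_of_le_of_lt (Nat.div_le_self _ _) hx)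
  · exact Nat.mod_eq_of_lt (lt_of_le_of_lt (Nat.mod_le _ _) hx)
  · exact Nat.mod_eq_of_lt (by split_ifs <;> omega)
  · exact Nat.mod_eq_of_lt (by split_ifs <;> omega)

/-- Two machine states agree on the memory and on the registers below `d`. -/
def Agree (d : ℕ) (s s' : State) : Prop := s'.mem = s.mem ∧ ∀ j < d, s'.reg j = s.reg j

theorem Agree.trans {d : ℕ} {s s' s'' : State} (h : Agree d s s') (h' : Agree d s' s'') :
    Agree d s s'' := ⟨h'.1.trans h.1, fun j hj => (h'.2 j hj).trans (h.2 j hj)⟩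

theorem Agree.mono {d d' : ℕ} (hd : d ≤ d') {s s' : State} (h : Agree d' s s') : Agree d s s' :=
  ⟨h.1, fun j hj => h.2 j (by omega)⟩

theorem agree_setReg {d r : ℕ} (h : d ≤ r) (s : State) (y : ℕ) : Agree d s (s.setReg r y) :=
  ⟨rfl, fun j hj => by simp [State.setReg, Function.update_of_ne (show j ≠ r by omega)]⟩

/-- Variables live in registers below 99, register 99 holds the block length, and the registers from
100 on are scratch space of expression evaluation, so changes there leave the represented state
alone. -/
theorem Rep.agree {M : Mach} {s s' : State} {σ : St} (h : Rep M s σ) {d : ℕ} (hd : 100 ≤ d)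
    (hs : Agree d s s') : Rep M s' σ where
  v x := by rw [hs.2 _ (by have := x.idx_lt; omega)]; exact h.v x
  a A i hi := by rw [hs.1]; exact h.a A i hi
  base := by rw [hs.2 _ (by omega)]; exact h.base
  pw := h.pw
  bv := h.bv
  ba := h.ba

@[simp] theorem State.setReg_self (s : State) (d y : ℕ) : (s.setReg d y).reg d = y := by
  simp [State.setReg]
theorem State.setReg_of_ne (s : State) {d r : ℕ} (y : ℕ) (h : r ≠ d) :
    (s.setReg d y).reg r = s.reg r := by
  simp [State.setReg, Function.update_of_ne h]
@[simp] theorem State.setReg_mem (s : State) (d y : ℕ) : (s.setReg d y).mem = s.mem := rfl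

theorem toCell_exec {M : Mach} {s : State} {A : Arr} {d : ℕ} (hd : 100 ≤ d)
    (hb : s.reg 99 = M.B) (hi : M.okIdx A (s.reg d)) (h1 : 10000 < M.U) :
    ∃ r s', Exec M.W M.len (toCell A d) s r s' ∧ r ≤ 5 ∧ Agree d s s' ∧
      s'.reg d = cell M.B A (s.reg d) := by
  by_cases hA : A = .raw
  · refine ⟨1, s.setReg (d + 1) (0 % 2 ^ M.W), ?_, by omega, agree_setReg (by omega) s _, ?_⟩
    · rw [toCell, if_pos hA]; exact .const _ _ _
    · rw [State.setReg_of_ne _ _ (by omega), cell, if_pos hA]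
  · have hUe : M.U = 2 ^ M.W := rfl
    rw [Mach.okIdx, if_neg hA] at hi
    have hA' := A.ctorIdx_lt
    have e0 := State.setReg_of_ne s (d := d + 1) (r := d) (16 % 2 ^ M.W) (by omega)
    have hx := Exec.seq (Exec.const (W := M.W) (len := M.len) (d + 1) 16 s)
      (.seq (.op .mul d d (d + 1) _) (.seq (.const (d + 1) A.ctorIdx _)
        (.seq (.op .add d d (d + 1) _) (.op .add d d 99 _))))
    rw [toCell, if_neg hA]
    refine ⟨_, _, hx, by omega, ?_, ?_⟩
    · refine Agree.trans ?_ (agree_setReg le_rfl _ _)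
      refine Agree.trans ?_ (agree_setReg le_rfl _ _)
      refine Agree.trans ?_ (agree_setReg (Nat.le_succ _) _ _)
      refine Agree.trans ?_ (agree_setReg le_rfl _ _)
      exact agree_setReg (Nat.le_succ _) _ _
    · have e1 : 99 ≠ d := by omega
      have e2 : 99 ≠ d + 1 := by omega
      have e3 : d ≠ d + 1 := by omega
      have e4 : d + 1 ≠ d := by omega
      simp only [State.setReg, Function.update_apply, e1, e2, e3, e4, if_true, if_false, hb]
      have m1 : 16 % 2 ^ M.W = 16 := Nat.mod_eq_of_lt (by omega)
      have m2 : A.ctorIdx % 2 ^ M.W = A.ctorIdx := Nat.mod_eq_of_lt (by omega)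
      simp only [m1, m2, WordOp.eval, cell, if_neg hA]
      have m3 : s.reg d * 16 % 2 ^ M.W = s.reg d * 16 := Nat.mod_eq_of_lt (by omega)
      have m4 : (s.reg d * 16 + A.ctorIdx) % 2 ^ M.W = s.reg d * 16 + A.ctorIdx :=
        Nat.mod_eq_of_lt (by omega)
      rw [m3, m4]
      exact Nat.mod_eq_of_lt (by omega)

/-- The registers from `d` upwards act as a stack: the second operand is evaluated from `d + 1` on
and leaves the value of the first one in `d` intact. -/
theorem Ex.code_exec {M : Mach} {σ : St} (e : Ex) (he : e.ok M σ) :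
    ∀ (s : State) (d : ℕ), 100 ≤ d → Rep M s σ →
      ∃ r s', Exec M.W M.len (e.code d) s r s' ∧ r ≤ e.cost ∧ Agree d s s' ∧
        s'.reg d = e.eval σ := by
  induction e with
  | v x =>
    intro s d hd h
    refine ⟨1, _, .op _ _ _ _ _, le_rfl, agree_setReg le_rfl _ _, ?_⟩
    rw [State.setReg_self, WordOp.eval]
    simp only [Nat.and_self, h.v]
    exact Nat.mod_eq_of_lt (h.bv x)
  | c n =>
    intro s d hd h
    refine ⟨1, _, .const _ _ _, le_rfl, agree_setReg le_rfl _ _, ?_⟩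
    rw [State.setReg_self]
    exact Nat.mod_eq_of_lt he
  | o p a b iha ihb =>
    intro s d hd h
    obtain ⟨r1, s1, x1, c1, a1, v1⟩ := iha he.1.1 s d hd h
    obtain ⟨r2, s2, x2, c2, a2, v2⟩ := ihb he.1.2 s1 (d + 1) (by omega) (h.agree hd a1)
    refine ⟨r1 + (r2 + 1), _, .seq x1 (.seq x2 (.op _ _ _ _ _)), ?_, ?_, ?_⟩
    · simp only [Ex.cost]; omega
    · exact (a1.trans (a2.mono (Nat.le_succ _))).trans (agree_setReg le_rfl _ _)
    · rw [State.setReg_self, v2, a2.2 d (by omega), v1]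
      exact Bop.toWord_eval he.2 (h.eval_lt he.1.1) h.pw
  | g A i ih =>
    intro s d hd h
    obtain ⟨r1, s1, x1, c1, a1, v1⟩ := ih he.1 s d hd h
    have h1 := h.agree hd a1
    obtain ⟨r2, s2, x2, c2, a2, v2⟩ := toCell_exec (M := M) (A := A) hd h1.base
      (by rw [v1]; exact he.2) h.pw
    refine ⟨r1 + (r2 + 1), _, .seq x1 (.seq x2 (.load _ _ _)), ?_, ?_, ?_⟩
    · simp only [Ex.cost]; omega
    · exact (a1.trans a2).trans (agree_setReg le_rfl _ _)
    · rw [State.setReg_self, v2, v1, (h1.agree hd a2).a]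
      · rfl
      · intro hA
        have := he.2
        rwa [Mach.okIdx, if_pos hA] at this

/-! ### Weakest preconditions -/

/-- Started in `σ`, the program halts in a state satisfying `Q`; the clock of the final state
accounts for all the steps. -/
def WP (M : Mach) (p : Prog) (σ : St) (Q : St → Prop) : Prop :=
  ∀ s, Rep M s σ → ∃ r s' σ', Exec M.W M.len p s r s' ∧ Rep M s' σ' ∧ σ.t + r ≤ σ'.t ∧ Q σ'

variable {M : Mach} {σ : St} {Q Q' : St → Prop}

theorem WP.mono {p : Prog} (h : WP M p σ Q) (hQ : ∀ σ', Q σ' → Q' σ') : WP M p σ Q' := by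
  intro s hs
  obtain ⟨r, s', σ', h1, h2, h3, h4⟩ := h s hs
  exact ⟨r, s', σ', h1, h2, h3, hQ _ h4⟩

/-- A represented state stores words only. This makes the range bounds available at any point where
an overflow condition has to be checked. -/
theorem WP.of_rep {p : Prog} (h : (∀ x, σ.v x < M.U) → (∀ A i, σ.a A i < M.U) →
    10000 < M.U → WP M p σ Q) : WP M p σ Q :=
  fun s hs => h hs.bv hs.ba hs.pw s hs

theorem WP.seq {p q : Prog} (h : WP M p σ fun σ' => WP M q σ' Q) : WP M (p.seq q) σ Q := by
  intro s hs
  obtain ⟨r, s', σ', h1, h2, h3, h4⟩ := h s hs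
  obtain ⟨r2, s2, σ2, g1, g2, g3, g4⟩ := h4 s' h2
  exact ⟨r + r2, s2, σ2, .seq h1 g1, g2, by omega, g4⟩

/-- Assignment of an expression to a variable. -/
def assign (x : Var) (e : Ex) : Prog := .seq (e.code 100) (.op .and x.idx 100 100)

theorem Rep.set {s : State} (h : Rep M s σ) (x : Var) {y : ℕ} (hy : y < M.U) (c : ℕ) :
    Rep M (s.setReg x.idx y) (σ.set x y c) where
  v z := by
    simp only [State.setReg, Function.update_apply, St.set_v, Var.idx_inj, h.v]
  a A i hi := h.a A i hi
  base := by rw [State.setReg_of_ne _ _ (by have := x.idx_lt; omega)]; exact h.base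
  pw := h.pw
  bv z := by rw [St.set_v]; split_ifs; exacts [hy, h.bv z]
  ba := h.ba

theorem Rep.tick {s : State} (h : Rep M s σ) (c : ℕ) : Rep M s (σ.tick c) :=
  ⟨h.v, h.a, h.base, h.pw, h.bv, h.ba⟩

theorem WP.assign {x : Var} {e : Ex} (he : e.ok M σ)
    (hQ : Q (σ.set x (e.eval σ) (e.cost + 1))) : WP M (assign x e) σ Q := by
  intro s hs
  obtain ⟨r, s1, x1, c1, a1, v1⟩ := e.code_exec he s 100 le_rfl hs
  have hy := hs.eval_lt he
  refine ⟨r + 1, _, _, .seq x1 (.op _ _ _ _ _), ?_, ?_, hQ⟩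
  · have : WordOp.and.eval M.W (s1.reg 100) (s1.reg 100) = e.eval σ := by
      rw [WordOp.eval]; simp only [Nat.and_self, v1]; exact Nat.mod_eq_of_lt hy
    rw [this]
    exact (hs.agree le_rfl a1).set x hy _
  · simp only [St.set_t]; omega

/-- Assignment to an array entry. -/
def store (A : Arr) (i e : Ex) : Prog :=
  .seq (e.code 100) (.seq (i.code 101) (.seq (toCell A 101) (.store 101 100)))

theorem Rep.put {s : State} (h : Rep M s σ) {A : Arr} {i : ℕ} (hi : A = .raw → i < M.B) {y : ℕ}
    (hy : y < M.U) (c : ℕ) : Rep M (s.setMem (cell M.B A i) y) (σ.put A i y c) where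
  v z := h.v z
  a A' i' hi' := by
    have := cell_inj hi' hi
    simp only [State.setMem, Function.update_apply, this, St.put_a]
    by_cases hA : A' = A
    · subst hA
      by_cases hii : i' = i
      · simp [hii]
      · simp [hii, h.a _ _ hi']
    · simp [hA, h.a _ _ hi']
  base := h.base
  pw := h.pw
  bv := h.bv
  ba A' i' := by
    rw [St.put_a]
    split_ifs with hA
    · rw [Function.update_apply]; split_ifs; exacts [hy, h.ba _ _]
    · exact h.ba _ _

theorem WP.store {A : Arr} {i e : Ex} (hi : i.ok M σ) (hA : M.okIdx A (i.eval σ))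
    (he : e.ok M σ) (hQ : Q (σ.put A (i.eval σ) (e.eval σ) (i.cost + e.cost + 6))) :
    WP M (store A i e) σ Q := by
  intro s hs
  obtain ⟨r, s1, x1, c1, a1, v1⟩ := e.code_exec he s 100 le_rfl hs
  have hs1 := hs.agree le_rfl a1
  obtain ⟨r2, s2, x2, c2, a2, v2⟩ := i.code_exec hi s1 101 (by omega) hs1
  have hs2 := hs1.agree (by omega) a2
  obtain ⟨r3, s3, x3, c3, a3, v3⟩ := toCell_exec (M := M) (A := A) (d := 101) (by omega) hs2.base
    (by rw [v2]; exact hA) hs.pw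
  have hs3 := hs2.agree (by omega) a3
  refine ⟨r + (r2 + (r3 + 1)), _, _, .seq x1 (.seq x2 (.seq x3 (.store _ _ _))), ?_, ?_, hQ⟩
  · rw [v3, v2, a3.2 100 (by omega), a2.2 100 (by omega), v1]
    refine hs3.put (fun h => ?_) (hs.eval_lt he) _
    rwa [Mach.okIdx, if_pos h] at hA
  · simp only [St.put_t]; omega

/-- `x := 1` if the length of edge `e₁` is at most the length of edge `e₂`, else `x := 0`. -/
def compare (x : Var) (e₁ e₂ : Ex) : Prog :=
  .seq (e₁.code 100) (.seq (e₂.code 101) (.cmp x.idx 100 101))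

open Classical in
theorem WP.compare {x : Var} {e₁ e₂ : Ex} (h1 : e₁.ok M σ) (h2 : e₂.ok M σ)
    (hQ : Q (σ.set x (if M.len (e₁.eval σ) ≤ M.len (e₂.eval σ) then 1 else 0)
      (e₁.cost + e₂.cost + 1))) : WP M (compare x e₁ e₂) σ Q := by
  intro s hs
  obtain ⟨r, s1, x1, c1, a1, v1⟩ := e₁.code_exec h1 s 100 le_rfl hs
  have hs1 := hs.agree le_rfl a1
  obtain ⟨r2, s2, x2, c2, a2, v2⟩ := e₂.code_exec h2 s1 101 (by omega) hs1
  have hs2 := hs1.agree (by omega) a2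
  have v1' : s2.reg 100 = e₁.eval σ := by rw [a2.2 100 (by omega), v1]
  have hU := hs.pw
  have hUe : M.U = 2 ^ M.W := rfl
  by_cases hc : M.len (e₁.eval σ) ≤ M.len (e₂.eval σ)
  · refine ⟨r + (r2 + 1), _, _, .seq x1 (.seq x2 (.cmp_le _ _ _ _ (by rwa [v1', v2]))), ?_, ?_, hQ⟩
    · rw [if_pos hc, Nat.mod_eq_of_lt (by omega)]
      exact hs2.set x (by omega) _
    · simp only [St.set_t]; omega
  · refine ⟨r + (r2 + 1), _, _, .seq x1 (.seq x2 (.cmp_gt _ _ _ _ (by rwa [v1', v2]))), ?_, ?_, hQ⟩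
    · rw [if_neg hc]
      exact hs2.set x (by omega) _
    · simp only [St.set_t]; omega

/-- Branching on an expression. -/
def cond (e : Ex) (p q : Prog) : Prog := .seq (e.code 100) (.ite 100 p q)

theorem WP.cond {e : Ex} {p q : Prog} (he : e.ok M σ)
    (h1 : e.eval σ ≠ 0 → WP M p (σ.tick (e.cost + 1)) Q)
    (h2 : e.eval σ = 0 → WP M q (σ.tick (e.cost + 1)) Q) : WP M (cond e p q) σ Q := by
  intro s hs
  obtain ⟨r, s1, x1, c1, a1, v1⟩ := e.code_exec he s 100 le_rfl hs
  have hs1 := (hs.agree le_rfl a1).tick (e.cost + 1)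
  by_cases h0 : e.eval σ = 0
  · obtain ⟨r2, s2, σ2, y1, y2, y3, y4⟩ := h2 h0 s1 hs1
    refine ⟨r + (r2 + 1), s2, σ2, .seq x1 (.ite_false (v1.trans h0) y1), y2, ?_, y4⟩
    simp only [St.tick_t] at y3; omega
  · obtain ⟨r2, s2, σ2, y1, y2, y3, y4⟩ := h1 h0 s1 hs1
    refine ⟨r + (r2 + 1), s2, σ2, .seq x1 (.ite_true (by rwa [v1]) y1), y2, ?_, y4⟩
    simp only [St.tick_t] at y3; omega

/-- A while loop on an expression. -/
def while_ (e : Ex) (p : Prog) : Prog :=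
  .seq (e.code 100) (.loop 100 (.seq p (e.code 100)))

/-- The rule for while loops: the invariant `I` carries a ghost parameter with a decreasing
measure. -/
theorem WP.while_ {ι : Type*} {e : Ex} {p : Prog} (I : ι → St → Prop) (μ : ι → ℕ)
    (he : ∀ g σ, I g σ → (∀ x, σ.v x < M.U) → (∀ A i, σ.a A i < M.U) →
      10000 < M.U → e.ok M σ)
    (hstep : ∀ g σ, I g σ → e.eval σ ≠ 0 →
      WP M p (σ.tick (e.cost + 1)) fun σ' => ∃ g', I g' σ' ∧ μ g' < μ g)
    (hexit : ∀ g σ, I g σ → e.eval σ = 0 → Q (σ.tick (e.cost + 1)))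
    {g : ι} (hI : I g σ) : WP M (while_ e p) σ Q := by
  -- The machine loop is entered with the condition already evaluated in register 100, but the clock
  -- has not been charged for this evaluation yet; hence the summand `e.cost`. The induction is on a
  -- bound `N` for the measure.
  have key : ∀ (N : ℕ) (g : ι) (σ : St) (s : State), μ g ≤ N → I g σ → Rep M s σ →
      s.reg 100 = e.eval σ → ∃ r s' σ', Exec M.W M.len (.loop 100 (.seq p (e.code 100))) s r s' ∧
        Rep M s' σ' ∧ σ.t + e.cost + r ≤ σ'.t ∧ Q σ' := by
    intro N
    induction N with
    | zero =>
      intro g σ s hg hI hs h100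
      by_cases h0 : e.eval σ = 0
      · exact ⟨1, s, _, Exec.loop_stop (h100.trans h0), hs.tick _, by simp only [St.tick_t]; omega,
          hexit g σ hI h0⟩
      · obtain ⟨r, s', σ', _, _, _, g', _, h⟩ := hstep g σ hI h0 s (hs.tick _)
        omega
    | succ N ih =>
      intro g σ s hg hI hs h100
      by_cases h0 : e.eval σ = 0
      · exact ⟨1, s, _, Exec.loop_stop (h100.trans h0), hs.tick _, by simp only [St.tick_t]; omega,
          hexit g σ hI h0⟩
      · obtain ⟨r, s', σ', x1, x2, x3, g', hI', h⟩ := hstep g σ hI h0 s (hs.tick _)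
        obtain ⟨r2, s2, y1, c2, a2, v2⟩ := e.code_exec (he g' σ' hI' x2.bv x2.ba x2.pw) s' 100
          le_rfl x2
        obtain ⟨r3, s3, σ3, z1, z2, z3, z4⟩ := ih g' σ' s2 (by omega) hI' (x2.agree le_rfl a2) v2
        refine ⟨(r + r2) + r3 + 1, s3, σ3, .loop_step (by rwa [h100]) (.seq x1 y1) z1, z2, ?_, z4⟩
        simp only [St.tick_t] at x3; omega
  intro s hs
  obtain ⟨r, s1, x1, c1, a1, v1⟩ := e.code_exec (he g σ hI hs.bv hs.ba hs.pw) s 100 le_rfl hs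
  obtain ⟨r2, s2, σ2, y1, y2, y3, y4⟩ := key _ g σ s1 le_rfl hI (hs.agree le_rfl a1) v1
  exact ⟨r + r2, s2, σ2, .seq x1 y1, y2, by omega, y4⟩

/-- No operation. -/
def skip : Prog := assign .tmp 0

/-! ## Incremental bounded-length reachability -/

/-- `Reach R s l b`: there is an `R`-walk of length `l` from `s` to `b`, where `s` carries an
`R`-loop. -/
inductive Reach (R : ℕ → ℕ → Prop) (s : ℕ) : ℕ → ℕ → Prop
  | refl : R s s → Reach R s 0 s
  | step {l a b : ℕ} : Reach R s l a → R a b → Reach R s (l + 1) b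

theorem Reach.mono {R R' : ℕ → ℕ → Prop} (h : ∀ a b, R a b → R' a b) {s l b : ℕ}
    (hr : Reach R s l b) : Reach R' s l b := by
  induction hr with
  | refl hs => exact .refl (h _ _ hs)
  | step _ hab ih => exact ih.step (h _ _ hab)

/-! ### Linked lists stored in arrays -/

/-- The last index below `j` (and at least `1`) at which `cls` takes the value `b`, or `0`. -/
def prevIdx (cls : ℕ → ℕ) (b : ℕ) : ℕ → ℕ
  | 0 => 0
  | j + 1 => if 1 ≤ j ∧ cls j = b then j else prevIdx cls b j

theorem prevIdx_spec (cls : ℕ → ℕ) (b j : ℕ) :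
    (prevIdx cls b j = 0 ∧ ∀ t, 1 ≤ t → t < j → cls t ≠ b) ∨
    (1 ≤ prevIdx cls b j ∧ prevIdx cls b j < j ∧ cls (prevIdx cls b j) = b ∧
      ∀ t, prevIdx cls b j < t → t < j → cls t ≠ b) := by
  induction j with
  | zero => left; exact ⟨rfl, fun t h1 h2 => by omega⟩
  | succ j ih =>
    rw [prevIdx]
    split_ifs with h
    · right; exact ⟨h.1, Nat.lt_succ_self _, h.2, fun t h1 h2 => by omega⟩
    · have hj : 1 ≤ j → cls j ≠ b := fun h1 h2 => h ⟨h1, h2⟩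
      rcases ih with ⟨h0, h1⟩ | ⟨h0, h1, h2, h3⟩
      · left
        refine ⟨h0, fun t ht1 ht2 => ?_⟩
        rcases Nat.lt_succ_iff_lt_or_eq.1 ht2 with h | rfl
        exacts [h1 t ht1 h, hj ht1]
      · right
        refine ⟨h0, by omega, h2, fun t ht1 ht2 => ?_⟩
        rcases Nat.lt_succ_iff_lt_or_eq.1 ht2 with h | rfl
        exacts [h3 t ht1 h, hj (by omega)]

theorem prevIdx_congr {cls cls' : ℕ → ℕ} (b j : ℕ) (h : ∀ t, 1 ≤ t → t < j → cls t = cls' t) :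
    prevIdx cls b j = prevIdx cls' b j := by
  induction j with
  | zero => rfl
  | succ j ih =>
    rw [prevIdx, prevIdx, ih fun t h1 h2 => h t h1 (by omega)]
    by_cases hj : 1 ≤ j
    · rw [h j hj (Nat.lt_succ_self _)]
    · simp [hj]

/-- The arrays `next`, `head` present, for every `b`, the linked list of the indices
`t ∈ [1, N]` with `cls t = b`, the last one first. -/
def Chain (cls next head : ℕ → ℕ) (N : ℕ) : Prop :=
  (∀ t, 1 ≤ t → t ≤ N → next t = prevIdx cls (cls t) t) ∧ ∀ b, head b = prevIdx cls b (N + 1)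

/-- A new index goes to the front of the list of its class: the old head becomes its next pointer,
and no other next pointer changes. -/
theorem Chain.push {cls next head : ℕ → ℕ} {N : ℕ} (h : Chain cls next head N) (b : ℕ) :
    Chain (Function.update cls (N + 1) b) (Function.update next (N + 1) (head b))
      (Function.update head b (N + 1)) (N + 1) := by
  have hc : ∀ t, t ≤ N → Function.update cls (N + 1) b t = cls t := fun t ht =>
    Function.update_of_ne (by omega) _ _
  constructor
  · intro t h1 h2
    rcases Nat.lt_succ_iff_lt_or_eq.1 (Nat.lt_succ_of_le h2) with h3 | rfl
    · rw [Function.update_of_ne (by omega), hc t (by omega), h.1 t h1 (by omega)]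
      exact prevIdx_congr _ _ fun t' _ h' => (hc t' (by omega)).symm
    · rw [Function.update_self, Function.update_self, h.2]
      exact prevIdx_congr _ _ fun t' _ h' => (hc t' (by omega)).symm
  · intro b'
    rw [prevIdx, Function.update_self]
    by_cases hb : b = b'
    · subst hb; simp
    · rw [Function.update_of_ne (Ne.symm hb), if_neg (by simp [hb]), h.2]
      exact prevIdx_congr _ _ fun t' _ h' => (hc t' (by omega)).symm

/-- The number of indices in `[j, N]` at which `cls` takes the value `b`. -/
def countIdx (cls : ℕ → ℕ) (b j N : ℕ) : ℕ := ((Finset.Icc j N).filter fun t => cls t = b).card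

/-- One hop along a linked list uses up exactly one matching index. This turns the number of
iterations of a list traversal into a `countIdx`. -/
theorem countIdx_prev {cls : ℕ → ℕ} {b j N t : ℕ} (h1 : t < j) (hj : j ≤ N + 1) (h2 : cls t = b)
    (h3 : ∀ t', t < t' → t' < j → cls t' ≠ b) : countIdx cls b t N = countIdx cls b j N + 1 := by
  have : (Finset.Icc t N).filter (fun t => cls t = b) =
      insert t ((Finset.Icc j N).filter fun t => cls t = b) := by
    ext t'
    simp only [Finset.mem_filter, Finset.mem_Icc, Finset.mem_insert]
    constructor
    · rintro ⟨⟨h4, h5⟩, h6⟩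
      by_cases h7 : t' = t
      · exact Or.inl h7
      · by_cases h8 : t' < j
        · exact absurd h6 (h3 t' (by omega) h8)
        · exact Or.inr ⟨⟨by omega, h5⟩, h6⟩
    · rintro (rfl | ⟨⟨h4, h5⟩, h6⟩)
      · exact ⟨⟨le_rfl, by omega⟩, h2⟩
      · exact ⟨⟨by omega, h5⟩, h6⟩
  rw [countIdx, this, Finset.card_insert_of_notMem]
  · rfl
  · simp only [Finset.mem_filter, Finset.mem_Icc]; omega

/-! ### The table of marks and its invariants -/

/-- The marked triple `(s, b, l)` is present. -/
def Has (σ : St) (s b l : ℕ) : Prop :=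
  ∃ t, 1 ≤ t ∧ t ≤ σ.v .tail ∧ σ.a .src t = s ∧ σ.a .plc t = b ∧ σ.a .len t = l

/-- The index of a triple in the array of marks. -/
def markIdx (P s b l : ℕ) : ℕ := (s * P + b) * P + l

theorem markIdx_lt {P s b l : ℕ} (hs : s < P) (hb : b < P) (hl : l < P) :
    markIdx P s b l < P * P * P := by
  have h1 : s * P + b + 1 ≤ P * P := by nlinarith
  unfold markIdx
  nlinarith

theorem pair_inj {P a b a' b' : ℕ} (hb : b < P) (hb' : b' < P)
    (h : a * P + b = a' * P + b') : a = a' ∧ b = b' := by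
  have hP : 0 < P := by omega
  have h1 : (a * P + b) / P = a := by
    rw [Nat.add_comm, Nat.add_mul_div_right _ _ hP, Nat.div_eq_of_lt hb, zero_add]
  have h2 : (a' * P + b') / P = a' := by
    rw [Nat.add_comm, Nat.add_mul_div_right _ _ hP, Nat.div_eq_of_lt hb', zero_add]
  have : a = a' := by rw [← h1, h, h2]
  subst this
  exact ⟨rfl, by omega⟩

theorem markIdx_inj {P s b l s' b' l' : ℕ} (hb : b < P) (hl : l < P) (hb' : b' < P) (hl' : l' < P)
    (h : markIdx P s b l = markIdx P s' b' l') : s = s' ∧ b = b' ∧ l = l' := by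
  obtain ⟨h1, h2⟩ := pair_inj hl hl' h
  obtain ⟨h3, h4⟩ := pair_inj hb hb' h1
  exact ⟨h3, h4, h2⟩

open Classical in
/-- The data structure in the state `σ` is consistent, and every mark is witnessed by an
`R`-walk. -/
structure DS (M : Mach) (R : ℕ → ℕ → Prop) (σ : St) : Prop where
  fit : (σ.v .pbase * σ.v .pbase * σ.v .pbase + 2) * 16 + 16 + M.B < M.U
  kP : σ.v .bigK < σ.v .pbase
  mark : ∀ s b l, s < σ.v .pbase → b < σ.v .pbase → l < σ.v .pbase →
    σ.a .mark (markIdx (σ.v .pbase) s b l) = if Has σ s b l then 1 else 0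
  bnd : ∀ t, 1 ≤ t → t ≤ σ.v .tail →
    σ.a .src t < σ.v .pbase ∧ σ.a .plc t < σ.v .pbase ∧ σ.a .len t ≤ σ.v .bigK
  inj : ∀ t t', 1 ≤ t → t ≤ σ.v .tail → 1 ≤ t' → t' ≤ σ.v .tail → σ.a .src t = σ.a .src t' →
    σ.a .plc t = σ.a .plc t' → σ.a .len t = σ.a .len t' → t = t'
  snd : ∀ t, 1 ≤ t → t ≤ σ.v .tail → Reach R (σ.a .src t) (σ.a .len t) (σ.a .plc t)
  rch : Chain (σ.a .plc) (σ.a .rnext) (σ.a .rhead) (σ.v .tail)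
  ach : Chain (σ.a .afr) (σ.a .anext) (σ.a .ahead) (σ.v .ecnt)
  abnd : ∀ e, 1 ≤ e → e ≤ σ.v .ecnt → σ.a .afr e < σ.v .pbase ∧ σ.a .ato e < σ.v .pbase
  adj : ∀ e, 1 ≤ e → e ≤ σ.v .ecnt → R (σ.a .afr e) (σ.a .ato e)
  ht : σ.v .head ≤ σ.v .tail
  ele : σ.v .ecnt ≤ σ.v .pbase

theorem DS.has_reach {M : Mach} {R : ℕ → ℕ → Prop} {σ : St} (h : DS M R σ) {s b l : ℕ}
    (hh : Has σ s b l) : Reach R s l b := by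
  obtain ⟨t, h1, h2, rfl, rfl, rfl⟩ := hh
  exact h.snd t h1 h2

/-- The marked triples are pairwise distinct and hence inject into a table with `pbase ^ 3` entries.
This bounds all indices of the queue of marks and makes the draining loop terminate. -/
theorem DS.tail_le {M : Mach} {R : ℕ → ℕ → Prop} {σ : St} (h : DS M R σ) :
    σ.v .tail ≤ σ.v .pbase * σ.v .pbase * σ.v .pbase := by
  have hk := h.kP
  have := Finset.card_le_card_of_injOn (s := Finset.Icc 1 (σ.v .tail))
    (t := Finset.range (σ.v .pbase * σ.v .pbase * σ.v .pbase))
    (fun t => markIdx (σ.v .pbase) (σ.a .src t) (σ.a .plc t) (σ.a .len t))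
    (fun t ht => by
      have ht := Finset.mem_Icc.1 ht
      obtain ⟨h1, h2, h3⟩ := h.bnd t ht.1 ht.2
      simpa using markIdx_lt h1 h2 (by omega))
    (fun t ht t' ht' he => by
      have ht := Finset.mem_Icc.1 ht
      have ht' := Finset.mem_Icc.1 ht'
      obtain ⟨h1, h2, h3⟩ := h.bnd t ht.1 ht.2
      obtain ⟨h1', h2', h3'⟩ := h.bnd t' ht'.1 ht'.2
      obtain ⟨e1, e2, e3⟩ := markIdx_inj h2 (by omega) h2' (by omega) he
      exact h.inj t t' ht.1 ht.2 ht'.1 ht'.2 e1 e2 e3)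
  simpa using this

/-- Arrays of the data structure. -/
def dsArr : List Arr := [.mark, .src, .plc, .len, .rnext, .rhead, .afr, .ato, .anext, .ahead]
/-- Arrays of the list of marks. -/
def markArr : List Arr := [.mark, .src, .plc, .len, .rnext, .rhead]

/-- `σ'` extends `σ` by further marks, changing only the variables in `X`. -/
structure Ext (X : List Var) (σ σ' : St) : Prop where
  v : ∀ x, x ∉ X → σ'.v x = σ.v x
  a : ∀ A, A ∉ markArr → σ'.a A = σ.a A
  tail : σ.v .tail ≤ σ'.v .tail
  old : ∀ t, 1 ≤ t → t ≤ σ.v .tail → σ'.a .src t = σ.a .src t ∧ σ'.a .plc t = σ.a .plc t ∧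
    σ'.a .len t = σ.a .len t

theorem Ext.trans {X : List Var} {σ σ' σ'' : St} (h : Ext X σ σ') (h' : Ext X σ' σ'') :
    Ext X σ σ'' where
  v x hx := (h'.v x hx).trans (h.v x hx)
  a A hA := (h'.a A hA).trans (h.a A hA)
  tail := h.tail.trans h'.tail
  old t h1 h2 := by
    obtain ⟨a1, a2, a3⟩ := h.old t h1 h2
    obtain ⟨b1, b2, b3⟩ := h'.old t h1 (h2.trans h.tail)
    exact ⟨b1.trans a1, b2.trans a2, b3.trans a3⟩

theorem Ext.mono {X Y : List Var} (hXY : ∀ x ∈ X, x ∈ Y) {σ σ' : St} (h : Ext X σ σ') :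
    Ext Y σ σ' := ⟨fun x hx => h.v x fun h => hx (hXY x h), h.a, h.tail, h.old⟩

theorem Ext.has {X : List Var} {σ σ' : St} (h : Ext X σ σ') {s b l : ℕ} (hh : Has σ s b l) :
    Has σ' s b l := by
  obtain ⟨t, h1, h2, h3, h4, h5⟩ := hh
  obtain ⟨a1, a2, a3⟩ := h.old t h1 h2
  exact ⟨t, h1, h2.trans h.tail, a1.trans h3, a2.trans h4, a3.trans h5⟩

/-- If `len ≤ K` and the triple `(src, dst, len)` is not yet marked, mark it. -/
def attempt : Prog :=
  cond (Ex.lt Var.bigK Var.len) skip <|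
  cond (.g .mark ((Var.src * Var.pbase + Var.dst) * Var.pbase + Var.len : Ex)) skip <|
  .seq (store .mark ((Var.src * Var.pbase + Var.dst) * Var.pbase + Var.len : Ex) 1) <|
  .seq (assign .tail (Var.tail + 1 : Ex)) <|
  .seq (store .src Var.tail Var.src) <|
  .seq (store .plc Var.tail Var.dst) <|
  .seq (store .len Var.tail Var.len) <|
  .seq (store .rnext Var.tail (.g .rhead Var.dst)) <|
  store .rhead Var.dst Var.tail

/-- The frame rule of the data structure: besides the arrays of `dsArr` only four variables enter
the invariants exactly, while `head` merely has to stay within the queue. -/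
theorem DS.of_same {M : Mach} {R : ℕ → ℕ → Prop} {σ σ' : St} (h : DS M R σ)
    (hv : ∀ x ∈ [Var.pbase, .bigK, .tail, .ecnt], σ'.v x = σ.v x)
    (hh : σ'.v .head ≤ σ.v .tail)
    (ha : ∀ A ∈ dsArr, σ'.a A = σ.a A) : DS M R σ' := by
  have v1 := hv .pbase (by simp)
  have v2 := hv .bigK (by simp)
  have v3 := hv .tail (by simp)
  have v4 := hv .ecnt (by simp)
  have a1 := ha .mark (by simp [dsArr])
  have a2 := ha .src (by simp [dsArr])
  have a3 := ha .plc (by simp [dsArr])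
  have a4 := ha .len (by simp [dsArr])
  have a5 := ha .rnext (by simp [dsArr])
  have a6 := ha .rhead (by simp [dsArr])
  have a7 := ha .afr (by simp [dsArr])
  have a8 := ha .ato (by simp [dsArr])
  have a9 := ha .anext (by simp [dsArr])
  have a10 := ha .ahead (by simp [dsArr])
  have hhas : Has σ' = Has σ := by
    funext s b l; simp only [Has, v3, a2, a3, a4]
  constructor
  · rw [v1]; exact h.fit
  · rw [v1, v2]; exact h.kP
  · intro s b l hs hb hl
    rw [v1] at hs hb hl ⊢
    rw [a1, hhas]; exact h.mark s b l hs hb hl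
  · simp only [v1, v2, v3, a2, a3, a4]; exact h.bnd
  · simp only [v3, a2, a3, a4]; exact h.inj
  · simp only [v3, a2, a3, a4]; exact h.snd
  · simp only [v3, a3, a5, a6]; exact h.rch
  · simp only [v4, a7, a9, a10]; exact h.ach
  · simp only [v1, v4, a7, a8]; exact h.abnd
  · simp only [v4, a7, a8]; exact h.adj
  · rw [v3]; exact hh
  · rw [v1, v4]; exact h.ele

/-- Only the soundness of marks and edges mentions the relation, and both are monotone. An insertion
can therefore be carried out relative to the final relation from the start. -/
theorem DS.mono {M : Mach} {R R' : ℕ → ℕ → Prop} {σ : St} (h : DS M R σ)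
    (hR : ∀ a b, R a b → R' a b) : DS M R' σ :=
  { h with
    snd := fun t h1 h2 => (h.snd t h1 h2).mono hR
    adj := fun e h1 h2 => hR _ _ (h.adj e h1 h2) }

/-- Absence of the triple keeps the marks distinct. Since codes of triples are injective below
`pbase`, writing one table entry changes the answer for this triple only. -/
theorem DS.push {M : Mach} {R : ℕ → ℕ → Prop} {σ σ' : St} (h : DS M R σ) {s b l : ℕ}
    (hs : s < σ.v .pbase) (hb : b < σ.v .pbase) (hl : l ≤ σ.v .bigK) (hr : Reach R s l b)
    (hn : ¬ Has σ s b l)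
    (hv : ∀ x, x ≠ .tail → σ'.v x = σ.v x) (ht : σ'.v .tail = σ.v .tail + 1)
    (a1 : σ'.a .mark = Function.update (σ.a .mark) (markIdx (σ.v .pbase) s b l) 1)
    (a2 : σ'.a .src = Function.update (σ.a .src) (σ.v .tail + 1) s)
    (a3 : σ'.a .plc = Function.update (σ.a .plc) (σ.v .tail + 1) b)
    (a4 : σ'.a .len = Function.update (σ.a .len) (σ.v .tail + 1) l)
    (a5 : σ'.a .rnext = Function.update (σ.a .rnext) (σ.v .tail + 1) (σ.a .rhead b))
    (a6 : σ'.a .rhead = Function.update (σ.a .rhead) b (σ.v .tail + 1))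
    (ha : ∀ A, A ∉ markArr → σ'.a A = σ.a A) :
    DS M R σ' ∧ Ext [.tail] σ σ' ∧ Has σ' s b l := by
  have v1 := hv .pbase (by simp)
  have v2 := hv .bigK (by simp)
  have v4 := hv .ecnt (by simp)
  have v5 := hv .head (by simp)
  have a7 := ha .afr (by simp [markArr])
  have a8 := ha .ato (by simp [markArr])
  have a9 := ha .anext (by simp [markArr])
  have a10 := ha .ahead (by simp [markArr])
  have hkP := h.kP
  have hold : ∀ t, 1 ≤ t → t ≤ σ.v .tail → σ'.a .src t = σ.a .src t ∧ σ'.a .plc t = σ.a .plc t ∧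
      σ'.a .len t = σ.a .len t := by
    intro t h1 h2
    have : t ≠ σ.v .tail + 1 := by omega
    simp [a2, a3, a4, Function.update_of_ne this]
  have hnew : σ'.a .src (σ.v .tail + 1) = s ∧ σ'.a .plc (σ.v .tail + 1) = b ∧
      σ'.a .len (σ.v .tail + 1) = l := by simp [a2, a3, a4]
  have hcase : ∀ t, t ≤ σ'.v .tail → t ≤ σ.v .tail ∨ t = σ.v .tail + 1 := by omega
  have hhas : ∀ s' b' l', Has σ' s' b' l' ↔ Has σ s' b' l' ∨ (s' = s ∧ b' = b ∧ l' = l) := by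
    intro s' b' l'
    constructor
    · rintro ⟨t, h1, h2, rfl, rfl, rfl⟩
      rcases hcase t h2 with h3 | rfl
      · obtain ⟨e1, e2, e3⟩ := hold t h1 h3
        exact Or.inl ⟨t, h1, h3, e1.symm, e2.symm, e3.symm⟩
      · exact Or.inr hnew
    · rintro (⟨t, h1, h2, rfl, rfl, rfl⟩ | ⟨rfl, rfl, rfl⟩)
      · exact ⟨t, h1, by omega, hold t h1 h2⟩
      · exact ⟨σ.v .tail + 1, by omega, by omega, hnew⟩
  have hext : Ext [.tail] σ σ' := ⟨fun x hx => hv x (by simpa using hx), ha, by omega, hold⟩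
  refine ⟨?_, hext, (hhas _ _ _).2 (Or.inr ⟨rfl, rfl, rfl⟩)⟩
  constructor
  · rw [v1]; exact h.fit
  · rw [v1, v2]; exact h.kP
  · intro s' b' l' hs' hb' hl'
    rw [v1] at hs' hb' hl' ⊢
    rw [a1, Function.update_apply]
    by_cases he : markIdx (σ.v .pbase) s' b' l' = markIdx (σ.v .pbase) s b l
    · obtain ⟨rfl, rfl, rfl⟩ := markIdx_inj hb' hl' hb (by omega) he
      rw [if_pos rfl, if_pos ((hhas _ _ _).2 (Or.inr ⟨rfl, rfl, rfl⟩))]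
    · rw [if_neg he, h.mark s' b' l' hs' hb' hl']
      have h2 : ¬ (s' = s ∧ b' = b ∧ l' = l) := by rintro ⟨rfl, rfl, rfl⟩; exact he rfl
      have h3 : Has σ' s' b' l' = Has σ s' b' l' := by rw [hhas, eq_iff_iff]; tauto
      rw [h3]
  · intro t h1 h2
    rw [v1, v2]
    rcases hcase t h2 with h3 | rfl
    · obtain ⟨e1, e2, e3⟩ := hold t h1 h3
      rw [e1, e2, e3]; exact h.bnd t h1 h3
    · rw [hnew.1, hnew.2.1, hnew.2.2]; exact ⟨hs, hb, hl⟩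
  · have hne : ∀ t, 1 ≤ t → t ≤ σ.v .tail → σ'.a .src t = s → σ'.a .plc t = b →
        σ'.a .len t = l → False := by
      intro t h1 h2 e1 e2 e3
      obtain ⟨g1, g2, g3⟩ := hold t h1 h2
      exact hn ⟨t, h1, h2, g1 ▸ e1, g2 ▸ e2, g3 ▸ e3⟩
    intro t t' h1 h2 h1' h2' e1 e2 e3
    rcases hcase t h2 with h3 | rfl <;> rcases hcase t' h2' with h3' | rfl
    · obtain ⟨g1, g2, g3⟩ := hold t h1 h3
      obtain ⟨g1', g2', g3'⟩ := hold t' h1' h3'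
      exact h.inj t t' h1 h3 h1' h3' (by rw [← g1, e1, g1']) (by rw [← g2, e2, g2'])
        (by rw [← g3, e3, g3'])
    · exact (hne t h1 h3 (e1.trans hnew.1) (e2.trans hnew.2.1) (e3.trans hnew.2.2)).elim
    · exact (hne t' h1' h3' (e1.symm.trans hnew.1) (e2.symm.trans hnew.2.1)
        (e3.symm.trans hnew.2.2)).elim
    · rfl
  · intro t h1 h2
    rcases hcase t h2 with h3 | rfl
    · obtain ⟨e1, e2, e3⟩ := hold t h1 h3
      rw [e1, e2, e3]; exact h.snd t h1 h3
    · rw [hnew.1, hnew.2.1, hnew.2.2]; exact hr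
  · rw [a3, a5, a6, ht]; exact h.rch.push b
  · simp only [v4, a7, a9, a10]; exact h.ach
  · rw [v1, v4, a7, a8]; exact h.abnd
  · rw [v4, a7, a8]; exact h.adj
  · rw [v5, ht]; exact h.ht.trans (Nat.le_succ _)
  · rw [v1, v4]; exact h.ele

/-- Every ingredient of an array access of the data structure is legal. -/
theorem DS.okIdx {M : Mach} {R : ℕ → ℕ → Prop} {σ : St} (h : DS M R σ) {A : Arr} (hA : A ≠ .raw)
    {i : ℕ} (hi : i ≤ σ.v .pbase * σ.v .pbase * σ.v .pbase + 1) : M.okIdx A i := by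
  have := h.fit
  rw [Mach.okIdx, if_neg hA]; omega

theorem WP.skip {M : Mach} {σ : St} {Q : St → Prop} (hQ : Q (σ.set .tmp 0 2)) :
    WP M skip σ Q :=
  WP.of_rep fun _ _ hU => WP.assign (by simp; omega) hQ

theorem and_and_and_imp {A B C B' C' D : Prop} (h : A ∧ B ∧ C) (hb : B → B') (hc : C → C')
    (hd : D) : A ∧ B' ∧ C' ∧ D := ⟨h.1, hb h.2.1, hc h.2.2, hd⟩

/-- A mark is added only with a witnessing walk, and triples longer than `K` are dropped; hence the
condition on the length in the conclusion. The cost is constant because the table decides membership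
by one access. -/
theorem attempt_spec {M : Mach} {R : ℕ → ℕ → Prop} {σ : St} (h : DS M R σ)
    (hs : σ.v .src < σ.v .pbase) (hb : σ.v .dst < σ.v .pbase)
    (hr : Reach R (σ.v .src) (σ.v .len) (σ.v .dst)) :
    WP M attempt σ fun σ' => DS M R σ' ∧ Ext [.tail, .tmp] σ σ' ∧
      (σ.v .len ≤ σ.v .bigK → Has σ' (σ.v .src) (σ.v .dst) (σ.v .len)) ∧ σ'.t ≤ σ.t + 100 := by
  refine WP.of_rep fun hv ha hU => ?_
  have hkP := h.kP
  have hfit := h.fit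
  have hst : ∀ c, DS M R (σ.tick c) ∧ Ext [.tail, .tmp] σ (σ.tick c) := fun c =>
    ⟨h.of_same (fun _ _ => rfl) h.ht fun _ _ => rfl, fun _ _ => rfl, fun _ _ => rfl, le_rfl,
      fun _ _ _ => ⟨rfl, rfl, rfl⟩⟩
  have hst2 : ∀ c c', DS M R ((σ.tick c).set .tmp 0 c') ∧
      Ext [.tail, .tmp] σ ((σ.tick c).set .tmp 0 c') := fun c c' =>
    ⟨h.of_same (by simp) h.ht fun _ _ => rfl, by simp +contextual, fun _ _ => rfl, le_rfl,
      fun _ _ _ => ⟨rfl, rfl, rfl⟩⟩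
  unfold attempt
  refine WP.cond (by simp) (fun h1 => WP.skip ⟨(hst2 _ _).1, (hst2 _ _).2, ?_, ?_⟩) fun h1 => ?_
  · intro h2; simp at h1; omega
  · simp
  have hl : σ.v .len ≤ σ.v .bigK := by simpa using h1
  have hidx := markIdx_lt hs hb (lt_of_le_of_lt hl hkP)
  have hP : 0 < σ.v .pbase := by omega
  have b0 : σ.v .pbase ≤ σ.v .pbase * σ.v .pbase := Nat.le_mul_self _
  have b00 : σ.v .pbase * σ.v .pbase ≤ σ.v .pbase * σ.v .pbase * σ.v .pbase :=
    Nat.le_mul_of_pos_right _ hP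
  have b1 : σ.v .src * σ.v .pbase + σ.v .dst < σ.v .pbase * σ.v .pbase := by nlinarith
  have hok : ∀ σ' : St, σ'.v = σ.v →
      Ex.ok M σ' (((Var.src * Var.pbase + Var.dst) * Var.pbase + Var.len : Ex)) := by
    intro σ' hσ'
    unfold markIdx at hidx
    simp only [Ex.ok_add, Ex.ok_mul, Ex.ok_v, Ex.eval_add, Ex.eval_mul, Ex.eval_v, hσ', true_and,
      and_true]
    refine ⟨⟨⟨?_, ?_⟩, ?_⟩, ?_⟩ <;> omega
  have htl := h.tail_le
  refine WP.cond ⟨hok _ rfl, ?_⟩ (fun h1 => WP.skip ⟨?_, ?_, ?_, ?_⟩) fun h1 => ?_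
  · exact h.okIdx (by simp) (by simp [markIdx] at hidx ⊢; omega)
  · exact (h.of_same (by simp) h.ht fun _ _ => rfl)
  · exact ⟨by simp +contextual, fun _ _ => rfl, le_rfl, fun _ _ _ => ⟨rfl, rfl, rfl⟩⟩
  · intro _
    by_contra hn
    refine h1 ((h.mark (σ.v .src) (σ.v .dst) (σ.v .len) hs hb (by omega)).trans (if_neg ?_))
    exact fun hh => hn hh
  · simp
  have hn : ¬ Has σ (σ.v .src) (σ.v .dst) (σ.v .len) := by
    intro hn
    have h3 := h.mark (σ.v .src) (σ.v .dst) (σ.v .len) hs hb (by omega)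
    rw [if_pos hn] at h3
    simp only [Ex.eval_g, Ex.eval_add, Ex.eval_mul, Ex.eval_v, St.tick_v, St.tick_a] at h1
    rw [markIdx] at h3
    omega
  have ok1 : ∀ A i, A ≠ .raw → i ≤ σ.v .pbase * σ.v .pbase * σ.v .pbase + 1 → M.okIdx A i :=
    fun A i hA hi => h.okIdx hA hi
  refine WP.seq (WP.store (hok _ rfl) ?_ (by simp; omega) ?_)
  · exact h.okIdx (by simp) (by simp [markIdx] at hidx ⊢; omega)
  refine WP.seq (WP.assign (by simp; omega) ?_)
  refine WP.seq (WP.store (by simp) (ok1 _ _ (by simp) (by simp; omega)) (by simp) ?_)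
  refine WP.seq (WP.store (by simp) (ok1 _ _ (by simp) (by simp; omega)) (by simp) ?_)
  refine WP.seq (WP.store (by simp) (ok1 _ _ (by simp) (by simp; omega)) (by simp) ?_)
  refine WP.seq (WP.store (by simp) (ok1 _ _ (by simp) (by simp; omega))
    (by simp; exact ok1 _ _ (by simp) (by omega)) ?_)
  refine WP.store (by simp) (ok1 _ _ (by simp) (by simp; omega)) (by simp) ?_
  refine and_and_and_imp (h.push hs hb hl hr hn ?_ ?_ ?_ ?_ ?_ ?_ ?_ ?_ ?_)
    (fun g => g.mono (by simp)) (fun g _ => g) ?_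
  · intro x hx; simp [hx]
  · simp
  · simp [markIdx]
  · simp
  · simp
  · simp
  · simp
  · simp
  · intro A hA
    simp only [markArr, List.mem_cons, List.not_mem_nil, or_false, not_or] at hA
    simp [hA]
  · simp

/-! ### Following marks, and the potential that pays for it -/

/-- All the edges leaving the place of the mark `t` have been followed. -/
def Followed (σ : St) (t e : ℕ) : Prop :=
  σ.a .plc t = σ.a .afr e → σ.a .len t < σ.v .bigK →
    Has σ (σ.a .src t) (σ.a .ato e) (σ.a .len t + 1)

/-- The first `T` marks have been followed along all the edges. -/
def Closed (σ : St) (T : ℕ) : Prop :=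
  ∀ t, 1 ≤ t → t ≤ T → ∀ e, 1 ≤ e → e ≤ σ.v .ecnt → Followed σ t e

/-- The work of following the first `T` marks. -/
def work (σ : St) (T : ℕ) : ℕ :=
  ∑ t ∈ Finset.Icc 1 T, (1 + countIdx (σ.a .afr) (σ.a .plc t) 1 (σ.v .ecnt))

theorem work_succ (σ : St) (T : ℕ) :
    work σ (T + 1) = work σ T + (1 + countIdx (σ.a .afr) (σ.a .plc (T + 1)) 1 (σ.v .ecnt)) := by
  rw [work, work, Finset.sum_Icc_succ_top (by omega)]

theorem work_congr {σ σ' : St} {T : ℕ} (h1 : σ'.a .afr = σ.a .afr) (h2 : σ'.v .ecnt = σ.v .ecnt)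
    (h3 : ∀ t, 1 ≤ t → t ≤ T → σ'.a .plc t = σ.a .plc t) : work σ' T = work σ T := by
  unfold work
  refine Finset.sum_congr rfl fun t ht => ?_
  have ht := Finset.mem_Icc.1 ht
  rw [h1, h2, h3 t ht.1 ht.2]

theorem Ext.work {X : List Var} {σ σ' : St} (h : Ext X σ σ') (hX : Var.ecnt ∉ X) {T : ℕ}
    (hT : T ≤ σ.v .tail) : work σ' T = work σ T :=
  work_congr (h.a _ (by simp [markArr])) (h.v _ hX) fun t h1 h2 => (h.old t h1 (h2.trans hT)).2.1

/-- Marks only accumulate, so having been followed is never undone. -/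
theorem Ext.followed {X : List Var} {σ σ' : St} (h : Ext X σ σ') (hX : Var.bigK ∉ X) {t e : ℕ}
    (h1 : 1 ≤ t) (h2 : t ≤ σ.v .tail) (hf : Followed σ t e) : Followed σ' t e := by
  obtain ⟨e1, e2, e3⟩ := h.old t h1 h2
  unfold Followed
  rw [e1, e2, e3, h.v _ hX, h.a .afr (by simp [markArr]), h.a .ato (by simp [markArr])]
  exact fun a b => h.has (hf a b)

theorem Ext.closed {X : List Var} {σ σ' : St} (h : Ext X σ σ') (hX : Var.bigK ∉ X)
    (hX' : Var.ecnt ∉ X) {T : ℕ} (hT : T ≤ σ.v .tail) (hc : Closed σ T) : Closed σ' T := by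
  intro t h1 h2 e h3 h4
  rw [h.v _ hX'] at h4
  exact h.followed hX h1 (h2.trans hT) (hc t h1 h2 e h3 h4)

/-- The variables changed by following one mark. -/
def followVar : List Var := [.tail, .tmp, .node, .src, .dst, .len]
/-- The variables changed by following marks. -/
def drainVar : List Var := [.tail, .tmp, .node, .src, .dst, .len, .head]

/-- Follow the mark `head` along the edge `node`. -/
def followStep : Prog :=
  .seq (assign .src (.g .src Var.head)) <|
  .seq (assign .len (.g .len Var.head + 1 : Ex)) <|
  .seq (assign .dst (.g .ato Var.node)) <|
  .seq attempt <|
  assign .node (.g .anext Var.node)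

/-- Follow the marks that have not been followed yet. -/
def drain : Prog :=
  while_ (Ex.lt Var.head Var.tail) <|
    .seq (assign .head (Var.head + 1 : Ex)) <|
    .seq (assign .node (.g .ahead (.g .plc Var.head))) <|
    while_ Var.node followStep

theorem le_cube (P : ℕ) : P ≤ P * P * P := by
  rcases Nat.eq_zero_or_pos P with rfl | h
  · simp
  · exact (Nat.le_mul_self P).trans (Nat.le_mul_of_pos_right _ h)

theorem DS.ext_self {σ : St} {X : List Var} {σ' : St} (hv : ∀ x, x ∉ X → σ'.v x = σ.v x)
    (ht : σ'.v .tail = σ.v .tail) (ha : σ'.a = σ.a) : Ext X σ σ' :=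
  ⟨hv, fun A _ => by rw [ha], ht.ge, fun t _ _ => by rw [ha]; exact ⟨rfl, rfl, rfl⟩⟩

theorem followStep_spec {M : Mach} {R : ℕ → ℕ → Prop} {σ : St} (h : DS M R σ)
    (h1 : 1 ≤ σ.v .head) (h2 : 1 ≤ σ.v .node) (h3 : σ.v .node ≤ σ.v .ecnt)
    (hp : σ.a .plc (σ.v .head) = σ.a .afr (σ.v .node)) :
    WP M followStep σ fun σ' => DS M R σ' ∧ Ext followVar σ σ' ∧
      σ'.v .node = prevIdx (σ.a .afr) (σ.a .afr (σ.v .node)) (σ.v .node) ∧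
      Followed σ' (σ.v .head) (σ.v .node) ∧ σ'.t ≤ σ.t + 140 := by
  refine WP.of_rep fun hv ha hU => ?_
  have hht := h.ht
  have htl := h.tail_le
  have hel := h.ele
  have hkP := h.kP
  have hcu := le_cube (σ.v .pbase)
  have hfit := h.fit
  obtain ⟨b1, b2, b3⟩ := h.bnd _ h1 hht
  obtain ⟨b4, b5⟩ := h.abnd _ h2 h3
  have hre := (h.snd _ h1 hht).step (hp ▸ h.adj _ h2 h3)
  refine WP.seq (WP.assign (by simp; exact h.okIdx (by simp) (by omega)) ?_)
  refine WP.seq (WP.assign ?_ ?_)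
  · simp
    exact ⟨⟨h.okIdx (by simp) (by omega), by omega⟩, by omega⟩
  refine WP.seq (WP.assign (by simp; exact h.okIdx (by simp) (by omega)) ?_)
  set σ1 := St.set _ _ _ _ with hσ1
  have e1 : σ1.a = σ.a := rfl
  have e2 : ∀ x, x ∉ followVar → σ1.v x = σ.v x := by
    intro x hx
    simp only [followVar, List.mem_cons, List.not_mem_nil, or_false, not_or] at hx
    simp [hσ1, hx]
  have e3 : σ1.v .src = σ.a .src (σ.v .head) := by simp [hσ1]
  have e4 : σ1.v .len = σ.a .len (σ.v .head) + 1 := by simp [hσ1]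
  have e5 : σ1.v .dst = σ.a .ato (σ.v .node) := by simp [hσ1]
  have e6 : σ1.v .tail = σ.v .tail := by simp [hσ1]
  have e7 : σ1.v .node = σ.v .node := by simp [hσ1]
  have et : σ1.t ≤ σ.t + 30 := by simp [hσ1]
  have v1 : σ1.v .pbase = σ.v .pbase := e2 _ (by simp [followVar])
  have v2 : σ1.v .bigK = σ.v .bigK := e2 _ (by simp [followVar])
  have v3 : σ1.v .head = σ.v .head := e2 _ (by simp [followVar])
  have v4 : σ1.v .ecnt = σ.v .ecnt := e2 _ (by simp [followVar])
  have d1 : DS M R σ1 := h.of_same (by simp [v1, v2, e6, v4]) (by rw [v3]; exact hht)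
    fun A _ => by rw [e1]
  have x1 : Ext followVar σ σ1 := DS.ext_self e2 e6 e1
  clear_value σ1
  refine WP.seq (WP.mono (attempt_spec d1 ?_ ?_ ?_) ?_)
  · rw [e3, v1]; exact b1
  · rw [e5, v1]; exact b5
  · rw [e3, e4, e5]; exact hre
  rintro σ2 ⟨d2, x2, hs2, t2⟩
  have w1 : σ2.v .node = σ.v .node := by rw [x2.v _ (by simp), e7]
  have w2 : σ2.v .pbase = σ.v .pbase := by rw [x2.v _ (by simp), v1]
  have x2' : Ext followVar σ σ2 := x1.trans (x2.mono (by simp [followVar]))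
  have x3 : Ext followVar σ (σ2.set .node (Ex.eval σ2 (Ex.g .anext (Ex.v .node)))
      ((Ex.g .anext (Ex.v .node)).cost + 1)) := x2'.trans (DS.ext_self (by
        intro x hx
        simp only [followVar, List.mem_cons, List.not_mem_nil, or_false, not_or] at hx
        simp [hx]) (by simp) rfl)
  refine WP.assign ?_ ⟨?_, x3, ?_, ?_, ?_⟩
  · simp; exact d2.okIdx (by simp) (by rw [w1, w2]; omega)
  · exact d2.of_same (by simp) (by simpa using d2.ht) fun _ _ => rfl
  · simp only [St.set_v, if_true, Ex.eval_g, Ex.eval_v]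
    rw [x2'.a _ (by simp [markArr]), w1, h.ach.1 _ h2 h3]
  · obtain ⟨g1, g2, g3⟩ := x3.old _ h1 hht
    intro _ hlt
    rw [g3, x3.v _ (by simp [followVar])] at hlt
    rw [g1, g3, x3.a _ (by simp [markArr])]
    have := hs2 (by rw [e4, v2]; omega)
    rw [e3, e4, e5] at this
    exact this
  · simp; omega

/-- Amortised analysis: moving `head` past a mark costs a constant, plus a constant for each edge
leaving its place, which is what `work` gains. Marks created on the way join the end of the queue
and are paid for when their turn comes. -/
theorem drain_spec {M : Mach} {R : ℕ → ℕ → Prop} {σ : St} (h : DS M R σ)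
    (hc : Closed σ (σ.v .head)) :
    WP M drain σ fun σ' => DS M R σ' ∧ Ext drainVar σ σ' ∧ σ'.v .head = σ'.v .tail ∧
      Closed σ' (σ'.v .tail) ∧
      σ'.t + 200 * work σ (σ.v .head) ≤ σ.t + 10 + 200 * work σ' (σ'.v .tail) := by
  -- The measure decreases because `head` grows and stays below `tail ≤ pbase ^ 3` inside the loop.
  refine WP.while_ (M := M) (σ := σ) (g := σ.v .head)
    (fun (g : ℕ) σ1 => σ1.v .head = g ∧ DS M R σ1 ∧ Ext drainVar σ σ1 ∧
      Closed σ1 g ∧ σ1.t + 200 * work σ (σ.v .head) ≤ σ.t + 200 * work σ1 g)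
    (fun g => σ.v .pbase * σ.v .pbase * σ.v .pbase - g) ?_ ?_ ?_ ?_
  · intro g σ1 _ _ _ _; simp
  · rintro g σ1 ⟨rfl, d1, x1, c1, t1⟩ hne
    have hlt : σ1.v .head < σ1.v .tail := by simpa using hne
    refine WP.of_rep fun hv ha hU => ?_
    have hpb : σ1.v .pbase = σ.v .pbase := x1.v _ (by simp [drainVar])
    have htl := d1.tail_le
    have hfit := d1.fit
    have hcu := le_cube (σ1.v .pbase)
    obtain ⟨b1, b2, b3⟩ := d1.bnd (σ1.v .head + 1) (by omega) hlt
    refine WP.seq (WP.assign (by simp; omega) ?_)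
    refine WP.seq (WP.assign ?_ ?_)
    · simp
      exact ⟨d1.okIdx (by simp) (by omega), d1.okIdx (by simp) (by omega)⟩
    set σ2 := St.set _ _ _ _ with hσ2
    have e1 : σ2.a = σ1.a := rfl
    have e2 : ∀ x, x ∉ drainVar → σ2.v x = σ1.v x := by
      intro x hx
      simp only [drainVar, List.mem_cons, List.not_mem_nil, or_false, not_or] at hx
      simp [hσ2, hx]
    have e3 : σ2.v .head = σ1.v .head + 1 := by simp [hσ2]
    have e4 : σ2.v .tail = σ1.v .tail := by simp [hσ2]
    have e5 : σ2.v .node = σ1.a .ahead (σ1.a .plc (σ1.v .head + 1)) := by simp [hσ2]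
    have e6 : σ2.t ≤ σ1.t + 30 := by simp [hσ2]
    have e7 : σ2.v .ecnt = σ1.v .ecnt := e2 _ (by simp [drainVar])
    have x2 : Ext drainVar σ1 σ2 := DS.ext_self e2 e4 e1
    have d2 : DS M R σ2 := d1.of_same
      (by simp [e4, e7, e2 .pbase (by simp [drainVar]), e2 .bigK (by simp [drainVar])])
      (by rw [e3]; omega) fun A _ => by rw [e1]
    clear_value σ2
    set b := σ1.a .plc (σ1.v .head + 1) with hb
    -- The ghost `j` is the edge visited last: the edges with index at least `j` are done, and
    -- `node` is the last edge out of `b` before `j`. It starts one past the end, and the null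
    -- pointer `0` stops the traversal.
    refine WP.while_ (M := M) (σ := σ2) (g := σ2.v .ecnt + 1)
      (fun (j : ℕ) σ3 => DS M R σ3 ∧ Ext followVar σ2 σ3 ∧
        σ3.v .node = prevIdx (σ2.a .afr) b j ∧ (1 ≤ j ∧ j ≤ σ2.v .ecnt + 1) ∧
        (∀ e, 1 ≤ e → j ≤ e → e ≤ σ2.v .ecnt → Followed σ3 (σ2.v .head) e) ∧
        σ3.t ≤ σ2.t + 150 * countIdx (σ2.a .afr) b j (σ2.v .ecnt))
      (fun j => j) ?_ ?_ ?_ ?_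
    · intro g σ1 _ _ _ _; simp
    · rintro j σ3 ⟨d3, x3, n3, j3, f3, t3⟩ hn
      replace hn : σ3.v .node ≠ 0 := hn
      rcases prevIdx_spec (σ2.a .afr) b j with ⟨p1, -⟩ | ⟨p1, p2, p3, p4⟩
      · exact absurd (n3.trans p1) hn
      rw [← n3] at p1 p2 p3 p4
      have v1 : σ3.v .ecnt = σ2.v .ecnt := x3.v _ (by simp [followVar])
      have v2 : σ3.v .head = σ2.v .head := x3.v _ (by simp [followVar])
      have a1 : σ3.a .afr = σ2.a .afr := x3.a _ (by simp [markArr])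
      have o1 := x3.old (σ2.v .head) (by omega) d2.ht
      refine WP.mono (followStep_spec (R := R) (d3.of_same (σ' := σ3.tick _) (fun _ _ => rfl)
        (by exact d3.ht) fun _ _ => rfl) ?_ p1 ?_ ?_) ?_
      · simp [v2]; omega
      · simp [v1]; omega
      · simp only [St.tick_v, St.tick_a]
        rw [v2, o1.2.1, e1, e3, a1, p3]
      · rintro σ4 ⟨d4, x4, n4, f4, t4⟩
        simp only [St.tick_v, St.tick_a, St.tick_t, Ex.cost_v] at n4 f4 t4
        have x34 : Ext followVar σ3 σ4 := ⟨x4.v, x4.a, x4.tail, x4.old⟩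
        refine ⟨σ3.v .node, ⟨d4, x3.trans x34, ?_, by omega, ?_, ?_⟩, by exact p2⟩
        · rw [n4, a1, p3]
        · intro e h1 h2 h3
          rcases Nat.lt_or_ge e j with hj | hj
          · rcases Nat.eq_or_lt_of_le h2 with rfl | h4
            · rw [v2] at f4; exact f4
            -- No edge strictly between `node` and `j` leaves the place `b`, so there is nothing to
            -- follow.
            · intro hp
              have := p4 e h4 hj
              have x24 := x3.trans x34
              rw [(x24.old (σ2.v .head) (by omega) d2.ht).2.1, x24.a .afr (by simp [markArr]),
                e1, e3, ← hb, ← e1] at hp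
              exact absurd hp.symm this
          · exact x34.followed (by simp [followVar]) (by omega) (d2.ht.trans x3.tail)
              (f3 e h1 hj h3)
        · rw [countIdx_prev p2 j3.2 p3 p4]; omega
    · rintro j σ3 ⟨d3, x3, n3, j3, f3, t3⟩ h0
      replace h0 : σ3.v .node = 0 := h0
      rw [h0] at n3
      rcases prevIdx_spec (σ2.a .afr) b j with ⟨-, p1⟩ | ⟨p1, -⟩
      swap
      · omega
      have v2 : σ3.v .head = σ2.v .head := x3.v _ (by simp [followVar])
      have v3 : σ3.v .ecnt = σ2.v .ecnt := x3.v _ (by simp [followVar])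
      have x3' : Ext drainVar σ1 (σ3.tick (Ex.cost (Ex.v .node) + 1)) :=
        x2.trans ((x3.mono (by simp [followVar, drainVar])).trans
          (DS.ext_self (fun _ _ => rfl) rfl rfl))
      -- Marks appended meanwhile lie beyond the first `head + 1` and do not enter this sum.
      have hw : work (σ3.tick (Ex.cost (Ex.v .node) + 1)) (σ1.v .head + 1) =
          work σ1 (σ1.v .head + 1) := x3'.work (by simp [drainVar]) hlt
      refine ⟨σ1.v .head + 1, ⟨?_, ?_, x1.trans x3', ?_, ?_⟩, ?_⟩
      · simp [v2, e3]
      · exact d3.of_same (fun _ _ => rfl) d3.ht fun _ _ => rfl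
      · intro t h1 h2 e h3 h4
        rcases Nat.eq_or_lt_of_le h2 with rfl | h2
        · show Followed σ3 _ _
          have h4 : e ≤ σ3.v .ecnt := h4
          rcases Nat.lt_or_ge e j with hj | hj
          · intro hp
            exfalso
            have hp' : b = σ2.a .afr e := by
              rw [← x3.a .afr (by simp [markArr]), ← hp,
                (x3.old (σ1.v .head + 1) (by omega) (by omega)).2.1, e1]
            exact p1 e h3 hj hp'.symm
          · rw [← e3]; exact f3 e h3 hj (by omega)
        · exact x3'.closed (by simp [drainVar]) (by simp [drainVar]) (by omega) c1 t h1
            (by omega) e h3 h4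
      · rw [hw, work_succ]
        have hcn : countIdx (σ2.a .afr) b j (σ2.v .ecnt) ≤
            countIdx (σ1.a .afr) (σ1.a .plc (σ1.v .head + 1)) 1 (σ1.v .ecnt) := by
          rw [e1, e7, ← hb]
          refine Finset.card_le_card fun t ht => ?_
          simp only [Finset.mem_filter, Finset.mem_Icc] at ht ⊢
          exact ⟨⟨j3.1.trans ht.1.1, ht.1.2⟩, ht.2⟩
        simp only [St.tick_t, Ex.cost_v]
        omega
      · rw [← hpb]; omega
    · refine ⟨d2.of_same (fun _ _ => rfl) d2.ht fun _ _ => rfl, DS.ext_self (fun _ _ => rfl) rfl rfl,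
        ?_, ⟨by omega, le_rfl⟩, fun e h1 h2 h3 => by omega, by simp⟩
      rw [e5, d1.ach.2, e1, e7]
  · rintro g σ1 ⟨rfl, d1, x1, c1, t1⟩ h0
    have h0' : σ1.v .tail ≤ σ1.v .head := by simpa using h0
    have h0 : σ1.v .head = σ1.v .tail := le_antisymm d1.ht h0'
    have x2 : Ext drainVar σ1 (σ1.tick ((Ex.lt Var.head Var.tail).cost + 1)) :=
      DS.ext_self (fun _ _ => rfl) rfl rfl
    refine ⟨d1.of_same (fun _ _ => rfl) d1.ht fun _ _ => rfl, x1.trans x2, h0, ?_, ?_⟩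
    · rw [h0] at c1; exact x2.closed (by simp [drainVar]) (by simp [drainVar]) le_rfl c1
    · have : work (σ1.tick ((Ex.lt Var.head Var.tail).cost + 1)) (σ1.v .tail) =
        work σ1 (σ1.v .tail) := rfl
      simp only [St.tick_v, St.tick_t, Ex.cost_lt, Ex.cost_v] at this ⊢
      rw [this, ← h0]
      omega
  · exact ⟨rfl, h, DS.ext_self (fun _ _ => rfl) rfl rfl, hc, le_rfl⟩

/-! ### Insertion of one directed edge -/

/-- Append the edge from `la` to `lb` to the adjacency lists. -/
def addEdge : Prog :=
  .seq (assign .ecnt (Var.ecnt + 1 : Ex)) <|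
  .seq (store .afr Var.ecnt Var.la) <|
  .seq (store .ato Var.ecnt Var.lb) <|
  .seq (store .anext Var.ecnt (.g .ahead Var.la)) <|
  .seq (store .ahead Var.la Var.ecnt) <|
  .seq (assign .dst Var.lb) <|
  assign .node (.g .rhead Var.la)

/-- Follow the mark `node` along the edge to `dst`. -/
def linkStep : Prog :=
  .seq (assign .src (.g .src Var.node)) <|
  .seq (assign .len (.g .len Var.node + 1 : Ex)) <|
  .seq attempt <|
  assign .node (.g .rnext Var.node)

/-- Insert the edge from `la` to `lb` and update the marks. -/
def insertEdge : Prog :=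
  .seq (assign .src Var.la) <| .seq (assign .dst Var.la) <| .seq (assign .len 0) <|
  .seq attempt <| .seq drain <| .seq addEdge <| .seq (while_ Var.node linkStep) drain

/-- The variables changed in inserting an edge. -/
def insVar : List Var := [.tail, .tmp, .node, .src, .dst, .len, .head, .ecnt]
/-- The variables changed by following marks along one edge. -/
def linkVar : List Var := [.tail, .tmp, .node, .src, .len]

theorem countIdx_push (cls : ℕ → ℕ) (a b N : ℕ) :
    countIdx (Function.update cls (N + 1) a) b 1 (N + 1) =
      countIdx cls b 1 N + if a = b then 1 else 0 := by
  have h0 : countIdx (Function.update cls (N + 1) a) b 1 N = countIdx cls b 1 N := by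
    unfold countIdx
    congr 1
    refine Finset.filter_congr fun t ht => ?_
    have := Finset.mem_Icc.1 ht
    rw [Function.update_of_ne (by omega)]
  rw [← h0]
  unfold countIdx
  rw [← Finset.insert_Icc_right_eq_Icc_add_one (by omega), Finset.filter_insert, Function.update_self]
  split_ifs with h
  · rw [Finset.card_insert_of_notMem (by simp)]
  · rfl

/-- A new edge out of `a` adds one to the summand of every mark at `a`; this increase pays for the
traversal in `link_spec`. -/
theorem work_addEdge {σ σ' : St} {a T : ℕ} (h1 : σ'.v .ecnt = σ.v .ecnt + 1)
    (h2 : σ'.a .afr = Function.update (σ.a .afr) (σ.v .ecnt + 1) a) (h3 : σ'.a .plc = σ.a .plc) :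
    work σ' T = work σ T + countIdx (σ.a .plc) a 1 T := by
  unfold work
  simp only [h1, h2, h3, countIdx_push, ← add_assoc]
  rw [Finset.sum_add_distrib]
  congr 1
  rw [countIdx, Finset.card_filter]
  exact Finset.sum_congr rfl fun t _ => by simp [eq_comm]

theorem addEdge_spec {M : Mach} {R : ℕ → ℕ → Prop} {σ : St} (h : DS M R σ)
    (ha : σ.v .la < σ.v .pbase) (hb : σ.v .lb < σ.v .pbase) (he : σ.v .ecnt + 1 ≤ σ.v .pbase)
    (hab : R (σ.v .la) (σ.v .lb)) :
    WP M addEdge σ fun σ' => DS M R σ' ∧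
      (∀ x, x ∉ [Var.dst, .node, .ecnt] → σ'.v x = σ.v x) ∧
      (∀ A, A ∉ [Arr.afr, .ato, .anext, .ahead] → σ'.a A = σ.a A) ∧
      σ'.v .ecnt = σ.v .ecnt + 1 ∧ σ'.v .dst = σ.v .lb ∧ σ'.v .node = σ.a .rhead (σ.v .la) ∧
      σ'.a .afr = Function.update (σ.a .afr) (σ.v .ecnt + 1) (σ.v .la) ∧
      σ'.a .ato = Function.update (σ.a .ato) (σ.v .ecnt + 1) (σ.v .lb) ∧
      σ'.t ≤ σ.t + 100 := by
  refine WP.of_rep fun hv hA hU => ?_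
  have hcu := le_cube (σ.v .pbase)
  have hfit := h.fit
  have ok1 : ∀ A i, A ≠ .raw → i ≤ σ.v .pbase * σ.v .pbase * σ.v .pbase + 1 → M.okIdx A i :=
    fun A i hA hi => h.okIdx hA hi
  refine WP.seq (WP.assign (by simp; omega) ?_)
  refine WP.seq (WP.store (by simp) (ok1 _ _ (by simp) (by simp; omega)) (by simp) ?_)
  refine WP.seq (WP.store (by simp) (ok1 _ _ (by simp) (by simp; omega)) (by simp) ?_)
  refine WP.seq (WP.store (by simp) (ok1 _ _ (by simp) (by simp; omega))
    (by simp; exact ok1 _ _ (by simp) (by omega)) ?_)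
  refine WP.seq (WP.store (by simp) (ok1 _ _ (by simp) (by simp; omega)) (by simp) ?_)
  refine WP.seq (WP.assign (by simp) ?_)
  refine WP.assign (by simp; exact ok1 _ _ (by simp) (by omega)) ?_
  set σ1 := St.set _ _ _ _ with hσ1
  have e1 : ∀ x, x ∉ [Var.dst, .node, .ecnt] → σ1.v x = σ.v x := by
    intro x hx
    simp only [List.mem_cons, List.not_mem_nil, or_false, not_or] at hx
    simp [hσ1, hx]
  have e2 : ∀ A, A ∉ [Arr.afr, .ato, .anext, .ahead] → σ1.a A = σ.a A := by
    intro x hx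
    simp only [List.mem_cons, List.not_mem_nil, or_false, not_or] at hx
    simp [hσ1, hx]
  have e3 : σ1.v .ecnt = σ.v .ecnt + 1 := by simp [hσ1]
  have e4 : σ1.v .dst = σ.v .lb := by simp [hσ1]
  have e5 : σ1.v .node = σ.a .rhead (σ.v .la) := by simp [hσ1]
  have e6 : σ1.a .afr = Function.update (σ.a .afr) (σ.v .ecnt + 1) (σ.v .la) := by simp [hσ1]
  have e7 : σ1.a .ato = Function.update (σ.a .ato) (σ.v .ecnt + 1) (σ.v .lb) := by simp [hσ1]
  have e8 : σ1.a .anext = Function.update (σ.a .anext) (σ.v .ecnt + 1) (σ.a .ahead (σ.v .la)) := by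
    simp [hσ1]
  have e9 : σ1.a .ahead = Function.update (σ.a .ahead) (σ.v .la) (σ.v .ecnt + 1) := by simp [hσ1]
  have e10 : σ1.t ≤ σ.t + 100 := by simp [hσ1]
  clear_value σ1
  refine ⟨?_, e1, e2, e3, e4, e5, e6, e7, e10⟩
  have v1 := e1 .pbase (by simp)
  have v2 := e1 .bigK (by simp)
  have v3 := e1 .tail (by simp)
  have v4 := e1 .head (by simp)
  have a1 := e2 .mark (by simp)
  have a2 := e2 .src (by simp)
  have a3 := e2 .plc (by simp)
  have a4 := e2 .len (by simp)
  have a5 := e2 .rnext (by simp)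
  have a6 := e2 .rhead (by simp)
  have hhas : Has σ1 = Has σ := by
    funext s b l; simp only [Has, v3, a2, a3, a4]
  constructor
  · rw [v1]; exact h.fit
  · rw [v1, v2]; exact h.kP
  · intro s b l hs hb hl
    rw [v1] at hs hb hl ⊢
    rw [a1, hhas]; exact h.mark s b l hs hb hl
  · rw [v1, v2, v3, a2, a3, a4]; exact h.bnd
  · rw [v3, a2, a3, a4]; exact h.inj
  · rw [v3, a2, a3, a4]; exact h.snd
  · rw [v3, a3, a5, a6]; exact h.rch
  · rw [e3, e6, e8, e9]; exact h.ach.push _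
  · intro e h1 h2
    rw [e3] at h2
    rw [v1, e6, e7, Function.update_apply, Function.update_apply]
    split_ifs with hE
    · exact ⟨ha, hb⟩
    · exact h.abnd e h1 (by omega)
  · intro e h1 h2
    rw [e3] at h2
    rw [e6, e7, Function.update_apply, Function.update_apply]
    split_ifs with hE
    · exact hab
    · exact h.adj e h1 (by omega)
  · rw [v3, v4]; exact h.ht
  · rw [v1, e3]; exact he

theorem linkStep_spec {M : Mach} {R : ℕ → ℕ → Prop} {σ : St} (h : DS M R σ)
    (h2 : 1 ≤ σ.v .node) (h3 : σ.v .node ≤ σ.v .tail) (hb : σ.v .dst < σ.v .pbase)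
    (hp : R (σ.a .plc (σ.v .node)) (σ.v .dst)) :
    WP M linkStep σ fun σ' => DS M R σ' ∧ Ext linkVar σ σ' ∧
      σ'.v .node = prevIdx (σ'.a .plc) (σ'.a .plc (σ.v .node)) (σ.v .node) ∧
      (σ.a .len (σ.v .node) < σ.v .bigK →
        Has σ' (σ.a .src (σ.v .node)) (σ.v .dst) (σ.a .len (σ.v .node) + 1)) ∧
      σ'.t ≤ σ.t + 140 := by
  refine WP.of_rep fun hv ha hU => ?_
  have hht := h.ht
  have htl := h.tail_le
  have hkP := h.kP
  have hcu := le_cube (σ.v .pbase)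
  have hfit := h.fit
  obtain ⟨b1, b2, b3⟩ := h.bnd _ h2 h3
  have hre := (h.snd _ h2 h3).step hp
  refine WP.seq (WP.assign (by simp; exact h.okIdx (by simp) (by omega)) ?_)
  refine WP.seq (WP.assign ?_ ?_)
  · simp
    exact ⟨⟨h.okIdx (by simp) (by omega), by omega⟩, by omega⟩
  set σ1 := St.set _ _ _ _ with hσ1
  have e1 : σ1.a = σ.a := rfl
  have e2 : ∀ x, x ∉ [Var.src, .len] → σ1.v x = σ.v x := by
    intro x hx
    simp only [List.mem_cons, List.not_mem_nil, or_false, not_or] at hx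
    simp [hσ1, hx]
  have e3 : σ1.v .src = σ.a .src (σ.v .node) := by simp [hσ1]
  have e4 : σ1.v .len = σ.a .len (σ.v .node) + 1 := by simp [hσ1]
  have et : σ1.t ≤ σ.t + 30 := by simp [hσ1]
  have v1 : σ1.v .pbase = σ.v .pbase := e2 _ (by simp)
  have v2 : σ1.v .bigK = σ.v .bigK := e2 _ (by simp)
  have v3 : σ1.v .head = σ.v .head := e2 _ (by simp)
  have v4 : σ1.v .ecnt = σ.v .ecnt := e2 _ (by simp)
  have v5 : σ1.v .dst = σ.v .dst := e2 _ (by simp)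
  have v6 : σ1.v .tail = σ.v .tail := e2 _ (by simp)
  have v7 : σ1.v .node = σ.v .node := e2 _ (by simp)
  have d1 : DS M R σ1 := h.of_same (by simp [v1, v2, v6, v4]) (by rw [v3]; exact hht)
    fun A _ => by rw [e1]
  have x1 : Ext [.src, .len] σ σ1 := DS.ext_self e2 v6 e1
  clear_value σ1
  refine WP.seq (WP.mono (attempt_spec d1 ?_ ?_ ?_) ?_)
  · rw [e3, v1]; exact b1
  · rw [v5, v1]; exact hb
  · rw [e3, e4, v5]; exact hre
  rintro σ2 ⟨d2, x2, hs2, t2⟩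
  have w1 : σ2.v .node = σ.v .node := by rw [x2.v _ (by simp), v7]
  have w2 : σ2.v .pbase = σ.v .pbase := by rw [x2.v _ (by simp), v1]
  have x2' : Ext linkVar σ σ2 :=
    (x1.mono (by simp [linkVar])).trans (x2.mono (by simp [linkVar]))
  have x3 : Ext linkVar σ (σ2.set .node (Ex.eval σ2 (Ex.g .rnext (Ex.v .node)))
      ((Ex.g .rnext (Ex.v .node)).cost + 1)) := x2'.trans (DS.ext_self (by
        intro x hx
        simp only [linkVar, List.mem_cons, List.not_mem_nil, or_false, not_or] at hx
        simp [hx]) (by simp) rfl)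
  refine WP.assign ?_ ⟨?_, x3, ?_, ?_, ?_⟩
  · simp; exact d2.okIdx (by simp) (by rw [w1, w2]; omega)
  · exact d2.of_same (by simp) (by simpa using d2.ht) fun _ _ => rfl
  · simp only [St.set_v, if_true, Ex.eval_g, Ex.eval_v, St.set_a]
    rw [w1, d2.rch.1 _ h2 (h3.trans x2'.tail)]
  · intro hlt
    have := hs2 (by rw [e4, v2]; omega)
    rw [e3, e4, v5] at this
    exact this
  · simp; omega

/-- The list of marks at the source of the new edge is traversed while `attempt` may extend it. New
marks enter at the front, so the traversal, which moves towards smaller indices, never meets them;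
they are left to the next `drain`. -/
theorem link_spec {M : Mach} {R : ℕ → ℕ → Prop} {σ : St} (h : DS M R σ)
    (hb : σ.v .dst < σ.v .pbase) (hp : R (σ.a .afr (σ.v .ecnt)) (σ.a .ato (σ.v .ecnt)))
    (hd : σ.v .dst = σ.a .ato (σ.v .ecnt))
    (hn : σ.v .node = σ.a .rhead (σ.a .afr (σ.v .ecnt))) (hht : σ.v .head = σ.v .tail) :
    WP M (while_ Var.node linkStep) σ fun σ' => DS M R σ' ∧ Ext linkVar σ σ' ∧
      (∀ t, 1 ≤ t → t ≤ σ.v .head → Followed σ' t (σ.v .ecnt)) ∧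
      σ'.t ≤ σ.t + 2 + 150 * countIdx (σ.a .plc) (σ.a .afr (σ.v .ecnt)) 1 (σ.v .tail) := by
  set a := σ.a .afr (σ.v .ecnt) with ha
  refine WP.while_ (M := M) (σ := σ) (g := σ.v .tail + 1)
    (fun (j : ℕ) σ3 => DS M R σ3 ∧ Ext linkVar σ σ3 ∧
      σ3.v .node = prevIdx (σ.a .plc) a j ∧ (1 ≤ j ∧ j ≤ σ.v .tail + 1) ∧
      (∀ t, 1 ≤ t → j ≤ t → t ≤ σ.v .tail → Followed σ3 t (σ.v .ecnt)) ∧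
      σ3.t ≤ σ.t + 150 * countIdx (σ.a .plc) a j (σ.v .tail))
    (fun j => j) ?_ ?_ ?_ ?_
  · intro g σ1 _ _ _ _; simp
  · rintro j σ3 ⟨d3, x3, n3, j3, f3, t3⟩ hn
    replace hn : σ3.v .node ≠ 0 := hn
    rcases prevIdx_spec (σ.a .plc) a j with ⟨p1, -⟩ | ⟨p1, p2, p3, p4⟩
    · exact absurd (n3.trans p1) hn
    rw [← n3] at p1 p2 p3 p4
    have v1 : σ3.v .dst = σ.v .dst := x3.v _ (by simp [linkVar])
    have v2 : σ3.v .pbase = σ.v .pbase := x3.v _ (by simp [linkVar])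
    have ht3 := x3.tail
    have o1 := x3.old (σ3.v .node) p1 (by omega)
    refine WP.mono (linkStep_spec (R := R) (d3.of_same (σ' := σ3.tick _) (fun _ _ => rfl)
      (by exact d3.ht) fun _ _ => rfl) p1 ?_ ?_ ?_) ?_
    · simp; omega
    · simp [v1, v2]; omega
    · simp only [St.tick_v, St.tick_a]
      rw [o1.2.1, p3, v1, hd]; exact hp
    · rintro σ4 ⟨d4, x4, n4, f4, t4⟩
      simp only [St.tick_v, St.tick_a, St.tick_t, Ex.cost_v] at n4 f4 t4
      have x34 : Ext linkVar σ3 σ4 := ⟨x4.v, x4.a, x4.tail, x4.old⟩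
      have x24 := x3.trans x34
      have o2 := x24.old (σ3.v .node) p1 (by omega)
      refine ⟨σ3.v .node, ⟨d4, x24, ?_, by omega, ?_, ?_⟩, by exact p2⟩
      · rw [n4, o2.2.1, p3]
        -- Appended marks have indices above the old `tail`, so below `node` the list is the old
        -- one.
        exact prevIdx_congr _ _ fun t h1 h2 => (x24.old t h1 (by omega)).2.1
      · intro t h1 h2 h3
        rcases Nat.lt_or_ge t j with hj | hj
        · rcases Nat.eq_or_lt_of_le h2 with rfl | h4
          · intro _ hlt
            rw [o2.2.2, x24.v .bigK (by simp [linkVar])] at hlt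
            rw [x24.a .ato (by simp [markArr]), o2.1, o2.2.2]
            rw [o1.2.2, x3.v .bigK (by simp [linkVar]), o1.1, v1, hd] at f4
            exact f4 hlt
          · intro hp
            rw [(x24.old t h1 h3).2.1, x24.a .afr (by simp [markArr]), ← ha] at hp
            exact absurd hp (p4 t h4 hj)
        · exact x34.followed (by simp [linkVar]) h1 (h3.trans x3.tail) (f3 t h1 hj h3)
      · rw [countIdx_prev p2 j3.2 p3 p4]; omega
  · rintro j σ3 ⟨d3, x3, n3, j3, f3, t3⟩ h0
    replace h0 : σ3.v .node = 0 := h0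
    rw [h0] at n3
    rcases prevIdx_spec (σ.a .plc) a j with ⟨-, p1⟩ | ⟨p1, -⟩
    swap
    · omega
    refine ⟨d3.of_same (fun _ _ => rfl) d3.ht fun _ _ => rfl,
      x3.trans (DS.ext_self (fun _ _ => rfl) rfl rfl), ?_, ?_⟩
    · intro t h1 h2
      rw [hht] at h2
      show Followed σ3 _ _
      rcases Nat.lt_or_ge t j with hj | hj
      · intro hp
        rw [(x3.old t h1 h2).2.1, x3.a .afr (by simp [markArr]), ← ha] at hp
        exact absurd hp (p1 t h1 hj)
      · exact f3 t h1 hj h2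
    · have : countIdx (σ.a .plc) a j (σ.v .tail) ≤ countIdx (σ.a .plc) a 1 (σ.v .tail) := by
        refine Finset.card_le_card fun t ht => ?_
        simp only [Finset.mem_filter, Finset.mem_Icc] at ht ⊢
        exact ⟨⟨j3.1.trans ht.1.1, ht.1.2⟩, ht.2⟩
      simp only [St.tick_t, Ex.cost_v]
      omega
  · refine ⟨h, DS.ext_self (fun _ _ => rfl) rfl rfl, ?_, ⟨by omega, le_rfl⟩,
      fun e h1 h2 h3 => by omega, by simp⟩
    rw [hn, h.rch.2]

/-- The queue has to be empty when the edge is added: then all marks have been followed along all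
old edges, and only the new edge is missing. Hence `drain` is run once after marking the source and
once after following the new edge. -/
theorem insertEdge_spec {M : Mach} {R : ℕ → ℕ → Prop} {σ : St} (h : DS M R σ)
    (hht : σ.v .head = σ.v .tail) (hc : Closed σ (σ.v .tail))
    (ha : σ.v .la < σ.v .pbase) (hb : σ.v .lb < σ.v .pbase) (he : σ.v .ecnt + 1 ≤ σ.v .pbase)
    (haa : R (σ.v .la) (σ.v .la)) (hab : R (σ.v .la) (σ.v .lb)) :
    WP M insertEdge σ fun σ' => DS M R σ' ∧ σ'.v .head = σ'.v .tail ∧ Closed σ' (σ'.v .tail) ∧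
      (∀ x, x ∉ insVar → σ'.v x = σ.v x) ∧ (∀ A, A ∉ dsArr → σ'.a A = σ.a A) ∧
      σ'.v .ecnt = σ.v .ecnt + 1 ∧
      σ'.a .afr = Function.update (σ.a .afr) (σ.v .ecnt + 1) (σ.v .la) ∧
      σ'.a .ato = Function.update (σ.a .ato) (σ.v .ecnt + 1) (σ.v .lb) ∧
      (∀ s b l, Has σ s b l → Has σ' s b l) ∧ Has σ' (σ.v .la) (σ.v .la) 0 ∧
      σ'.t + 200 * work σ (σ.v .tail) ≤ σ.t + 1000 + 200 * work σ' (σ'.v .tail) := by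
  refine WP.of_rep fun hv hA hU => ?_
  refine WP.seq (WP.assign (by simp) ?_)
  refine WP.seq (WP.assign (by simp) ?_)
  refine WP.seq (WP.assign (by simp; omega) ?_)
  set σ1 := St.set _ _ _ _ with hσ1
  have e1 : σ1.a = σ.a := rfl
  have e2 : ∀ x, x ∉ [Var.src, .dst, .len] → σ1.v x = σ.v x := by
    intro x hx
    simp only [List.mem_cons, List.not_mem_nil, or_false, not_or] at hx
    simp [hσ1, hx]
  have e3 : σ1.v .src = σ.v .la := by simp [hσ1]
  have e4 : σ1.v .len = 0 := by simp [hσ1]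
  have e5 : σ1.v .dst = σ.v .la := by simp [hσ1]
  have et : σ1.t ≤ σ.t + 30 := by simp [hσ1]
  have v1 : σ1.v .pbase = σ.v .pbase := e2 _ (by simp)
  have v2 : σ1.v .bigK = σ.v .bigK := e2 _ (by simp)
  have v3 : σ1.v .head = σ.v .head := e2 _ (by simp)
  have v4 : σ1.v .ecnt = σ.v .ecnt := e2 _ (by simp)
  have v6 : σ1.v .tail = σ.v .tail := e2 _ (by simp)
  have d1 : DS M R σ1 := h.of_same (by simp [v1, v2, v6, v4]) (by rw [v3]; exact h.ht)
    fun A _ => by rw [e1]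
  have x1 : Ext drainVar σ σ1 :=
    (DS.ext_self e2 v6 e1 : Ext [.src, .dst, .len] σ σ1).mono (by simp [drainVar])
  clear_value σ1
  refine WP.seq (WP.mono (attempt_spec d1 ?_ ?_ ?_) ?_)
  · rw [e3, v1]; exact ha
  · rw [e5, v1]; exact ha
  · rw [e3, e4, e5]; exact .refl haa
  rintro σ2 ⟨d2, x2, hs2, t2⟩
  replace hs2 := hs2 (by omega)
  rw [e3, e4, e5] at hs2
  have x2' : Ext drainVar σ1 σ2 := x2.mono (by simp [drainVar])
  have h2h : σ2.v .head = σ.v .tail := by rw [x2.v _ (by simp), v3, hht]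
  have x02 := x1.trans x2'
  have c2 : Closed σ2 (σ2.v .head) := by
    rw [h2h]; exact x02.closed (by simp [drainVar]) (by simp [drainVar]) le_rfl hc
  refine WP.seq (WP.mono (drain_spec d2 c2) ?_)
  rintro σ3 ⟨d3, x3, h3, c3, t3⟩
  have x03 := x02.trans x3
  have w2 : work σ2 (σ2.v .head) = work σ (σ.v .tail) := by
    rw [h2h]; exact x02.work (by simp [drainVar]) le_rfl
  rw [w2] at t3
  have u1 : σ3.v .la = σ.v .la := x03.v _ (by simp [drainVar])
  have u2 : σ3.v .lb = σ.v .lb := x03.v _ (by simp [drainVar])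
  have u3 : σ3.v .pbase = σ.v .pbase := x03.v _ (by simp [drainVar])
  have u4 : σ3.v .ecnt = σ.v .ecnt := x03.v _ (by simp [drainVar])
  refine WP.seq (WP.mono (addEdge_spec d3 (by omega) (by omega) (by omega)
    (by rw [u1, u2]; exact hab)) ?_)
  rintro σ4 ⟨d4, y1, y2, y3, y4, y5, y6, y7, y8⟩
  have k1 := y1 .tail (by simp)
  have k2 := y1 .head (by simp)
  have k3 := y1 .pbase (by simp)
  have k4 := y1 .bigK (by simp)
  have k5 := y2 .plc (by simp)
  have k6 := y2 .src (by simp)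
  have k7 := y2 .len (by simp)
  have k8 := y2 .rhead (by simp)
  have k9 : σ4.a .afr (σ4.v .ecnt) = σ.v .la := by rw [y3, y6, Function.update_self, u1]
  have k10 : σ4.a .ato (σ4.v .ecnt) = σ.v .lb := by rw [y3, y7, Function.update_self, u2]
  have hhas4 : Has σ4 = Has σ3 := by
    funext s b l; simp only [Has, k1, k5, k6, k7]
  refine WP.seq (WP.mono (link_spec d4 (by omega) (by rw [k9, k10]; exact hab)
    (by rw [y4, k10, u2]) (by rw [y5, k9, u1, k8]) (by omega)) ?_)
  rintro σ5 ⟨d5, x5, f5, t5⟩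
  have z1 : σ5.v .head = σ4.v .head := x5.v _ (by simp [linkVar])
  have z2 : σ5.v .ecnt = σ4.v .ecnt := x5.v _ (by simp [linkVar])
  have c5 : Closed σ5 (σ5.v .head) := by
    intro t h1 h2 e h3' h4
    rw [z1] at h2
    rcases Nat.lt_or_ge e (σ4.v .ecnt) with h6 | h6
    · refine x5.followed (by simp [linkVar]) h1 (by omega) ?_
      have := c3 t h1 (by omega) e h3' (by omega)
      unfold Followed at this ⊢
      rwa [k4, k5, k6, k7, hhas4, y6, y7, Function.update_of_ne (by omega),
        Function.update_of_ne (by omega)]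
    · have : e = σ4.v .ecnt := by omega
      subst this
      exact f5 t h1 h2
  refine WP.mono (drain_spec d5 c5) ?_
  rintro σ6 ⟨d6, x6, h6, c6, t6⟩
  have x46 : Ext drainVar σ4 σ6 := (x5.mono (by simp [linkVar, drainVar])).trans x6
  have hmono : ∀ s b l, Has σ3 s b l → Has σ6 s b l := by
    intro s b l hh
    rw [← hhas4] at hh
    exact x46.has hh
  refine ⟨d6, h6, c6, ?_, ?_, ?_, ?_, ?_, fun s b l hh => hmono _ _ _ (x03.has hh),
    hmono _ _ _ (x3.has hs2), ?_⟩
  · intro x hx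
    simp only [insVar, List.mem_cons, List.not_mem_nil, or_false, not_or] at hx
    rw [x46.v x (by simp [drainVar, hx]), y1 x (by simp [hx]), x03.v x (by simp [drainVar, hx])]
  · intro A hx
    simp only [dsArr, List.mem_cons, List.not_mem_nil, or_false, not_or] at hx
    rw [x46.a A (by simp [markArr, hx]), y2 A (by simp [hx]), x03.a A (by simp [markArr, hx])]
  · rw [x46.v _ (by simp [drainVar]), y3, u4]
  · rw [x46.a _ (by simp [markArr]), y6, u4, u1, x03.a _ (by simp [markArr])]
  · rw [x46.a _ (by simp [markArr]), y7, u4, u2, x03.a _ (by simp [markArr])]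
  · have w5 : work σ5 (σ5.v .head) = work σ4 (σ4.v .tail) := by
      rw [z1, k2, h3, ← k1]; exact x5.work (by simp [linkVar]) le_rfl
    have w4 := work_addEdge (T := σ3.v .tail) y3 y6 k5
    rw [k9, k5, k1] at t5
    rw [u1] at w4
    rw [w5, k1, w4] at t6
    omega

/-! ### Insertion of pairs and the answers to reachability queries -/

/-- The symmetric reflexive relation generated by a list of pairs. -/
def Adj (E : List (ℕ × ℕ)) (a b : ℕ) : Prop :=
  ∃ e ∈ E, (a = e.1 ∨ a = e.2) ∧ (b = e.1 ∨ b = e.2)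

theorem Adj.symm {E : List (ℕ × ℕ)} {a b : ℕ} (h : Adj E a b) : Adj E b a := by
  obtain ⟨e, he, h1, h2⟩ := h
  exact ⟨e, he, h2, h1⟩

theorem Adj.left {E : List (ℕ × ℕ)} {a b : ℕ} (h : Adj E a b) : Adj E a a := by
  obtain ⟨e, he, h1, h2⟩ := h
  exact ⟨e, he, h1, h1⟩

theorem Adj.cons {E : List (ℕ × ℕ)} {a b : ℕ} (e : ℕ × ℕ) (h : Adj E a b) : Adj (e :: E) a b := by
  obtain ⟨e', he, h'⟩ := h
  exact ⟨e', List.mem_cons_of_mem _ he, h'⟩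

/-- The data structure presents the graph with the list `E` of edges. -/
structure DSE (M : Mach) (E : List (ℕ × ℕ)) (σ : St) : Prop where
  ds : DS M (Adj E) σ
  ht : σ.v .head = σ.v .tail
  closed : Closed σ (σ.v .tail)
  ecnt : σ.v .ecnt = 4 * E.length
  adj : ∀ a b, Adj E a b → ∃ e, 1 ≤ e ∧ e ≤ σ.v .ecnt ∧ σ.a .afr e = a ∧ σ.a .ato e = b
  has : ∀ a, Adj E a a → Has σ a a 0

/-- Completeness, by induction along the walk: the trivial mark at the source is present, and
closedness passes it on along each edge as long as the length does not exceed `K`. -/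
theorem DSE.has_of_reach {M : Mach} {E : List (ℕ × ℕ)} {σ : St} (h : DSE M E σ) {s l b : ℕ}
    (hr : Reach (Adj E) s l b) (hl : l ≤ σ.v .bigK) : Has σ s b l := by
  induction hr with
  | refl hs => exact h.has _ hs
  | step hr hab ih =>
    obtain ⟨t, h1, h2, h3, h4, h5⟩ := ih (by omega)
    obtain ⟨e, g1, g2, g3, g4⟩ := h.adj _ _ hab
    have := h.closed t h1 h2 e g1 g2 (by rw [h4, g3]) (by omega)
    rwa [h3, h5, g4] at this

/-- A look-up in the array of marks decides whether there is a short walk. -/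
theorem DSE.mark_ne_zero {M : Mach} {E : List (ℕ × ℕ)} {σ : St} (h : DSE M E σ) {p q : ℕ}
    (hp : p < σ.v .pbase) (hq : q < σ.v .pbase) :
    σ.a .mark ((p * σ.v .pbase + q) * σ.v .pbase + σ.v .bigK) ≠ 0 ↔
      Reach (Adj E) p (σ.v .bigK) q := by
  have := h.ds.mark p q (σ.v .bigK) hp hq h.ds.kP
  rw [markIdx] at this
  rw [this]
  constructor
  · intro hh
    by_contra hn
    exact hh (if_neg fun h' => hn (h.ds.has_reach h'))
  · intro hr
    rw [if_pos (h.has_of_reach hr le_rfl)]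
    exact one_ne_zero

/-- Insert the loops and the two directed edges of the pair `p1, p2`. -/
def insertPair : Prog :=
  .seq (assign .la Var.p1) <| .seq (assign .lb Var.p1) <| .seq insertEdge <|
  .seq (assign .la Var.p2) <| .seq (assign .lb Var.p2) <| .seq insertEdge <|
  .seq (assign .la Var.p1) <| .seq (assign .lb Var.p2) <| .seq insertEdge <|
  .seq (assign .la Var.p2) <| .seq (assign .lb Var.p1) <| .seq insertEdge skip

/-- The variables changed in inserting a pair. -/
def pairVar : List Var := [.tail, .tmp, .node, .src, .dst, .len, .head, .ecnt, .la, .lb]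

/-- The relation between the states before and after an insertion of a directed edge `(a, b)`. -/
structure Ins (M : Mach) (R : ℕ → ℕ → Prop) (a b : ℕ) (σ σ' : St) : Prop where
  ds : DS M R σ'
  ht : σ'.v .head = σ'.v .tail
  closed : Closed σ' (σ'.v .tail)
  v : ∀ x, x ∉ pairVar → σ'.v x = σ.v x
  arr : ∀ A, A ∉ dsArr → σ'.a A = σ.a A
  ecnt : σ'.v .ecnt = σ.v .ecnt + 1
  afr : σ'.a .afr = Function.update (σ.a .afr) (σ.v .ecnt + 1) a
  ato : σ'.a .ato = Function.update (σ.a .ato) (σ.v .ecnt + 1) b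
  mono : ∀ s b l, Has σ s b l → Has σ' s b l
  has : Has σ' a a 0
  time : σ'.t + 200 * work σ (σ.v .tail) ≤ σ.t + 1010 + 200 * work σ' (σ'.v .tail)

/-- The rest of the program appears as a continuation, so that the four insertions belonging to a
pair can be chained. -/
theorem insertEdge_args_spec {M : Mach} {R : ℕ → ℕ → Prop} {σ : St} (x y : Var)
    (hy : y ∉ pairVar) (h : DS M R σ) (hht : σ.v .head = σ.v .tail)
    (hc : Closed σ (σ.v .tail))
    (ha : σ.v x < σ.v .pbase) (hb : σ.v y < σ.v .pbase) (he : σ.v .ecnt + 1 ≤ σ.v .pbase)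
    (haa : R (σ.v x) (σ.v x)) (hab : R (σ.v x) (σ.v y)) {p : Prog} {Q : St → Prop}
    (hQ : ∀ σ', Ins M R (σ.v x) (σ.v y) σ σ' → WP M p σ' Q) :
    WP M (.seq (assign .la x) <| .seq (assign .lb y) <| .seq insertEdge p) σ Q := by
  simp only [pairVar, List.mem_cons, List.not_mem_nil, or_false, not_or] at hy
  refine WP.seq (WP.assign (by simp) (WP.seq (WP.assign (by simp) ?_)))
  set σ1 := St.set _ _ _ _ with hσ1
  have e1 : σ1.a = σ.a := rfl
  have e2 : ∀ x, x ∉ [Var.la, .lb] → σ1.v x = σ.v x := by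
    intro x hx
    simp only [List.mem_cons, List.not_mem_nil, or_false, not_or] at hx
    simp [hσ1, hx]
  have e3 : σ1.v .la = σ.v x := by simp [hσ1]
  have e4 : σ1.v .lb = σ.v y := by simp [hσ1, hy]
  have et : σ1.t = σ.t + 4 := by simp [hσ1]
  have v1 : σ1.v .pbase = σ.v .pbase := e2 _ (by simp)
  have v2 : σ1.v .bigK = σ.v .bigK := e2 _ (by simp)
  have v3 : σ1.v .head = σ.v .head := e2 _ (by simp)
  have v4 : σ1.v .ecnt = σ.v .ecnt := e2 _ (by simp)
  have v5 : σ1.v .tail = σ.v .tail := e2 _ (by simp)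
  have x1 : Ext [.la, .lb] σ σ1 := DS.ext_self e2 v5 e1
  have d1 : DS M R σ1 := h.of_same (by simp [v1, v2, v5, v4]) (by rw [v3]; exact h.ht)
    fun A _ => by rw [e1]
  clear_value σ1
  have hw : work σ1 (σ1.v .tail) = work σ (σ.v .tail) := by
    rw [v5]; exact x1.work (by simp) le_rfl
  refine WP.seq (WP.mono (insertEdge_spec d1 (by omega) ?_ (by omega) (by omega) (by omega)
    (by rw [e3]; exact haa) (by rw [e3, e4]; exact hab)) ?_)
  · rw [v5]; exact x1.closed (by simp) (by simp) le_rfl hc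
  rintro σ2 ⟨g1, g2, g3, g4, g5, g6, g7, g8, g9, g10, g11⟩
  refine hQ σ2 ⟨g1, g2, g3, ?_, ?_, by omega, ?_, ?_, fun s b l hh => g9 s b l (x1.has hh), ?_, ?_⟩
  · intro z hz
    simp only [pairVar, List.mem_cons, List.not_mem_nil, or_false, not_or] at hz
    rw [g4 z (by simp [insVar, hz]), e2 z (by simp [hz])]
  · intro A hA
    rw [g5 A hA, e1]
  · rw [g7, v4, e3, e1]
  · rw [g8, v4, e4, e1]
  · rw [e3] at g10; exact g10
  · rw [hw] at g11; omega

/-- A pair enters as two loops and two opposite edges, that is, four entries of the adjacency lists.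
The loops let a walk idle, so that the single table entry for length exactly `K` answers the query
for length at most `K`. -/
theorem insertPair_spec {M : Mach} {E : List (ℕ × ℕ)} {σ : St} (h : DSE M E σ)
    (hp : σ.v .p1 < σ.v .pbase) (hq : σ.v .p2 < σ.v .pbase)
    (he : 4 * E.length + 4 ≤ σ.v .pbase) {Q : St → Prop}
    (hQ : ∀ σ', DSE M ((σ.v .p1, σ.v .p2) :: E) σ' → (∀ x, x ∉ pairVar → σ'.v x = σ.v x) →
      (∀ A, A ∉ dsArr → σ'.a A = σ.a A) →
      σ'.t + 200 * work σ (σ.v .tail) ≤ σ.t + 4042 + 200 * work σ' (σ'.v .tail) →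
      Q (σ')) :
    WP M insertPair σ Q := by
  -- All four insertions are justified by the final relation, which the intermediate graphs realise
  -- only in part.
  set R := Adj ((σ.v .p1, σ.v .p2) :: E) with hR
  have hRE : ∀ a b, Adj E a b → R a b := fun a b hab => hab.cons _
  have rpp : R (σ.v .p1) (σ.v .p1) := ⟨_, List.mem_cons_self, Or.inl rfl, Or.inl rfl⟩
  have rqq : R (σ.v .p2) (σ.v .p2) := ⟨_, List.mem_cons_self, Or.inr rfl, Or.inr rfl⟩
  have rpq : R (σ.v .p1) (σ.v .p2) := ⟨_, List.mem_cons_self, Or.inl rfl, Or.inr rfl⟩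
  have rqp : R (σ.v .p2) (σ.v .p1) := ⟨_, List.mem_cons_self, Or.inr rfl, Or.inl rfl⟩
  have hec := h.ecnt
  refine insertEdge_args_spec .p1 .p1 (by simp [pairVar]) (h.ds.mono hRE) h.ht
    h.closed hp hp (by omega) rpp rpp fun σ1 i1 => ?_
  have a1 := i1.v .p1 (by simp [pairVar])
  have a2 := i1.v .p2 (by simp [pairVar])
  have a3 := i1.v .pbase (by simp [pairVar])
  have a4 := i1.ecnt
  refine insertEdge_args_spec .p2 .p2 (by simp [pairVar]) i1.ds i1.ht i1.closed
    (by omega) (by omega) (by omega) (by rw [a2]; exact rqq) (by rw [a2]; exact rqq) fun σ2 i2 => ?_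
  have b1 := i2.v .p1 (by simp [pairVar])
  have b2 := i2.v .p2 (by simp [pairVar])
  have b3 := i2.v .pbase (by simp [pairVar])
  have b4 := i2.ecnt
  refine insertEdge_args_spec .p1 .p2 (by simp [pairVar]) i2.ds i2.ht i2.closed
    (by omega) (by omega) (by omega) (by rw [b1, a1]; exact rpp) (by rw [b1, a1, b2, a2]; exact rpq)
    fun σ3 i3 => ?_
  have c1 := i3.v .p1 (by simp [pairVar])
  have c2 := i3.v .p2 (by simp [pairVar])
  have c3 := i3.v .pbase (by simp [pairVar])
  have c4 := i3.ecnt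
  refine insertEdge_args_spec .p2 .p1 (by simp [pairVar]) i3.ds i3.ht i3.closed
    (by omega) (by omega) (by omega) (by rw [c2, b2, a2]; exact rqq)
    (by rw [c1, b1, a1, c2, b2, a2]; exact rqp) fun σ4 i4 => ?_
  have d4 := i4.ecnt
  rw [c2, b2, a2, c1, b1, a1] at i4
  rw [b1, a1, b2, a2] at i3
  rw [a2] at i2
  have t1 := i1.time
  have t2 := i2.time
  have t3 := i3.time
  have t4 := i4.time
  have hafr : σ4.a .afr = Function.update (Function.update (Function.update (Function.update
      (σ.a .afr) (σ.v .ecnt + 1) (σ.v .p1)) (σ.v .ecnt + 2) (σ.v .p2)) (σ.v .ecnt + 3) (σ.v .p1))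
      (σ.v .ecnt + 4) (σ.v .p2) := by
    rw [i4.afr, i3.afr, i2.afr, i1.afr, c4, b4, a4]
  have hato : σ4.a .ato = Function.update (Function.update (Function.update (Function.update
      (σ.a .ato) (σ.v .ecnt + 1) (σ.v .p1)) (σ.v .ecnt + 2) (σ.v .p2)) (σ.v .ecnt + 3) (σ.v .p2))
      (σ.v .ecnt + 4) (σ.v .p1) := by
    rw [i4.ato, i3.ato, i2.ato, i1.ato, c4, b4, a4]
  have hec4 : σ4.v .ecnt = σ.v .ecnt + 4 := by omega
  have hnew : ∀ a b, R a b → ∃ e, 1 ≤ e ∧ e ≤ σ4.v .ecnt ∧ σ4.a .afr e = a ∧ σ4.a .ato e = b := by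
    rintro a b ⟨e, he, h1, h2⟩
    rcases List.mem_cons.1 he with rfl | he
    · rcases h1 with rfl | rfl <;> rcases h2 with rfl | rfl
      · exact ⟨σ.v .ecnt + 1, by omega, by omega, by simp [hafr], by simp [hato]⟩
      · exact ⟨σ.v .ecnt + 3, by omega, by omega, by simp [hafr], by simp [hato]⟩
      · exact ⟨σ.v .ecnt + 4, by omega, by omega, by simp [hafr], by simp [hato]⟩
      · exact ⟨σ.v .ecnt + 2, by omega, by omega, by simp [hafr], by simp [hato]⟩
    · obtain ⟨e', g1, g2, g3, g4⟩ := h.adj a b ⟨e, he, h1, h2⟩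
      refine ⟨e', g1, by omega, ?_, ?_⟩
      · rw [hafr]
        iterate 4 rw [Function.update_of_ne (by omega)]
        exact g3
      · rw [hato]
        iterate 4 rw [Function.update_of_ne (by omega)]
        exact g4
  have hhas : ∀ a, R a a → Has σ4 a a 0 := by
    rintro a ⟨e, he, h1, h2⟩
    rcases List.mem_cons.1 he with rfl | he
    · rcases h1 with rfl | rfl
      · exact i4.mono _ _ _ (i3.mono _ _ _ (i2.mono _ _ _ i1.has))
      · exact i4.has
    · exact i4.mono _ _ _ (i3.mono _ _ _ (i2.mono _ _ _ (i1.mono _ _ _ (h.has a ⟨e, he, h1, h2⟩))))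
  refine WP.skip (hQ _ ⟨?_, ?_, ?_, ?_, ?_, ?_⟩ ?_ ?_ ?_)
  · exact i4.ds.of_same (by simp) (by simpa using i4.ds.ht) fun _ _ => rfl
  · simpa using i4.ht
  · have := i4.closed
    simpa [Closed, Followed, Has] using this
  · simp [hec4, hec]; omega
  · simpa using hnew
  · simpa [Has] using hhas
  · intro x hx
    have hx' := hx
    simp only [pairVar, List.mem_cons, List.not_mem_nil, or_false, not_or] at hx'
    simp only [St.set_v, hx', if_false]
    rw [i4.v x hx, i3.v x hx, i2.v x hx, i1.v x hx]
  · intro A hA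
    rw [St.set_a, i4.arr A hA, i3.arr A hA, i2.arr A hA, i1.arr A hA]
  · have hw : work (σ4.set .tmp 0 2) (σ4.v .tail) = work σ4 (σ4.v .tail) :=
      work_congr rfl (by simp) fun _ _ _ => rfl
    simp only [St.set_v, St.set_t, reduceCtorEq, if_false]
    rw [hw]
    omega

/-! ## Hashing and the treatment of one edge -/

/-- Parameters of the algorithm. -/
structure Param where
  n : ℕ
  m : ℕ
  K : ℕ
  D : ℕ
  q : ℕ
  s : ℕ
  A : ℕ

/-- The base of the codes of places. -/
def Param.base (π : Param) : ℕ := π.q * π.q + π.n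
/-- A bound on the codes of places. -/
def Param.pbase (π : Param) : ℕ := π.base * π.base * π.base * π.base
/-- The number of seeds. -/
def Param.seeds (π : Param) : ℕ := π.q * π.A

/-- The polynomial over `ℤ/q` whose coefficients are the digits of `x`, evaluated at `al`. -/
def polyHash (q D al x : ℕ) : ℕ := (∑ i ∈ Finset.range D, x / q ^ i % q * al ^ i) % q

/-- The hash value of `x` for the seed `sg`. -/
def Param.hash (π : Param) (sg x : ℕ) : ℕ :=
  (sg % π.A + 1) * polyHash π.q π.D (sg / π.A) x % π.q / π.s

/-- The code of the vertex `x` in the class of the seed `sg` that is spanned by `u` and `v`. -/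
def Param.place (π : Param) (sg u v x : ℕ) : ℕ :=
  ((sg * π.base + (π.hash sg u + π.hash sg v)) * π.base + π.hash sg u * π.hash sg v) * π.base + x

open Classical in
/-- The seeds below `N` that require the edge `{u, v}`, as pairs of places. -/
noncomputable def Param.batchUpTo (π : Param) (E : List (ℕ × ℕ)) (u v N : ℕ) : List (ℕ × ℕ) :=
  ((List.range N).filter fun sg => π.hash sg u ≠ π.hash sg v ∧
    ¬ Reach (Adj E) (π.place sg u v u) π.K (π.place sg u v v)).map
      fun sg => (π.place sg u v u, π.place sg u v v)

/-- The seeds that require the edge `{u, v}`, as pairs of places. -/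
noncomputable def Param.batch (π : Param) (E : List (ℕ × ℕ)) (u v : ℕ) : List (ℕ × ℕ) :=
  π.batchUpTo E u v π.seeds

theorem Param.length_batchUpTo_le (π : Param) (E : List (ℕ × ℕ)) (u v N : ℕ) :
    (π.batchUpTo E u v N).length ≤ N := by
  unfold Param.batchUpTo
  rw [List.length_map]
  exact (List.length_filter_le _ _).trans (by simp)

/-- The parameters fit the machine. -/
structure Param.Valid (M : Mach) (π : Param) : Prop where
  q2 : 2 ≤ π.q
  s1 : 1 ≤ π.s
  A1 : 1 ≤ π.A
  Aq : π.A < π.q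
  KP : π.K < π.pbase
  B : M.B = 3 * π.m
  mP : 4 * (π.m * π.seeds) + 4 * π.m + 4 ≤ π.pbase
  fit : (π.pbase * π.pbase * π.pbase + 2) * 16 + 16 + M.B < M.U

/-- The variables hold the parameters. -/
structure Param.Holds (π : Param) (σ : St) : Prop where
  n : σ.v .n = π.n
  m : σ.v .m = π.m
  K : σ.v .bigK = π.K
  D : σ.v .dig = π.D
  q : σ.v .q = π.q
  s : σ.v .s = π.s
  A : σ.v .amax = π.A
  seeds : σ.v .seeds = π.seeds
  base : σ.v .base = π.base
  pbase : σ.v .pbase = π.pbase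

/-- The variables of the parameters. -/
def fixVar : List Var := [.n, .m, .bigK, .dig, .q, .s, .amax, .seeds, .base, .pbase]

theorem Param.Holds.of_frame {π : Param} {σ σ' : St} (h : π.Holds σ)
    (hv : ∀ x ∈ fixVar, σ'.v x = σ.v x) : π.Holds σ' where
  n := (hv _ (by simp [fixVar])).trans h.n
  m := (hv _ (by simp [fixVar])).trans h.m
  K := (hv _ (by simp [fixVar])).trans h.K
  D := (hv _ (by simp [fixVar])).trans h.D
  q := (hv _ (by simp [fixVar])).trans h.q
  s := (hv _ (by simp [fixVar])).trans h.s
  A := (hv _ (by simp [fixVar])).trans h.A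
  seeds := (hv _ (by simp [fixVar])).trans h.seeds
  base := (hv _ (by simp [fixVar])).trans h.base
  pbase := (hv _ (by simp [fixVar])).trans h.pbase

theorem Param.Valid.base_pos {M : Mach} {π : Param} (h : π.Valid M) : 4 ≤ π.base := by
  have := h.q2
  unfold Param.base; nlinarith

theorem Param.Valid.base_le {M : Mach} {π : Param} (h : π.Valid M) : π.base ≤ π.pbase := by
  have h0 := h.base_pos
  unfold Param.pbase
  exact (le_cube _).trans (Nat.le_mul_of_pos_right _ (by omega))

theorem Param.Valid.pbase_lt {M : Mach} {π : Param} (h : π.Valid M) : 16 * π.pbase < M.U := by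
  have := h.fit
  have := le_cube π.pbase
  omega

theorem polyHash_lt {q D al x : ℕ} (hq : 2 ≤ q) : polyHash q D al x < q :=
  Nat.mod_lt _ (by omega)

theorem Param.hash_lt {π : Param} (hq : 2 ≤ π.q) (sg x : ℕ) : π.hash sg x < π.q :=
  lt_of_le_of_lt (Nat.div_le_self _ _) (Nat.mod_lt _ (by omega))

theorem Param.Valid.parts_lt {M : Mach} {π : Param} (h : π.Valid M) {sg x : ℕ}
    (hs : sg < π.seeds) (hx : x < π.n) (u v : ℕ) : sg < π.base ∧
      π.hash sg u + π.hash sg v < π.base ∧ π.hash sg u * π.hash sg v < π.base ∧ x < π.base := by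
  have h2 := h.q2
  have hu := Param.hash_lt h2 sg u
  have hv := Param.hash_lt h2 sg v
  have h3 := h.Aq
  unfold Param.seeds at hs
  unfold Param.base
  have e1 : π.q * π.A ≤ π.q * π.q := Nat.mul_le_mul_left _ h3.le
  have e2 : 2 * π.q ≤ π.q * π.q := Nat.mul_le_mul_right _ h2
  have e3 : π.hash sg u * π.hash sg v ≤ π.q * π.q := Nat.mul_le_mul hu.le hv.le
  refine ⟨by omega, by omega, by omega, by omega⟩

/-- The seed, the sum and the product of the two hash values, and the vertex are the four digits of
a place in base `base`. -/
theorem Param.Valid.place_lt {M : Mach} {π : Param} (h : π.Valid M) {sg x : ℕ}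
    (hs : sg < π.seeds) (hx : x < π.n) (u v : ℕ) : π.place sg u v x < π.pbase := by
  obtain ⟨h1, h2, h3, h4⟩ := h.parts_lt hs hx u v
  have a1 : sg * π.base + (π.hash sg u + π.hash sg v) + 1 ≤ π.base * π.base := by nlinarith
  have a2 : (sg * π.base + (π.hash sg u + π.hash sg v)) * π.base +
      π.hash sg u * π.hash sg v + 1 ≤ π.base * π.base * π.base := by nlinarith
  unfold Param.place Param.pbase
  nlinarith

/-- `r :=` the hash value of `a` for the seed presented by `al` and `am`. -/
def computeHash (a r : Var) : Prog :=
  .seq (assign .y 0) <| .seq (assign .d a) <| .seq (assign .pw 1) <| .seq (assign .i 0) <|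
  .seq (while_ (Ex.lt Var.i Var.dig) <|
    .seq (assign .y ((Var.y + Var.d % Var.q * Var.pw) % Var.q : Ex)) <|
    .seq (assign .d (Var.d / Var.q : Ex)) <|
    .seq (assign .pw (Var.pw * Var.al % Var.q : Ex)) <|
    assign .i (Var.i + 1 : Ex)) <|
  assign r (Var.am * Var.y % Var.q / Var.s : Ex)

/-- The scratch variables of hashing. -/
def hashVar : List Var := [.y, .d, .pw, .i]

/-- The digits of the vertex are split off by division while the powers of `al` are accumulated.
Everything is reduced modulo `q`, so intermediate products stay below the square of `q` and fit into
words. -/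
theorem computeHash_spec {M : Mach} {π : Param} {σ : St} (hV : π.Valid M) (hF : π.Holds σ)
    {a r : Var} (ha : a ∉ hashVar) {sg : ℕ} (hs : sg < π.seeds)
    (hal : σ.v .al = sg / π.A) (ham : σ.v .am = sg % π.A + 1) :
    WP M (computeHash a r) σ fun σ' => (∀ x, x ≠ r → x ∉ hashVar → σ'.v x = σ.v x) ∧
      σ'.a = σ.a ∧ σ'.v r = π.hash sg (σ.v a) ∧ σ'.t ≤ σ.t + 50 * (π.D + 1) := by
  refine WP.of_rep fun hv hA hU => ?_
  have hq := hV.q2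
  have hb := hV.pbase_lt
  have hb2 := hV.base_le
  have hqq : π.q * π.q ≤ π.base := Nat.le_add_right _ _
  have hqb : π.q ≤ π.q * π.q := Nat.le_mul_self _
  have hA1 := hV.A1
  have hlt : sg / π.A < π.q := by
    rw [Nat.div_lt_iff_lt_mul (by omega)]; exact hs
  have hml : sg % π.A < π.A := Nat.mod_lt _ (by omega)
  have hAq := hV.Aq
  simp only [hashVar, List.mem_cons, List.not_mem_nil, or_false, not_or] at ha
  refine WP.seq (WP.assign (by simp; omega) ?_)
  refine WP.seq (WP.assign (by simp) ?_)
  refine WP.seq (WP.assign (by simp; omega) ?_)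
  refine WP.seq (WP.assign (by simp; omega) ?_)
  refine WP.seq (WP.while_ (g := 0) (fun (i : ℕ) σ1 =>
    (∀ x, x ∉ hashVar → σ1.v x = σ.v x) ∧ σ1.a = σ.a ∧ σ1.v .i = i ∧ i ≤ π.D ∧
    σ1.v .y = polyHash π.q i (sg / π.A) (σ.v a) ∧ σ1.v .d = σ.v a / π.q ^ i ∧
    σ1.v .pw = (sg / π.A) ^ i % π.q ∧ σ1.t ≤ σ.t + 10 + 50 * i) (fun i => π.D - i) ?_ ?_ ?_ ?_)
  · intro g σ1 _ _ _ _; simp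
  · rintro i σ1 ⟨f1, f2, f3, f4, f5, f6, f7, f8⟩ hne
    have w1 := (f1 .dig (by simp [hashVar])).trans hF.D
    have w2 := (f1 .q (by simp [hashVar])).trans hF.q
    have w3 := (f1 .al (by simp [hashVar])).trans hal
    have hlt' : i < π.D := by simpa [f3, w1] using hne
    have b1 : σ1.v .d % π.q < π.q := Nat.mod_lt _ (by omega)
    have b2 : σ1.v .pw < π.q := by rw [f7]; exact Nat.mod_lt _ (by omega)
    have b3 : σ1.v .y < π.q := by rw [f5]; exact polyHash_lt hq
    have b4 : σ1.v .d % π.q * σ1.v .pw ≤ π.q * π.q := Nat.mul_le_mul b1.le b2.le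
    have b5 : σ1.v .pw * (sg / π.A) ≤ π.q * π.q := Nat.mul_le_mul b2.le hlt.le
    refine WP.of_rep fun hv1 _ _ => ?_
    have := hv1 .dig
    simp only [St.tick_v] at this
    refine WP.seq (WP.assign (by simp [w2]; omega) ?_)
    refine WP.seq (WP.assign (by simp) ?_)
    refine WP.seq (WP.assign (by simp [w3]; omega) ?_)
    refine WP.assign (by simp; omega) ⟨i + 1, ⟨?_, ?_, ?_, by omega, ?_, ?_, ?_, ?_⟩, by omega⟩
    · intro x hx
      have hx' := hx
      simp only [hashVar, List.mem_cons, List.not_mem_nil, or_false, not_or] at hx'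
      simp [hx', f1 x hx]
    · simp [f2]
    · simp [f3]
    · simp only [St.set_v, reduceCtorEq, if_true, if_false, Ex.eval_mod, Ex.eval_add, Ex.eval_mul,
        Ex.eval_v, St.tick_v]
      rw [w2, f5, f6, f7, polyHash, polyHash, Finset.sum_range_succ]
      simp [Nat.add_mod, Nat.mul_mod]
    · simp [w2, f6, Nat.div_div_eq_div_mul, pow_succ]
    · simp [w2, w3, f7, pow_succ, Nat.mul_mod]
    · simp; omega
  · rintro i σ1 ⟨f1, f2, f3, f4, f5, f6, f7, f8⟩ h0
    have w1 := (f1 .dig (by simp [hashVar])).trans hF.D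
    have w2 := (f1 .q (by simp [hashVar])).trans hF.q
    have w3 := (f1 .am (by simp [hashVar])).trans ham
    have w4 := (f1 .s (by simp [hashVar])).trans hF.s
    have hi : i = π.D := by
      have : π.D ≤ i := by simpa [f3, w1] using h0
      omega
    subst hi
    have b3 : σ1.v .y < π.q := by rw [f5]; exact polyHash_lt hq
    have b4 : (sg % π.A + 1) * σ1.v .y ≤ π.q * π.q := Nat.mul_le_mul (by omega) b3.le
    refine WP.assign (by simp [w3]; omega) ⟨?_, ?_, ?_, ?_⟩
    · intro x hx1 hx2
      simp [hx1, f1 x hx2]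
    · simp [f2]
    · simp [w2, w3, w4, f5, Param.hash]
    · simp; omega
  · refine ⟨?_, rfl, ?_, by omega, ?_, ?_, ?_, ?_⟩
    · intro x hx
      simp only [hashVar, List.mem_cons, List.not_mem_nil, or_false, not_or] at hx
      simp [hx]
    · simp
    · simp [polyHash]
    · simp [ha]
    · simp; rw [Nat.mod_eq_of_lt (by omega)]
    · simp

theorem DS.of_frame {M : Mach} {R : ℕ → ℕ → Prop} {σ σ' : St} (h : DS M R σ)
    (hv : ∀ x ∈ [Var.pbase, .bigK, .tail, .ecnt, .head], σ'.v x = σ.v x)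
    (ha : ∀ A ∈ dsArr, σ'.a A = σ.a A) : DS M R σ' :=
  h.of_same (fun x hx => hv x (by simp at hx ⊢; tauto)) (by rw [hv .head (by simp)]; exact h.ht) ha

theorem work_frame {σ σ' : St} (hv : ∀ x ∈ [Var.pbase, .bigK, .tail, .ecnt, .head], σ'.v x = σ.v x)
    (ha : ∀ A ∈ dsArr, σ'.a A = σ.a A) : work σ' (σ'.v .tail) = work σ (σ.v .tail) := by
  rw [hv .tail (by simp)]
  exact work_congr (ha _ (by simp [dsArr])) (hv _ (by simp)) fun _ _ _ => by
    rw [ha .plc (by simp [dsArr])]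

theorem DSE.of_frame {M : Mach} {E : List (ℕ × ℕ)} {σ σ' : St} (h : DSE M E σ)
    (hv : ∀ x ∈ [Var.pbase, .bigK, .tail, .ecnt, .head], σ'.v x = σ.v x)
    (ha : ∀ A ∈ dsArr, σ'.a A = σ.a A) : DSE M E σ' := by
  have v1 := hv .tail (by simp)
  have v2 := hv .ecnt (by simp)
  have v3 := hv .head (by simp)
  have v4 := hv .bigK (by simp)
  have a1 := ha .src (by simp [dsArr])
  have a2 := ha .plc (by simp [dsArr])
  have a3 := ha .len (by simp [dsArr])
  have a4 := ha .afr (by simp [dsArr])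
  have a5 := ha .ato (by simp [dsArr])
  have hh : Has σ' = Has σ := by
    funext s b l; simp only [Has, v1, a1, a2, a3]
  refine ⟨h.ds.of_frame hv ha, ?_, ?_, ?_, ?_, ?_⟩
  · rw [v1, v3]; exact h.ht
  · have := h.closed
    unfold Closed Followed at this ⊢
    rw [v1, v2, v4, a1, a2, a3, a4, a5, hh]; exact this
  · rw [v2]; exact h.ecnt
  · rw [v2, a4, a5]; exact h.adj
  · rw [hh]; exact h.has

/-! ### Testing all seeds for one edge and inserting the outcome -/

/-- Test one seed. -/
def collectSeed : Prog :=
  .seq (assign .al (Var.sg / Var.amax : Ex)) <|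
  .seq (assign .am (Var.sg % Var.amax + 1 : Ex)) <|
  .seq (computeHash .u .hu) <| .seq (computeHash .v .hv) <|
  .seq (cond (Ex.eq Var.hu Var.hv) skip <|
    .seq (assign .pu (((Var.sg * Var.base + (Var.hu + Var.hv)) * Var.base + Var.hu * Var.hv) *
      Var.base + Var.u : Ex)) <|
    .seq (assign .pv (((Var.sg * Var.base + (Var.hu + Var.hv)) * Var.base + Var.hu * Var.hv) *
      Var.base + Var.v : Ex)) <|
    cond (.g .mark ((Var.pu * Var.pbase + Var.pv) * Var.pbase + Var.bigK : Ex)) skip <|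
    .seq (store .tp Var.cnt Var.pu) <| .seq (store .tq Var.cnt Var.pv) <|
    assign .cnt (Var.cnt + 1 : Ex)) <|
  assign .sg (Var.sg + 1 : Ex)

/-- The variables changed by testing seeds. -/
def collectVar : List Var :=
  [.y, .d, .pw, .i, .al, .am, .hu, .hv, .pu, .pv, .tmp, .cnt, .sg]

/-- The array entries `tp`, `tq` present the list `l`. -/
def Listed (σ : St) (l : List (ℕ × ℕ)) : Prop :=
  σ.v .cnt = l.length ∧ ∀ j (h : j < l.length), σ.a .tp j = l[j].1 ∧ σ.a .tq j = l[j].2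

theorem Param.batchUpTo_succ_of_not {π : Param} {E : List (ℕ × ℕ)} {u v N : ℕ}
    (h : ¬ (π.hash N u ≠ π.hash N v ∧ ¬ Reach (Adj E) (π.place N u v u) π.K (π.place N u v v))) :
    π.batchUpTo E u v (N + 1) = π.batchUpTo E u v N := by
  unfold Param.batchUpTo
  rw [List.range_succ, List.filter_append, List.filter_singleton]
  simp [h]

theorem Param.batchUpTo_succ {π : Param} {E : List (ℕ × ℕ)} {u v N : ℕ}
    (h : π.hash N u ≠ π.hash N v ∧ ¬ Reach (Adj E) (π.place N u v u) π.K (π.place N u v v)) :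
    π.batchUpTo E u v (N + 1) = π.batchUpTo E u v N ++ [(π.place N u v u, π.place N u v v)] := by
  unfold Param.batchUpTo
  rw [List.range_succ, List.filter_append, List.filter_singleton]
  simp [h]

theorem collectSeed_spec {M : Mach} {π : Param} {E : List (ℕ × ℕ)} {σ : St} (hV : π.Valid M)
    (hF : π.Holds σ) (hD : DSE M E σ) (hs : σ.v .sg < π.seeds) (hu : σ.v .u < π.n)
    (hv : σ.v .v < π.n) (hm : 1 ≤ π.m)
    (hl : Listed σ (π.batchUpTo E (σ.v .u) (σ.v .v) (σ.v .sg))) :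
    WP M collectSeed σ fun σ' => (∀ x, x ∉ collectVar → σ'.v x = σ.v x) ∧
      (∀ A, A ∉ [Arr.tp, .tq] → σ'.a A = σ.a A) ∧ σ'.v .sg = σ.v .sg + 1 ∧
      Listed σ' (π.batchUpTo E (σ.v .u) (σ.v .v) (σ.v .sg + 1)) ∧
      σ'.t ≤ σ.t + 300 * (π.D + 1) := by
  refine WP.of_rep fun hv0 hA0 hU => ?_
  have hbU := hV.pbase_lt
  have hbP := hV.base_le
  have hfit := hV.fit
  have hcu := le_cube π.pbase
  have hqq : π.q * π.q ≤ π.base := Nat.le_add_right _ _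
  have hqb : π.q ≤ π.q * π.q := Nat.le_mul_self _
  have hA1 := hV.A1
  have hAq := hV.Aq
  have hml : σ.v .sg % π.A < π.A := Nat.mod_lt _ (by omega)
  have hSm : π.seeds ≤ π.m * π.seeds := Nat.le_mul_of_pos_left _ hm
  have hmP := hV.mP
  have hlen := π.length_batchUpTo_le E (σ.v .u) (σ.v .v) (σ.v .sg)
  refine WP.seq (WP.assign (by simp) ?_)
  refine WP.seq (WP.assign (by simp [hF.A]; omega) ?_)
  set σ1 := St.set _ _ _ _ with hσ1
  have e1 : ∀ x, x ∉ [Var.al, .am] → σ1.v x = σ.v x := by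
    intro x hx
    simp only [List.mem_cons, List.not_mem_nil, or_false, not_or] at hx
    simp [hσ1, hx]
  have e2 : σ1.v .al = σ.v .sg / π.A := by simp [hσ1, hF.A]
  have e3 : σ1.v .am = σ.v .sg % π.A + 1 := by simp [hσ1, hF.A]
  have e4 : σ1.a = σ.a := rfl
  have e5 : σ1.t ≤ σ.t + 10 := by simp [hσ1]
  clear_value σ1
  have F1 : π.Holds σ1 := hF.of_frame fun x hx => e1 x (by
    simp [fixVar] at hx; rcases hx with rfl | rfl | rfl | rfl | rfl | rfl | rfl | rfl | rfl | rfl <;>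
      simp)
  refine WP.seq (WP.mono (computeHash_spec hV F1 (by simp [hashVar]) hs e2 e3) ?_)
  rintro σ2 ⟨a1, a2, a3, a4⟩
  have F2 : π.Holds σ2 := F1.of_frame fun x hx => a1 x
    (by rintro rfl; simp [fixVar] at hx) (by
    simp [fixVar] at hx; rcases hx with rfl | rfl | rfl | rfl | rfl | rfl | rfl | rfl | rfl | rfl <;>
      simp [hashVar])
  refine WP.seq (WP.mono (computeHash_spec hV F2 (by simp [hashVar]) hs
    ((a1 _ (by simp) (by simp [hashVar])).trans e2)
    ((a1 _ (by simp) (by simp [hashVar])).trans e3)) ?_)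
  rintro σ3 ⟨b1, b2, b3, b4⟩
  have hfr : ∀ x, x ∉ [Var.y, .d, .pw, .i, .al, .am, .hu, .hv] → σ3.v x = σ.v x := by
    intro x hx
    simp only [List.mem_cons, List.not_mem_nil, or_false, not_or] at hx
    rw [b1 x (by simp [hx]) (by simp [hashVar, hx]), a1 x (by simp [hx]) (by simp [hashVar, hx]),
      e1 x (by simp [hx])]
  have c1 : σ3.v .hu = π.hash (σ.v .sg) (σ.v .u) := by
    rw [b1 _ (by simp) (by simp [hashVar]), a3, e1 _ (by simp)]
  have c2 : σ3.v .hv = π.hash (σ.v .sg) (σ.v .v) := by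
    rw [b3, a1 _ (by simp) (by simp [hashVar]), e1 _ (by simp)]
  have c3 : σ3.a = σ.a := by rw [b2, a2, e4]
  have c4 : σ3.t ≤ σ.t + 10 + 100 * (π.D + 1) := by omega
  have c5 : σ3.v .sg = σ.v .sg := hfr _ (by simp)
  have c6 : σ3.v .u = σ.v .u := hfr _ (by simp)
  have c7 : σ3.v .v = σ.v .v := hfr _ (by simp)
  have c8 : σ3.v .cnt = σ.v .cnt := hfr _ (by simp)
  have c9 : σ3.v .base = π.base := (hfr _ (by simp)).trans hF.base
  have c10 : σ3.v .pbase = π.pbase := (hfr _ (by simp)).trans hF.pbase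
  have c11 : σ3.v .bigK = π.K := (hfr _ (by simp)).trans hF.K
  clear a1 a2 a3 a4 b1 b2 b3 b4 e1 e2 e3 e4 e5 F1 F2
  have hpu := hV.place_lt hs hu (σ.v .u) (σ.v .v)
  have hpv := hV.place_lt hs hv (σ.v .u) (σ.v .v)
  -- The three outcomes of a test (collision, short walk, edge required) share the concluding
  -- increment of `sg`.
  have fin : ∀ σ4 : St, (∀ x, x ∉ [Var.pu, .pv, .tmp, .cnt] → σ4.v x = σ3.v x) →
      (∀ A, A ∉ [Arr.tp, .tq] → σ4.a A = σ3.a A) →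
      Listed σ4 (π.batchUpTo E (σ.v .u) (σ.v .v) (σ.v .sg + 1)) → σ4.t ≤ σ3.t + 150 →
      WP M (assign .sg (Var.sg + 1 : Ex)) σ4 fun σ' => (∀ x, x ∉ collectVar → σ'.v x = σ.v x) ∧
      (∀ A, A ∉ [Arr.tp, .tq] → σ'.a A = σ.a A) ∧ σ'.v .sg = σ.v .sg + 1 ∧
      Listed σ' (π.batchUpTo E (σ.v .u) (σ.v .v) (σ.v .sg + 1)) ∧
      σ'.t ≤ σ.t + 300 * (π.D + 1) := by
    intro σ4 g1 g2 g3 g4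
    have g5 : σ4.v .sg = σ.v .sg := (g1 _ (by simp)).trans c5
    refine WP.assign (by simp [g5]; omega) ⟨?_, ?_, ?_, ?_, ?_⟩
    · intro x hx
      simp only [collectVar, List.mem_cons, List.not_mem_nil, or_false, not_or] at hx
      simp only [St.set_v, hx, if_false]
      rw [g1 x (by simp [hx]), hfr x (by simp [hx])]
    · intro A hA
      rw [St.set_a, g2 A hA, c3]
    · simp [g5]
    · simpa [Listed] using g3
    · simp; omega
  refine WP.seq (WP.cond (by simp) (fun hne => WP.skip ?_) fun heq => ?_)
  · have hne' : π.hash (σ.v .sg) (σ.v .u) = π.hash (σ.v .sg) (σ.v .v) := by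
      simpa [c1, c2] using hne
    refine fin _ ?_ (fun _ _ => rfl) ?_ ?_
    · intro x hx
      simp only [List.mem_cons, List.not_mem_nil, or_false, not_or] at hx
      simp [hx]
    · rw [Param.batchUpTo_succ_of_not (by simp [hne'])]
      simpa [Listed, c8, c3] using hl
    · simp
  have heq' : π.hash (σ.v .sg) (σ.v .u) ≠ π.hash (σ.v .sg) (σ.v .v) := by
    simpa [c1, c2] using heq
  obtain ⟨p1, p2, p3, p4⟩ := hV.parts_lt hs hu (σ.v .u) (σ.v .v)
  have hok : ∀ x : Var, x = .u ∨ x = .v → ∀ σ4 : St,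
      (∀ z, z ≠ .pu → σ4.v z = σ3.v z) →
      Ex.ok M σ4 (((Var.sg * Var.base + (Var.hu + Var.hv)) * Var.base + Var.hu * Var.hv) *
      Var.base + x : Ex) ∧
      Ex.eval σ4 (((Var.sg * Var.base + (Var.hu + Var.hv)) * Var.base + Var.hu * Var.hv) *
      Var.base + x : Ex) = π.place (σ.v .sg) (σ.v .u) (σ.v .v) (σ.v x) := by
    intro x hx σ4 h4
    have hvx : σ4.v x = σ.v x := by
      rcases hx with rfl | rfl
      · rw [h4 _ (by simp), c6]
      · rw [h4 _ (by simp), c7]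
    have hpx : π.place (σ.v .sg) (σ.v .u) (σ.v .v) (σ.v x) < π.pbase := by
      rcases hx with rfl | rfl
      exacts [hpu, hpv]
    unfold Param.place at hpx ⊢
    simp only [Ex.ok_add, Ex.ok_mul, Ex.ok_v, Ex.eval_add, Ex.eval_mul, Ex.eval_v, hvx,
      h4 .sg (by simp), h4 .base (by simp), h4 .hu (by simp), h4 .hv (by simp), c1, c2, c5, c9,
      true_and, and_true]
    set b := π.base
    set X := σ.v .sg * b
    set Y := (X + (π.hash (σ.v .sg) (σ.v .u) + π.hash (σ.v .sg) (σ.v .v))) * b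
    have hb4 := hV.base_pos
    have i1 : X + (π.hash (σ.v .sg) (σ.v .u) + π.hash (σ.v .sg) (σ.v .v)) ≤ Y :=
      Nat.le_mul_of_pos_right _ (by omega)
    have i2 : Y + π.hash (σ.v .sg) (σ.v .u) * π.hash (σ.v .sg) (σ.v .v) ≤
      (Y + π.hash (σ.v .sg) (σ.v .u) * π.hash (σ.v .sg) (σ.v .v)) * b :=
      Nat.le_mul_of_pos_right _ (by omega)
    repeat' apply And.intro
    all_goals omega
  obtain ⟨k1, k2⟩ := hok .u (Or.inl rfl) (σ3.tick (((Ex.v .hu).eq (Ex.v .hv)).cost + 1))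
    fun _ _ => rfl
  refine WP.seq (WP.assign k1 ?_)
  rw [k2]
  obtain ⟨k3, k4⟩ := hok .v (Or.inr rfl) ((σ3.tick (((Ex.v .hu).eq (Ex.v .hv)).cost + 1)).set .pu
    (π.place (σ.v .sg) (σ.v .u) (σ.v .v) (σ.v .u))
    ((((Var.sg * Var.base + (Var.hu + Var.hv)) * Var.base + Var.hu * Var.hv) *
      Var.base + Var.u : Ex).cost + 1)) fun z hz => by simp [hz]
  refine WP.seq (WP.assign k3 ?_)
  rw [k4]
  set σ4 := St.set _ _ _ _ with hσ4
  have d1 : ∀ x, x ∉ [Var.pu, .pv] → σ4.v x = σ3.v x := by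
    intro x hx
    simp only [List.mem_cons, List.not_mem_nil, or_false, not_or] at hx
    simp [hσ4, hx]
  have d2 : σ4.a = σ.a := by simp [hσ4, c3]
  have d3 : σ4.v .pu = π.place (σ.v .sg) (σ.v .u) (σ.v .v) (σ.v .u) := by simp [hσ4]
  have d4 : σ4.v .pv = π.place (σ.v .sg) (σ.v .u) (σ.v .v) (σ.v .v) := by simp [hσ4]
  have d5 : σ4.t ≤ σ3.t + 60 := by simp [hσ4]
  have d6 : σ4.v .pbase = π.pbase := (d1 _ (by simp)).trans c10
  have d7 : σ4.v .bigK = π.K := (d1 _ (by simp)).trans c11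
  have d8 : σ4.v .cnt = σ.v .cnt := (d1 _ (by simp)).trans c8
  clear_value σ4
  have D4 : DSE M E σ4 := hD.of_frame (by
      intro x hx
      simp at hx
      rcases hx with rfl | rfl | rfl | rfl | rfl <;> rw [d1 _ (by simp), hfr _ (by simp)])
    fun A _ => by rw [d2]
  have hmk := D4.mark_ne_zero (p := σ4.v .pu) (q := σ4.v .pv) (by rw [d3, d6]; exact hpu)
    (by rw [d4, d6]; exact hpv)
  have okIdx : ∀ A i, A ≠ .raw → i < π.pbase * π.pbase * π.pbase → M.okIdx A i := by
    intro A i hA hi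
    rw [Mach.okIdx, if_neg hA]; omega
  have hcnt : σ4.v .cnt < π.pbase := by rw [d8, hl.1]; omega
  have hcode := markIdx_lt (P := π.pbase) (s := σ4.v .pu) (b := σ4.v .pv) (l := π.K)
    (by rw [d3]; exact hpu) (by rw [d4]; exact hpv) hV.KP
  unfold markIdx at hcode
  refine WP.cond ?_ (fun hne => WP.skip ?_) fun h0 => ?_
  · simp only [Ex.ok_g, Ex.ok_add, Ex.ok_mul, Ex.ok_v, Ex.eval_add, Ex.eval_mul, Ex.eval_v,
      true_and, and_true, d6, d7]
    have hP1 : 0 < π.pbase := by omega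
    have i1 : σ4.v .pu * π.pbase + σ4.v .pv ≤ (σ4.v .pu * π.pbase + σ4.v .pv) * π.pbase :=
      Nat.le_mul_of_pos_right _ hP1
    refine ⟨?_, okIdx _ _ (by simp) hcode⟩
    repeat' apply And.intro
    all_goals omega
  · have hr := hmk.1 hne
    rw [d3, d4, d7] at hr
    refine fin _ ?_ (fun A _ => by simp [d2, c3]) ?_ ?_
    · intro x hx
      simp only [List.mem_cons, List.not_mem_nil, or_false, not_or] at hx
      simp [hx, d1]
    · rw [Param.batchUpTo_succ_of_not (by simp [hr])]
      simpa [Listed, d8, d2] using hl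
    · simp; omega
  have hr : ¬ Reach (Adj E) (π.place (σ.v .sg) (σ.v .u) (σ.v .v) (σ.v .u)) π.K
      (π.place (σ.v .sg) (σ.v .u) (σ.v .v) (σ.v .v)) := by
    rw [← d3, ← d4, ← d7]
    intro hr
    exact hmk.2 hr h0
  refine WP.seq (WP.store (by simp) (okIdx _ _ (by simp) (by simp; omega)) (by simp) ?_)
  refine WP.seq (WP.store (by simp) (okIdx _ _ (by simp) (by simp; omega)) (by simp) ?_)
  refine WP.assign (by simp; omega) (fin _ ?_ ?_ ?_ ?_)
  · intro x hx
    simp only [List.mem_cons, List.not_mem_nil, or_false, not_or] at hx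
    simp [hx, d1]
  · intro A hA
    simp only [List.mem_cons, List.not_mem_nil, or_false, not_or] at hA
    simp [hA, d2, c3]
  · rw [Param.batchUpTo_succ ⟨heq', hr⟩]
    refine ⟨by simp [d8, hl.1], fun j hj => ?_⟩
    simp only [List.length_append, List.length_singleton] at hj
    rcases Nat.lt_succ_iff_lt_or_eq.1 hj with hj' | rfl
    · have := hl.2 j hj'
      have hne : j ≠ σ.v .cnt := by rw [hl.1]; omega
      simp [d8, d2, Function.update_of_ne hne, List.getElem_append_left hj', this]
    · simp [d8, ← hl.1, d3, d4]
  · simp; omega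

/-- Test all seeds. -/
def collect : Prog :=
  .seq (assign .cnt 0) <| .seq (assign .sg 0) <| while_ (Ex.lt Var.sg Var.seeds) collectSeed

/-- All seeds are tested against the same graph and their pairs are merely listed, because whether
anything is inserted depends on how many there are. -/
theorem collect_spec {M : Mach} {π : Param} {E : List (ℕ × ℕ)} {σ : St} (hV : π.Valid M)
    (hF : π.Holds σ) (hD : DSE M E σ) (hu : σ.v .u < π.n) (hv : σ.v .v < π.n) (hm : 1 ≤ π.m) :
    WP M collect σ fun σ' => (∀ x, x ∉ collectVar → σ'.v x = σ.v x) ∧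
      (∀ A, A ∉ [Arr.tp, .tq] → σ'.a A = σ.a A) ∧
      Listed σ' (π.batch E (σ.v .u) (σ.v .v)) ∧
      σ'.t ≤ σ.t + 10 + 310 * (π.D + 1) * π.seeds := by
  refine WP.of_rep fun hv0 hA0 hU => ?_
  refine WP.seq (WP.assign (by simp; omega) ?_)
  refine WP.seq (WP.assign (by simp; omega) ?_)
  refine WP.while_ (g := 0) (fun (i : ℕ) σ1 =>
    (∀ x, x ∉ collectVar → σ1.v x = σ.v x) ∧ (∀ A, A ∉ [Arr.tp, .tq] → σ1.a A = σ.a A) ∧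
    σ1.v .sg = i ∧ i ≤ π.seeds ∧ Listed σ1 (π.batchUpTo E (σ.v .u) (σ.v .v) i) ∧
    σ1.t ≤ σ.t + 4 + 310 * (π.D + 1) * i) (fun i => π.seeds - i) ?_ ?_ ?_ ?_
  · intro g σ1 _ _ _ _; simp
  · rintro i σ1 ⟨f1, f2, f3, f4, f5, f6⟩ hne
    have w1 := (f1 .seeds (by simp [collectVar])).trans hF.seeds
    have w2 := f1 .u (by simp [collectVar])
    have w3 := f1 .v (by simp [collectVar])
    have hlt : i < π.seeds := by simpa [f3, w1] using hne
    have F1 : π.Holds (σ1.tick ((Ex.lt Var.sg Var.seeds).cost + 1)) := hF.of_frame fun x hx => f1 x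
      (by simp [fixVar] at hx; rcases hx with rfl | rfl | rfl | rfl | rfl | rfl | rfl | rfl | rfl |
            rfl <;> simp [collectVar])
    have D1 : DSE M E (σ1.tick ((Ex.lt Var.sg Var.seeds).cost + 1)) := hD.of_frame
      (fun x hx => f1 x (by
        simp at hx; rcases hx with rfl | rfl | rfl | rfl | rfl <;> simp [collectVar]))
      (fun A hA => f2 A (by rintro h; simp [dsArr] at hA; simp at h; aesop))
    refine WP.mono (collectSeed_spec hV F1 D1 (by simp [f3, hlt]) (by simp [w2, hu])
      (by simp [w3, hv]) hm (by simp only [St.tick_v]; rw [w2, w3, f3]; exact f5)) ?_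
    rintro σ2 ⟨g1, g2, g3, g4, g5⟩
    simp only [St.tick_v, St.tick_a, St.tick_t, Ex.cost_lt, Ex.cost_v] at g1 g2 g3 g4 g5
    rw [w2, w3, f3] at g4
    refine ⟨i + 1, ⟨fun x hx => (g1 x hx).trans (f1 x hx), fun A hA => (g2 A hA).trans (f2 A hA),
      by rw [g3, f3], hlt, g4, ?_⟩, by omega⟩
    generalize hc : (π.D + 1) = c at f6 g5 ⊢
    have : 310 * c * (i + 1) = 310 * c * i + 310 * c := by ring
    rw [this]
    generalize 310 * c * i = z at f6 ⊢
    omega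
  · rintro i σ1 ⟨f1, f2, f3, f4, f5, f6⟩ h0
    have w1 := (f1 .seeds (by simp [collectVar])).trans hF.seeds
    have : π.seeds ≤ i := by simpa [f3, w1] using h0
    have hi : i = π.seeds := by omega
    rw [hi] at f5 f6
    refine ⟨f1, f2, f5, ?_⟩
    simp only [St.tick_t, Ex.cost_lt, Ex.cost_v]
    omega
  · refine ⟨?_, fun _ _ => rfl, by simp, by omega, ?_, by simp⟩
    · intro x hx
      simp only [collectVar, List.mem_cons, List.not_mem_nil, or_false, not_or] at hx
      simp [hx]
    · simp [Listed, Param.batchUpTo]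

/-- Insert all the listed pairs. -/
def insertBatch : Prog :=
  .seq (assign .j 0) <| while_ (Ex.lt Var.j Var.cnt) <|
    .seq (assign .p1 (.g .tp Var.j)) <| .seq (assign .p2 (.g .tq Var.j)) <|
    .seq insertPair <| assign .j (Var.j + 1 : Ex)

/-- The variables changed in inserting the listed pairs. -/
def batchVar : List Var := [.tail, .tmp, .node, .src, .dst, .len, .head, .ecnt, .la, .lb, .j, .p1, .p2]

theorem insertBatch_spec {M : Mach} {E l : List (ℕ × ℕ)} {σ : St} (hD : DSE M E σ)
    (hl : Listed σ l) (hlt : ∀ e ∈ l, e.1 < σ.v .pbase ∧ e.2 < σ.v .pbase)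
    (hE : 4 * (E.length + l.length) + 4 ≤ σ.v .pbase) :
    WP M insertBatch σ fun σ' => DSE M (l.reverse ++ E) σ' ∧
      (∀ x, x ∉ batchVar → σ'.v x = σ.v x) ∧ (∀ A, A ∉ dsArr → σ'.a A = σ.a A) ∧
      σ'.t + 200 * work σ (σ.v .tail) ≤
        σ.t + 10 + 4100 * l.length + 200 * work σ' (σ'.v .tail) := by
  refine WP.of_rep fun hv0 hA0 hU => ?_
  refine WP.seq (WP.assign (by simp; omega) ?_)
  refine WP.while_ (g := 0) (fun (i : ℕ) σ1 => σ1.v .j = i ∧ i ≤ l.length ∧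
    DSE M ((l.take i).reverse ++ E) σ1 ∧
    (∀ x, x ∉ batchVar → σ1.v x = σ.v x) ∧ (∀ A, A ∉ dsArr → σ1.a A = σ.a A) ∧
    σ1.t + 200 * work σ (σ.v .tail) ≤ σ.t + 4 + 4100 * i + 200 * work σ1 (σ1.v .tail))
    (fun i => l.length - i) ?_ ?_ ?_ ?_
  · intro g σ1 _ _ _ _; simp
  · rintro i σ1 ⟨f1, f2, f3, f4, f5, f6⟩ hne
    have w1 := (f4 .cnt (by simp [batchVar])).trans hl.1
    have w2 := f4 .pbase (by simp [batchVar])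
    have hi : i < l.length := by simpa [f1, w1] using hne
    obtain ⟨t1, t2⟩ := hl.2 i hi
    have a1 := f5 .tp (by simp [dsArr])
    have a2 := f5 .tq (by simp [dsArr])
    have hfit := f3.ds.fit
    have hcu := le_cube (σ1.v .pbase)
    have okIdx : ∀ A i, A ≠ .raw → i < σ1.v .pbase → M.okIdx A i := by
      intro A i hA hi
      rw [Mach.okIdx, if_neg hA]; omega
    obtain ⟨b1, b2⟩ := hlt _ (List.getElem_mem hi)
    refine WP.seq (WP.assign (by simp; exact okIdx _ _ (by simp) (by omega)) ?_)
    refine WP.seq (WP.assign (by simp; exact okIdx _ _ (by simp) (by omega)) ?_)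
    set σ2 := St.set _ _ _ _ with hσ2
    have e1 : ∀ x, x ∉ [Var.p1, .p2] → σ2.v x = σ1.v x := by
      intro x hx
      simp only [List.mem_cons, List.not_mem_nil, or_false, not_or] at hx
      simp [hσ2, hx]
    have e2 : σ2.a = σ1.a := rfl
    have e3 : σ2.v .p1 = l[i].1 := by simp [hσ2, a1, f1, t1]
    have e4 : σ2.v .p2 = l[i].2 := by simp [hσ2, a2, f1, t2]
    have e5 : σ2.t ≤ σ1.t + 30 := by simp [hσ2]
    clear_value σ2
    have hfr : ∀ x ∈ [Var.pbase, .bigK, .tail, .ecnt, .head], σ2.v x = σ1.v x := by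
      intro x hx
      exact e1 x (by simp at hx; rcases hx with rfl | rfl | rfl | rfl | rfl <;> simp)
    have D2 := f3.of_frame hfr fun A _ => by rw [e2]
    have hw := work_frame hfr fun A _ => by rw [e2]
    have w3 : σ2.v .pbase = σ.v .pbase := (e1 _ (by simp)).trans w2
    refine WP.seq (insertPair_spec D2 (by omega) (by omega) ?_ ?_)
    · simp only [List.length_append, List.length_reverse, List.length_take]; omega
    intro σ3 D3 g1 g2 g3
    have g4 : σ3.v .j = i := by rw [g1 _ (by simp [pairVar]), e1 _ (by simp), f1]
    have hbP : l.length < σ.v .pbase := by omega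
    refine WP.assign (by simp [g4]; omega) ⟨i + 1, ⟨by simp [g4], hi, ?_, ?_, ?_, ?_⟩, by omega⟩
    · rw [e3, e4] at D3
      rw [List.take_succ_eq_append_getElem hi, List.reverse_append]
      refine DSE.of_frame D3 (fun x hx => ?_) fun _ _ => rfl
      simp at hx; rcases hx with rfl | rfl | rfl | rfl | rfl <;> simp
    · intro x hx
      have hx' := hx
      simp only [batchVar, List.mem_cons, List.not_mem_nil, or_false, not_or] at hx'
      simp only [St.set_v, hx', if_false]
      rw [g1 x (by simp [pairVar, hx']), e1 x (by simp [hx']), f4 x hx]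
    · intro A hA
      rw [St.set_a, g2 A hA, e2, f5 A hA]
    · have hw' : work (σ3.set .j (Ex.eval σ3 (Var.j + 1 : Ex)) ((Var.j + 1 : Ex).cost + 1))
          (σ3.v .tail) = work σ3 (σ3.v .tail) := work_congr rfl (by simp) fun _ _ _ => rfl
      simp only [Ex.cost_add, Ex.cost_v, Ex.cost_ofNat] at hw' ⊢
      simp only [St.set_v, St.set_t, reduceCtorEq, if_false]
      rw [hw']
      omega
  · rintro i σ1 ⟨f1, f2, f3, f4, f5, f6⟩ h0
    have w1 := (f4 .cnt (by simp [batchVar])).trans hl.1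
    have : l.length ≤ i := by simpa [f1, w1] using h0
    have hi : i = l.length := by omega
    subst hi
    rw [List.take_length] at f3
    have hw' : work (σ1.tick ((Ex.lt Var.j Var.cnt).cost + 1)) (σ1.v .tail) =
        work σ1 (σ1.v .tail) := rfl
    refine ⟨f3.of_frame (fun _ _ => rfl) fun _ _ => rfl, f4, f5, ?_⟩
    simp only [Ex.cost_lt, Ex.cost_v, St.tick_t, St.tick_v] at hw' ⊢
    rw [hw']; omega
  · refine ⟨by simp, by omega, ?_, ?_, fun _ _ => rfl, ?_⟩
    · simp only [List.take_zero, List.reverse_nil, List.nil_append]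
      refine hD.of_frame (fun x hx => ?_) fun _ _ => rfl
      simp at hx; rcases hx with rfl | rfl | rfl | rfl | rfl <;> simp
    · intro x hx
      simp only [batchVar, List.mem_cons, List.not_mem_nil, or_false, not_or] at hx
      simp [hx]
    · have hw' : work (σ.set .j (Ex.eval σ (0 : Ex)) ((0 : Ex).cost + 1)) (σ.v .tail) =
        work σ (σ.v .tail) := work_congr rfl (by simp) fun _ _ _ => rfl
      simp only [Ex.cost_ofNat, St.set_v, St.set_t, reduceCtorEq, if_false] at hw' ⊢
      rw [hw']; omega

/-- Decide on the edge `ed`. -/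
def processEdge : Prog :=
  .seq (assign .u (.g .raw (2 * Var.ed : Ex))) <|
  .seq (assign .v (.g .raw (2 * Var.ed + 1 : Ex))) <|
  .seq collect <|
  cond (Ex.lt (4 * Var.cnt : Ex) Var.seeds) skip <|
    .seq (store .raw (2 * Var.m + Var.nout : Ex) Var.ed) <|
    .seq (assign .nout (Var.nout + 1 : Ex)) insertBatch

/-- The variables changed in treating an edge. -/
def processVar : List Var := [.y, .d, .pw, .i, .al, .am, .hu, .hv, .pu, .pv, .tmp, .cnt, .sg,
  .tail, .node, .src, .dst, .len, .head, .ecnt, .la, .lb, .j, .p1, .p2, .u, .v, .nout]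

theorem Param.Valid.batch_lt {M : Mach} {π : Param} (hV : π.Valid M) (E : List (ℕ × ℕ)) {u v : ℕ}
    (hu : u < π.n) (hv : v < π.n) : ∀ e ∈ π.batch E u v, e.1 < π.pbase ∧ e.2 < π.pbase := by
  intro e he
  unfold Param.batch Param.batchUpTo at he
  rw [List.mem_map] at he
  obtain ⟨sg, hs, rfl⟩ := he
  have hs := List.mem_range.1 (List.mem_of_mem_filter hs)
  exact ⟨hV.place_lt hs hu u v, hV.place_lt hs hv u v⟩

/-- The potential `work` stands on both sides of the time bound: following marks is charged to the
growth of the data structure, and only the seed tests and the constant overhead per inserted pair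
are charged to the edge. -/
theorem processEdge_spec {M : Mach} {π : Param} {E : List (ℕ × ℕ)} {σ : St} (hV : π.Valid M)
    (hF : π.Holds σ) (hD : DSE M E σ) (hed : σ.v .ed < π.m)
    (hu : σ.a .raw (2 * σ.v .ed) < π.n) (hv : σ.a .raw (2 * σ.v .ed + 1) < π.n)
    (hn : σ.v .nout < π.m) (hE : 4 * (E.length + π.seeds) + 4 ≤ π.pbase) :
    let bt := π.batch E (σ.a .raw (2 * σ.v .ed)) (σ.a .raw (2 * σ.v .ed + 1))
    WP M processEdge σ fun σ' =>
      ((4 * bt.length < π.seeds ∧ DSE M E σ' ∧ σ'.v .nout = σ.v .nout ∧ σ'.a .raw = σ.a .raw) ∨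
       (π.seeds ≤ 4 * bt.length ∧ DSE M (bt.reverse ++ E) σ' ∧ σ'.v .nout = σ.v .nout + 1 ∧
        σ'.a .raw = Function.update (σ.a .raw) (2 * π.m + σ.v .nout) (σ.v .ed))) ∧
      (∀ x, x ∉ processVar → σ'.v x = σ.v x) ∧ σ'.a .tree = σ.a .tree ∧
      σ'.t + 200 * work σ (σ.v .tail) ≤
        σ.t + 200 + 5000 * (π.D + 1) * π.seeds + 200 * work σ' (σ'.v .tail) := by
  intro bt
  refine WP.of_rep fun hv0 hA0 hU => ?_
  have hB := hV.B
  have hPU := hV.pbase_lt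
  have hmP := hV.mP
  have hokr : ∀ i, i < 3 * π.m → M.okIdx .raw i := fun i hi => by
    rw [Mach.okIdx, if_pos rfl]; omega
  have hSD : (π.D + 1) * π.seeds ≥ π.seeds := Nat.le_mul_of_pos_left _ (by omega)
  refine WP.seq (WP.assign (by simp; exact ⟨⟨by omega, by omega⟩, hokr _ (by omega)⟩) ?_)
  refine WP.seq (WP.assign (by
    simp; exact ⟨⟨⟨⟨by omega, by omega⟩, by omega⟩, by omega⟩, hokr _ (by omega)⟩) ?_)
  set σ1 := St.set _ _ _ _ with hσ1
  have e1 : ∀ x, x ∉ [Var.u, .v] → σ1.v x = σ.v x := by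
    intro x hx
    simp only [List.mem_cons, List.not_mem_nil, or_false, not_or] at hx
    simp [hσ1, hx]
  have e2 : σ1.a = σ.a := rfl
  have e3 : σ1.v .u = σ.a .raw (2 * σ.v .ed) := by simp [hσ1]
  have e4 : σ1.v .v = σ.a .raw (2 * σ.v .ed + 1) := by simp [hσ1]
  have e5 : σ1.t ≤ σ.t + 40 := by simp [hσ1]
  clear_value σ1
  have F1 : π.Holds σ1 := hF.of_frame fun x hx => e1 x (by
    simp [fixVar] at hx; rcases hx with rfl | rfl | rfl | rfl | rfl | rfl | rfl | rfl | rfl | rfl <;>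
      simp)
  have hfr1 : ∀ x ∈ [Var.pbase, .bigK, .tail, .ecnt, .head], σ1.v x = σ.v x := by
    intro x hx
    exact e1 x (by simp at hx; rcases hx with rfl | rfl | rfl | rfl | rfl <;> simp)
  have D1 := hD.of_frame hfr1 fun A _ => by rw [e2]
  refine WP.seq (WP.mono (collect_spec hV F1 D1 (by omega) (by omega) (by omega)) ?_)
  rintro σ2 ⟨g1, g2, g3, g4⟩
  rw [e3, e4] at g3
  change Listed σ2 bt at g3
  have hbt : bt.length ≤ π.seeds := π.length_batchUpTo_le _ _ _ _
  have hfr2 : ∀ x ∈ [Var.pbase, .bigK, .tail, .ecnt, .head], σ2.v x = σ.v x := by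
    intro x hx
    rw [← hfr1 x hx]
    exact g1 x (by simp at hx; rcases hx with rfl | rfl | rfl | rfl | rfl <;> simp [collectVar])
  have hfa2 : ∀ A ∈ dsArr, σ2.a A = σ.a A := by
    intro A hA
    rw [g2 A (by rintro h; simp [dsArr] at hA; simp at h; aesop), e2]
  have hfr : ∀ x, x ∉ processVar → σ2.v x = σ.v x := by
    intro x hx
    simp only [processVar, List.mem_cons, List.not_mem_nil, or_false, not_or] at hx
    rw [g1 x (by simp [collectVar, hx]), e1 x (by simp [hx])]
  have D2 := hD.of_frame hfr2 hfa2
  have hw2 := work_frame hfr2 hfa2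
  have u1 : σ2.v .seeds = π.seeds := (hfr _ (by simp [processVar])).trans hF.seeds
  have u2 : σ2.v .m = π.m := (hfr _ (by simp [processVar])).trans hF.m
  have u3 : σ2.v .nout = σ.v .nout := by rw [g1 _ (by simp [collectVar]), e1 _ (by simp)]
  have u4 : σ2.v .ed = σ.v .ed := hfr _ (by simp [processVar])
  have u5 : σ2.v .pbase = π.pbase := (hfr _ (by simp [processVar])).trans hF.pbase
  have ar : σ2.a .raw = σ.a .raw := by rw [g2 _ (by simp), e2]
  have atr : σ2.a .tree = σ.a .tree := by rw [g2 _ (by simp), e2]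
  have hlin : 310 * (π.D + 1) * π.seeds = 310 * ((π.D + 1) * π.seeds) := by ring
  have hlin2 : 5000 * (π.D + 1) * π.seeds = 5000 * ((π.D + 1) * π.seeds) := by ring
  rw [hlin] at g4
  rw [hlin2]
  refine WP.cond (by simp [g3.1]; omega) (fun hne => WP.skip ?_) fun h0 => ?_
  · have h4 : 4 * bt.length < π.seeds := by simpa [g3.1, u1] using hne
    set σ3 := St.set _ _ _ _ with hσ3
    have k1 : ∀ x ≠ Var.tmp, σ3.v x = σ2.v x := fun x hx => by simp [hσ3, hx]
    have k2 : σ3.a = σ2.a := rfl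
    have k3 : σ3.t ≤ σ2.t + 10 := by simp [hσ3]
    clear_value σ3
    have hfr3 : ∀ x ∈ [Var.pbase, .bigK, .tail, .ecnt, .head], σ3.v x = σ2.v x := by
      intro x hx
      exact k1 x (by simp at hx; rcases hx with rfl | rfl | rfl | rfl | rfl <;> simp)
    have hw3 := work_frame hfr3 fun A _ => by rw [k2]
    refine ⟨Or.inl ⟨h4, D2.of_frame hfr3 fun A _ => by rw [k2], ?_, ?_⟩, ?_, ?_, ?_⟩
    · rw [k1 _ (by simp), u3]
    · rw [k2, ar]
    · intro x hx
      rw [k1 x (by rintro rfl; simp [processVar] at hx), hfr x hx]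
    · rw [k2, atr]
    · omega
  have h4 : π.seeds ≤ 4 * bt.length := by simpa [g3.1, u1] using h0
  refine WP.seq (WP.store (by simp [u2, u3]; omega) (hokr _ (by simp [u2, u3]; omega)) (by simp) ?_)
  refine WP.seq (WP.assign (by simp [u3]; omega) ?_)
  set σ3 := St.set _ _ _ _ with hσ3
  have k1 : ∀ x ≠ Var.nout, σ3.v x = σ2.v x := fun x hx => by simp [hσ3, hx]
  have k2 : ∀ A ≠ Arr.raw, σ3.a A = σ2.a A := fun A hA => by simp [hσ3, hA]
  have k3 : σ3.t ≤ σ2.t + 40 := by simp [hσ3]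
  have k4 : σ3.v .nout = σ.v .nout + 1 := by simp [hσ3, u3]
  have k5 : σ3.a .raw = Function.update (σ.a .raw) (2 * π.m + σ.v .nout) (σ.v .ed) := by
    simp [hσ3, u2, u3, u4, ar]
  clear_value σ3
  have hfr3 : ∀ x ∈ [Var.pbase, .bigK, .tail, .ecnt, .head], σ3.v x = σ2.v x := by
    intro x hx
    exact k1 x (by simp at hx; rcases hx with rfl | rfl | rfl | rfl | rfl <;> simp)
  have hfa3 : ∀ A ∈ dsArr, σ3.a A = σ2.a A := by
    intro A hA
    exact k2 A (by rintro rfl; simp [dsArr] at hA)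
  have hw3 := work_frame hfr3 hfa3
  have k6 : σ3.v .pbase = π.pbase := (k1 _ (by simp)).trans u5
  have L3 : Listed σ3 bt := by
    have := g3
    unfold Listed at this ⊢
    rwa [k1 _ (by simp), k2 _ (by simp), k2 _ (by simp)]
  refine WP.mono (insertBatch_spec (D2.of_frame hfr3 hfa3) L3 ?_ (by omega)) ?_
  · rw [k6]; exact hV.batch_lt E hu hv
  rintro σ4 ⟨D4, y1, y2, y3⟩
  refine ⟨Or.inr ⟨h4, D4, ?_, ?_⟩, ?_, ?_, ?_⟩
  · rw [y1 _ (by simp [batchVar]), k4]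
  · rw [y2 _ (by simp [dsArr]), k5]
  · intro x hx
    have hx' := hx
    simp only [processVar, List.mem_cons, List.not_mem_nil, or_false, not_or] at hx'
    rw [y1 x (by simp [batchVar, hx']), k1 x (by simp [hx']), hfr x hx]
  · rw [y2 _ (by simp [dsArr]), k2 _ (by simp), atr]
  · omega

/-! ## A tournament tree on the edges -/

open Classical in
/-- The winner of two entries of a tournament; an entry is `0` or the successor of an edge. -/
noncomputable def better (len : ℕ → ℝ≥0) (a b : ℕ) : ℕ :=
  if a = 0 then b else if b = 0 then a else if len (a - 1) ≤ len (b - 1) then a else b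

theorem better_eq (len : ℕ → ℝ≥0) (a b : ℕ) : better len a b = a ∨ better len a b = b := by
  unfold better; split_ifs <;> simp

theorem better_left (len : ℕ → ℝ≥0) {a : ℕ} (b : ℕ) (ha : a ≠ 0) :
    better len a b ≠ 0 ∧ len (better len a b - 1) ≤ len (a - 1) := by
  unfold better
  rw [if_neg ha]
  split_ifs with h1 h2
  · exact ⟨ha, le_rfl⟩
  · exact ⟨ha, le_rfl⟩
  · exact ⟨h1, (not_le.1 h2).le⟩

theorem better_right (len : ℕ → ℝ≥0) (a : ℕ) {b : ℕ} (hb : b ≠ 0) :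
    better len a b ≠ 0 ∧ len (better len a b - 1) ≤ len (b - 1) := by
  unfold better
  split_ifs with h1 h2
  · exact ⟨hb, le_rfl⟩
  · exact ⟨h1, h2⟩
  · exact ⟨hb, le_rfl⟩

/-- The tree `T` is a tournament among the edges below `m` outside `done`. -/
structure TreeOK (len : ℕ → ℝ≥0) (m : ℕ) (done : Finset ℕ) (T : ℕ → ℕ) : Prop where
  leaf : ∀ e < m, T (m + e) = if e ∈ done then 0 else e + 1
  node : ∀ j, 1 ≤ j → j < m → T j = better len (T (2 * j)) (T (2 * j + 1))

/-- Induction towards the leaves, with `r` bounding the distance of `j` from the end of the array.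
The nodes `1, …, 2m - 1` form a tree even if `m` is not a power of two. -/
theorem TreeOK.entry {len : ℕ → ℝ≥0} {m : ℕ} {done : Finset ℕ} {T : ℕ → ℕ}
    (h : TreeOK len m done T) : ∀ (r j : ℕ), 2 * m ≤ j + r → 1 ≤ j → j < 2 * m → T j ≠ 0 →
      T j - 1 < m ∧ T j - 1 ∉ done := by
  intro r
  induction r with
  | zero => intro j h1 h2 h3; omega
  | succ r ih =>
    intro j h1 h2 h3 h4
    by_cases hj : j < m
    · rw [h.node j h2 hj] at h4 ⊢
      rcases better_eq len (T (2 * j)) (T (2 * j + 1)) with e | e <;> rw [e] at h4 ⊢ <;>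
        exact ih _ (by omega) (by omega) (by omega) h4
    · have := h.leaf (j - m) (by omega)
      rw [show m + (j - m) = j by omega] at this
      rw [this] at h4 ⊢
      split_ifs at h4 ⊢ with hd
      · exact absurd rfl h4
      · exact ⟨by omega, by simpa using hd⟩

/-- Passing from a node to its parent `j / 2` never increases the winning length. -/
theorem TreeOK.up {len : ℕ → ℝ≥0} {m : ℕ} {done : Finset ℕ} {T : ℕ → ℕ}
    (h : TreeOK len m done T) : ∀ (j : ℕ), 1 ≤ j → j < 2 * m → T j ≠ 0 →
      T 1 ≠ 0 ∧ len (T 1 - 1) ≤ len (T j - 1) := by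
  intro j
  induction j using Nat.strong_induction_on with
  | _ j ih =>
    intro h1 h2 h3
    rcases eq_or_lt_of_le h1 with rfl | h1
    · exact ⟨h3, le_rfl⟩
    have hn := h.node (j / 2) (by omega) (by omega)
    have key : T (j / 2) ≠ 0 ∧ len (T (j / 2) - 1) ≤ len (T j - 1) := by
      rw [hn]
      rcases Nat.even_or_odd' j with ⟨c, rfl | rfl⟩
      · rw [show 2 * c / 2 = c by omega]; exact better_left _ _ h3
      · rw [show (2 * c + 1) / 2 = c by omega]; exact better_right _ _ h3
    obtain ⟨g1, g2⟩ := ih (j / 2) (by omega) (by omega) (by omega) key.1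
    exact ⟨g1, g2.trans key.2⟩

theorem TreeOK.root {len : ℕ → ℝ≥0} {m : ℕ} {done : Finset ℕ} {T : ℕ → ℕ}
    (h : TreeOK len m done T) {e : ℕ} (he : e < m) (hd : e ∉ done) :
    T 1 ≠ 0 ∧ len (T 1 - 1) ≤ len e := by
  have hl := h.leaf e he
  rw [if_neg hd] at hl
  have := h.up (m + e) (by omega) (by omega) (by omega)
  rwa [hl] at this

/-- Recompute the tree entry `j` from its children. -/
def fixNode : Prog :=
  .seq (assign .la (.g .tree (2 * Var.j : Ex))) <|
  .seq (assign .lb (.g .tree (2 * Var.j + 1 : Ex))) <|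
  cond (Ex.eq Var.la (0 : Ex)) (store .tree Var.j Var.lb) <|
  cond (Ex.eq Var.lb (0 : Ex)) (store .tree Var.j Var.la) <|
  .seq (compare .c1 (Var.la - 1 : Ex) (Var.lb - 1 : Ex)) <|
  cond Var.c1 (store .tree Var.j Var.la) (store .tree Var.j Var.lb)

/-- The effect of a program that only changes the tree and some scratch variables. -/
def TreeStep (X : List Var) (c : ℕ) (σ σ' : St) : Prop :=
  (∀ x, x ∉ X → σ'.v x = σ.v x) ∧ (∀ A, A ≠ .tree → σ'.a A = σ.a A) ∧ σ'.t ≤ σ.t + c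

theorem fixNode_spec {M : Mach} {σ : St} (hj : (2 * σ.v .j + 1) * 16 + 16 + M.B < M.U) :
    WP M fixNode σ fun σ' => TreeStep [.la, .lb, .c1] 60 σ σ' ∧ σ'.a .tree =
      Function.update (σ.a .tree) (σ.v .j)
        (better M.len (σ.a .tree (2 * σ.v .j)) (σ.a .tree (2 * σ.v .j + 1))) := by
  have ok : ∀ i, i ≤ 2 * σ.v .j + 1 → M.okIdx .tree i := fun i hi => by
    rw [Mach.okIdx, if_neg (by simp)]; omega
  refine WP.of_rep fun hv0 hA0 hU => ?_
  refine WP.seq (WP.assign (by simp; exact ⟨⟨by omega, by omega⟩, ok _ (by omega)⟩) ?_)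
  refine WP.seq (WP.assign (by
    simp; exact ⟨⟨⟨⟨by omega, by omega⟩, by omega⟩, by omega⟩, ok _ (by omega)⟩) ?_)
  set σ1 := St.set _ _ _ _ with hσ1
  have e1 : ∀ x, x ∉ [Var.la, .lb, .c1] → σ1.v x = σ.v x := by
    intro x hx
    simp only [List.mem_cons, List.not_mem_nil, or_false, not_or] at hx
    simp [hσ1, hx]
  have e2 : σ1.a = σ.a := rfl
  have e3 : σ1.v .la = σ.a .tree (2 * σ.v .j) := by simp [hσ1]
  have e4 : σ1.v .lb = σ.a .tree (2 * σ.v .j + 1) := by simp [hσ1]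
  have e5 : σ1.t ≤ σ.t + 23 := by simp [hσ1]
  have e6 : σ1.v .j = σ.v .j := e1 _ (by simp)
  clear_value σ1
  have fin : ∀ (σ2 : St) (x : Var), (∀ x, x ∉ [Var.c1] → σ2.v x = σ1.v x) → σ2.a = σ1.a →
      σ2.t ≤ σ1.t + 29 →
      σ2.v x = better M.len (σ.a .tree (2 * σ.v .j)) (σ.a .tree (2 * σ.v .j + 1)) →
      WP M (store .tree Var.j x) σ2 fun σ' => TreeStep [.la, .lb, .c1] 60 σ σ' ∧ σ'.a .tree =
        Function.update (σ.a .tree) (σ.v .j)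
          (better M.len (σ.a .tree (2 * σ.v .j)) (σ.a .tree (2 * σ.v .j + 1))) := by
    intro σ2 x h1 h2 h3 h4
    have h5 : σ2.v .j = σ.v .j := by rw [h1 _ (by simp), e6]
    refine WP.store (by simp) (ok _ (by simp [h5]; omega)) (by simp) ⟨⟨?_, ?_, ?_⟩, ?_⟩
    · intro x hx
      have hx' := hx
      simp only [List.mem_cons, List.not_mem_nil, or_false, not_or] at hx'
      rw [St.put_v, h1 x (by simp [hx']), e1 x hx]
    · intro A hA
      rw [St.put_a, if_neg hA, h2, e2]
    · simp only [St.put_t, Ex.cost_v]; omega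
    · simp [h5, h2, e2, h4]
  refine WP.cond (by simp; omega) (fun h => ?_) fun h => ?_
  · have h' : σ1.v .la = 0 := by
      by_contra hh; exact h (by simpa using hh)
    refine fin _ _ (by simp) rfl (by simp) ?_
    rw [St.tick_v, e4, better, if_pos (by rw [← e3, h'])]
  have ha : σ1.v .la ≠ 0 := by simpa using h
  refine WP.cond (by simp; omega) (fun h => ?_) fun h => ?_
  · have h' : σ1.v .lb = 0 := by
      by_contra hh; exact h (by simpa using hh)
    refine fin _ _ (by simp) rfl (by simp) ?_
    rw [St.tick_v, St.tick_v, e3, better, if_neg (by rwa [← e3]), if_pos (by rw [← e4, h'])]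
  have hb : σ1.v .lb ≠ 0 := by simpa using h
  refine WP.seq (WP.compare (by simp; omega) (by simp; omega) ?_)
  refine WP.cond (by simp) (fun h => ?_) fun h => ?_
  · refine fin _ _ ?_ (by simp) (by simp) ?_
    · intro x hx
      simp only [List.mem_cons, List.not_mem_nil, or_false] at hx
      simp [hx]
    · have h' : M.len (σ1.v .la - 1) ≤ M.len (σ1.v .lb - 1) := by
        by_contra hh; exact h (if_neg hh)
      rw [← e3, ← e4, better, if_neg ha, if_neg hb, if_pos h']
      simp
  · refine fin _ _ ?_ (by simp) (by simp) ?_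
    · intro x hx
      simp only [List.mem_cons, List.not_mem_nil, or_false] at hx
      simp [hx]
    · have h' : ¬ M.len (σ1.v .la - 1) ≤ M.len (σ1.v .lb - 1) := fun hh =>
        one_ne_zero ((if_pos hh).symm.trans h)
      rw [← e3, ← e4, better, if_neg ha, if_neg hb, if_neg h']
      simp

/-- Build the tournament tree on all edges. -/
def buildTree : Prog :=
  .seq (assign .j 0) <|
  .seq (while_ (Ex.lt Var.j Var.m) <|
    .seq (store .tree (Var.m + Var.j : Ex) (Var.j + 1 : Ex)) <| assign .j (Var.j + 1 : Ex)) <|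
  .seq (assign .j (Var.m - 1 : Ex)) <|
  while_ Var.j <| .seq fixNode <| assign .j (Var.j - 1 : Ex)

/-- The scratch variables of operations on the tree. -/
def treeVar : List Var := [.la, .lb, .c1, .j]

theorem TreeStep.v {X : List Var} {c : ℕ} {σ σ' : St} (h : TreeStep X c σ σ') {x : Var}
    (hx : x ∉ X) : σ'.v x = σ.v x := h.1 x hx

theorem buildTree_spec {M : Mach} {σ : St} (hm : 1 ≤ σ.v .m)
    (hU : 2 * σ.v .m * 16 + 16 + M.B < M.U) :
    WP M buildTree σ fun σ' => TreeStep treeVar (200 * (σ.v .m + 1)) σ σ' ∧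
      TreeOK M.len (σ.v .m) ∅ (σ'.a .tree) := by
  have ok : ∀ i, i < 2 * σ.v .m → M.okIdx .tree i := fun i hi => by
    rw [Mach.okIdx, if_neg (by simp)]; omega
  refine WP.of_rep fun _ _ hU' => ?_
  refine WP.seq (WP.assign (by simp; omega) ?_)
  refine WP.seq (WP.while_ (g := 0) (fun (i : ℕ) σ1 =>
    TreeStep treeVar (10 + 40 * i) σ σ1 ∧ σ1.v .j = i ∧ i ≤ σ.v .m ∧
    ∀ e < i, σ1.a .tree (σ.v .m + e) = e + 1) (fun i => σ.v .m - i) ?_ ?_ ?_ ?_)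
  · intro g σ1 _ _ _ _; simp
  · rintro i σ1 ⟨f1, f2, f3, f4⟩ hne
    have w1 := f1.v (x := .m) (by simp [treeVar])
    have hi : i < σ.v .m := by simpa [f2, w1] using hne
    refine WP.seq (WP.store (by simp [w1, f2]; omega) (ok _ (by simp [w1, f2]; omega))
      (by simp [f2]; omega) ?_)
    refine WP.assign (by simp [f2]; omega) ⟨i + 1, ⟨⟨?_, ?_, ?_⟩, by simp [f2], hi, ?_⟩, by omega⟩
    · intro x hx
      have hx' := hx
      simp only [treeVar, List.mem_cons, List.not_mem_nil, or_false, not_or] at hx'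
      simp [hx', f1.v hx]
    · intro A hA
      simp [hA, f1.2.1]
    · have := f1.2.2
      simp; omega
    · intro e he
      simp only [St.set_a, St.put_a, if_true, St.tick_a, Ex.eval_add, Ex.eval_v, St.tick_v, w1, f2,
        Ex.eval_ofNat]
      rcases Nat.lt_succ_iff_lt_or_eq.1 he with he | rfl
      · rw [Function.update_of_ne (by omega), f4 e he]
      · simp
  · rintro i σ1 ⟨f1, f2, f3, f4⟩ h0
    have w1 := f1.v (x := .m) (by simp [treeVar])
    have hi : i = σ.v .m := by
      have : σ.v .m ≤ i := by simpa [f2, w1] using h0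
      omega
    rw [hi] at f1 f4
    refine WP.seq (WP.assign (by simp [w1]; omega) ?_)
    refine WP.while_ (g := σ.v .m - 1) (fun (i : ℕ) σ1 =>
      TreeStep treeVar (20 + 40 * σ.v .m + 80 * (σ.v .m - 1 - i)) σ σ1 ∧ σ1.v .j = i ∧
      i ≤ σ.v .m - 1 ∧ (∀ e < σ.v .m, σ1.a .tree (σ.v .m + e) = e + 1) ∧
      ∀ j, i < j → j < σ.v .m → σ1.a .tree j =
        better M.len (σ1.a .tree (2 * j)) (σ1.a .tree (2 * j + 1))) (fun i => i) ?_ ?_ ?_ ?_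
    · intro g σ1 _ _ _ _; simp
    · rintro i σ1 ⟨f1, f2, f3, f4, f5⟩ hne
      have hi : i ≠ 0 := by simpa [f2] using hne
      refine WP.seq (WP.mono (fixNode_spec (by simp [f2]; omega)) ?_)
      rintro σ2 ⟨⟨g1, g2, g3⟩, g4⟩
      simp only [St.tick_v, St.tick_a, St.tick_t, f2, Ex.cost_v] at g1 g2 g3 g4
      have hj : σ2.v .j = i := by rw [g1 _ (by simp), f2]
      have hne' : ∀ x, x ≠ i → σ2.a .tree x = σ1.a .tree x := fun x hx => by
        rw [g4, Function.update_of_ne hx]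
      refine WP.assign (by simp [hj]; omega) ⟨i - 1, ⟨⟨?_, ?_, ?_⟩, by simp [hj], by omega, ?_, ?_⟩,
        by omega⟩
      · intro x hx
        have hx' := hx
        simp only [treeVar, List.mem_cons, List.not_mem_nil, or_false, not_or] at hx'
        rw [St.set_v, if_neg hx'.2.2.2, g1 x (by simp [hx']), f1.v hx]
      · intro A hA
        rw [St.set_a, g2 A hA, f1.2.1 A hA]
      · have := f1.2.2
        simp; omega
      · intro e he
        rw [St.set_a, hne' _ (by omega), f4 e he]
      · intro j h1 h2
        rw [St.set_a, hne' (2 * j) (by omega), hne' (2 * j + 1) (by omega)]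
        rcases eq_or_ne j i with rfl | hji
        · rw [g4, Function.update_self]
        · rw [hne' j hji, f5 j (by omega) h2]
    · rintro i σ1 ⟨f1, f2, f3, f4, f5⟩ h0
      have hi : i = 0 := by simpa [f2] using h0
      subst hi
      refine ⟨⟨fun x hx => f1.v hx, f1.2.1, ?_⟩, fun e he => ?_, fun j h1 h2 => ?_⟩
      · have := f1.2.2
        simp; omega
      · simp [f4 e he]
      · exact f5 j (by omega) h2
    · refine ⟨⟨?_, f1.2.1, ?_⟩, by simp [w1], le_rfl, f4, fun j h1 h2 => by omega⟩
      · intro x hx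
        have hx' := hx
        simp only [treeVar, List.mem_cons, List.not_mem_nil, or_false, not_or] at hx'
        simp [hx', f1.v hx]
      · have := f1.2.2
        simp; omega
  · refine ⟨⟨?_, fun _ _ => rfl, by simp⟩, by simp, by omega, fun e he => by omega⟩
    intro x hx
    simp only [treeVar, List.mem_cons, List.not_mem_nil, or_false, not_or] at hx
    simp [hx]

/-- Remove the edge `ed` from the tree. -/
def extract : Prog :=
  .seq (assign .j (Var.m + Var.ed : Ex)) <| .seq (store .tree Var.j (0 : Ex)) <|
  while_ (Ex.lt (1 : Ex) Var.j) <| .seq (assign .j (Var.j / 2 : Ex)) fixNode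

/-- Clearing a leaf spoils the node equations only on the path to the root. The invariant exempts
just the parent of the current node, and halving the index bounds the number of rounds by a binary
logarithm. -/
theorem extract_spec {M : Mach} {σ : St} {done : Finset ℕ} (hed : σ.v .ed < σ.v .m)
    (hU : 2 * σ.v .m * 16 + 16 + M.B < M.U) (hT : TreeOK M.len (σ.v .m) done (σ.a .tree)) :
    WP M extract σ fun σ' => TreeStep treeVar (20 + 80 * Nat.log 2 (2 * σ.v .m)) σ σ' ∧
      TreeOK M.len (σ.v .m) (insert (σ.v .ed) done) (σ'.a .tree) := by
  have ok : ∀ i, i < 2 * σ.v .m → M.okIdx .tree i := fun i hi => by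
    rw [Mach.okIdx, if_neg (by simp)]; omega
  refine WP.of_rep fun _ _ hU' => ?_
  refine WP.seq (WP.assign (by simp; omega) ?_)
  refine WP.seq (WP.store (by simp) (ok _ (by simp; omega)) (by simp; omega) ?_)
  have hlog : Nat.log 2 (σ.v .m + σ.v .ed) ≤ Nat.log 2 (2 * σ.v .m) :=
    Nat.log_mono_right (by omega)
  refine WP.while_ (g := σ.v .m + σ.v .ed) (fun (j : ℕ) σ1 =>
    TreeStep treeVar (15 + 80 * (Nat.log 2 (2 * σ.v .m) - Nat.log 2 j)) σ σ1 ∧ σ1.v .j = j ∧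
    1 ≤ j ∧ j < 2 * σ.v .m ∧ Nat.log 2 j ≤ Nat.log 2 (2 * σ.v .m) ∧
    (∀ e < σ.v .m, σ1.a .tree (σ.v .m + e) = if e ∈ insert (σ.v .ed) done then 0 else e + 1) ∧
    ∀ i, 1 ≤ i → i < σ.v .m → i ≠ j / 2 → σ1.a .tree i =
      better M.len (σ1.a .tree (2 * i)) (σ1.a .tree (2 * i + 1))) (fun j => j) ?_ ?_ ?_ ?_
  · intro g σ1 _ _ _ _; simp; omega
  · rintro j σ1 ⟨f1, f2, f3, f4, f5, f6, f7⟩ hne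
    have hj : 1 < j := by simpa [f2] using hne
    refine WP.seq (WP.assign (by simp; omega) ?_)
    refine WP.mono (fixNode_spec (by simp [f2]; omega)) ?_
    rintro σ2 ⟨⟨g1, g2, g3⟩, g4⟩
    simp only [St.tick_v, St.tick_a, St.tick_t, f2, Ex.cost_v, St.set_a, St.set_v, St.set_t,
      Ex.eval_div, Ex.eval_v, Ex.eval_ofNat, if_true, Ex.cost_div, Ex.cost_lt, Ex.cost_ofNat]
      at g1 g2 g3 g4
    have hj' : σ2.v .j = j / 2 := by rw [g1 _ (by simp)]; simp
    have hne' : ∀ x, x ≠ j / 2 → σ2.a .tree x = σ1.a .tree x := fun x hx => by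
      rw [g4, Function.update_of_ne hx]
    have hl : Nat.log 2 (j / 2) = Nat.log 2 j - 1 := Nat.log_div_base 2 j
    have hl1 : 1 ≤ Nat.log 2 j := Nat.log_pos (by omega) hj
    refine ⟨j / 2, ⟨⟨?_, ?_, ?_⟩, hj', by omega, by omega, by omega, ?_, ?_⟩, by omega⟩
    · intro x hx
      have hx' := hx
      simp only [treeVar, List.mem_cons, List.not_mem_nil, or_false, not_or] at hx'
      rw [g1 x (by simp [hx']), if_neg hx'.2.2.2, f1.v hx]
    · intro A hA
      rw [g2 A hA, f1.2.1 A hA]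
    · have := f1.2.2
      omega
    · intro e he
      rw [hne' _ (by omega), f6 e he]
    · intro i h1 h2 h3
      rw [hne' (2 * i) (by omega), hne' (2 * i + 1) (by omega)]
      rcases eq_or_ne i (j / 2) with rfl | hji
      · rw [g4, Function.update_self]
      · rw [hne' i hji, f7 i h1 h2 hji]
  · rintro j σ1 ⟨f1, f2, f3, f4, f5, f6, f7⟩ h0
    have hj : j ≤ 1 := by simpa [f2] using h0
    refine ⟨⟨fun x hx => f1.v hx, f1.2.1, ?_⟩, fun e he => ?_, fun i h1 h2 => ?_⟩
    · have := f1.2.2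
      simp; omega
    · exact f6 e he
    · exact f7 i h1 h2 (by omega)
  · refine ⟨⟨?_, ?_, ?_⟩, by simp, by omega, by omega, hlog, ?_, ?_⟩
    · intro x hx
      simp only [treeVar, List.mem_cons, List.not_mem_nil, or_false, not_or] at hx
      simp [hx]
    · intro A hA
      simp [hA]
    · simp; omega
    · intro e he
      simp only [St.put_a, if_true, St.set_a, Ex.eval_v, St.set_v, Ex.eval_add, Ex.eval_ofNat]
      rcases eq_or_ne e (σ.v .ed) with rfl | hne
      · simp
      · rw [Function.update_of_ne (by omega), hT.leaf e he]
        simp [hne]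
    · intro i h1 h2 h3
      simp only [St.put_a, if_true, St.set_a, Ex.eval_v, St.set_v, Ex.eval_add, Ex.eval_ofNat]
      rw [Function.update_of_ne (by omega), Function.update_of_ne (by omega),
        Function.update_of_ne (by omega), hT.node i h1 h2]

/-! ## The greedy procedure -/

/-- The runs of the greedy procedure: the set of edges that have been treated, the list of the
chosen edges, and the list of the pairs of places that have been joined. -/
inductive Greedy (π : Param) (len : ℕ → ℝ≥0) (en : ℕ → ℕ × ℕ) :
    Finset ℕ → List ℕ → List (ℕ × ℕ) → Prop
  | nil : Greedy π len en ∅ [] []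
  | skip {done : Finset ℕ} {out : List ℕ} {E : List (ℕ × ℕ)} (e : ℕ)
      (h : Greedy π len en done out E) (he : e < π.m) (hd : e ∉ done)
      (hle : ∀ e' < π.m, e' ∉ done → len e ≤ len e')
      (hb : 4 * (π.batch E (en e).1 (en e).2).length < π.seeds) :
      Greedy π len en (insert e done) out E
  | take {done : Finset ℕ} {out : List ℕ} {E : List (ℕ × ℕ)} (e : ℕ)
      (h : Greedy π len en done out E) (he : e < π.m) (hd : e ∉ done)
      (hle : ∀ e' < π.m, e' ∉ done → len e ≤ len e')
      (hb : π.seeds ≤ 4 * (π.batch E (en e).1 (en e).2).length) :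
      Greedy π len en (insert e done) (out ++ [e]) ((π.batch E (en e).1 (en e).2).reverse ++ E)

theorem Greedy.card_bounds {π : Param} {len : ℕ → ℝ≥0} {en : ℕ → ℕ × ℕ} {done : Finset ℕ}
    {out : List ℕ} {E : List (ℕ × ℕ)} (h : Greedy π len en done out E) :
    done ⊆ Finset.range π.m ∧ out.length ≤ done.card ∧ E.length ≤ done.card * π.seeds := by
  induction h with
  | nil => simp
  | skip e h he hd hle hb ih =>
    obtain ⟨h1, h2, h3⟩ := ih
    rw [Finset.card_insert_of_notMem hd]
    refine ⟨Finset.insert_subset (Finset.mem_range.2 he) h1, by omega, h3.trans ?_⟩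
    exact Nat.mul_le_mul_right _ (Nat.le_succ _)
  | @take done out E e h he hd hle hb ih =>
    obtain ⟨h1, h2, h3⟩ := ih
    rw [Finset.card_insert_of_notMem hd]
    refine ⟨Finset.insert_subset (Finset.mem_range.2 he) h1, by simp; omega, ?_⟩
    have := π.length_batchUpTo_le E (en e).1 (en e).2 π.seeds
    rw [List.length_append, List.length_reverse, add_mul, one_mul, Param.batch]
    omega

/-- Treat the edges by increasing length. -/
def mainLoop : Prog :=
  .seq (assign .x (.g .tree (1 : Ex))) <| while_ Var.x <|
    .seq (assign .ed (Var.x - 1 : Ex)) <| .seq extract <| .seq processEdge <|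
    assign .x (.g .tree (1 : Ex))

/-- The variables that the main loop does not change. -/
def keepVar : List Var := [.n, .m, .f, .k]

/-- The root of the tournament is a shortest untreated edge, so the loop performs a run of `Greedy`;
an empty root means that no edge is left. -/
theorem mainLoop_spec {M : Mach} {π : Param} {σ : St} (hV : π.Valid M) (hF : π.Holds σ)
    (hD : DSE M [] σ) (hm : 1 ≤ π.m) (hT : TreeOK M.len π.m ∅ (σ.a .tree))
    (hn : σ.v .nout = 0) (hraw : ∀ i < 2 * π.m, σ.a .raw i < π.n) :
    WP M mainLoop σ fun σ' => ∃ out E,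
      Greedy π M.len (fun e => (σ.a .raw (2 * e), σ.a .raw (2 * e + 1))) (Finset.range π.m) out E ∧
      DSE M E σ' ∧ σ'.v .nout = out.length ∧
      (∀ j (h : j < out.length), σ'.a .raw (2 * π.m + j) = out[j]) ∧ π.Holds σ' ∧
      σ'.t + 200 * work σ (σ.v .tail) ≤ σ.t + 20 +
        π.m * (300 + 80 * Nat.log 2 (2 * π.m) + 5000 * (π.D + 1) * π.seeds) +
        200 * work σ' (σ'.v .tail) := by
  set en : ℕ → ℕ × ℕ := fun e => (σ.a .raw (2 * e), σ.a .raw (2 * e + 1)) with hen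
  have hPU := hV.pbase_lt
  have hmP := hV.mP
  have hfit := hV.fit
  have hcu := le_cube π.pbase
  have hUt : 2 * π.m * 16 + 16 + M.B < M.U := by omega
  refine WP.of_rep fun hv0 hA0 hU => ?_
  have ok1 : M.okIdx .tree 1 := by rw [Mach.okIdx, if_neg (by simp)]; omega
  refine WP.seq (WP.assign (by simp; exact ⟨by omega, ok1⟩) ?_)
  set c := 300 + 80 * Nat.log 2 (2 * π.m) + 5000 * (π.D + 1) * π.seeds with hc
  refine WP.while_ (g := (∅, [], [])) (fun (g : Finset ℕ × List ℕ × List (ℕ × ℕ)) σ1 =>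
    Greedy π M.len en g.1 g.2.1 g.2.2 ∧ DSE M g.2.2 σ1 ∧ π.Holds σ1 ∧
    σ1.v .nout = g.2.1.length ∧ (∀ j (h : j < g.2.1.length), σ1.a .raw (2 * π.m + j) = g.2.1[j]) ∧
    (∀ i < 2 * π.m, σ1.a .raw i = σ.a .raw i) ∧ TreeOK M.len π.m g.1 (σ1.a .tree) ∧
    σ1.v .x = σ1.a .tree 1 ∧
    σ1.t + 200 * work σ (σ.v .tail) ≤ σ.t + 10 + g.1.card * c + 200 * work σ1 (σ1.v .tail))
    (fun g => π.m - g.1.card) ?_ ?_ ?_ ?_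
  · intro g σ1 _ _ _ _; simp
  · rintro ⟨done, out, E⟩ σ1 ⟨f1, f2, f3, f4, f5, f6, f7, f8, f9⟩ hne
    dsimp only at f1 f2 f4 f5 f7 f9 ⊢
    obtain ⟨b1, b2, b3⟩ := f1.card_bounds
    have hx : σ1.a .tree 1 ≠ 0 := by rw [← f8]; exact hne
    obtain ⟨h1, h2⟩ := f7.entry (2 * π.m) 1 (by omega) le_rfl (by omega) hx
    set e := σ1.a .tree 1 - 1 with he
    have hcard : done.card < π.m := by
      have := Finset.card_le_card (Finset.insert_subset (Finset.mem_range.2 h1) b1)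
      rw [Finset.card_insert_of_notMem h2, Finset.card_range] at this
      omega
    refine WP.of_rep fun _ hA1 _ => ?_
    refine WP.seq (WP.assign (by simp [f8]; omega) ?_)
    set σ2 := St.set _ _ _ _ with hσ2
    have e1 : ∀ x, x ≠ Var.ed → σ2.v x = σ1.v x := by
      intro x hx; simp [hσ2, hx]
    have e2 : σ2.a = σ1.a := rfl
    have e3 : σ2.v .ed = e := by simp [hσ2, f8, he]
    have e4 : σ2.t ≤ σ1.t + 10 := by simp [hσ2]
    clear_value σ2
    have F2 : π.Holds σ2 := f3.of_frame fun x hx => e1 x (by rintro rfl; simp [fixVar] at hx)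
    have u1 := F2.m
    refine WP.seq (WP.mono (extract_spec (done := done) (by omega) (by rw [u1]; omega)
      (by rw [u1, e2]; exact f7)) ?_)
    rintro σ3 ⟨⟨g1, g2, g3⟩, g4⟩
    rw [u1, e3] at g4
    rw [u1] at g3
    have F3 : π.Holds σ3 := F2.of_frame fun x hx => g1 x (by
      simp [fixVar] at hx; rcases hx with rfl | rfl | rfl | rfl | rfl | rfl | rfl | rfl | rfl | rfl <;>
        simp [treeVar])
    have hfr : ∀ x ∈ [Var.pbase, .bigK, .tail, .ecnt, .head], σ3.v x = σ1.v x := by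
      intro x hx
      simp at hx
      rw [g1 x (by rcases hx with rfl | rfl | rfl | rfl | rfl <;> simp [treeVar]),
        e1 x (by rcases hx with rfl | rfl | rfl | rfl | rfl <;> simp)]
    have hfa : ∀ A ∈ dsArr, σ3.a A = σ1.a A := by
      intro A hA
      rw [g2 A (by rintro rfl; simp [dsArr] at hA), e2]
    have D3 := f2.of_frame hfr hfa
    have hw := work_frame hfr hfa
    have u2 : σ3.v .ed = e := by rw [g1 _ (by simp [treeVar]), e3]
    have u3 : σ3.v .nout = out.length := by rw [g1 _ (by simp [treeVar]), e1 _ (by simp), f4]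
    have u4 : σ3.a .raw = σ1.a .raw := by rw [g2 _ (by simp), e2]
    have u5 : σ3.a .raw (2 * e) = σ.a .raw (2 * e) := by rw [u4, f6 _ (by omega)]
    have u6 : σ3.a .raw (2 * e + 1) = σ.a .raw (2 * e + 1) := by rw [u4, f6 _ (by omega)]
    -- At most `seeds` pairs were inserted for each treated edge, and an untreated edge is left;
    -- this keeps the adjacency arrays within `pbase` entries.
    have hES : E.length + π.seeds ≤ π.m * π.seeds := by
      have : (done.card + 1) * π.seeds ≤ π.m * π.seeds := Nat.mul_le_mul_right _ hcard
      rw [add_mul, one_mul] at this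
      omega
    refine WP.seq (WP.mono (processEdge_spec hV F3 D3 (by omega) ?_ ?_ (by omega) (by omega)) ?_)
    · rw [u2, u5]; exact hraw _ (by omega)
    · rw [u2, u6]; exact hraw _ (by omega)
    rintro σ4 ⟨k1, k2, k3, k4⟩
    rw [u2, u5, u6] at k1
    have hbt : π.batch E (σ.a .raw (2 * e)) (σ.a .raw (2 * e + 1)) =
      π.batch E (en e).1 (en e).2 := rfl
    rw [hbt] at k1
    have F4 : π.Holds σ4 := F3.of_frame fun x hx => k2 x (by
      simp [fixVar] at hx; rcases hx with rfl | rfl | rfl | rfl | rfl | rfl | rfl | rfl | rfl | rfl <;>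
        simp [processVar])
    refine WP.assign (by simp; exact ⟨by omega, ok1⟩) ?_
    set σ5 := St.set _ _ _ _ with hσ5
    have l1 : ∀ x, x ≠ Var.x → σ5.v x = σ4.v x := by
      intro x hx; simp [hσ5, hx]
    have l2 : σ5.a = σ4.a := rfl
    have l3 : σ5.v .x = σ4.a .tree 1 := by simp [hσ5]
    have l4 : σ5.t ≤ σ4.t + 10 := by simp [hσ5]
    clear_value σ5
    have F5 : π.Holds σ5 := F4.of_frame fun x hx => l1 x (by rintro rfl; simp [fixVar] at hx)
    have hfr5 : ∀ x ∈ [Var.pbase, .bigK, .tail, .ecnt, .head], σ5.v x = σ4.v x := by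
      intro x hx
      exact l1 x (by rintro rfl; simp at hx)
    have hfa5 : ∀ A ∈ dsArr, σ5.a A = σ4.a A := fun A _ => by rw [l2]
    have hw5 := work_frame hfr5 hfa5
    have hcardi : (insert e done).card = done.card + 1 := Finset.card_insert_of_notMem h2
    have hle : ∀ e' < π.m, e' ∉ done → M.len e ≤ M.len e' := fun e' he' hd =>
      (f7.root he' hd).2
    have ht : σ5.t + 200 * work σ (σ.v .tail) ≤ σ.t + 10 + (insert e done).card * c +
        200 * work σ5 (σ5.v .tail) := by
      rw [hcardi, add_mul, one_mul, hw5, hc]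
      rw [hc] at f9
      generalize done.card * (300 + 80 * Nat.log 2 (2 * π.m) + 5000 * (π.D + 1) * π.seeds) = z
        at f9 ⊢
      generalize 5000 * (π.D + 1) * π.seeds = y at k4 ⊢
      omega
    have hT5 : TreeOK M.len π.m (insert e done) (σ5.a .tree) := by
      rw [l2, k3]; exact g4
    rcases k1 with ⟨c1, c2, c3, c4⟩ | ⟨c1, c2, c3, c4⟩
    · refine ⟨(insert e done, out, E), ⟨f1.skip e h1 h2 hle c1, c2.of_frame hfr5 hfa5, F5, ?_, ?_, ?_,
        hT5, by rw [l3, l2], ht⟩, ?_⟩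
      · rw [l1 _ (by simp), c3, u3]
      · intro j hj
        rw [l2, c4, u4]; exact f5 j hj
      · intro i hi
        rw [l2, c4, u4]; exact f6 i hi
      · dsimp only; rw [hcardi]; omega
    · refine ⟨(insert e done, out ++ [e], _), ⟨f1.take e h1 h2 hle c1, c2.of_frame hfr5 hfa5, F5,
        ?_, ?_, ?_, hT5, by rw [l3, l2], ht⟩, ?_⟩
      · rw [l1 _ (by simp), c3, u3]; simp
      · intro j hj
        simp only [List.length_append, List.length_singleton] at hj
        rw [l2, c4, u3, u4]
        rcases Nat.lt_succ_iff_lt_or_eq.1 hj with hj' | rfl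
        · rw [Function.update_of_ne (by omega), f5 j hj']
          simp [List.getElem_append_left hj']
        · simp
      · intro i hi
        rw [l2, c4, u4, Function.update_of_ne (by omega)]; exact f6 i hi
      · dsimp only; rw [hcardi]; omega
  · rintro ⟨done, out, E⟩ σ1 ⟨f1, f2, f3, f4, f5, f6, f7, f8, f9⟩ h0
    dsimp only at f1 f2 f4 f5 f7 f9 ⊢
    have hx : σ1.a .tree 1 = 0 := by rw [← f8]; exact h0
    have hdone : done = Finset.range π.m := by
      refine Finset.Subset.antisymm f1.card_bounds.1 fun e he => ?_
      by_contra hd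
      exact (f7.root (Finset.mem_range.1 he) hd).1 hx
    subst hdone
    refine ⟨out, E, f1, f2.of_frame (fun _ _ => rfl) fun _ _ => rfl, f4, f5,
      f3.of_frame fun _ _ => rfl, ?_⟩
    rw [Finset.card_range] at f9
    have : work (σ1.tick ((Ex.v .x).cost + 1)) ((σ1.tick ((Ex.v .x).cost + 1)).v .tail) =
      work σ1 (σ1.v .tail) := rfl
    rw [this]
    simp only [St.tick_t, Ex.cost_v]
    omega
  · have hw : work (σ.set .x (Ex.eval σ (.g .tree (1 : Ex))) ((Ex.g .tree (1 : Ex)).cost + 1))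
      ((σ.set .x (Ex.eval σ (.g .tree (1 : Ex))) ((Ex.g .tree (1 : Ex)).cost + 1)).v .tail) =
      work σ (σ.v .tail) := work_frame (fun x hx => by
        simp at hx; rcases hx with rfl | rfl | rfl | rfl | rfl <;> simp) fun _ _ => rfl
    refine ⟨.nil, hD.of_frame (fun x hx => ?_) fun _ _ => rfl, hF.of_frame fun x hx => ?_, by simp [hn],
      by simp, fun _ _ => rfl, hT, by simp, ?_⟩
    · simp at hx; rcases hx with rfl | rfl | rfl | rfl | rfl <;> simp
    · rw [St.set_v, if_neg]
      rintro rfl; simp [fixVar] at hx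
    · dsimp only
      rw [hw]
      simp

/-! ## The choice of the parameters -/

/-- The effect of a program that only changes some variables. -/
def VarStep (X : List Var) (c : ℕ) (σ σ' : St) : Prop :=
  (∀ x, x ∉ X → σ'.v x = σ.v x) ∧ σ'.a = σ.a ∧ σ'.t ≤ σ.t + c

/-- `lg :=` the number of binary digits of `n`, plus one. -/
def logProg : Prog :=
  .seq (assign .lg 2) <| .seq (assign .y Var.n) <|
  while_ (Ex.lt (1 : Ex) Var.y) <|
    .seq (assign .y (Var.y / 2 : Ex)) <| assign .lg (Var.lg + 1 : Ex)

theorem logProg_spec {M : Mach} {σ : St} (hn : 1 ≤ σ.v .n) (hU : σ.v .n + 2 < M.U) :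
    WP M logProg σ fun σ' => VarStep [.lg, .y] (20 + 20 * Nat.log 2 (σ.v .n)) σ σ' ∧
      σ'.v .lg = Nat.log 2 (σ.v .n) + 2 := by
  refine WP.of_rep fun _ _ hU' => ?_
  have hlog : Nat.log 2 (σ.v .n) ≤ σ.v .n := Nat.log_le_self _ _
  refine WP.seq (WP.assign (by simp; omega) ?_)
  refine WP.seq (WP.assign (by simp) ?_)
  refine WP.while_ (g := σ.v .n) (fun (y : ℕ) σ1 => 1 ≤ y ∧ σ1.v .y = y ∧
    (∀ x, x ∉ [Var.lg, .y] → σ1.v x = σ.v x) ∧ σ1.a = σ.a ∧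
    σ1.v .lg + Nat.log 2 y = Nat.log 2 (σ.v .n) + 2 ∧
    σ1.t + 20 * Nat.log 2 y ≤ σ.t + 10 + 20 * Nat.log 2 (σ.v .n)) (fun y => y) ?_ ?_ ?_ ?_
  · intro g σ1 _ _ _ _; simp; omega
  · rintro y σ1 ⟨f1, f2, f3, f4, f5, f6⟩ hne
    have hy : 1 < y := by simpa [f2] using hne
    have hl : Nat.log 2 (y / 2) = Nat.log 2 y - 1 := Nat.log_div_base 2 y
    have hl1 : 1 ≤ Nat.log 2 y := Nat.log_pos (by omega) hy
    refine WP.seq (WP.assign (by simp; omega) ?_)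
    refine WP.assign (by simp; omega) ⟨y / 2, ⟨by omega, by simp [f2], ?_, by simp [f4], ?_, ?_⟩,
      by omega⟩
    · intro x hx
      have hx' := hx
      simp only [List.mem_cons, List.not_mem_nil, or_false, not_or] at hx'
      simp [hx', f3 x hx]
    · simp; omega
    · simp; omega
  · rintro y σ1 ⟨f1, f2, f3, f4, f5, f6⟩ h0
    have hy : y ≤ 1 := by simpa [f2] using h0
    have hy1 : y = 1 := by omega
    subst hy1
    simp only [Nat.log_one_right, mul_zero, add_zero] at f5 f6
    refine ⟨⟨f3, f4, by simp; omega⟩, f5⟩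
  · refine ⟨hn, by simp, ?_, rfl, by simp; omega, by simp⟩
    intro x hx
    simp only [List.mem_cons, List.not_mem_nil, or_false, not_or] at hx
    simp [hx]

/-- `dig :=` the least `D ≥ 1` with `(2f)^D ≥ n`. -/
def degProg : Prog :=
  .seq (assign .dig 1) <| .seq (assign .pw (2 * Var.f : Ex)) <|
  while_ (Ex.lt Var.pw Var.n) <|
    .seq (assign .pw (Var.pw * (2 * Var.f) : Ex)) <| assign .dig (Var.dig + 1 : Ex)

theorem degProg_spec {M : Mach} {σ : St} (hf : 1 ≤ σ.v .f) (hfn : σ.v .f < σ.v .n)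
    (hU : 2 * (σ.v .n * σ.v .n) + 2 < M.U) :
    WP M degProg σ fun σ' => ∃ D, VarStep [.dig, .pw] (20 + 20 * D) σ σ' ∧
      σ'.v .dig = D ∧ 1 ≤ D ∧ σ.v .n ≤ (2 * σ.v .f) ^ D ∧
      (D = 1 ∨ (2 * σ.v .f) ^ (D - 1) < σ.v .n) := by
  refine WP.of_rep fun _ _ hU' => ?_
  set n := σ.v .n with hn
  set f := σ.v .f with hf'
  have hnn : n ≤ n * n := Nat.le_mul_self n
  refine WP.seq (WP.assign (by simp; omega) ?_)
  refine WP.seq (WP.assign (by simp; omega) ?_)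
  refine WP.while_ (g := 1) (fun (D : ℕ) σ1 => 1 ≤ D ∧ D ≤ n ∧ σ1.v .dig = D ∧
    σ1.v .pw = (2 * f) ^ D ∧
    (∀ x, x ∉ [Var.dig, .pw] → σ1.v x = σ.v x) ∧ σ1.a = σ.a ∧
    (D = 1 ∨ (2 * f) ^ (D - 1) < n) ∧ σ1.t ≤ σ.t + 10 + 20 * D) (fun D => n - D) ?_ ?_ ?_ ?_
  · intro g σ1 _ _ _ _; simp
  · rintro D σ1 ⟨f1, f2, f3, f4, f5, f6, f7, f8⟩ hne
    have w1 := f5 .n (by simp)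
    have w2 := f5 .f (by simp)
    rw [← hn] at w1
    rw [← hf'] at w2
    have hlt : (2 * f) ^ D < n := by simpa [w1, f4] using hne
    -- A power outgrows its exponent, so `D` stays below `n` and `n - D` is a valid measure.
    have hD : D < (2 * f) ^ D := Nat.lt_pow_self (by omega)
    have hmul : (2 * f) ^ D * (2 * f) ≤ n * (2 * n) := Nat.mul_le_mul hlt.le (by omega)
    have hmul' : n * (2 * n) = 2 * (n * n) := by ring
    refine WP.seq (WP.assign (by simp [f4, w2]; omega) ?_)
    refine WP.assign (by simp [f3]; omega) ⟨D + 1, ⟨by omega, by omega, by simp [f3], ?_, ?_,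
      by simp [f6], Or.inr hlt, by simp; omega⟩, by omega⟩
    · simp [f4, w2, pow_succ]
    · intro x hx
      have hx' := hx
      simp only [List.mem_cons, List.not_mem_nil, or_false, not_or] at hx'
      simp [hx', f5 x hx]
  · rintro D σ1 ⟨f1, f2, f3, f4, f5, f6, f7, f8⟩ h0
    have w1 := f5 .n (by simp)
    rw [← hn] at w1
    have hle : n ≤ (2 * f) ^ D := by simpa [w1, f4] using h0
    exact ⟨D, ⟨f5, f6, by simp; omega⟩, f3, f1, hle, f7⟩
  · refine ⟨le_rfl, by omega, by simp, by simp [hf'], ?_, rfl, Or.inl rfl, by simp⟩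
    intro x hx
    simp only [List.mem_cons, List.not_mem_nil, or_false, not_or] at hx
    simp [hx]

/-- `flag := 0` if `q` is prime, else `flag := 1`. -/
def testPrime : Prog :=
  .seq (assign .flag 0) <| .seq (assign .j 2) <|
  while_ (Ex.lt Var.j Var.q) <|
    .seq (cond (Var.q % Var.j : Ex) skip (assign .flag 1)) <| assign .j (Var.j + 1 : Ex)

theorem testPrime_spec {M : Mach} {σ : St} (hq : 2 ≤ σ.v .q) :
    WP M testPrime σ fun σ' => VarStep [.flag, .j, .tmp] (20 + 30 * σ.v .q) σ σ' ∧
      (σ'.v .flag = 0 ↔ (σ.v .q).Prime) ∧ σ'.v .flag ≤ 1 := by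
  refine WP.of_rep fun hv _ hU' => ?_
  have hqU := hv .q
  set q := σ.v .q with hq'
  refine WP.seq (WP.assign (by simp; omega) ?_)
  refine WP.seq (WP.assign (by simp; omega) ?_)
  refine WP.while_ (g := 2) (fun (j : ℕ) σ1 => 2 ≤ j ∧ j ≤ q ∧ σ1.v .j = j ∧
    (∀ x, x ∉ [Var.flag, .j, .tmp] → σ1.v x = σ.v x) ∧ σ1.a = σ.a ∧
    (σ1.v .flag = 0 ↔ ∀ i, 2 ≤ i → i < j → ¬ i ∣ q) ∧ σ1.v .flag ≤ 1 ∧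
    σ1.t ≤ σ.t + 10 + 30 * j) (fun j => q - j) ?_ ?_ ?_ ?_
  · intro g σ1 _ _ _ _; simp
  · rintro j σ1 ⟨f1, f2, f3, f4, f5, f6, f7, f8⟩ hne
    have w1 := f4 .q (by simp)
    rw [← hq'] at w1
    have hlt : j < q := by simpa [w1, f3] using hne
    refine WP.seq (WP.cond (by simp) (fun h => WP.skip ?_) fun h => WP.assign (by simp; omega) ?_)
    · have hj : ¬ j ∣ q := by
        rw [Nat.dvd_iff_mod_eq_zero]; simpa [w1, f3] using h
      refine WP.assign (by simp [f3]; omega) ⟨j + 1, ⟨by omega, by omega, by simp [f3], ?_,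
        by simp [f5], ?_, by simp [f7], by simp; omega⟩, by omega⟩
      · intro x hx
        have hx' := hx
        simp only [List.mem_cons, List.not_mem_nil, or_false, not_or] at hx'
        simp [hx', f4 x hx]
      · simp only [St.set_v, St.tick_v, reduceCtorEq, if_false, f6]
        constructor
        · intro h i h1 h2
          rcases Nat.lt_succ_iff_lt_or_eq.1 h2 with h3 | rfl
          exacts [h i h1 h3, hj]
        · intro h i h1 h2
          exact h i h1 (by omega)
    · have hj : j ∣ q := by
        rw [Nat.dvd_iff_mod_eq_zero]; simpa [w1, f3] using h
      refine WP.assign (by simp [f3]; omega) ⟨j + 1, ⟨by omega, by omega, by simp [f3], ?_,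
        by simp [f5], ?_, by simp, by simp; omega⟩, by omega⟩
      · intro x hx
        have hx' := hx
        simp only [List.mem_cons, List.not_mem_nil, or_false, not_or] at hx'
        simp [hx', f4 x hx]
      · simp only [St.set_v, St.tick_v, reduceCtorEq, if_false, if_true, Ex.eval_ofNat]
        constructor
        · intro h; simp at h
        · intro h
          exact absurd hj (h j f1 (by omega))
  · rintro j σ1 ⟨f1, f2, f3, f4, f5, f6, f7, f8⟩ h0
    have w1 := f4 .q (by simp)
    rw [← hq'] at w1
    have hle : q ≤ j := by simpa [w1, f3] using h0
    have hj : j = q := by omega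
    rw [hj] at f6 f8
    refine ⟨⟨f4, f5, by simp; omega⟩, ?_, f7⟩
    rw [St.tick_v, f6, Nat.prime_def_lt']
    simp [hq]
  · refine ⟨le_rfl, hq, by simp, ?_, rfl, ?_, by simp, by simp⟩
    · intro x hx
      simp only [List.mem_cons, List.not_mem_nil, or_false, not_or] at hx
      simp [hx]
    · simp; omega

/-- `q :=` the first prime larger than `24 f dig`. -/
def primeProg : Prog :=
  .seq (assign .q (24 * Var.f * Var.dig : Ex)) <| .seq (assign .flag 1) <|
  while_ Var.flag <| .seq (assign .q (Var.q + 1 : Ex)) testPrime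

/-- Bertrand's postulate supplies a prime in `(N, 2N]`, so trial division of at most `N` candidates
suffices. The quadratic cost is harmless, as `f * dig` is below `n` where this is used. -/
theorem primeProg_spec {M : Mach} {σ : St} {N : ℕ} (hN : N = 24 * σ.v .f * σ.v .dig) (h1 : 1 ≤ N)
    (hU : 2 * N + 100 < M.U) :
    WP M primeProg σ fun σ' => VarStep [.flag, .j, .tmp, .q] (20 + (60 * N + 40) * N) σ σ' ∧
      (σ'.v .q).Prime ∧ N < σ'.v .q ∧ σ'.v .q ≤ 2 * N := by
  obtain ⟨p, hp, hp1, hp2⟩ := Nat.exists_prime_lt_and_le_two_mul N (by omega)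
  refine WP.of_rep fun hv _ hU' => ?_
  have hf24 : 24 * σ.v .f ≤ N := by
    rw [hN]; refine Nat.le_mul_of_pos_right _ ?_
    rcases Nat.eq_zero_or_pos (σ.v .dig) with h | h
    · rw [h] at hN; omega
    · exact h
  refine WP.seq (WP.assign (by simp; omega) ?_)
  refine WP.seq (WP.assign (by simp; omega) ?_)
  -- Each round increases `q`, and `q` is below the Bertrand prime `p` while `flag` is `1`; hence `p
  -- - q + flag` decreases, also in the round that resets `flag`.
  refine WP.while_ (g := (N, 1)) (fun (g : ℕ × ℕ) σ1 => σ1.v .q = g.1 ∧ σ1.v .flag = g.2 ∧ g.2 ≤ 1 ∧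
    N ≤ g.1 ∧ (g.2 = 1 → g.1 < p) ∧ (g.2 = 0 → g.1.Prime ∧ N < g.1 ∧ g.1 ≤ p) ∧
    (∀ x, x ∉ [Var.flag, .j, .tmp, .q] → σ1.v x = σ.v x) ∧ σ1.a = σ.a ∧
    σ1.t ≤ σ.t + 13 + (60 * N + 40) * (g.1 - N)) (fun g => p - g.1 + g.2) ?_ ?_ ?_ ?_
  · intro g σ1 _ _ _ _; simp
  · rintro ⟨q, fl⟩ σ1 ⟨f1, f2, f3, f4, f5, f6, f7, f8, f9⟩ hne
    dsimp only at f1 f2 f3 f4 f5 f6 f9 ⊢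
    have hfl : fl = 1 := by
      have : fl ≠ 0 := by simpa [f2] using hne
      omega
    have hqp := f5 hfl
    refine WP.seq (WP.assign (by simp [f1]; omega) ?_)
    refine WP.mono (testPrime_spec (by simp [f1]; omega)) ?_
    rintro σ2 ⟨⟨g1, g2, g3⟩, g4, g5⟩
    simp only [St.set_v, St.tick_v, f1, if_true, Ex.eval_add, Ex.eval_v, Ex.eval_ofNat, St.set_t,
      St.tick_t, Ex.cost_v, Ex.cost_add, Ex.cost_ofNat, St.set_a, St.tick_a] at g1 g2 g3 g4
    have hq2 : σ2.v .q = q + 1 := by rw [g1 _ (by simp)]; simp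
    refine ⟨(q + 1, σ2.v .flag), ⟨hq2, rfl, g5, by dsimp only; omega, ?_, ?_, ?_, by rw [g2, f8], ?_⟩,
      by dsimp only; omega⟩
    · intro h
      dsimp only at h ⊢
      have : q + 1 ≠ p := by
        intro h'
        rw [← h'] at hp
        have := g4.2 hp
        omega
      omega
    · intro h
      exact ⟨g4.1 h, by dsimp only; omega, by dsimp only; omega⟩
    · intro x hx
      have hx' := hx
      simp only [List.mem_cons, List.not_mem_nil, or_false, not_or] at hx'
      rw [g1 x (by simp [hx']), if_neg (by simp [hx']), f7 x hx]
    · dsimp only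
      have e1 : q + 1 - N = (q - N) + 1 := by omega
      rw [e1, mul_add, mul_one]
      omega
  · rintro ⟨q, fl⟩ σ1 ⟨f1, f2, f3, f4, f5, f6, f7, f8, f9⟩ h0
    dsimp only at f1 f2 f3 f4 f5 f6 f9
    have hfl : fl = 0 := by simpa [f2] using h0
    obtain ⟨h1, h2, h3⟩ := f6 hfl
    have hle : (60 * N + 40) * (q - N) ≤ (60 * N + 40) * N := Nat.mul_le_mul_left _ (by omega)
    refine ⟨⟨f7, f8, by simp; omega⟩, ?_⟩
    rw [St.tick_v, f1]
    exact ⟨h1, h2, by omega⟩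
  · refine ⟨by simp [hN], by simp, le_rfl, le_rfl, fun _ => hp1, fun h => by simp at h, ?_, rfl,
      by simp⟩
    intro x hx
    simp only [List.mem_cons, List.not_mem_nil, or_false, not_or] at hx
    simp [hx]

/-- Compute the parameters; `D₀` is the largest degree for which plain polynomials are used. -/
def paramProg (D₀ : ℕ) : Prog :=
  .seq logProg <| .seq degProg <| .seq primeProg <|
  .seq (cond (Ex.lt Var.k Var.lg) (assign .bigK (2 * Var.k - 1 : Ex))
    (assign .bigK (2 * Var.lg - 1 : Ex))) <|
  .seq (cond (Ex.lt Var.dig (Ex.c (D₀ + 1))) (.seq (assign .s 1) (assign .amax 1))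
    (.seq (assign .s Var.dig) (assign .amax (Var.q - 1 : Ex)))) <|
  .seq (assign .seeds (Var.q * Var.amax : Ex)) <|
  .seq (assign .base (Var.q * Var.q + Var.n : Ex)) <|
  assign .pbase (Var.base * Var.base * Var.base * Var.base : Ex)

/-! ### Arithmetic of the parameters and their fit to the word length -/

/-- The specification of the parameters. -/
structure ParamOK (D₀ n m f k : ℕ) (π : Param) : Prop where
  n_eq : π.n = n
  m_eq : π.m = m
  K : ∃ k', π.K = 2 * k' - 1 ∧ k' = min k (Nat.log 2 n + 2)
  D1 : 1 ≤ π.D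
  nD : n ≤ (2 * f) ^ π.D
  Dn : π.D = 1 ∨ (2 * f) ^ (π.D - 1) < n
  prime : π.q.Prime
  lt_q : 24 * f * π.D < π.q
  q_le : π.q ≤ 2 * (24 * f * π.D)
  sA : (π.D ≤ D₀ ∧ π.s = 1 ∧ π.A = 1) ∨ (D₀ < π.D ∧ π.s = π.D ∧ π.A = π.q - 1)

theorem mul_le_pow_of_two_le {x : ℕ} (hx : 2 ≤ x) (d : ℕ) (hd : 1 ≤ d) : x * d ≤ x ^ d := by
  induction d with
  | zero => omega
  | succ d ih =>
    rcases Nat.eq_zero_or_pos d with rfl | hd'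
    · simp
    · have := ih hd'
      have h2 : x * 1 ≤ x * d := Nat.mul_le_mul_left _ hd'
      calc x * (d + 1) = x * d + x * 1 := by ring
        _ ≤ x * d + x * d := by omega
        _ = x * d * 2 := by ring
        _ ≤ x ^ d * x := Nat.mul_le_mul this hx
        _ = x ^ (d + 1) := by ring

/-- For `D > 1` one has `f D ≤ 2f(D - 1) ≤ (2f)^(D - 1) < n`. This keeps `q` linear in `n` and later
keeps the classes of size `O(n/f)`. -/
theorem mul_deg_lt {n f D : ℕ} (hf : 1 ≤ f) (hfn : f < n) (hD1 : 1 ≤ D)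
    (h : D = 1 ∨ (2 * f) ^ (D - 1) < n) : f * D < n := by
  rcases h with rfl | h
  · omega
  · rcases eq_or_lt_of_le hD1 with rfl | hD
    · omega
    · have h1 := mul_le_pow_of_two_le (x := 2 * f) (by omega) (D - 1) (by omega)
      have h2 : f * D ≤ f * (2 * (D - 1)) := Nat.mul_le_mul_left _ (by omega)
      have h3 : f * (2 * (D - 1)) = 2 * f * (D - 1) := by ring
      omega

/-- The number of machine words suffices for graphs on `n` vertices. -/
def Mach.Large (M : Mach) (n : ℕ) : Prop := 64 * (2400 * (n * n)) ^ 12 ≤ M.U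

theorem pow_twelve (X : ℕ) : X ^ 12 = X * X * X * X * (X * X * X * X) * (X * X * X * X) := by ring

theorem ParamOK.q_lt {D₀ n m f k : ℕ} {π : Param} (h : ParamOK D₀ n m f k π) (hf : 1 ≤ f)
    (hfn : f < n) : π.q < 48 * n := by
  have h1 := mul_deg_lt hf hfn h.D1 h.Dn
  have h2 := h.q_le
  have h3 : 2 * (24 * f * π.D) = 48 * (f * π.D) := by ring
  omega

theorem ParamOK.base_le {D₀ n m f k : ℕ} {π : Param} (h : ParamOK D₀ n m f k π) (hf : 1 ≤ f)
    (hfn : f < n) : π.base ≤ 2400 * (n * n) := by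
  have h1 := h.q_lt hf hfn
  have h2 : π.q * π.q ≤ 48 * n * (48 * n) := Nat.mul_le_mul h1.le h1.le
  have h3 : 48 * n * (48 * n) = 2304 * (n * n) := by ring
  have h4 : n ≤ n * n := Nat.le_mul_self n
  unfold Param.base
  rw [h.n_eq]; omega

theorem ParamOK.pbase_le {D₀ n m f k : ℕ} {π : Param} (h : ParamOK D₀ n m f k π) (hf : 1 ≤ f)
    (hfn : f < n) : π.pbase * π.pbase * π.pbase ≤ (2400 * (n * n)) ^ 12 := by
  have h1 := h.base_le hf hfn
  rw [pow_twelve]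
  have h2 : π.pbase ≤ 2400 * (n * n) * (2400 * (n * n)) * (2400 * (n * n)) * (2400 * (n * n)) :=
    Nat.mul_le_mul (Nat.mul_le_mul (Nat.mul_le_mul h1 h1) h1) h1
  exact Nat.mul_le_mul (Nat.mul_le_mul h2 h2) h2

/-- Everything is measured in powers of `base ≤ 2400 n²`: the pairs number at most `m * seeds ≤ base
^ 3`, well below `pbase = base ^ 4`, and the table of marks needs `base ^ 12` entries. -/
theorem ParamOK.valid {D₀ n m f k : ℕ} {π : Param} (h : ParamOK D₀ n m f k π) (hf : 1 ≤ f)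
    (hfn : f < n) (hm : m ≤ n * n) {M : Mach} (hB : M.B = 3 * m) (hM : M.Large n) : π.Valid M := by
  have hq2 := h.prime.two_le
  have hb := h.base_le hf hfn
  have hp := h.pbase_le hf hfn
  have hD := h.D1
  have hDq : 24 ≤ π.q := by
    have h1 := h.lt_q
    have h2 : 1 ≤ f * π.D := Nat.mul_pos hf hD
    have h3 : 24 * f * π.D = 24 * (f * π.D) := by ring
    omega
  have hs : 1 ≤ π.s ∧ 1 ≤ π.A ∧ π.A < π.q := by
    rcases h.sA with ⟨_, h1, h2⟩ | ⟨_, h1, h2⟩ <;> omega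
  have hbq : 576 ≤ π.q * π.q := Nat.mul_le_mul hDq hDq
  have hbn : n + 576 ≤ π.base := by unfold Param.base; rw [h.n_eq]; omega
  have hS : π.seeds ≤ π.base :=
    (Nat.mul_le_mul_left _ hs.2.2.le).trans (Nat.le_add_right _ _)
  have hbb : 576 * π.base ≤ π.base * π.base := Nat.mul_le_mul_right _ (by omega)
  have hnn : n * n ≤ π.base * π.base := Nat.mul_le_mul (by omega) (by omega)
  have hP : π.pbase = π.base * π.base * (π.base * π.base) := by unfold Param.pbase; ring
  have hP1 : 576 * (π.base * π.base * π.base) ≤ π.pbase := by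
    rw [hP]
    calc 576 * (π.base * π.base * π.base) ≤ π.base * (π.base * π.base * π.base) :=
          Nat.mul_le_mul_right _ (by omega)
      _ = _ := by ring
  have hmS : π.m * π.seeds ≤ π.base * π.base * π.base := by
    rw [h.m_eq]; exact Nat.mul_le_mul (hm.trans hnn) hS
  have hb3 : π.base * π.base ≤ π.base * π.base * π.base := Nat.le_mul_of_pos_right _ (by omega)
  refine ⟨hq2, hs.1, hs.2.1, hs.2.2, ?_, by rw [hB, h.m_eq], ?_, ?_⟩
  · obtain ⟨k', h1, h2⟩ := h.K
    have h3 := Nat.log_le_self 2 n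
    omega
  · have := h.m_eq
    omega
  · unfold Mach.Large at hM
    rw [hB]
    have hX : 2400 * (n * n) ≤ (2400 * (n * n)) ^ 12 := Nat.le_self_pow (by omega) _
    have : 1 ≤ n * n := Nat.mul_pos (by omega) (by omega)
    omega

/-- The variables changed in computing the parameters. -/
def paramVar : List Var := [.lg, .y, .dig, .pw, .flag, .j, .tmp, .q, .bigK, .s, .amax, .seeds,
  .base, .pbase]

theorem paramProg_spec {M : Mach} {σ : St} {D₀ : ℕ} (hf : 1 ≤ σ.v .f) (hk : 1 ≤ σ.v .k)
    (hfn : σ.v .f < σ.v .n) (hM : M.Large (σ.v .n)) (hD₀ : D₀ + 1 < M.U) :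
    WP M (paramProg D₀) σ fun σ' => ∃ π,
      ParamOK D₀ (σ.v .n) (σ.v .m) (σ.v .f) (σ.v .k) π ∧ π.Holds σ' ∧
      VarStep paramVar (300 + 20 * Nat.log 2 (σ.v .n) + 200 * (24 * σ.v .f * π.D) ^ 2) σ σ' := by
  obtain ⟨n, hn⟩ : ∃ n, n = σ.v .n := ⟨_, rfl⟩
  obtain ⟨m, hm⟩ : ∃ m, m = σ.v .m := ⟨_, rfl⟩
  obtain ⟨f, hf'⟩ : ∃ f, f = σ.v .f := ⟨_, rfl⟩
  obtain ⟨k, hk'⟩ : ∃ k, k = σ.v .k := ⟨_, rfl⟩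
  rw [← hf'] at hf
  rw [← hk'] at hk
  rw [← hn, ← hf'] at hfn
  rw [← hn] at hM
  rw [← hn, ← hm, ← hf', ← hk']
  have hM' := hM
  unfold Mach.Large at hM'
  have hX : 2400 * (n * n) ≤ (2400 * (n * n)) ^ 12 := Nat.le_self_pow (by omega) _
  have hnn : n ≤ n * n := Nat.le_mul_self n
  have hlog := Nat.log_le_self 2 n
  refine WP.seq (WP.mono (logProg_spec (by rw [← hn]; omega) (by rw [← hn]; omega)) ?_)
  rintro σ1 ⟨⟨a1, a2, a3⟩, a4⟩
  rw [← hn] at a3 a4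
  have n1 : σ1.v .n = n := by rw [a1 _ (by simp), hn]
  have f1 : σ1.v .f = f := by rw [a1 _ (by simp), hf']
  refine WP.seq (WP.mono (degProg_spec (by rw [f1]; omega) (by rw [f1, n1]; omega) (by rw [n1]; omega)) ?_)
  rintro σ2 ⟨D, ⟨b1, b2, b3⟩, b4, b5, b6, b7⟩
  rw [n1, f1] at b6 b7
  have hfD := mul_deg_lt hf hfn b5 b7
  have hfD1 : 1 ≤ f * D := Nat.mul_pos hf b5
  have h24 : 24 * f * D = 24 * (f * D) := by ring
  have f2 : σ2.v .f = f := by rw [b1 _ (by simp), f1]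
  refine WP.seq (WP.mono (primeProg_spec (N := 24 * f * D) (by rw [f2, b4]) (by omega) (by omega)) ?_)
  rintro σ3 ⟨⟨c1, c2, c3⟩, c4, c5, c6⟩
  have lg3 : σ3.v .lg = Nat.log 2 n + 2 := by rw [c1 _ (by simp), b1 _ (by simp), a4]
  have k3 : σ3.v .k = k := by rw [c1 _ (by simp), b1 _ (by simp), a1 _ (by simp), hk']
  have n3 : σ3.v .n = n := by rw [c1 _ (by simp), b1 _ (by simp), n1]
  have m3 : σ3.v .m = m := by rw [c1 _ (by simp), b1 _ (by simp), a1 _ (by simp), hm]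
  have d3 : σ3.v .dig = D := by rw [c1 _ (by simp), b4]
  obtain ⟨q, hq⟩ : ∃ q, q = σ3.v .q := ⟨_, rfl⟩
  rw [← hq] at c4 c5 c6
  have t3 : σ3.t ≤ σ.t + (60 + 20 * Nat.log 2 n + 20 * D + (60 * (24 * f * D) + 40) * (24 * f * D)) := by
    omega
  have fr3 : ∀ x, x ∉ paramVar → σ3.v x = σ.v x := by
    intro x hx
    simp only [paramVar, List.mem_cons, List.not_mem_nil, or_false, not_or] at hx
    rw [c1 x (by simp [hx]), b1 x (by simp [hx]), a1 x (by simp [hx])]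
  have ar3 : σ3.a = σ.a := by rw [c2, b2, a2]
  clear c1 c2 c3 b1 b2 b3 b4 a1 a2 a3 a4 n1 f1 f2
  refine WP.seq (WP.mono (Q := fun σ4 => VarStep [.bigK] 20 σ3 σ4 ∧
    σ4.v .bigK = 2 * min k (Nat.log 2 n + 2) - 1) ?_ ?_)
  · refine WP.of_rep fun _ _ hU' => ?_
    refine WP.cond (by simp) (fun h => ?_) fun h => ?_
    · have h : k < Nat.log 2 n + 2 := by simpa [k3, lg3] using h
      refine WP.assign (by simp [k3]; omega) ⟨⟨?_, rfl, by simp⟩, ?_⟩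
      · intro x hx
        simp only [List.mem_cons, List.not_mem_nil, or_false] at hx
        simp [hx]
      · simp [k3]; omega
    · have h : Nat.log 2 n + 2 ≤ k := by simpa [k3, lg3] using h
      refine WP.assign (by simp [lg3]; omega) ⟨⟨?_, rfl, by simp⟩, ?_⟩
      · intro x hx
        simp only [List.mem_cons, List.not_mem_nil, or_false] at hx
        simp [hx]
      · simp [lg3]; omega
  rintro σ4 ⟨⟨a1, a2, a3⟩, a4⟩
  have d4 : σ4.v .dig = D := by rw [a1 _ (by simp), d3]
  have q4 : σ4.v .q = q := by rw [a1 _ (by simp), hq]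
  have hq1 : 1 < q := c4.one_lt
  refine WP.seq (WP.mono (Q := fun σ5 => VarStep [.s, .amax] 20 σ4 σ5 ∧
    ((D ≤ D₀ ∧ σ5.v .s = 1 ∧ σ5.v .amax = 1) ∨
      (D₀ < D ∧ σ5.v .s = D ∧ σ5.v .amax = q - 1))) ?_ ?_)
  · refine WP.of_rep fun _ _ hU' => ?_
    refine WP.cond (by simp; omega) (fun h => ?_) fun h => ?_
    · have h : D < D₀ + 1 := by simpa [d4] using h
      refine WP.seq (WP.assign (by simp; omega) (WP.assign (by simp; omega)
        ⟨⟨?_, rfl, by simp⟩, Or.inl ⟨by omega, by simp, by simp⟩⟩))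
      intro x hx
      simp only [List.mem_cons, List.not_mem_nil, or_false, not_or] at hx
      simp [hx]
    · have h : D₀ + 1 ≤ D := by simpa [d4] using h
      refine WP.seq (WP.assign (by simp) (WP.assign (by simp [q4]; omega)
        ⟨⟨?_, rfl, by simp⟩, Or.inr ⟨by omega, by simp [d4], by simp [q4]⟩⟩))
      intro x hx
      simp only [List.mem_cons, List.not_mem_nil, or_false, not_or] at hx
      simp [hx]
  rintro σ5 ⟨⟨b1, b2, b3⟩, b4⟩
  obtain ⟨s, hs⟩ : ∃ s, s = σ5.v .s := ⟨_, rfl⟩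
  obtain ⟨A, hA⟩ : ∃ A, A = σ5.v .amax := ⟨_, rfl⟩
  rw [← hs, ← hA] at b4
  set π : Param := ⟨n, m, 2 * min k (Nat.log 2 n + 2) - 1, D, q, s, A⟩ with hπ
  have hOK : ParamOK D₀ n m f k π :=
    ⟨rfl, rfl, ⟨_, rfl, rfl⟩, b5, b6, b7, c4, c5, c6, b4⟩
  have q5 : σ5.v .q = q := by rw [b1 _ (by simp), q4]
  have n5 : σ5.v .n = n := by rw [b1 _ (by simp), a1 _ (by simp), n3]
  have hbase := hOK.base_le hf hfn
  have hpb := hOK.pbase_le hf hfn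
  have hbe : π.base = q * q + n := rfl
  have hse : π.seeds = q * A := rfl
  have hpe : π.pbase = π.base * π.base * π.base * π.base := rfl
  have hcu := le_cube π.pbase
  have hAq : A ≤ q := by rcases b4 with ⟨_, _, h⟩ | ⟨_, _, h⟩ <;> omega
  have hqA : q * A ≤ q * q := Nat.mul_le_mul_left _ hAq
  have hb1 : 1 ≤ π.base := by rw [hbe]; omega
  have hb2 : π.base * π.base ≤ π.base * π.base * π.base := Nat.le_mul_of_pos_right _ hb1
  have hb3 : π.base * π.base * π.base ≤ π.pbase := Nat.le_mul_of_pos_right _ hb1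
  refine WP.seq (WP.assign (by simp [q5, ← hA]; omega) ?_)
  refine WP.seq (WP.assign (by simp [q5, n5]; omega) ?_)
  refine WP.assign ?_ ⟨π, hOK, ?_, ?_, ?_, ?_⟩
  · simp [q5, n5, ← hbe]; omega
  · have m5 : σ5.v .m = m := by rw [b1 _ (by simp), a1 _ (by simp), m3]
    have K5 : σ5.v .bigK = π.K := by rw [b1 _ (by simp), a4]
    have d5 : σ5.v .dig = D := by rw [b1 _ (by simp), d4]
    exact ⟨by simp [n5, hπ], by simp [m5, hπ], by simp [K5], by simp [d5, hπ], by simp [q5, hπ],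
      by simp [hs, hπ], by simp [hA, hπ], by simp [hse, q5, hA], by simp [hbe, q5, n5],
      by simp [hpe, hbe, q5, n5]⟩
  · intro x hx
    have hx' := hx
    simp only [paramVar, List.mem_cons, List.not_mem_nil, or_false, not_or] at hx'
    rw [← fr3 x hx, ← a1 x (by simp [hx']), ← b1 x (by simp [hx'])]
    simp [hx']
  · simp only [St.set_a]; rw [b2, a2, ar3]
  · have e1 : (24 * f * D) ^ 2 = 24 * f * D * (24 * f * D) := sq _
    have e2 : (60 * (24 * f * D) + 40) * (24 * f * D) =
      60 * (24 * f * D * (24 * f * D)) + 40 * (24 * f * D) := by ring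
    have e3 : 24 * f * D ≤ 24 * f * D * (24 * f * D) := Nat.le_mul_self _
    have e4 : D ≤ f * D := Nat.le_mul_of_pos_left _ hf
    rw [show π.D = D from rfl, e1]
    simp only [St.set_t, Ex.cost_add, Ex.cost_mul, Ex.cost_v]
    omega

/-! ## The complete program -/

/-- If no place is reached from more than `Z` places, the work of the data structure is linear in
the number of edges, up to the factor `(K + 1) Z`. -/
theorem DSE.work_le {M : Mach} {E : List (ℕ × ℕ)} {σ : St} (h : DSE M E σ) {Z : ℕ}
    (hZ : ∀ (b : ℕ) (S : Finset ℕ), (∀ s ∈ S, ∃ l, Reach (Adj E) s l b) → S.card ≤ Z) :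
    work σ (σ.v .tail) ≤ 8 * E.length * ((σ.v .bigK + 1) * Z) := by
  set T := Finset.Icc 1 (σ.v .tail) with hT
  -- A mark at `b` is determined by its length, one of `K + 1` values, and its source, one of at
  -- most `Z` places.
  have hb : ∀ b, (T.filter fun t => σ.a .plc t = b).card ≤ (σ.v .bigK + 1) * Z := by
    intro b
    set S := (T.filter fun t => σ.a .plc t = b).image (σ.a .src) with hS
    have hSZ : S.card ≤ Z := by
      refine hZ b S fun s hs => ?_
      rw [hS, Finset.mem_image] at hs
      obtain ⟨t, ht, rfl⟩ := hs
      rw [Finset.mem_filter, hT, Finset.mem_Icc] at ht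
      have := h.ds.snd t ht.1.1 ht.1.2
      rw [ht.2] at this
      exact ⟨_, this⟩
    have hle : (T.filter fun t => σ.a .plc t = b).card ≤
        (Finset.range (σ.v .bigK + 1) ×ˢ S).card := by
      refine Finset.card_le_card_of_injOn (fun t => (σ.a .len t, σ.a .src t)) ?_ ?_
      · intro t ht
        have ht' := ht
        rw [Finset.mem_coe, Finset.mem_filter, hT, Finset.mem_Icc] at ht'
        have := (h.ds.bnd t ht'.1.1 ht'.1.2).2.2
        rw [Finset.mem_coe, Finset.mem_product]
        exact ⟨Finset.mem_range.2 (Nat.lt_succ_of_le this), Finset.mem_image_of_mem _ ht⟩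
      · intro t ht t' ht' heq
        rw [Finset.mem_coe, Finset.mem_filter, hT, Finset.mem_Icc] at ht ht'
        simp only [Prod.mk.injEq] at heq
        exact h.ds.inj t t' ht.1.1 ht.1.2 ht'.1.1 ht'.1.2 heq.2 (ht.2.trans ht'.2.symm) heq.1
    rw [Finset.card_product, Finset.card_range] at hle
    exact hle.trans (Nat.mul_le_mul_left _ hSZ)
  -- Double counting: a directed edge is followed once from each mark at its source.
  have hsum : ∑ t ∈ T, countIdx (σ.a .afr) (σ.a .plc t) 1 (σ.v .ecnt) ≤
      σ.v .ecnt * ((σ.v .bigK + 1) * Z) := by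
    calc ∑ t ∈ T, countIdx (σ.a .afr) (σ.a .plc t) 1 (σ.v .ecnt)
        = ∑ t ∈ T, ∑ e ∈ Finset.Icc 1 (σ.v .ecnt), if σ.a .afr e = σ.a .plc t then 1 else 0 := by
          refine Finset.sum_congr rfl fun t _ => ?_
          rw [countIdx, Finset.card_filter]
      _ = ∑ e ∈ Finset.Icc 1 (σ.v .ecnt), ∑ t ∈ T, if σ.a .afr e = σ.a .plc t then 1 else 0 :=
          Finset.sum_comm
      _ ≤ ∑ _e ∈ Finset.Icc 1 (σ.v .ecnt), (σ.v .bigK + 1) * Z := by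
          refine Finset.sum_le_sum fun e _ => ?_
          rw [← Finset.card_filter]
          refine le_trans (le_of_eq ?_) (hb (σ.a .afr e))
          congr 1
          exact Finset.filter_congr fun t _ => eq_comm
      _ = _ := by simp
  -- Every marked place carries a loop, so the summand `1` of `work` is dominated by the count of
  -- edges. This doubles the bound, and `ecnt = 4 * E.length` turns it into the factor 8.
  have hone : ∀ t ∈ T, 1 ≤ countIdx (σ.a .afr) (σ.a .plc t) 1 (σ.v .ecnt) := by
    intro t ht
    rw [hT, Finset.mem_Icc] at ht
    have hr := h.ds.snd t ht.1 ht.2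
    have hl : Adj E (σ.a .plc t) (σ.a .plc t) := by
      generalize σ.a .plc t = b at hr
      generalize σ.a .len t = l at hr
      cases hr with
      | refl h => exact h
      | step _ h => exact h.symm.left
    obtain ⟨e, h1, h2, h3, _⟩ := h.adj _ _ hl
    refine Finset.card_pos.2 ⟨e, ?_⟩
    rw [Finset.mem_filter, Finset.mem_Icc]
    exact ⟨⟨h1, h2⟩, h3⟩
  have hw : work σ (σ.v .tail) = ∑ t ∈ T, (1 + countIdx (σ.a .afr) (σ.a .plc t) 1 (σ.v .ecnt)) := rfl
  rw [hw, Finset.sum_add_distrib]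
  have h1 := Finset.sum_le_sum hone
  have h2 : 8 * E.length * ((σ.v .bigK + 1) * Z) =
    σ.v .ecnt * ((σ.v .bigK + 1) * Z) + σ.v .ecnt * ((σ.v .bigK + 1) * Z) := by
    rw [h.ecnt]; ring
  omega

/-- Zero is both the null pointer and the absent mark, so an all-zero memory is a valid empty
structure and the large tables need no initialisation. -/
theorem DSE.nil {M : Mach} {σ : St} (h1 : σ.v .head = 0) (h2 : σ.v .tail = 0) (h3 : σ.v .ecnt = 0)
    (h4 : ∀ A ∈ dsArr, σ.a A = fun _ => 0)
    (hfit : (σ.v .pbase * σ.v .pbase * σ.v .pbase + 2) * 16 + 16 + M.B < M.U)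
    (hK : σ.v .bigK < σ.v .pbase) : DSE M [] σ := by
  have hh : ∀ s b l, ¬ Has σ s b l := by
    rintro s b l ⟨t, h5, h6, _⟩
    omega
  have hp : ∀ b, prevIdx (fun _ => 0) b 1 = 0 := by
    intro b; simp [prevIdx]
  have hnil : ∀ a b, ¬ Adj [] a b := by
    rintro a b ⟨e, he, _⟩; simp at he
  constructor
  · constructor <;> try (intros; omega)
    · intro s b l _ _ _
      rw [if_neg (hh s b l), h4 _ (by simp [dsArr])]
    · refine ⟨fun t _ _ => by omega, fun b => ?_⟩
      rw [h4 .rhead (by simp [dsArr]), h4 .plc (by simp [dsArr]), h2, hp]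
    · refine ⟨fun t _ _ => by omega, fun b => ?_⟩
      rw [h4 .ahead (by simp [dsArr]), h4 .afr (by simp [dsArr]), h3, hp]
  · omega
  · intro t _ _; omega
  · simp [h3]
  · intro a b h; exact absurd h (hnil _ _)
  · intro a h; exact absurd h (hnil _ _)

/-- Output all the edges. -/
def allEdges : Prog :=
  .seq (assign .nout Var.m) <| .seq (assign .j 0) <|
  while_ (Ex.lt Var.j Var.m) <|
    .seq (store .raw (2 * Var.m + Var.j : Ex) Var.j) <| assign .j (Var.j + 1 : Ex)

/-- The program on the abstract machine. -/
def bodyProg (D₀ : ℕ) : Prog :=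
  .seq (cond (Ex.lt (0 : Ex) Var.m * Ex.lt Var.f Var.n : Ex)
    (.seq (paramProg D₀) <| .seq buildTree mainLoop) allEdges) <|
  .seq (assign .n Var.nout) <| assign .m (2 * Var.m : Ex)

/-- The complete program. -/
def spannerProg (D₀ : ℕ) : Prog :=
  .seq (.const 100 3) <| .seq (.op .mul 99 100 1) (bodyProg D₀)

theorem allEdges_spec {M : Mach} {σ : St} (hB : M.B = 3 * σ.v .m) (hU : 3 * σ.v .m + 10 < M.U) :
    WP M allEdges σ fun σ' => σ'.v .m = σ.v .m ∧ σ'.v .nout = σ.v .m ∧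
      (∀ j < σ.v .m, σ'.a .raw (2 * σ.v .m + j) = j) ∧ σ'.t ≤ σ.t + 20 + 40 * σ.v .m := by
  refine WP.of_rep fun _ _ hU' => ?_
  refine WP.seq (WP.assign (by simp) ?_)
  refine WP.seq (WP.assign (by simp; omega) ?_)
  refine WP.while_ (g := 0) (fun (i : ℕ) σ1 => σ1.v .j = i ∧ i ≤ σ.v .m ∧
    σ1.v .m = σ.v .m ∧ σ1.v .nout = σ.v .m ∧ (∀ j < i, σ1.a .raw (2 * σ.v .m + j) = j) ∧
    σ1.t ≤ σ.t + 10 + 40 * i) (fun i => σ.v .m - i) ?_ ?_ ?_ ?_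
  · intro g σ1 _ _ _ _; simp
  · rintro i σ1 ⟨f1, f2, f3, f4, f5, f6⟩ hne
    have hi : i < σ.v .m := by simpa [f1, f3] using hne
    refine WP.seq (WP.store (by simp [f1, f3]; omega)
      (by rw [Mach.okIdx, if_pos rfl]; simp [f1, f3]; omega) (by simp) ?_)
    refine WP.assign (by simp [f1]; omega) ⟨i + 1, ⟨by simp [f1], hi, by simp [f3], by simp [f4],
      ?_, by simp; omega⟩, by omega⟩
    intro j hj
    rcases Nat.lt_succ_iff_lt_or_eq.1 hj with hj' | rfl
    · simp only [St.set_a, St.put_a, if_true, Ex.eval_add, Ex.eval_mul, Ex.eval_v, St.tick_v, f1, f3,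
        Ex.eval_ofNat, St.tick_a]
      rw [Function.update_of_ne (by omega), f5 j hj']
    · simp [f1, f3]
  · rintro i σ1 ⟨f1, f2, f3, f4, f5, f6⟩ h0
    have hi : i = σ.v .m := by
      have : σ.v .m ≤ i := by simpa [f1, f3] using h0
      omega
    rw [hi] at f5 f6
    exact ⟨f3, f4, f5, by simp; omega⟩
  · exact ⟨by simp, by omega, by simp, by simp, fun j hj => by omega, by simp⟩

/-! ### The abstract program on a given input -/

/-- The end points of the edges, by number. -/
def Input.ends (I : Input) (e : ℕ) : ℕ × ℕ := (I.init.mem (2 * e), I.init.mem (2 * e + 1))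

theorem Input.ends_eq (I : Input) (e : Fin I.m) :
    I.ends e = (((I.e e).1 : ℕ), ((I.e e).2 : ℕ)) := by
  have h1 : 2 * (e : ℕ) / 2 = e := by omega
  have h2 : (2 * (e : ℕ) + 1) / 2 = e := by omega
  have h3 : 2 * (e : ℕ) % 2 = 0 := by omega
  have h4 : (2 * (e : ℕ) + 1) % 2 = 1 := by omega
  have h5 := e.2
  unfold Input.ends Input.init
  simp only [h1, h2, h3, h4, h5, dite_true, if_true]
  simp

theorem Input.mem_lt (I : Input) (a : ℕ) : I.init.mem a < I.n := by
  have hn := I.n_pos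
  unfold Input.init
  dsimp only
  split_ifs
  · exact Fin.is_lt _
  · exact Fin.is_lt _
  · omega

theorem Input.m_le (I : Input) : I.m ≤ I.n * I.n := by
  have hinj : Function.Injective I.e := fun i j h => I.e_injective (by simp [h])
  have := Fintype.card_le_of_injective _ hinj
  simpa using this

/-- The initial abstract state. -/
def Input.st (I : Input) : St :=
  ⟨fun x => I.init.reg x.idx, fun A i => if A = .raw then I.init.mem i else 0, 2⟩

/-- The bound on the number of steps in terms of the parameters and the number of joined pairs. -/
def stepBound (π : Param) (f N : ℕ) : ℕ :=
  1000 + 20 * Nat.log 2 π.n + 200 * (24 * f * π.D) ^ 2 + 200 * π.m +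
    π.m * (300 + 80 * Nat.log 2 (2 * π.m) + 5000 * (π.D + 1) * π.seeds) + 200 * N

/-- The result of the program. -/
def Input.Result (I : Input) (D₀ t : ℕ) (out : List ℕ) : Prop :=
  ((I.m = 0 ∨ I.n ≤ I.f) ∧ out = List.range I.m ∧ t ≤ 100 * (I.m + 1)) ∨
  (1 ≤ I.m ∧ I.f < I.n ∧ ∃ π E, ParamOK D₀ I.n I.m I.f I.k π ∧
    Greedy π I.len I.ends (Finset.range I.m) out E ∧
    ∀ Z, (∀ (b : ℕ) (S : Finset ℕ), (∀ s ∈ S, ∃ l, Reach (Adj E) s l b) → S.card ≤ Z) →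
      t ≤ stepBound π I.f (8 * E.length * ((π.K + 1) * Z)))

/-- If there is no edge or `n ≤ f`, the whole graph is the output. Otherwise the time bound is left
open in the component bound `Z`, which depends on the analysis of the hash functions. -/
theorem bodyProg_spec {I : Input} {W D₀ : ℕ} {M : Mach} (hMe : M = ⟨W, I.len, 3 * I.m⟩)
    (hM : M.Large I.n) (hD₀ : D₀ + 1 < M.U) :
    WP M (bodyProg D₀) I.st fun σ => ∃ out, σ.v .n = out.length ∧ σ.v .m = 2 * I.m ∧
      out.length ≤ I.m ∧ (∀ j (h : j < out.length), σ.a .raw (2 * I.m + j) = out[j]) ∧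
      I.Result D₀ σ.t out := by
  have hB : M.B = 3 * I.m := by rw [hMe]
  have hlen : M.len = I.len := by rw [hMe]
  have vn : I.st.v .n = I.n := rfl
  have vm : I.st.v .m = I.m := rfl
  have vf : I.st.v .f = I.f := rfl
  have vk : I.st.v .k = I.k := rfl
  have v0 : ∀ x, x ∉ keepVar → I.st.v x = 0 := by
    intro x hx
    cases x <;> simp [keepVar] at hx <;> rfl
  have hm2 := I.m_le
  have hn1 := I.n_pos
  have hnn : 1 ≤ I.n * I.n := Nat.mul_pos hn1 hn1
  have hM' := hM
  unfold Mach.Large at hM'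
  have hX : 2400 * (I.n * I.n) ≤ (2400 * (I.n * I.n)) ^ 12 := Nat.le_self_pow (by omega) _
  refine WP.of_rep fun _ _ hU' => ?_
  refine WP.seq (WP.mono (Q := fun σ => ∃ out, σ.v .nout = out.length ∧ σ.v .m = I.m ∧
      out.length ≤ I.m ∧ (∀ j (h : j < out.length), σ.a .raw (2 * I.m + j) = out[j]) ∧
      I.Result D₀ (σ.t + 20) out) ?_ ?_)
  swap
  · rintro σ ⟨out, h1, h2, h3, h4, h5⟩
    refine WP.seq (WP.assign (by simp) (WP.assign (by simp [h2]; omega) ⟨out, by simp [h1],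
      by simp [h2], h3, h4, ?_⟩))
    have ht : ((σ.set .n (Ex.eval σ Var.nout) ((Ex.v .nout).cost + 1)).set .m
        (Ex.eval (σ.set .n (Ex.eval σ Var.nout) ((Ex.v .nout).cost + 1)) (2 * Var.m : Ex))
        ((2 * Var.m : Ex).cost + 1)).t ≤ σ.t + 20 := by simp
    rcases h5 with ⟨g1, g2, g3⟩ | ⟨g1, g2, π, E, g3, g4, g5⟩
    · exact Or.inl ⟨g1, g2, ht.trans g3⟩
    · exact Or.inr ⟨g1, g2, π, E, g3, g4, fun Z hZ => ht.trans (g5 Z hZ)⟩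
  -- The product of two tests with values `0` and `1` acts as their conjunction.
  have hcond : Ex.eval I.st (Ex.lt (0 : Ex) Var.m * Ex.lt Var.f Var.n : Ex) ≠ 0 ↔
      1 ≤ I.m ∧ I.f < I.n := by
    rw [Ex.eval_mul, mul_ne_zero_iff, Ne, Ne, Ex.eval_lt_eq_zero, Ex.eval_lt_eq_zero]
    simp only [Ex.eval_v, Ex.eval_ofNat, vn, vm, vf]
    omega
  refine WP.cond ?_ (fun h => ?_) fun h => ?_
  · simp only [Ex.ok_mul, Ex.ok_lt, Ex.ok_v, Ex.ok_ofNat, Ex.eval_lt, and_true]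
    refine ⟨by omega, ?_⟩
    split_ifs <;> omega
  · obtain ⟨hm1, hfn⟩ := hcond.1 h
    set σ0 := St.tick _ _ with hσ0
    have w0 : ∀ x, σ0.v x = I.st.v x := fun x => rfl
    have wa : σ0.a = I.st.a := rfl
    have wt : σ0.t ≤ 20 := by
      rw [hσ0, St.tick_t]
      simp only [Ex.cost_mul, Ex.cost_lt, Ex.cost_v, Ex.cost_ofNat]
      exact le_of_eq_of_le (by rfl) (show 2 + 8 ≤ 20 by omega)
    clear_value σ0
    have hf1 := I.f_pos
    refine WP.seq (WP.mono (paramProg_spec (by rw [w0]; exact hf1) (by rw [w0]; exact I.k_pos)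
      (by rw [w0, w0]; exact hfn) (by rw [w0]; exact hM) hD₀) ?_)
    rintro σ1 ⟨π, hP, F1, c1, c2, c3⟩
    rw [w0, w0, w0, w0, vn, vm, vf, vk] at hP
    rw [w0, w0, vn, vf] at c3
    have hV := hP.valid hf1 hfn hm2 hB hM
    have m1 : σ1.v .m = I.m := by rw [F1.m, hP.m_eq]
    refine WP.seq (WP.mono (buildTree_spec (by omega) (by rw [m1]; omega)) ?_)
    rintro σ2 ⟨⟨d1, d2, d3⟩, d4⟩
    rw [m1] at d3 d4
    have F2 : π.Holds σ2 := F1.of_frame fun x hx => d1 x (by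
      simp [fixVar] at hx; rcases hx with rfl | rfl | rfl | rfl | rfl | rfl | rfl | rfl | rfl | rfl <;>
        simp [treeVar])
    have hz : ∀ x, x ∉ keepVar → x ∉ paramVar → x ∉ treeVar → σ2.v x = 0 := by
      intro x h1 h2 h3
      rw [d1 x h3, c1 x h2, w0, v0 x h1]
    have ha : ∀ A, A ≠ .tree → σ2.a A = I.st.a A := by
      intro A hA
      rw [d2 A hA, c2, wa]
    have D2 : DSE M [] σ2 := by
      refine DSE.nil (hz _ (by simp [keepVar]) (by simp [paramVar]) (by simp [treeVar]))
        (hz _ (by simp [keepVar]) (by simp [paramVar]) (by simp [treeVar]))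
        (hz _ (by simp [keepVar]) (by simp [paramVar]) (by simp [treeVar])) ?_ ?_ ?_
      · intro A hA
        have h1 : A ≠ .tree := by rintro rfl; simp [dsArr] at hA
        have h2 : A ≠ .raw := by rintro rfl; simp [dsArr] at hA
        rw [ha A h1]
        funext i
        simp [Input.st, h2]
      · rw [F2.pbase]; exact hV.fit
      · rw [F2.pbase, F2.K]; exact hV.KP
    have hraw : ∀ i, σ2.a .raw i = I.init.mem i := by
      intro i
      rw [ha _ (by simp)]
      simp [Input.st]
    refine WP.mono (mainLoop_spec hV F2 D2 (by rw [hP.m_eq]; exact hm1) (by rw [hP.m_eq]; exact d4)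
      (hz _ (by simp [keepVar]) (by simp [paramVar]) (by simp [treeVar])) ?_) ?_
    · intro i _
      rw [hraw, hP.n_eq]; exact I.mem_lt i
    rintro σ3 ⟨out, E, g1, g2, g3, g4, g5, g6⟩
    have hen : (fun e => (σ2.a .raw (2 * e), σ2.a .raw (2 * e + 1))) = I.ends := by
      funext e
      rw [hraw, hraw]; rfl
    rw [hen, hlen] at g1
    have hc := g1.card_bounds.2.1
    rw [Finset.card_range, hP.m_eq] at hc
    refine ⟨out, g3, by rw [g5.m, hP.m_eq], hc, ?_, Or.inr ⟨hm1, hfn, π, E, hP, ?_, ?_⟩⟩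
    · intro j hj
      rw [← g4 j hj, hP.m_eq]
    · rw [← hP.m_eq]; exact g1
    · intro Z hZ
      have hw := g2.work_le hZ
      rw [g5.K] at hw
      unfold stepBound
      rw [hP.n_eq]
      rw [hP.m_eq] at g6 ⊢
      generalize I.m * (300 + 80 * Nat.log 2 (2 * I.m) + 5000 * (π.D + 1) * π.seeds) = y at g6 ⊢
      omega
  · have h' : I.m = 0 ∨ I.n ≤ I.f := by
      by_contra hh
      exact (hcond.2 (by omega)) h
    refine WP.mono (allEdges_spec (by simp [hB, vm]) (by simp [vm]; omega)) ?_
    rintro σ1 ⟨g1, g2, g3, g4⟩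
    simp only [St.tick_v, vm, St.tick_t] at g1 g2 g3 g4
    refine ⟨List.range I.m, by simp [g2], g1, by simp, fun j hj => ?_, Or.inl ⟨h', rfl, ?_⟩⟩
    · rw [g3 j (by simpa using hj)]; simp
    · have ht : I.st.t = 2 := rfl
      simp only [Ex.cost_mul, Ex.cost_lt, Ex.cost_v, Ex.cost_ofNat] at g4
      omega

/-- The abstract clock starts at `2` for the two instructions that put the block length `3m` into
register 99. -/
theorem spannerProg_exec (I : Input) {W D₀ : ℕ} (hM : 64 * (2400 * (I.n * I.n)) ^ 12 ≤ 2 ^ W)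
    (hD₀ : D₀ + 1 < 2 ^ W) (hf : I.f < 2 ^ W) (hk : I.k < 2 ^ W) :
    ∃ t s out, Exec W I.len (spannerProg D₀) I.init t s ∧ s.reg 0 = out.length ∧
      s.reg 1 = 2 * I.m ∧ (∀ j (h : j < out.length), s.mem (2 * I.m + j) = out[j]) ∧
      ∃ t', t ≤ t' ∧ I.Result D₀ t' out := by
  set M : Mach := ⟨W, I.len, 3 * I.m⟩ with hMe
  have hUe : M.U = 2 ^ W := rfl
  rw [← hUe] at hM hD₀ hf hk
  have hm2 := I.m_le
  have hn1 := I.n_pos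
  have hnn : I.n ≤ I.n * I.n := Nat.le_mul_self _
  have hX : 2400 * (I.n * I.n) ≤ (2400 * (I.n * I.n)) ^ 12 := Nat.le_self_pow (by omega) _
  have hX2 : 2400 ≤ (2400 * (I.n * I.n)) ^ 12 := le_trans (by omega) hX
  have r0 : ∀ r, 4 ≤ r → I.init.reg r = 0 := by
    intro r hr
    unfold Input.init
    dsimp only
    iterate 4 rw [if_neg (by omega)]
  have hreg : ∀ r, I.init.reg r < M.U := by
    intro r
    unfold Input.init
    dsimp only
    split_ifs <;> omega
  set s1 := (I.init.setReg 100 (3 % 2 ^ W)) with hs1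
  set s2 := s1.setReg 99 (WordOp.mul.eval W (s1.reg 100) (s1.reg 1)) with hs2
  have hval : WordOp.mul.eval W (s1.reg 100) (s1.reg 1) = 3 * I.m := by
    have e1 : s1.reg 100 = 3 := by
      rw [hs1, State.setReg_self, Nat.mod_eq_of_lt (by omega)]
    have e2 : s1.reg 1 = I.m := by
      rw [hs1, State.setReg_of_ne _ _ (by omega)]; rfl
    rw [e1, e2, WordOp.eval]
    exact Nat.mod_eq_of_lt (by omega)
  have hrep : Rep M s2 I.st := by
    refine ⟨fun x => ?_, fun A i hi => ?_, ?_, by omega, fun x => hreg _, fun A i => ?_⟩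
    · have := x.idx_lt
      rw [hs2, State.setReg_of_ne _ _ (by omega), hs1, State.setReg_of_ne _ _ (by omega)]
      rfl
    · rw [hs2, State.setReg_mem, hs1, State.setReg_mem]
      by_cases hA : A = .raw
      · simp [Input.st, hA, cell]
      -- Cells outside `raw` have addresses of at least `3m`, beyond the `2m` cells of the input,
      -- and therefore contain `0`.
      · have h2 : ¬ cell M.B A i / 2 < I.m := by
          have : M.B = 3 * I.m := rfl
          rw [cell, if_neg hA]; omega
        simp only [Input.st, hA, if_false]
        unfold Input.init
        dsimp only
        rw [dif_neg h2]
    · rw [hs2, State.setReg_self, hval]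
    · simp only [Input.st]
      split_ifs
      · have := I.mem_lt i
        omega
      · omega
  obtain ⟨r, s, σ, h1, h2, h3, out, h4, h5, h6, h7, h8⟩ := bodyProg_spec hMe hM hD₀ s2 hrep
  refine ⟨1 + (1 + r), s, out, .seq (.const _ _ _) (.seq (.op _ _ _ _ _) h1), ?_, ?_, ?_, σ.t, ?_, h8⟩
  · rw [← h4]; exact h2.v .n
  · rw [← h5]; exact h2.v .m
  · intro j hj
    rw [← h7 j hj, ← h2.a .raw _ fun _ => by rw [hMe]; dsimp only; omega]
    rfl
  · have : I.st.t = 2 := rfl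
    omega

/-! ## Lists of pairs without short cycles -/

/-- The simple graph of a list of pairs. -/
def graphOf (E : List (ℕ × ℕ)) : SimpleGraph ℕ :=
  SimpleGraph.fromEdgeSet {e | e ∈ E.map fun p => s(p.1, p.2)}

theorem graphOf_cons (p : ℕ × ℕ) (E : List (ℕ × ℕ)) :
    graphOf (p :: E) = graphOf E ⊔ SimpleGraph.edge p.1 p.2 := by
  unfold graphOf SimpleGraph.edge
  rw [← SimpleGraph.fromEdgeSet_union]
  congr 1
  ext e
  simp [eq_comm]

theorem Adj.mono {E E' : List (ℕ × ℕ)} (h : E ⊆ E') {a b : ℕ} (hab : Adj E a b) : Adj E' a b := by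
  obtain ⟨e, he, h'⟩ := hab
  exact ⟨e, h he, h'⟩

theorem Adj.of_graphOf {E : List (ℕ × ℕ)} {a b : ℕ} (h : (graphOf E).Adj a b) : Adj E a b := by
  unfold graphOf at h
  rw [SimpleGraph.fromEdgeSet_adj, Set.mem_ofPred_eq, List.mem_map] at h
  obtain ⟨⟨p, hp, hpe⟩, -⟩ := h
  refine ⟨p, hp, ?_⟩
  rcases Sym2.eq_iff.1 hpe with ⟨h1, h2⟩ | ⟨h1, h2⟩
  · exact ⟨Or.inl h1.symm, Or.inr h2.symm⟩
  · exact ⟨Or.inr h2.symm, Or.inl h1.symm⟩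

theorem Reach.adj_right {E : List (ℕ × ℕ)} {s l b : ℕ} (h : Reach (Adj E) s l b) : Adj E b b := by
  cases h with
  | refl h => exact h
  | step _ h => exact h.symm.left

/-- A walk is prolonged by idling on the loop at its end. -/
theorem Reach.mono_length {E : List (ℕ × ℕ)} {s l l' b : ℕ} (h : Reach (Adj E) s l b)
    (hl : l ≤ l') : Reach (Adj E) s l' b := by
  induction l', hl using Nat.le_induction with
  | base => exact h
  | succ l' _ ih => exact ih.step h.adj_right

theorem Reach.walk {E : List (ℕ × ℕ)} {s l a b : ℕ} (h : Reach (Adj E) s l a)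
    (p : (graphOf E).Walk a b) : Reach (Adj E) s (l + p.length) b := by
  induction p generalizing l with
  | nil => exact h
  | cons hab p ih =>
    have := ih (h.step (Adj.of_graphOf hab))
    rw [SimpleGraph.Walk.length_cons, Nat.add_comm p.length 1, ← Nat.add_assoc]
    exact this

/-- Positive length is needed because a place that occurs in no pair carries no loop. -/
theorem reach_of_walk {E : List (ℕ × ℕ)} {a b : ℕ} (p : (graphOf E).Walk a b)
    (hp : 0 < p.length) : Reach (Adj E) a p.length b := by
  have ha : Adj E a a := by
    cases p with
    | nil => simp at hp
    | cons hab p => exact (Adj.of_graphOf hab).left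
  simpa using (Reach.refl ha).walk p

/-- Every pair of the list is far apart in the graph of the later pairs. -/
def Spread (K : ℕ) : List (ℕ × ℕ) → Prop
  | [] => True
  | p :: E => p.1 ≠ p.2 ∧ ¬ Reach (Adj E) p.1 K p.2 ∧ Spread K E

theorem Spread.ne {K : ℕ} {E : List (ℕ × ℕ)} (h : Spread K E) : ∀ p ∈ E, p.1 ≠ p.2 := by
  induction E with
  | nil => simp
  | cons p E ih =>
    intro q hq
    rcases List.mem_cons.1 hq with rfl | hq
    exacts [h.1, ih h.2.2 q hq]

/-- A repeated pair would already be joined by a walk of length one. -/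
theorem Spread.nodup {K : ℕ} (hK : 1 ≤ K) {E : List (ℕ × ℕ)} (h : Spread K E) :
    (E.map fun p => s(p.1, p.2)).Nodup := by
  induction E with
  | nil => simp
  | cons p E ih =>
    rw [List.map_cons, List.nodup_cons]
    refine ⟨fun hp => h.2.1 ?_, ih h.2.2⟩
    rw [List.mem_map] at hp
    obtain ⟨q, hq, hqp⟩ := hp
    have hadj : Adj E p.1 p.2 := by
      refine ⟨q, hq, ?_⟩
      rcases Sym2.eq_iff.1 hqp with ⟨h1, h2⟩ | ⟨h1, h2⟩
      · exact ⟨Or.inl h1.symm, Or.inr h2.symm⟩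
      · exact ⟨Or.inr h2.symm, Or.inl h1.symm⟩
    exact ((Reach.refl hadj.left).step hadj).mono_length (by omega)

theorem path_length_le {E : List (ℕ × ℕ)} {a b : ℕ} (p : (graphOf E).Walk a b) (hp : p.IsPath) :
    p.length ≤ E.length := by
  have h1 : p.edges.Nodup := hp.isTrail.edges_nodup
  have h2 : p.edges ⊆ E.map fun p => s(p.1, p.2) := by
    intro e he
    have := p.edges_subset_edgeSet he
    unfold graphOf at this
    rw [SimpleGraph.edgeSet_fromEdgeSet] at this
    exact this.1
  have := (List.subperm_of_subset h1 h2).length_le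
  simpa using this

/-- Few pairs of a spread list form a forest. -/
theorem Spread.isAcyclic {K : ℕ} {E E' : List (ℕ × ℕ)} (h : Spread K E) (hs : E'.Sublist E)
    (hl : E'.length ≤ K + 1) : (graphOf E').IsAcyclic := by
  induction hs with
  | slnil =>
    have : graphOf [] = ⊥ := by simp [graphOf]
    rw [this]; exact SimpleGraph.isAcyclic_bot
  | cons p _ ih => exact ih h.2.2 hl
  | @cons_cons E' E p hs ih =>
    rw [List.length_cons] at hl
    rw [graphOf_cons]
    -- An added edge closes a cycle only if its ends were connected before. A path connecting them
    -- uses only the remaining pairs, of which there are at most `K`, contrary to `Spread`.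
    refine SimpleGraph.IsAcyclic.sup_edge_of_not_reachable (fun hr => ?_) (ih h.2.2 (by omega))
    obtain ⟨w, hw⟩ := hr.exists_isPath
    have h1 := path_length_le w hw
    have h0 : 0 < w.length := by
      rcases Nat.eq_zero_or_pos w.length with h0 | h0
      · exact absurd (SimpleGraph.Walk.eq_of_length_eq_zero h0) h.1
      · exact h0
    refine h.2.1 (((reach_of_walk w h0).mono_length (by omega)).mono fun a b hab => ?_)
    exact hab.mono hs.subset

/-- Short non-backtracking walks are determined by their end points. -/
theorem Spread.support_eq {K : ℕ} {E : List (ℕ × ℕ)} (h : Spread K E) (hK : 1 ≤ K) {a b : ℕ}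
    (p q : (graphOf E).Walk a b) (hp : p.edges.IsChain (· ≠ ·)) (hq : q.edges.IsChain (· ≠ ·))
    (hl : p.length + q.length ≤ K + 1) : p.support = q.support := by
  -- The pairs used by the two walks number at most `K + 1` and so form a forest. In a forest
  -- non-backtracking walks are paths, and paths are determined by their ends.
  set E' := E.filter fun r => s(r.1, r.2) ∈ p.edges ++ q.edges with hE'
  have hsub : E'.Sublist E := List.filter_sublist
  have hlen : E'.length ≤ K + 1 := by
    have h1 : (E'.map fun p => s(p.1, p.2)).Nodup := (h.nodup hK).sublist (hsub.map _)
    have h2 : (E'.map fun p => s(p.1, p.2)) ⊆ p.edges ++ q.edges := by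
      intro e he
      rw [List.mem_map] at he
      obtain ⟨r, hr, rfl⟩ := he
      rw [hE', List.mem_filter] at hr
      simpa using hr.2
    have := (List.subperm_of_subset h1 h2).length_le
    simp only [List.length_map, List.length_append, SimpleGraph.Walk.length_edges] at this
    omega
  have hac := h.isAcyclic hsub hlen
  have htr : ∀ e ∈ p.edges ++ q.edges, e ∈ (graphOf E').edgeSet := by
    intro e he
    have h1 : e ∈ (graphOf E).edgeSet := by
      rcases List.mem_append.1 he with he | he
      exacts [p.edges_subset_edgeSet he, q.edges_subset_edgeSet he]
    unfold graphOf at h1 ⊢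
    rw [SimpleGraph.edgeSet_fromEdgeSet] at h1 ⊢
    refine ⟨?_, h1.2⟩
    obtain ⟨r, hr, rfl⟩ := List.mem_map.1 h1.1
    exact List.mem_map.2 ⟨r, List.mem_filter.2 ⟨hr, by simpa using he⟩, rfl⟩
  have hpt := p.edges_transfer fun e he => htr e (List.mem_append_left _ he)
  have hqt := q.edges_transfer fun e he => htr e (List.mem_append_right _ he)
  have h1 := (hac.isPath_iff_isChain (p.transfer _ fun e he => htr e (List.mem_append_left _ he))).2
    (by rw [hpt]; exact hp)
  have h2 := (hac.isPath_iff_isChain (q.transfer _ fun e he => htr e (List.mem_append_right _ he))).2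
    (by rw [hqt]; exact hq)
  have h3 := (hac.subsingleton_path a b).elim ⟨_, h1⟩ ⟨_, h2⟩
  have h4 := congrArg (fun w => w.support) (congrArg Subtype.val h3)
  simpa [SimpleGraph.Walk.support_transfer] using h4

open Classical in
/-- In a part of large minimum degree the number of ends of non-backtracking walks grows
exponentially. -/
theorem Spread.branch {K : ℕ} {E : List (ℕ × ℕ)} (h : Spread K E) (hK : 1 ≤ K) {V : Finset ℕ} {t : ℕ}
    (ht : ∀ v ∈ V, t < (V.filter ((graphOf E).Adj v)).card) (i : ℕ) (hi : 2 * i ≤ K + 1) :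
    ∀ v ∈ V, ∀ p, ∃ S : Finset ℕ, t ^ i ≤ S.card ∧ ∀ y ∈ S, ∃ w : (graphOf E).Walk v y,
      w.length = i ∧ (s(p, v) :: w.edges).IsChain (· ≠ ·) := by
  induction i with
  | zero =>
    intro v _ p
    refine ⟨{v}, by simp, fun y hy => ?_⟩
    rw [Finset.mem_singleton] at hy
    subst hy
    exact ⟨.nil, rfl, by simp⟩
  | succ i ih =>
    intro v hv p
    choose! S hS1 hS2 using ih (by omega)
    -- Excluding the predecessor `p` may cost one neighbour, which is why the degrees have to exceed
    -- `t`.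
    set N := (V.filter ((graphOf E).Adj v)).erase p with hN
    have hNm : ∀ c ∈ N, c ≠ p ∧ c ∈ V ∧ (graphOf E).Adj v c := by
      intro c hc
      rw [hN, Finset.mem_erase, Finset.mem_filter] at hc
      exact hc
    have hNc : t ≤ N.card := by
      have := ht v hv
      exact le_trans (by omega) Finset.pred_card_le_card_erase
    have hw : ∀ c ∈ N, ∀ y ∈ S c v, ∃ w : (graphOf E).Walk v y, w.length = i + 1 ∧
        (s(p, v) :: w.edges).IsChain (· ≠ ·) ∧ w.support[1]? = some c := by
      intro c hc y hy
      obtain ⟨h1, h2, h3⟩ := hNm c hc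
      obtain ⟨w, hw1, hw2⟩ := hS2 c h2 v y hy
      refine ⟨.cons h3 w, by simp [hw1], ?_, ?_⟩
      · rw [SimpleGraph.Walk.edges_cons, List.isChain_cons_cons]
        refine ⟨fun he => ?_, hw2⟩
        rcases Sym2.eq_iff.1 he with ⟨h4, h5⟩ | ⟨h4, h5⟩
        · exact h3.ne h5
        · exact h1 h4.symm
      · cases w <;> simp
    refine ⟨N.biUnion fun c => S c v, ?_, ?_⟩
    · rw [Finset.card_biUnion]
      · calc t ^ (i + 1) = t * t ^ i := pow_succ' _ _
          _ ≤ N.card * t ^ i := Nat.mul_le_mul_right _ hNc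
          _ = ∑ _c ∈ N, t ^ i := by simp
          _ ≤ _ := Finset.sum_le_sum fun c hc => hS1 c (hNm c hc).2.1 v
      -- Walks through different neighbours cannot meet at their ends: they would be
      -- non-backtracking walks of total length at most `K + 1` with the same ends and different
      -- second vertices.
      · intro c hc c' hc' hne
        rw [Function.onFun, Finset.disjoint_left]
        intro y hy hy'
        obtain ⟨w, hw1, hw2, hw3⟩ := hw c hc y hy
        obtain ⟨w', hw1', hw2', hw3'⟩ := hw c' hc' y hy'
        have := h.support_eq hK w w' hw2.tail hw2'.tail (by omega)
        rw [this, hw3'] at hw3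
        exact hne (Option.some.inj hw3).symm
    · intro y hy
      rw [Finset.mem_biUnion] at hy
      obtain ⟨c, hc, hy⟩ := hy
      obtain ⟨w, hw1, hw2, -⟩ := hw c hc y hy
      exact ⟨w, hw1, hw2⟩

open Classical in
/-- A graph all of whose subgraphs have vertices of small degree has few edges. -/
theorem card_edges_le {α : Type*} (G : SimpleGraph α) (Es : Finset (Sym2 α))
    (hEs : ∀ e ∈ Es, e ∈ G.edgeSet) {t : ℕ}
    (h : ∀ V : Finset α, V.Nonempty → ∃ v ∈ V, (V.filter (G.Adj v)).card ≤ t) (V : Finset α) :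
    (Es.filter fun e => ∀ x ∈ e, x ∈ V).card ≤ t * V.card := by
  induction V using Finset.strongInduction with
  | H V ih =>
    rcases V.eq_empty_or_nonempty with rfl | hV
    · rw [Finset.card_empty, mul_zero, Nat.le_zero, Finset.card_eq_zero, Finset.filter_eq_empty_iff]
      intro e _ he
      induction e with
      | _ a b => simpa using he a (by simp)
    -- Deleting a vertex of degree at most `t` loses at most `t` edges.
    · obtain ⟨v, hv, hd⟩ := h V hV
      have h1 := ih (V.erase v) (Finset.erase_ssubset hv)
      have h2 : (Es.filter fun e => ∀ x ∈ e, x ∈ V) ⊆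
          (Es.filter fun e => ∀ x ∈ e, x ∈ V.erase v) ∪
            (V.filter (G.Adj v)).image fun y => s(v, y) := by
        intro e he
        rw [Finset.mem_filter] at he
        rw [Finset.mem_union]
        by_cases hve : v ∈ e
        · right
          obtain ⟨y, rfl⟩ := hve
          refine Finset.mem_image.2 ⟨y, Finset.mem_filter.2 ⟨he.2 y (by simp), hEs _ he.1⟩, rfl⟩
        · left
          refine Finset.mem_filter.2 ⟨he.1, fun x hx => Finset.mem_erase.2 ⟨?_, he.2 x hx⟩⟩
          rintro rfl
          exact hve hx
      have h3 := (Finset.card_le_card h2).trans (Finset.card_union_le _ _)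
      have h4 := Finset.card_image_le (s := V.filter (G.Adj v)) (f := fun y => s(v, y))
      have h5 := Finset.card_erase_add_one hv
      have h6 : t * (V.erase v).card + t = t * V.card := by rw [← h5]; ring
      omega

/-- The Moore bound with a bound on the sizes of the components. -/
theorem Spread.length_le {K k t Z : ℕ} {E : List (ℕ × ℕ)} (h : Spread K E) (hk : 1 ≤ k)
    (hKk : 2 * k ≤ K + 1) (htZ : Z < t ^ k)
    (hZ : ∀ (b : ℕ) (S : Finset ℕ), (∀ s ∈ S, ∃ l, Reach (Adj E) s l b) → S.card ≤ Z)
    (V : Finset ℕ) (hV : ∀ p ∈ E, p.1 ∈ V ∧ p.2 ∈ V) : E.length ≤ t * V.card := by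
  classical
  set Es := (E.map fun p => s(p.1, p.2)).toFinset with hEs
  have hcard : Es.card = E.length := by
    rw [hEs, List.toFinset_card_of_nodup (h.nodup (by omega)), List.length_map]
  have hmem : ∀ e ∈ Es, e ∈ (graphOf E).edgeSet := by
    intro e he
    rw [hEs, List.mem_toFinset, List.mem_map] at he
    obtain ⟨p, hp, rfl⟩ := he
    unfold graphOf
    rw [SimpleGraph.edgeSet_fromEdgeSet]
    exact ⟨List.mem_map.2 ⟨p, hp, rfl⟩, by simpa using h.ne p hp⟩
  have hdeg : ∀ V : Finset ℕ, V.Nonempty → ∃ v ∈ V, (V.filter ((graphOf E).Adj v)).card ≤ t := by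
    rintro V ⟨v, hv⟩
    by_contra! hcon
    -- The start `v` itself plays the forbidden predecessor; as `v` is not its own neighbour, this
    -- excludes nothing. The resulting `t ^ k` ends all lie in one component, of size at most `Z`.
    obtain ⟨S, hS1, hS2⟩ := h.branch (by omega) hcon k hKk v hv v
    have := hZ v S fun y hy => by
      obtain ⟨w, hw, -⟩ := hS2 y hy
      exact ⟨_, reach_of_walk w.reverse (by rw [SimpleGraph.Walk.length_reverse]; omega)⟩
    omega
  have := card_edges_le (graphOf E) Es hmem hdeg V
  rwa [Finset.filter_true_of_mem, hcard] at this
  intro e he x hx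
  rw [hEs, List.mem_toFinset, List.mem_map] at he
  obtain ⟨p, hp, rfl⟩ := he
  rcases Sym2.mem_iff.1 hx with rfl | rfl
  exacts [(hV p hp).1, (hV p hp).2]

/-! ## Properties of the hash functions -/

theorem eq_of_digits_eq {q : ℕ} (D : ℕ) : ∀ {x y : ℕ}, x < q ^ D → y < q ^ D →
    (∀ i < D, x / q ^ i % q = y / q ^ i % q) → x = y := by
  induction D with
  | zero => intro x y hx hy _; simp at hx hy; omega
  | succ D ih =>
    intro x y hx hy h
    have h0 : x % q = y % q := by simpa using h 0 (by omega)
    have h1 : x / q = y / q := by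
      refine ih (Nat.div_lt_of_lt_mul (by rwa [← pow_succ'])) (Nat.div_lt_of_lt_mul
        (by rwa [← pow_succ'])) fun i hi => ?_
      have := h (i + 1) (by omega)
      rwa [pow_succ', ← Nat.div_div_eq_div_mul, ← Nat.div_div_eq_div_mul] at this
    rw [← Nat.div_add_mod x q, ← Nat.div_add_mod y q, h0, h1]

/-- The polynomial whose coefficients are the digits of `x`. -/
noncomputable def digitPoly (q D x : ℕ) : Polynomial (ZMod q) :=
  ∑ i ∈ Finset.range D, Polynomial.C ((x / q ^ i % q : ℕ) : ZMod q) * Polynomial.X ^ i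

theorem digitPoly_natDegree_le (q D x : ℕ) : (digitPoly q D x).natDegree ≤ D - 1 := by
  refine Polynomial.natDegree_sum_le_of_forall_le _ _ fun i hi => ?_
  have := Finset.mem_range.1 hi
  exact (Polynomial.natDegree_C_mul_X_pow_le _ _).trans (by omega)

section
variable {q : ℕ} [Fact q.Prime]

theorem natCast_inj_of_lt {x y : ℕ} (hx : x < q) (hy : y < q) (h : (x : ZMod q) = y) : x = y := by
  rw [ZMod.natCast_eq_natCast_iff] at h
  exact Nat.ModEq.eq_of_lt_of_lt h hx hy

theorem polyHash_cast (D al x : ℕ) :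
    ((polyHash q D al x : ℕ) : ZMod q) = (digitPoly q D x).eval (al : ZMod q) := by
  unfold polyHash digitPoly
  rw [ZMod.natCast_mod, Polynomial.eval_finsetSum, Nat.cast_sum]
  refine Finset.sum_congr rfl fun i _ => ?_
  simp

theorem digitPoly_coeff {D i : ℕ} (hi : i < D) (x : ℕ) :
    (digitPoly q D x).coeff i = ((x / q ^ i % q : ℕ) : ZMod q) := by
  unfold digitPoly
  rw [Polynomial.finsetSum_coeff, Finset.sum_eq_single i]
  · simp
  · intro j _ hj
    rw [Polynomial.coeff_C_mul_X_pow, if_neg (Ne.symm hj)]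
  · intro h
    exact absurd (Finset.mem_range.2 hi) h

theorem digitPoly_ne {D x y : ℕ} (hx : x < q ^ D) (hy : y < q ^ D) (hxy : x ≠ y) :
    digitPoly q D x ≠ digitPoly q D y := by
  intro h
  have hq : 0 < q := (Fact.out : q.Prime).pos
  refine hxy (eq_of_digits_eq D hx hy fun i hi => ?_)
  refine natCast_inj_of_lt (Nat.mod_lt _ hq) (Nat.mod_lt _ hq) ?_
  rw [← digitPoly_coeff hi, ← digitPoly_coeff hi, h]

/-- Distinct vertices collide under few polynomials. -/
theorem card_polyHash_eq_le {D x y : ℕ} (hx : x < q ^ D) (hy : y < q ^ D) (hxy : x ≠ y) :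
    ((Finset.range q).filter fun al => polyHash q D al x = polyHash q D al y).card ≤ D - 1 := by
  classical
  -- Distinct polynomials of degree below `D` agree at no more than `D - 1` points.
  set P := digitPoly q D x - digitPoly q D y with hP
  have hP0 : P ≠ 0 := sub_ne_zero.2 (digitPoly_ne hx hy hxy)
  have hdeg : P.natDegree ≤ D - 1 := (Polynomial.natDegree_sub_le _ _).trans
    (max_le (digitPoly_natDegree_le q D x) (digitPoly_natDegree_le q D y))
  refine le_trans ?_ ((P.roots.toFinset_card_le.trans (P.card_roots')).trans hdeg)
  refine Finset.card_le_card_of_injOn (fun al => (al : ZMod q)) ?_ ?_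
  · intro al hal
    rw [Finset.mem_coe, Finset.mem_filter] at hal
    rw [Finset.mem_coe, Multiset.mem_toFinset, Polynomial.mem_roots hP0, Polynomial.IsRoot, hP,
      Polynomial.eval_sub, ← polyHash_cast, ← polyHash_cast, hal.2, sub_self]
  · intro al hal al' hal' h
    rw [Finset.mem_coe, Finset.mem_filter, Finset.mem_range] at hal hal'
    exact natCast_inj_of_lt hal.1 hal'.1 h

/-- Distinct values collide under few multiplications followed by rounding. -/
theorem card_mul_eq_le {s A x y : ℕ} (hs : 1 ≤ s) (hA : A < q) (hx : x < q) (hy : y < q)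
    (hxy : x ≠ y) :
    ((Finset.range A).filter fun a => (a + 1) * x % q / s = (a + 1) * y % q / s).card ≤
      2 * (s - 1) := by
  classical
  have hq : 0 < q := (Fact.out : q.Prime).pos
  have hne : (x : ZMod q) - y ≠ 0 := sub_ne_zero.2 fun h => hxy (natCast_inj_of_lt hx hy h)
  have hcast : ∀ a : ℕ, ((((a + 1) * x % q : ℕ) : ℤ) - (((a + 1) * y % q : ℕ) : ℤ) : ℤ) =
      (((a + 1 : ℕ) : ZMod q) * ((x : ZMod q) - y)) := by
    intro a
    push_cast
    ring
  -- If the rounded values agree, the two residues differ by less than `s` in absolute value. Their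
  -- difference is nonzero and congruent to `(a + 1) * (x - y)` modulo `q`, so it determines `a`.
  have hcard : ((Finset.Ioo (-(s : ℤ)) s).erase 0).card = 2 * (s - 1) := by
    rw [Finset.card_erase_of_mem (by simp; omega), Int.card_Ioo]; omega
  rw [← hcard]
  refine Finset.card_le_card_of_injOn
    (fun a => (((a + 1) * x % q : ℕ) : ℤ) - (((a + 1) * y % q : ℕ) : ℤ)) ?_ ?_
  · intro a ha
    rw [Finset.mem_coe, Finset.mem_filter, Finset.mem_range] at ha
    obtain ⟨ha1, ha2⟩ := ha
    rw [Finset.mem_coe, Finset.mem_erase, Finset.mem_Ioo]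
    dsimp only
    have e1 := Nat.div_add_mod ((a + 1) * x % q) s
    have e2 := Nat.div_add_mod ((a + 1) * y % q) s
    have e3 := Nat.mod_lt ((a + 1) * x % q) hs
    have e4 := Nat.mod_lt ((a + 1) * y % q) hs
    rw [ha2] at e1
    refine ⟨fun h0 => ?_, by omega, by omega⟩
    have h1 := hcast a
    rw [h0, Int.cast_zero] at h1
    rcases mul_eq_zero.1 h1.symm with h2 | h2
    · have := natCast_inj_of_lt (q := q) (x := a + 1) (y := 0) (by omega) hq (by simpa using h2)
      omega
    · exact hne h2
  · intro a ha a' ha' h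
    rw [Finset.mem_coe, Finset.mem_filter, Finset.mem_range] at ha ha'
    have h1 := hcast a
    rw [show (((a + 1) * x % q : ℕ) : ℤ) - (((a + 1) * y % q : ℕ) : ℤ) = _ from h, hcast a'] at h1
    have h2 := mul_right_cancel₀ hne h1
    have := natCast_inj_of_lt (q := q) (by omega) (by omega) h2
    omega

end

/-! ### Collisions and sizes of buckets -/

/-- The number of seeds under which two vertices collide. -/
def Param.coll (π : Param) (u v : ℕ) : ℕ :=
  ((Finset.range π.seeds).filter fun sg => π.hash sg u = π.hash sg v).card

/-- A seed consists of an evaluation point and a multiplier. The two polynomials agree at no more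
than `D - 1` points, and then possibly all `A` multipliers are bad; at each other point at most `2
(s - 1)` multipliers produce a collision by rounding. -/
theorem Param.coll_le {π : Param} (hq : π.q.Prime) (hs : 1 ≤ π.s) (hA1 : 1 ≤ π.A) (hA : π.A < π.q)
    {u v : ℕ} (hu : u < π.q ^ π.D) (hv : v < π.q ^ π.D) (huv : u ≠ v) :
    π.coll u v ≤ π.A * (π.D - 1) + π.q * (2 * (π.s - 1)) := by
  classical
  have := Fact.mk hq
  set T := ((Finset.range π.q ×ˢ Finset.range π.A).filter fun p =>
    (p.2 + 1) * polyHash π.q π.D p.1 u % π.q / π.s = (p.2 + 1) * polyHash π.q π.D p.1 v % π.q / π.s)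
    with hT
  have h1 : π.coll u v ≤ T.card := by
    refine Finset.card_le_card_of_injOn (fun sg => (sg / π.A, sg % π.A)) ?_ ?_
    · intro sg hsg
      rw [Finset.mem_coe, Finset.mem_filter, Finset.mem_range] at hsg
      rw [Finset.mem_coe, hT, Finset.mem_filter, Finset.mem_product, Finset.mem_range,
        Finset.mem_range]
      refine ⟨⟨?_, Nat.mod_lt _ hA1⟩, hsg.2⟩
      rw [Nat.div_lt_iff_lt_mul hA1]; exact hsg.1
    · intro sg _ sg' _ h
      simp only [Prod.mk.injEq] at h
      rw [← Nat.div_add_mod sg π.A, ← Nat.div_add_mod sg' π.A, h.1, h.2]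
  set B := (Finset.range π.q).filter fun al => polyHash π.q π.D al u = polyHash π.q π.D al v with hB
  have hBc : B.card ≤ π.D - 1 := card_polyHash_eq_le hu hv huv
  have h2 : T.card ≤ ∑ al ∈ Finset.range π.q, ((if al ∈ B then π.A else 0) + 2 * (π.s - 1)) := by
    rw [hT, Finset.card_filter, Finset.sum_product]
    refine Finset.sum_le_sum fun al hal => ?_
    rw [← Finset.card_filter]
    by_cases hal' : al ∈ B
    · rw [if_pos hal']
      refine (Finset.card_filter_le _ _).trans ?_
      rw [Finset.card_range]; omega
    · rw [if_neg hal', zero_add]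
      refine card_mul_eq_le hs hA (polyHash_lt hq.two_le) (polyHash_lt hq.two_le) fun h => hal' ?_
      exact Finset.mem_filter.2 ⟨hal, h⟩
  have h3 : ∑ al ∈ Finset.range π.q, ((if al ∈ B then π.A else 0) + 2 * (π.s - 1)) =
      B.card * π.A + π.q * (2 * (π.s - 1)) := by
    have hBq : Finset.range π.q ∩ B = B := Finset.inter_eq_right.2 (Finset.filter_subset _ _)
    rw [Finset.sum_add_distrib, Finset.sum_ite_mem, hBq]
    simp
  have h4 : B.card * π.A ≤ π.A * (π.D - 1) := by
    rw [Nat.mul_comm]; exact Nat.mul_le_mul_left _ hBc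
  omega

/-- A bound on the number of vertices with a given hash value. -/
def Param.cap (π : Param) : ℕ := π.s * (π.n / π.q + 1)

/-- A vertex `x` of a bucket is determined by the remainder lost in rounding and by `x / q`. The
former yields the value of the polynomial, the latter all coefficients but the constant one, and
together they give the constant coefficient `x % q`. -/
theorem Param.card_class_le {π : Param} (hq : π.q.Prime) (hs : 1 ≤ π.s) (hA1 : 1 ≤ π.A)
    (hA : π.A < π.q) (hD : 1 ≤ π.D) (sg j : ℕ) :
    ((Finset.range π.n).filter fun x => π.hash sg x = j).card ≤ π.cap := by
  classical
  have := Fact.mk hq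
  have hcard : (Finset.range π.s ×ˢ Finset.range (π.n / π.q + 1)).card = π.cap := by
    rw [Finset.card_product, Finset.card_range, Finset.card_range, Param.cap]
  rw [← hcard]
  set a := sg % π.A + 1 with ha
  have haq : a < π.q := by
    have := Nat.mod_lt sg hA1
    omega
  refine Finset.card_le_card_of_injOn
    (fun x => (a * polyHash π.q π.D (sg / π.A) x % π.q % π.s, x / π.q)) ?_ ?_
  · intro x hx
    rw [Finset.mem_coe, Finset.mem_filter, Finset.mem_range] at hx
    rw [Finset.mem_coe, Finset.mem_product, Finset.mem_range, Finset.mem_range]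
    exact ⟨Nat.mod_lt _ hs, Nat.lt_succ_of_le (Nat.div_le_div_right hx.1.le)⟩
  · intro x hx y hy h
    rw [Finset.mem_coe, Finset.mem_filter] at hx hy
    simp only [Prod.mk.injEq] at h
    obtain ⟨h1, h2⟩ := h
    have hxy : a * polyHash π.q π.D (sg / π.A) x % π.q = a * polyHash π.q π.D (sg / π.A) y % π.q := by
      have e1 := Nat.div_add_mod (a * polyHash π.q π.D (sg / π.A) x % π.q) π.s
      have e2 := Nat.div_add_mod (a * polyHash π.q π.D (sg / π.A) y % π.q) π.s
      have e3 : a * polyHash π.q π.D (sg / π.A) x % π.q / π.s = j := hx.2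
      have e4 : a * polyHash π.q π.D (sg / π.A) y % π.q / π.s = j := hy.2
      rw [e3] at e1
      rw [e4] at e2
      omega
    have ha0 : (a : ZMod π.q) ≠ 0 := fun h0 => by
      have := natCast_inj_of_lt (q := π.q) haq hq.pos (by simpa using h0)
      omega
    have hp : (digitPoly π.q π.D x).eval ((sg / π.A : ℕ) : ZMod π.q) =
        (digitPoly π.q π.D y).eval ((sg / π.A : ℕ) : ZMod π.q) := by
      rw [← polyHash_cast, ← polyHash_cast]
      have := congrArg (Nat.cast : ℕ → ZMod π.q) hxy
      rw [ZMod.natCast_mod, ZMod.natCast_mod, Nat.cast_mul, Nat.cast_mul] at this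
      exact mul_left_cancel₀ ha0 this
    obtain ⟨D', hD'⟩ : ∃ D', π.D = D' + 1 := ⟨π.D - 1, by omega⟩
    unfold digitPoly at hp
    rw [hD', Finset.sum_range_succ', Finset.sum_range_succ'] at hp
    have hrest : ∀ i ∈ Finset.range D', Polynomial.C ((x / π.q ^ (i + 1) % π.q : ℕ) : ZMod π.q) *
        Polynomial.X ^ (i + 1) = Polynomial.C ((y / π.q ^ (i + 1) % π.q : ℕ) : ZMod π.q) *
        Polynomial.X ^ (i + 1) := by
      intro i _
      rw [pow_succ' π.q, ← Nat.div_div_eq_div_mul, ← Nat.div_div_eq_div_mul, h2]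
    rw [Finset.sum_congr rfl hrest, Polynomial.eval_add, Polynomial.eval_add] at hp
    have hp' := add_left_cancel hp
    simp only [pow_zero, Nat.div_one, mul_one, Polynomial.eval_C] at hp'
    have h3 := natCast_inj_of_lt (q := π.q) (Nat.mod_lt _ hq.pos) (Nat.mod_lt _ hq.pos) hp'
    rw [← Nat.div_add_mod x π.q, ← Nat.div_add_mod y π.q, h2, h3]

/-! ## The structure of the graph on places -/

/-- The conditions on the parameters that the analysis uses. -/
structure Param.Good (π : Param) : Prop where
  prime : π.q.Prime
  s1 : 1 ≤ π.s
  A1 : 1 ≤ π.A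
  Aq : π.A < π.q
  D1 : 1 ≤ π.D

/-- The code of the class of the seed `sg` that is spanned by `u` and `v`. -/
def Param.key (π : Param) (sg u v : ℕ) : ℕ :=
  (sg * π.base + (π.hash sg u + π.hash sg v)) * π.base + π.hash sg u * π.hash sg v

theorem Param.place_eq (π : Param) (sg u v x : ℕ) :
    π.place sg u v x = π.key sg u v * π.base + x := rfl

theorem Param.lt_base {π : Param} {x : ℕ} (hx : x < π.n) : x < π.base :=
  lt_of_lt_of_le hx (Nat.le_add_left _ _)

theorem Param.place_div {π : Param} {sg u v x : ℕ} (hx : x < π.n) :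
    π.place sg u v x / π.base = π.key sg u v := by
  have hb := Param.lt_base hx
  rw [π.place_eq, Nat.add_comm, Nat.add_mul_div_right _ _ (by omega), Nat.div_eq_of_lt hb, zero_add]

theorem eq_or_eq_of_add_mul {a b c d : ℕ} (h1 : a + b = c + d) (h2 : a * b = c * d) :
    (a = c ∧ b = d) ∨ (a = d ∧ b = c) := by
  have h : ((a : ℤ) - c) * ((a : ℤ) - d) = 0 := by
    have h1' : (a : ℤ) + b = c + d := by exact_mod_cast h1
    have h2' : (a : ℤ) * b = c * d := by exact_mod_cast h2
    linear_combination (a : ℤ) * h1' - h2'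
  rcases mul_eq_zero.1 h with h | h <;> omega

/-- The code of a class determines the seed and the pair of hash values. -/
theorem Param.Good.key_inj {π : Param} (hG : π.Good) {sg u v sg' u' v' : ℕ}
    (h : π.key sg u v = π.key sg' u' v') : sg = sg' ∧
      ((π.hash sg u = π.hash sg' u' ∧ π.hash sg v = π.hash sg' v') ∨
        (π.hash sg u = π.hash sg' v' ∧ π.hash sg v = π.hash sg' u')) := by
  have hq := hG.prime.two_le
  have hqq : π.q * π.q ≤ π.base := Nat.le_add_right _ _
  have h2q : 2 * π.q ≤ π.q * π.q := Nat.mul_le_mul_right _ hq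
  have hsum : ∀ sg u v, π.hash sg u + π.hash sg v < π.base := fun sg u v => by
    have := Param.hash_lt hq sg u
    have := Param.hash_lt hq sg v
    omega
  have hprod : ∀ sg u v, π.hash sg u * π.hash sg v < π.base := fun sg u v => by
    have h1 := Param.hash_lt hq sg u
    have h2 := Param.hash_lt hq sg v
    exact lt_of_lt_of_le (Nat.mul_lt_mul'' h1 h2) hqq
  obtain ⟨h1, h2⟩ := pair_inj (hprod _ _ _) (hprod _ _ _) h
  obtain ⟨h3, h4⟩ := pair_inj (hsum _ _ _) (hsum _ _ _) h1
  exact ⟨h3, eq_or_eq_of_add_mul h4 h2⟩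

/-- The pair of places is joined on account of an edge with the property `P`. -/
def Joined (π : Param) (en : ℕ → ℕ × ℕ) (P : ℕ → Prop) (p : ℕ × ℕ) : Prop :=
  ∃ e, P e ∧ ∃ sg < π.seeds, π.hash sg (en e).1 ≠ π.hash sg (en e).2 ∧
    p = (π.place sg (en e).1 (en e).2 (en e).1, π.place sg (en e).1 (en e).2 (en e).2)

theorem Joined.mono {π : Param} {en : ℕ → ℕ × ℕ} {P Q : ℕ → Prop} (h : ∀ e, P e → Q e) {p : ℕ × ℕ}
    (hp : Joined π en P p) : Joined π en Q p := by
  obtain ⟨e, he, h'⟩ := hp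
  exact ⟨e, h e he, h'⟩

/-- The ends of the edges are distinct vertices. -/
def Ends (π : Param) (en : ℕ → ℕ × ℕ) : Prop :=
  ∀ e < π.m, (en e).1 < π.n ∧ (en e).2 < π.n ∧ (en e).1 ≠ (en e).2

theorem mem_batch {π : Param} {E : List (ℕ × ℕ)} {u v : ℕ} {p : ℕ × ℕ} (hp : p ∈ π.batch E u v) :
    ∃ sg < π.seeds, π.hash sg u ≠ π.hash sg v ∧ p = (π.place sg u v u, π.place sg u v v) := by
  unfold Param.batch Param.batchUpTo at hp
  rw [List.mem_map] at hp
  obtain ⟨sg, h, rfl⟩ := hp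
  simp only [List.mem_filter, List.mem_range, decide_eq_true_eq] at h
  exact ⟨sg, h.1, h.2.1, rfl⟩

theorem Greedy.joined {π : Param} {len : ℕ → ℝ≥0} {en : ℕ → ℕ × ℕ} {done : Finset ℕ}
    {out : List ℕ} {E : List (ℕ × ℕ)} (h : Greedy π len en done out E) :
    ∀ p ∈ E, Joined π en (· ∈ out) p := by
  induction h with
  | nil => simp
  | skip e h he hd hle hb ih => exact ih
  | take e h he hd hle hb ih =>
    intro p hp
    rcases List.mem_append.1 hp with hp | hp
    · obtain ⟨sg, h1, h2, h3⟩ := mem_batch (List.mem_reverse.1 hp)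
      exact ⟨e, by simp, sg, h1, h2, h3⟩
    · exact (ih p hp).mono fun e' he' => List.mem_append_left _ he'

theorem Greedy.out_subset {π : Param} {len : ℕ → ℝ≥0} {en : ℕ → ℕ × ℕ} {done : Finset ℕ}
    {out : List ℕ} {E : List (ℕ × ℕ)} (h : Greedy π len en done out E) :
    (∀ e ∈ out, e ∈ done) ∧ (∀ e ∈ done, e < π.m) ∧
      ∀ e ∈ done, ∀ e' < π.m, e' ∉ done → len e ≤ len e' := by
  induction h with
  | nil => simp
  | @skip done out E e h he hd hle hb ih =>
    obtain ⟨h1, h2, h3⟩ := ih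
    refine ⟨fun e' he' => Finset.mem_insert_of_mem (h1 e' he'), ?_, ?_⟩
    · intro e' he'
      rcases Finset.mem_insert.1 he' with rfl | he'
      exacts [he, h2 e' he']
    · intro e' he' e'' h4 h5
      rw [Finset.mem_insert, not_or] at h5
      rcases Finset.mem_insert.1 he' with rfl | he'
      exacts [hle e'' h4 h5.2, h3 e' he' e'' h4 h5.2]
  | @take done out E e h he hd hle hb ih =>
    obtain ⟨h1, h2, h3⟩ := ih
    refine ⟨fun e' he' => ?_, ?_, ?_⟩
    · rcases List.mem_append.1 he' with he' | he'
      · exact Finset.mem_insert_of_mem (h1 e' he')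
      · rw [List.mem_singleton.1 he']; exact Finset.mem_insert_self _ _
    · intro e' he'
      rcases Finset.mem_insert.1 he' with rfl | he'
      exacts [he, h2 e' he']
    · intro e' he' e'' h4 h5
      rw [Finset.mem_insert, not_or] at h5
      rcases Finset.mem_insert.1 he' with rfl | he'
      exacts [hle e'' h4 h5.2, h3 e' he' e'' h4 h5.2]

/-- Every edge that is not chosen was rejected in the presence of pairs that are joined on account
of chosen edges that are not longer. -/
theorem Greedy.rejected {π : Param} {len : ℕ → ℝ≥0} {en : ℕ → ℕ × ℕ} {done : Finset ℕ}
    {out : List ℕ} {E : List (ℕ × ℕ)} (h : Greedy π len en done out E) :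
    ∀ e ∈ done, e ∉ out → ∃ E', (∀ p ∈ E', Joined π en (fun e' => e' ∈ out ∧ len e' ≤ len e) p) ∧
      4 * (π.batch E' (en e).1 (en e).2).length < π.seeds := by
  induction h with
  | nil => simp
  | @skip done out E e h he hd hle hb ih =>
    intro e' he' ho
    rcases Finset.mem_insert.1 he' with rfl | he'
    · refine ⟨E, fun p hp => (h.joined p hp).mono fun e'' h' => ⟨h', ?_⟩, hb⟩
      obtain ⟨h1, h2, h3⟩ := h.out_subset
      exact h3 e'' (h1 e'' h') e' he hd
    · exact ih e' he' ho
  | @take done out E e h he hd hle hb ih =>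
    intro e' he' ho
    rcases Finset.mem_insert.1 he' with rfl | he'
    · simp at ho
    · obtain ⟨E', h1, h2⟩ := ih e' he' fun h' => ho (List.mem_append_left _ h')
      exact ⟨E', fun p hp => (h1 p hp).mono fun e'' h' => ⟨List.mem_append_left _ h'.1, h'.2⟩, h2⟩

/-- Each chosen edge accounts for at least a quarter of the seeds in joined pairs. -/
theorem Greedy.length_out {π : Param} {len : ℕ → ℝ≥0} {en : ℕ → ℕ × ℕ} {done : Finset ℕ}
    {out : List ℕ} {E : List (ℕ × ℕ)} (h : Greedy π len en done out E) :
    out.length * π.seeds ≤ 4 * E.length := by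
  induction h with
  | nil => simp
  | skip e h he hd hle hb ih => exact ih
  | take e h he hd hle hb ih =>
    rw [List.length_append, List.length_append, List.length_reverse, List.length_singleton, add_mul,
      one_mul]
    omega

/-- Joined places lie in the same class. -/
theorem Joined.div_eq {π : Param} {en : ℕ → ℕ × ℕ} (hen : Ends π en) {P : ℕ → Prop}
    (hP : ∀ e, P e → e < π.m) {p : ℕ × ℕ} (h : Joined π en P p) :
    p.1 / π.base = p.2 / π.base := by
  obtain ⟨e, he, sg, hs, hne, rfl⟩ := h
  obtain ⟨h1, h2, -⟩ := hen e (hP e he)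
  rw [Param.place_div h1, Param.place_div h2]

theorem adj_div_eq {π : Param} {E : List (ℕ × ℕ)} (hE : ∀ p ∈ E, p.1 / π.base = p.2 / π.base)
    {a b : ℕ} (h : Adj E a b) : a / π.base = b / π.base := by
  obtain ⟨p, hp, h1, h2⟩ := h
  have := hE p hp
  rcases h1 with rfl | rfl <;> rcases h2 with rfl | rfl <;> simp [this]

theorem reach_div_eq {π : Param} {E : List (ℕ × ℕ)} (hE : ∀ p ∈ E, p.1 / π.base = p.2 / π.base)
    {s l b : ℕ} (h : Reach (Adj E) s l b) : s / π.base = b / π.base := by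
  induction h with
  | refl => rfl
  | step _ hab ih => exact ih.trans (adj_div_eq hE hab)

/-- Pairs in other classes do not help to reach a place. -/
theorem Reach.of_append {π : Param} {E l : List (ℕ × ℕ)}
    (hE : ∀ p ∈ E, p.1 / π.base = p.2 / π.base) {s j b : ℕ}
    (hl : ∀ p ∈ l, p.1 / π.base ≠ s / π.base ∧ p.2 / π.base ≠ s / π.base)
    (h : Reach (Adj (l ++ E)) s j b) : Reach (Adj E) s j b := by
  have key : ∀ a b, a / π.base = s / π.base → Adj (l ++ E) a b → Adj E a b := by
    rintro a b ha ⟨p, hp, h1, h2⟩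
    rcases List.mem_append.1 hp with hp | hp
    · have := hl p hp
      rcases h1 with rfl | rfl
      exacts [absurd ha this.1, absurd ha this.2]
    · exact ⟨p, hp, h1, h2⟩
  induction h with
  | refl h => exact .refl (key _ _ rfl h)
  | step _ hab ih => exact ih.step (key _ _ (reach_div_eq hE ih).symm hab)

/-- A pair of the batch was tested against `E` alone and not against the pairs inserted together
with it. Those belong to other seeds, hence to other classes, and cannot provide a walk in its
class. -/
theorem spread_batch {π : Param} (hG : π.Good) {E : List (ℕ × ℕ)}
    (hE : ∀ p ∈ E, p.1 / π.base = p.2 / π.base) (hS : Spread π.K E) {u v : ℕ} (hu : u < π.n)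
    (hv : v < π.n) (huv : u ≠ v) : Spread π.K ((π.batch E u v).reverse ++ E) := by
  have key : ∀ l : List ℕ, l.Nodup →
      (∀ sg ∈ l, ¬ Reach (Adj E) (π.place sg u v u) π.K (π.place sg u v v)) →
      Spread π.K ((l.map fun sg => (π.place sg u v u, π.place sg u v v)) ++ E) := by
    intro l
    induction l with
    | nil => intro _ _; exact hS
    | cons sg l ih =>
      intro hnd hr
      rw [List.nodup_cons] at hnd
      refine ⟨?_, fun h => ?_, ih hnd.2 fun sg' h' => hr sg' (List.mem_cons_of_mem _ h')⟩
      · dsimp only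
        rw [π.place_eq, π.place_eq]
        omega
      · refine hr sg List.mem_cons_self (Reach.of_append hE ?_ h)
        intro p hp
        obtain ⟨sg', h', rfl⟩ := List.mem_map.1 hp
        dsimp only
        rw [Param.place_div hu, Param.place_div hv, Param.place_div hu]
        have : π.key sg' u v ≠ π.key sg u v := fun hk => by
          have := (hG.key_inj hk).1
          exact hnd.1 (this ▸ h')
        exact ⟨this, this⟩
  unfold Param.batch Param.batchUpTo
  rw [← List.map_reverse]
  refine key _ (List.nodup_reverse.2 (List.nodup_range.filter _)) fun sg hsg => ?_
  simp only [List.mem_reverse, List.mem_filter, decide_eq_true_eq] at hsg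
  exact hsg.2.2

theorem Greedy.div_eq {π : Param} {len : ℕ → ℝ≥0} {en : ℕ → ℕ × ℕ} {done : Finset ℕ}
    {out : List ℕ} {E : List (ℕ × ℕ)} (hen : Ends π en) (h : Greedy π len en done out E) :
    ∀ p ∈ E, p.1 / π.base = p.2 / π.base := fun p hp =>
  (h.joined p hp).div_eq hen fun e he => h.out_subset.2.1 e (h.out_subset.1 e he)

theorem Greedy.spread {π : Param} (hG : π.Good) {len : ℕ → ℝ≥0} {en : ℕ → ℕ × ℕ} {done : Finset ℕ}
    {out : List ℕ} {E : List (ℕ × ℕ)} (hen : Ends π en) (h : Greedy π len en done out E) :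
    Spread π.K E := by
  induction h with
  | nil => trivial
  | skip e h he hd hle hb ih => exact ih
  | take e h he hd hle hb ih =>
    obtain ⟨h1, h2, h3⟩ := hen e he
    exact spread_batch hG (h.div_eq hen) ih h1 h2 h3

theorem Reach.adj_left {E : List (ℕ × ℕ)} {s l b : ℕ} (h : Reach (Adj E) s l b) : Adj E s s := by
  induction h with
  | refl h => exact h
  | step _ _ ih => exact ih

/-- A place of a joined pair. -/
theorem Greedy.exists_place {π : Param} {len : ℕ → ℝ≥0} {en : ℕ → ℕ × ℕ} {done : Finset ℕ}
    {out : List ℕ} {E : List (ℕ × ℕ)} (hen : Ends π en) (h : Greedy π len en done out E) {a : ℕ}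
    (ha : Adj E a a) : ∃ sg u v x, x < π.n ∧ (x = u ∨ x = v) ∧ a = π.place sg u v x := by
  obtain ⟨p, hp, h1, -⟩ := ha
  obtain ⟨e, he, sg, hs, hne, rfl⟩ := h.joined p hp
  obtain ⟨g1, g2, -⟩ := hen e (h.out_subset.2.1 e (h.out_subset.1 e he))
  rcases h1 with rfl | rfl
  · exact ⟨sg, _, _, _, g1, Or.inl rfl, rfl⟩
  · exact ⟨sg, _, _, _, g2, Or.inr rfl, rfl⟩

/-- The components of the graph on places are small. -/
theorem Greedy.card_le {π : Param} (hG : π.Good) {len : ℕ → ℝ≥0} {en : ℕ → ℕ × ℕ} {done : Finset ℕ}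
    {out : List ℕ} {E : List (ℕ × ℕ)} (hen : Ends π en) (h : Greedy π len en done out E) (b : ℕ)
    (S : Finset ℕ) (hS : ∀ s ∈ S, ∃ l, Reach (Adj E) s l b) : S.card ≤ 2 * π.cap := by
  classical
  rcases S.eq_empty_or_nonempty with rfl | ⟨s₀, hs₀⟩
  · simp
  obtain ⟨l₀, hl₀⟩ := hS s₀ hs₀
  obtain ⟨sg, u, v, x₀, hx₀, -, rfl⟩ := h.exists_place hen hl₀.adj_left
  have hb := reach_div_eq (h.div_eq hen) hl₀
  rw [Param.place_div hx₀] at hb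
  -- All sources lie in the class of `b`, and a vertex that occurs there has one of the two hash
  -- values of the class.
  have hsub : S ⊆ (((Finset.range π.n).filter fun x => π.hash sg x = π.hash sg u) ∪
      ((Finset.range π.n).filter fun x => π.hash sg x = π.hash sg v)).image
        fun x => π.key sg u v * π.base + x := by
    intro s hs
    obtain ⟨l, hl⟩ := hS s hs
    obtain ⟨sg', u', v', x, hx, hxe, rfl⟩ := h.exists_place hen hl.adj_left
    have hb' := reach_div_eq (h.div_eq hen) hl
    rw [Param.place_div hx, ← hb] at hb'
    refine Finset.mem_image.2 ⟨x, ?_, by rw [π.place_eq, hb']⟩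
    obtain ⟨rfl, h2⟩ := hG.key_inj hb'
    rw [Finset.mem_union, Finset.mem_filter, Finset.mem_filter, Finset.mem_range]
    rcases hxe with rfl | rfl <;> rcases h2 with ⟨h3, h4⟩ | ⟨h3, h4⟩
    · exact Or.inl ⟨hx, h3⟩
    · exact Or.inr ⟨hx, h3⟩
    · exact Or.inr ⟨hx, h4⟩
    · exact Or.inl ⟨hx, h4⟩
  refine (Finset.card_le_card hsub).trans (Finset.card_image_le.trans
    ((Finset.card_union_le _ _).trans ?_))
  have h1 := π.card_class_le hG.prime hG.s1 hG.A1 hG.Aq hG.D1 sg (π.hash sg u)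
  have h2 := π.card_class_le hG.prime hG.s1 hG.A1 hG.Aq hG.D1 sg (π.hash sg v)
  omega

/-! ### Counting joined pairs and chosen edges -/

/-- The number of hash values. -/
def Param.buckets (π : Param) : ℕ := (π.q - 1) / π.s + 1

theorem Param.hash_lt_buckets {π : Param} (hq : 2 ≤ π.q) (sg x : ℕ) : π.hash sg x < π.buckets := by
  refine Nat.lt_succ_of_le (Nat.div_le_div_right ?_)
  have := Nat.mod_lt ((sg % π.A + 1) * polyHash π.q π.D (sg / π.A) x) (show 0 < π.q by omega)
  omega

/-- The number of joined pairs. -/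
theorem Greedy.length_pairs {π : Param} (hG : π.Good) {len : ℕ → ℝ≥0} {en : ℕ → ℕ × ℕ}
    {done : Finset ℕ} {out : List ℕ} {E : List (ℕ × ℕ)} (hen : Ends π en)
    (h : Greedy π len en done out E) {k t : ℕ} (hk : 1 ≤ k) (hK : π.K = 2 * k - 1)
    (ht : 2 * π.cap < t ^ k) : E.length ≤ t * (π.seeds * π.n * π.buckets) := by
  classical
  -- A place is named by its seed, its vertex and the hash value of the other end: the vertex
  -- supplies its own hash value, and sum and product ignore the order.
  set V : Finset ℕ := ((Finset.range π.seeds ×ˢ Finset.range π.n) ×ˢ Finset.range π.buckets).image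
    fun p => ((p.1.1 * π.base + (π.hash p.1.1 p.1.2 + p.2)) * π.base + π.hash p.1.1 p.1.2 * p.2) *
      π.base + p.1.2 with hV
  have hVc : V.card ≤ π.seeds * π.n * π.buckets := by
    refine Finset.card_image_le.trans (le_of_eq ?_)
    simp
  refine ((h.spread hG hen).length_le hk (by omega) ht (h.card_le hG hen) V ?_).trans
    (Nat.mul_le_mul_left _ hVc)
  intro p hp
  obtain ⟨e, he, sg, hs, hne, rfl⟩ := h.joined p hp
  obtain ⟨g1, g2, -⟩ := hen e (h.out_subset.2.1 e (h.out_subset.1 e he))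
  have hb := fun x => Param.hash_lt_buckets hG.prime.two_le sg x
  constructor
  · refine Finset.mem_image.2 ⟨((sg, (en e).1), π.hash sg (en e).2), ?_, rfl⟩
    simp [hs, g1, hb]
  · refine Finset.mem_image.2 ⟨((sg, (en e).2), π.hash sg (en e).1), ?_, ?_⟩
    · simp [hs, g2, hb]
    · dsimp only
      rw [π.place_eq, Param.key, Nat.add_comm (π.hash sg (en e).2), Nat.mul_comm (π.hash sg (en e).2)]

/-- The number of chosen edges. -/
theorem Greedy.length_out_le {π : Param} (hG : π.Good) {len : ℕ → ℝ≥0} {en : ℕ → ℕ × ℕ}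
    {done : Finset ℕ} {out : List ℕ} {E : List (ℕ × ℕ)} (hen : Ends π en)
    (h : Greedy π len en done out E) {k t : ℕ} (hk : 1 ≤ k) (hK : π.K = 2 * k - 1)
    (ht : 2 * π.cap < t ^ k) : out.length ≤ 4 * t * (π.n * π.buckets) := by
  have h1 := h.length_pairs hG hen hk hK ht
  have h2 := h.length_out
  have hS : 0 < π.seeds := Nat.mul_pos hG.prime.pos hG.A1
  -- The number of seeds cancels, so a large family of hash functions costs time but no edges.
  refine Nat.le_of_mul_le_mul_right (h2.trans ((Nat.mul_le_mul_left 4 h1).trans (le_of_eq ?_))) hS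
  ring

/-! ## The chosen edges form a fault-tolerant spanner -/

section
variable {V : Type*} {G : SimpleGraph V} {w : Sym2 V → ℝ≥0}

theorem wdist_self (u : V) : wdist G w u u = 0 := by
  refine le_antisymm (iInf_le_of_le .nil ?_) bot_le
  simp

theorem wdist_step {u x y : V} (h : G.Adj x y) :
    wdist G w u y ≤ wdist G w u x + (w s(x, y) : ℝ≥0∞) := by
  unfold wdist
  rw [ENNReal.iInf_add]
  refine le_iInf fun p => iInf_le_of_le (p.concat h) ?_
  rw [SimpleGraph.Walk.edges_concat, List.concat_eq_append, List.map_append, List.sum_append]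
  simp

theorem wdist_triangle (u x y : V) : wdist G w u y ≤ wdist G w u x + wdist G w x y := by
  unfold wdist
  rw [ENNReal.iInf_add]
  refine le_iInf fun p => ?_
  rw [ENNReal.add_iInf]
  refine le_iInf fun q => iInf_le_of_le (p.append q) ?_
  rw [SimpleGraph.Walk.edges_append, List.map_append, List.sum_append]

/-- It suffices to bound the stretch of edges. -/
theorem wdist_le_of_edges {G' : SimpleGraph V} {t : ℕ} (ht : t ≠ 0)
    (h : ∀ x y, G'.Adj x y → wdist G w x y ≤ (t : ℝ≥0∞) * (w s(x, y) : ℝ≥0∞)) (u v : V) :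
    wdist G w u v ≤ (t : ℝ≥0∞) * wdist G' w u v := by
  have key : ∀ {u v : V} (p : G'.Walk u v),
      wdist G w u v ≤ (t : ℝ≥0∞) * (p.edges.map fun e => (w e : ℝ≥0∞)).sum := by
    intro u v p
    induction p with
    | nil => simp [wdist_self]
    | cons hxy p ih =>
      rw [SimpleGraph.Walk.edges_cons, List.map_cons, List.sum_cons, mul_add]
      exact (wdist_triangle _ _ _).trans (add_le_add (h _ _ hxy) ih)
  conv_rhs => unfold wdist
  rw [ENNReal.mul_iInf_of_ne (by exact_mod_cast ht) (ENNReal.natCast_ne_top t)]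
  exact le_iInf key

end

/-- The graph of the listed edges. -/
def Input.outGraph (I : Input) (out : List ℕ) : SimpleGraph (Fin I.n) :=
  SimpleGraph.fromEdgeSet {x | ∃ i : Fin I.m, (i : ℕ) ∈ out ∧ x = s((I.e i).1, (I.e i).2)}

theorem Input.mem_edgeSet (I : Input) (i : Fin I.m) : s((I.e i).1, (I.e i).2) ∈ I.G.edgeSet := by
  rw [← I.e_range]; exact ⟨i, rfl⟩

theorem Input.e_ne (I : Input) (i : Fin I.m) : (I.e i).1 ≠ (I.e i).2 :=
  (I.G.mem_edgeSet.1 (I.mem_edgeSet i)).ne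

theorem Input.edgeSet_outGraph (I : Input) (out : List ℕ) : (I.outGraph out).edgeSet =
    {x | ∃ i : Fin I.m, (i : ℕ) ∈ out ∧ x = s((I.e i).1, (I.e i).2)} := by
  unfold Input.outGraph
  rw [SimpleGraph.edgeSet_fromEdgeSet, sdiff_eq_left, Set.disjoint_left]
  rintro x ⟨i, -, rfl⟩ h
  exact I.e_ne i (by simpa using h)

theorem Input.outGraph_le (I : Input) (out : List ℕ) : I.outGraph out ≤ I.G := by
  rw [← SimpleGraph.edgeSet_subset_edgeSet, I.edgeSet_outGraph]
  rintro x ⟨i, -, rfl⟩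
  exact I.mem_edgeSet i

theorem Input.len_eq (I : Input) (i : Fin I.m) : I.len i = I.w s((I.e i).1, (I.e i).2) := by
  unfold Input.len
  rw [dif_pos i.2]

theorem Input.ends_spec (I : Input) {π : Param} (hn : π.n = I.n) (hm : π.m = I.m) :
    Ends π I.ends := by
  intro e he
  rw [hm] at he
  have := I.ends_eq ⟨e, he⟩
  dsimp only at this
  rw [this, hn]
  exact ⟨Fin.is_lt _, Fin.is_lt _, fun h => I.e_ne ⟨e, he⟩ (Fin.ext h)⟩

/-- The number of edges that are listed. -/
theorem Input.ncard_outGraph_le (I : Input) (out : List ℕ) :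
    (I.outGraph out).edgeSet.ncard ≤ out.length := by
  classical
  rw [I.edgeSet_outGraph]
  set g : ℕ → Option (Sym2 (Fin I.n)) := fun j =>
    if h : j < I.m then some s((I.e ⟨j, h⟩).1, (I.e ⟨j, h⟩).2) else none with hg
  have hsub : {x | ∃ i : Fin I.m, (i : ℕ) ∈ out ∧ x = s((I.e i).1, (I.e i).2)} ⊆
      ((out.filterMap g).toFinset : Set (Sym2 (Fin I.n))) := by
    rintro x ⟨i, hi, rfl⟩
    rw [Finset.mem_coe, List.mem_toFinset, List.mem_filterMap]
    exact ⟨i, hi, by simp [hg]⟩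
  refine (Set.ncard_le_ncard hsub (Finset.finite_toSet _)).trans ?_
  rw [Set.ncard_coe_finset]
  exact (List.toFinset_card_le _).trans (List.length_filterMap_le _ _)

/-- A walk on places projects to a walk in the graph of chosen edges. -/
theorem wdist_le_of_reach {I : Input} {π : Param} (hG : π.Good) (hn : π.n = I.n) (hm : π.m = I.m)
    {out : List ℕ} (hout : ∀ e ∈ out, e < π.m) {L : ℝ≥0} {E : List (ℕ × ℕ)}
    (hE : ∀ p ∈ E, Joined π I.ends (fun e => e ∈ out ∧ I.len e ≤ L) p) {sg : ℕ} {u v : Fin I.n}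
    {F : Finset (Fin I.n)}
    (hF : ∀ x ∈ F, π.hash sg x ≠ π.hash sg u ∧ π.hash sg x ≠ π.hash sg v) {l b : ℕ}
    (h : Reach (Adj E) (π.place sg u v u) l b) : ∃ y : Fin I.n, b = π.place sg u v y ∧
      (π.hash sg y = π.hash sg u ∨ π.hash sg y = π.hash sg v) ∧
      wdist (removeVerts (I.outGraph out) F) I.w u y ≤ (l : ℝ≥0∞) * (L : ℝ≥0∞) := by
  induction h with
  | refl _ => exact ⟨u, rfl, Or.inl rfl, by simp [wdist_self]⟩
  | @step l a b _ hab ih =>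
    obtain ⟨y, rfl, hy, hd⟩ := ih
    have hyF : y ∉ F := fun h => by
      rcases hy with hy | hy
      exacts [(hF y h).1 hy, (hF y h).2 hy]
    obtain ⟨p, hp, h1, h2⟩ := hab
    obtain ⟨e, ⟨heo, hel⟩, sg', hs', hne, rfl⟩ := hE p hp
    have he : e < I.m := hm ▸ hout e heo
    have hends := I.ends_eq ⟨e, he⟩
    dsimp only at hends
    set x₁ := (I.e ⟨e, he⟩).1 with hx₁
    set x₂ := (I.e ⟨e, he⟩).2 with hx₂
    rw [hends] at h1 h2
    dsimp only at h1 h2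
    have hlt : ∀ x : Fin I.n, (x : ℕ) < π.n := fun x => by rw [hn]; exact x.2
    have hkey : π.key sg u v = π.key sg' x₁ x₂ := by
      rcases h1 with h1 | h1 <;>
      · have := congrArg (· / π.base) h1
        simpa only [Param.place_div (hlt _)] using this
    have hinj : ∀ x x' : Fin I.n, π.place sg u v x = π.place sg' x₁ x₂ x' → x = x' := by
      intro x x' h
      rw [π.place_eq, π.place_eq, hkey] at h
      exact Fin.ext (by omega)
    obtain ⟨hsg, hh⟩ := hG.key_inj hkey
    rw [← hsg] at hh
    have hz : ∃ z, (z = x₁ ∨ z = x₂) ∧ b = π.place sg' x₁ x₂ z := by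
      rcases h2 with rfl | rfl
      exacts [⟨x₁, Or.inl rfl, rfl⟩, ⟨x₂, Or.inr rfl, rfl⟩]
    have hy' : y = x₁ ∨ y = x₂ := by
      rcases h1 with h1 | h1
      exacts [Or.inl (hinj _ _ h1), Or.inr (hinj _ _ h1)]
    obtain ⟨z, hz, rfl⟩ := hz
    have hzh : π.hash sg z = π.hash sg u ∨ π.hash sg z = π.hash sg v := by
      rcases hz with rfl | rfl <;> rcases hh with ⟨h3, h4⟩ | ⟨h3, h4⟩
      · exact Or.inl h3.symm
      · exact Or.inr h4.symm
      · exact Or.inr h4.symm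
      · exact Or.inl h3.symm
    have hzF : z ∉ F := fun h => by
      rcases hzh with hy | hy
      exacts [(hF z h).1 hy, (hF z h).2 hy]
    refine ⟨z, by rw [π.place_eq, π.place_eq, hkey], hzh, ?_⟩
    have hle : (l : ℝ≥0∞) * (L : ℝ≥0∞) ≤ ((l + 1 : ℕ) : ℝ≥0∞) * (L : ℝ≥0∞) := by
      gcongr
      exact_mod_cast Nat.le_succ l
    -- A step along a loop stays at its vertex and costs nothing.
    by_cases hyz : y = z
    · rw [← hyz]; exact hd.trans hle
    have hs : s(y, z) = s(x₁, x₂) := by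
      rcases hy' with rfl | rfl <;> rcases hz with rfl | rfl
      · exact absurd rfl hyz
      · rfl
      · exact Sym2.eq_swap
      · exact absurd rfl hyz
    have hadj : (removeVerts (I.outGraph out) F).Adj y z := by
      refine ⟨?_, hyF, hzF⟩
      rw [← SimpleGraph.mem_edgeSet, I.edgeSet_outGraph, hs]
      exact ⟨⟨e, he⟩, heo, rfl⟩
    have hw : (I.w s(y, z) : ℝ≥0∞) ≤ (L : ℝ≥0∞) := by
      have := I.len_eq ⟨e, he⟩
      dsimp only at this
      rw [hs, ← this]
      exact_mod_cast hel
    refine (wdist_step hadj).trans ((add_le_add hd hw).trans (le_of_eq ?_))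
    push_cast; ring

/-- If collisions are rare, some seed separates `u` and `v` from the faults and does not ask for
the edge. -/
theorem exists_seed {π : Param} {E : List (ℕ × ℕ)} {u v c f : ℕ} {F : Finset ℕ}
    (hb : 4 * (π.batch E u v).length < π.seeds) (huv : π.coll u v ≤ c)
    (hF : ∀ x ∈ F, π.coll x u ≤ c ∧ π.coll x v ≤ c) (hFf : F.card ≤ f)
    (hc : 4 * ((2 * f + 1) * c) ≤ 3 * π.seeds) :
    ∃ sg, Reach (Adj E) (π.place sg u v u) π.K (π.place sg u v v) ∧
      ∀ x ∈ F, π.hash sg x ≠ π.hash sg u ∧ π.hash sg x ≠ π.hash sg v := by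
  classical
  by_contra! hcon
  set S := Finset.range π.seeds
  set B := (S.filter fun sg => π.hash sg u ≠ π.hash sg v ∧
    ¬ Reach (Adj E) (π.place sg u v u) π.K (π.place sg u v v)) with hB
  have hBc : B.card ≤ (π.batch E u v).length := by
    unfold Param.batch Param.batchUpTo
    rw [List.length_map]
    have : B = ((List.range π.seeds).filter fun sg => π.hash sg u ≠ π.hash sg v ∧
        ¬ Reach (Adj E) (π.place sg u v u) π.K (π.place sg u v v)).toFinset := by
      ext sg
      simp [hB, S]
    rw [this]
    refine (List.toFinset_card_le _).trans (le_of_eq ?_)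
    congr!
  -- Without a good seed each seed would fail for one of three reasons: `u` and `v` collide, the
  -- edge is required, or a fault collides with `u` or `v`. By the union bound these are fewer than
  -- all seeds.
  have hsub : S ⊆ (S.filter fun sg => π.hash sg u = π.hash sg v) ∪ B ∪
      F.biUnion fun x => (S.filter fun sg => π.hash sg x = π.hash sg u) ∪
        (S.filter fun sg => π.hash sg x = π.hash sg v) := by
    intro sg hsg
    by_cases h1 : π.hash sg u = π.hash sg v
    · exact Finset.mem_union_left _ (Finset.mem_union_left _ (Finset.mem_filter.2 ⟨hsg, h1⟩))
    by_cases h2 : Reach (Adj E) (π.place sg u v u) π.K (π.place sg u v v)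
    · refine Finset.mem_union_right _ ?_
      obtain ⟨x, hx, h3⟩ := hcon sg h2
      refine Finset.mem_biUnion.2 ⟨x, hx, ?_⟩
      by_cases h4 : π.hash sg x = π.hash sg u
      · exact Finset.mem_union_left _ (Finset.mem_filter.2 ⟨hsg, h4⟩)
      · exact Finset.mem_union_right _ (Finset.mem_filter.2 ⟨hsg, h3 h4⟩)
    · exact Finset.mem_union_left _ (Finset.mem_union_right _ (Finset.mem_filter.2 ⟨hsg, h1, h2⟩))
  have hbi : (F.biUnion fun x => (S.filter fun sg => π.hash sg x = π.hash sg u) ∪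
        (S.filter fun sg => π.hash sg x = π.hash sg v)).card ≤ f * (2 * c) := by
    refine Finset.card_biUnion_le.trans ((Finset.sum_le_card_nsmul _ _ (2 * c) fun x hx => ?_).trans
      ?_)
    · obtain ⟨h1, h2⟩ := hF x hx
      refine (Finset.card_union_le _ _).trans ?_
      have h1' : (S.filter fun sg => π.hash sg x = π.hash sg u).card ≤ c := h1
      have h2' : (S.filter fun sg => π.hash sg x = π.hash sg v).card ≤ c := h2
      omega
    · rw [smul_eq_mul]; exact Nat.mul_le_mul_right _ hFf
  have h1 := (Finset.card_le_card hsub).trans (Finset.card_union_le _ _)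
  have h2 := Finset.card_union_le (S.filter fun sg => π.hash sg u = π.hash sg v) B
  have h3 : (S.filter fun sg => π.hash sg u = π.hash sg v).card ≤ c := huv
  have h4 : S.card = π.seeds := Finset.card_range _
  have h5 : (2 * f + 1) * c = f * (2 * c) + c := by ring
  omega

/-- It suffices to bridge single edges avoiding `F`. For a rejected edge some seed has no fault in
the class of its ends and already held a walk of length `K` there; its projection uses chosen edges
no longer than the rejected one. -/
theorem Greedy.isVFTSpanner {I : Input} {π : Param} (hG : π.Good) (hn : π.n = I.n)
    (hm : π.m = I.m) {k' c : ℕ} (hK : π.K = 2 * k' - 1) (hk' : k' ≤ I.k)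
    (hc : ∀ x y : ℕ, x < I.n → y < I.n → x ≠ y → π.coll x y ≤ c)
    (hcS : 4 * ((2 * I.f + 1) * c) ≤ 3 * π.seeds) {out : List ℕ} {E : List (ℕ × ℕ)}
    (h : Greedy π I.len I.ends (Finset.range I.m) out E) :
    IsVFTSpanner I.f (2 * I.k - 1) I.G I.w (I.outGraph out) := by
  refine ⟨I.outGraph_le out, fun u v F _ _ hF => ?_⟩
  have hk := I.k_pos
  obtain ⟨ho1, ho2, -⟩ := h.out_subset
  have hout : ∀ e ∈ out, e < π.m := fun e he => ho2 e (ho1 e he)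
  have hcard : (F.image fun x : Fin I.n => (x : ℕ)).card ≤ I.f := Finset.card_image_le.trans hF
  have main : ∀ i : Fin I.m, (I.e i).1 ∉ F → (I.e i).2 ∉ F →
      wdist (removeVerts (I.outGraph out) F) I.w (I.e i).1 (I.e i).2 ≤
        ((2 * I.k - 1 : ℕ) : ℝ≥0∞) * (I.w s((I.e i).1, (I.e i).2) : ℝ≥0∞) := by
    intro i h1 h2
    by_cases hi : (i : ℕ) ∈ out
    · have hadj : (removeVerts (I.outGraph out) F).Adj (I.e i).1 (I.e i).2 := by
        refine ⟨?_, h1, h2⟩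
        rw [← SimpleGraph.mem_edgeSet, I.edgeSet_outGraph]
        exact ⟨i, hi, rfl⟩
      refine (wdist_step hadj).trans ?_
      rw [wdist_self, zero_add]
      refine le_mul_of_one_le_left bot_le ?_
      exact_mod_cast (show 1 ≤ 2 * I.k - 1 by omega)
    · obtain ⟨E', hE', hb⟩ := h.rejected i (Finset.mem_range.2 i.2) hi
      rw [I.ends_eq i] at hb
      dsimp only at hb
      have hne : ((I.e i).1 : ℕ) ≠ (I.e i).2 := fun h => I.e_ne i (Fin.ext h)
      obtain ⟨sg, hr, hsF⟩ := exists_seed hb (hc _ _ (Fin.is_lt _) (Fin.is_lt _) hne)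
        (F := F.image fun x : Fin I.n => (x : ℕ)) (fun x hx => by
          obtain ⟨y, hy, rfl⟩ := Finset.mem_image.1 hx
          refine ⟨hc _ _ y.2 (Fin.is_lt _) fun h => h1 ?_, hc _ _ y.2 (Fin.is_lt _) fun h => h2 ?_⟩
          · rw [← Fin.ext h]; exact hy
          · rw [← Fin.ext h]; exact hy) hcard hcS
      obtain ⟨y, hy1, -, hy2⟩ := wdist_le_of_reach hG hn hm hout hE' (F := F)
        (fun x hx => hsF x (Finset.mem_image_of_mem _ hx)) hr
      have hyv : (I.e i).2 = y := by
        rw [π.place_eq, π.place_eq] at hy1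
        exact Fin.ext (by omega)
      rw [← hyv, I.len_eq i] at hy2
      refine hy2.trans ?_
      gcongr
      omega
  refine wdist_le_of_edges (by omega) (fun x y hxy => ?_) u v
  obtain ⟨hG', hx, hy⟩ := hxy
  rw [← SimpleGraph.mem_edgeSet, ← I.e_range] at hG'
  obtain ⟨i, hi⟩ := hG'
  dsimp only at hi
  rcases Sym2.eq_iff.1 hi with ⟨rfl, rfl⟩ | ⟨rfl, rfl⟩
  · exact main i hx hy
  · have hsymm : wdist (removeVerts (I.outGraph out) F) I.w (I.e i).2 (I.e i).1 ≤
        wdist (removeVerts (I.outGraph out) F) I.w (I.e i).1 (I.e i).2 := by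
      refine le_iInf fun p => iInf_le_of_le p.reverse ?_
      rw [SimpleGraph.Walk.edges_reverse, List.map_reverse, List.sum_reverse]
    rw [Sym2.eq_swap]
    exact hsymm.trans (main i hy hx)

/-! ## The size of the parameters -/

section

variable {D₀ n m f k : ℕ} {π : Param}

theorem ParamOK.good (h : ParamOK D₀ n m f k π) (hf : 1 ≤ f) : π.Good := by
  have hD := h.D1
  have hfD : 0 < f * π.D := Nat.mul_pos hf hD
  have hq := h.lt_q
  rw [mul_assoc] at hq
  refine ⟨h.prime, ?_, ?_, ?_, hD⟩ <;> rcases h.sA with ⟨-, h1, h2⟩ | ⟨-, h1, h2⟩ <;> omega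

theorem ParamOK.deg_le (h : ParamOK D₀ n m f k π) (hf : 1 ≤ f) : π.D ≤ Nat.log 2 n + 1 := by
  rcases h.Dn with h1 | h1
  · omega
  · have h2 : 2 ^ (π.D - 1) ≤ n := (Nat.pow_le_pow_left (by omega) _).trans h1.le
    have h3 := Nat.le_log_of_pow_le (by norm_num) h2
    omega

theorem ParamOK.le_pow (h : ParamOK D₀ n m f k π) : n ≤ π.q ^ π.D := by
  refine h.nD.trans (Nat.pow_le_pow_left ?_ _)
  have h1 : f * 1 ≤ f * π.D := Nat.mul_le_mul_left _ h.D1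
  have h2 := h.lt_q
  rw [mul_assoc] at h2
  omega

/-- Three quarters of the seeds separate two vertices from `f` other ones. -/
theorem ParamOK.coll_small (h : ParamOK D₀ n m f k π) (hf : 1 ≤ f) :
    4 * ((2 * f + 1) * (π.A * (π.D - 1) + π.q * (2 * (π.s - 1)))) ≤ 3 * π.seeds := by
  have hD := h.D1
  have hq := h.lt_q
  -- The constant 24 in the choice of `q` leaves room: the left side is at most `36 f D`, while the
  -- right side is at least `72 f D`.
  have h1 : 4 * ((2 * f + 1) * (3 * (π.D - 1))) ≤ 3 * (π.q - 1) := by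
    have h2 : (2 * f + 1) * (π.D - 1) ≤ 3 * f * (π.D - 1) := Nat.mul_le_mul_right _ (by omega)
    have h3 : 3 * f * (π.D - 1) ≤ 3 * f * π.D := Nat.mul_le_mul_left _ (by omega)
    have h4 : 4 * ((2 * f + 1) * (3 * (π.D - 1))) = 12 * ((2 * f + 1) * (π.D - 1)) := by ring
    have h5 : 24 * f * π.D = 8 * (3 * f * π.D) := by ring
    omega
  unfold Param.seeds
  rcases h.sA with ⟨-, hs, hA⟩ | ⟨-, hs, hA⟩
  · rw [hs, hA]
    have h2 : (2 * f + 1) * (π.D - 1) ≤ (2 * f + 1) * (3 * (π.D - 1)) :=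
      Nat.mul_le_mul_left _ (by omega)
    simp only [one_mul, mul_one, Nat.sub_self, mul_zero, add_zero]
    omega
  · rw [hs, hA]
    have h2 : (π.q - 1) * (π.D - 1) ≤ π.q * (π.D - 1) := Nat.mul_le_mul_right _ (by omega)
    calc 4 * ((2 * f + 1) * ((π.q - 1) * (π.D - 1) + π.q * (2 * (π.D - 1))))
        ≤ 4 * ((2 * f + 1) * (π.q * (π.D - 1) + π.q * (2 * (π.D - 1)))) := by gcongr
      _ = π.q * (4 * ((2 * f + 1) * (3 * (π.D - 1)))) := by ring
      _ ≤ π.q * (3 * (π.q - 1)) := Nat.mul_le_mul_left _ h1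
      _ = 3 * (π.q * (π.q - 1)) := by ring

/-- Rounding merges `s ≤ D` values, for which the factor `D` in `q` compensates; the remaining term
`f s ≤ f D` is below `n`. Hence classes have size `O(n/f)`. -/
theorem ParamOK.mul_cap_le (h : ParamOK D₀ n m f k π) (hf : 1 ≤ f) (hfn : f < n) :
    f * π.cap ≤ 2 * n := by
  have hD := h.D1
  have hq := h.lt_q
  have h1 := mul_deg_lt hf hfn h.D1 h.Dn
  have h2 : f * π.s ≤ f * π.D :=
    Nat.mul_le_mul_left _ (by rcases h.sA with ⟨-, hs, -⟩ | ⟨-, hs, -⟩ <;> omega)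
  have h3 : f * π.D ≤ π.q := by rw [mul_assoc] at hq; omega
  have h4 : f * π.s * (n / π.q) ≤ π.q * (n / π.q) := Nat.mul_le_mul_right _ (by omega)
  have h5 := Nat.mul_div_le n π.q
  unfold Param.cap
  rw [h.n_eq]
  have h6 : f * (π.s * (n / π.q + 1)) = f * π.s * (n / π.q) + f * π.s := by ring
  omega

/-- Without rounding the factor `D` in `q` is at most the constant `D₀`; otherwise the division by
`s = D` removes it. -/
theorem ParamOK.buckets_le (h : ParamOK D₀ n m f k π) (hf : 1 ≤ f) :
    π.buckets ≤ 49 * f * (D₀ + 1) := by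
  have hD := h.D1
  have hq := h.q_le
  unfold Param.buckets
  rcases h.sA with ⟨h1, hs, -⟩ | ⟨-, hs, -⟩
  · rw [hs, Nat.div_one]
    have h2 : f * π.D ≤ f * D₀ := Nat.mul_le_mul_left _ h1
    have h3 : 2 * (24 * f * π.D) = 48 * (f * π.D) := by ring
    have h4 : 49 * f * (D₀ + 1) = 49 * (f * D₀) + 49 * f := by ring
    omega
  · rw [hs]
    have h2 : (π.q - 1) / π.D ≤ 48 * f := by
      refine Nat.div_le_of_le_mul ?_
      have : 2 * (24 * f * π.D) = π.D * (48 * f) := by ring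
      omega
    have h3 : 49 * f * 1 ≤ 49 * f * (D₀ + 1) := Nat.mul_le_mul_left _ (by omega)
    omega

theorem ParamOK.q_le_log (h : ParamOK D₀ n m f k π) (hf : 1 ≤ f) :
    π.q ≤ 48 * (f * (Nat.log 2 n + 2)) := by
  have h1 := h.deg_le hf
  have h2 : f * π.D ≤ f * (Nat.log 2 n + 2) := Nat.mul_le_mul_left _ (by omega)
  have h3 := h.q_le
  have h4 : 2 * (24 * f * π.D) = 48 * (f * π.D) := by ring
  omega

theorem ParamOK.seeds_le (h : ParamOK D₀ n m f k π) (hf : 1 ≤ f) :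
    π.seeds ≤ (48 * (f * (Nat.log 2 n + 2))) ^ 2 := by
  have h1 := h.q_le_log hf
  have h2 := (h.good hf).Aq
  rw [pow_two]
  exact Nat.mul_le_mul h1 (h2.le.trans h1)

theorem ParamOK.seeds_le_of_deg_le (h : ParamOK D₀ n m f k π) (hf : 1 ≤ f) (hD : π.D ≤ D₀) :
    π.seeds ≤ 48 * (f * (Nat.log 2 n + 2)) := by
  have h1 := h.q_le_log hf
  unfold Param.seeds
  rcases h.sA with ⟨-, -, hA⟩ | ⟨h2, -, -⟩
  · rw [hA, mul_one]; exact h1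
  · omega

/-- The factor `f` that the number of buckets brings into the count of joined pairs cancels against
the component size `O(n/f)`, which leaves `n ^ 2`. The prime search, quadratic in `f D < n`, is
absorbed as well. -/
theorem ParamOK.stepBound_le (h : ParamOK D₀ n m f k π) (hf : 1 ≤ f) (hfn : f < n)
    (hm : m ≤ n * n) {t l : ℕ} (ht : 1 ≤ t) (hl : l ≤ t * (π.seeds * π.n * π.buckets)) :
    stepBound π f (8 * l * ((π.K + 1) * (2 * π.cap))) ≤
      1000000 * (D₀ + 1) * (Nat.log 2 n + 2) ^ 2 * (π.seeds * (t * n ^ 2 + m)) := by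
  obtain ⟨k', hK, hk'⟩ := h.K
  have hG := h.good hf
  have hS : 1 ≤ π.seeds := Nat.mul_pos hG.prime.pos hG.A1
  have hDL := h.deg_le hf
  have hb := h.buckets_le hf
  have hc := h.mul_cap_le hf hfn
  unfold stepBound
  rw [h.n_eq] at hl ⊢
  rw [h.m_eq]
  set S := π.seeds
  have hL : Nat.log 2 (2 * m) ≤ 2 * (Nat.log 2 n + 2) := by
    rcases Nat.eq_zero_or_pos m with rfl | hm0
    · simp
    have h1 : n < 2 ^ (Nat.log 2 n + 1) := Nat.lt_pow_succ_log_self (by norm_num) n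
    have h2 : n * n < 2 ^ (Nat.log 2 n + 1) * 2 ^ (Nat.log 2 n + 1) := Nat.mul_lt_mul'' h1 h1
    refine (Nat.log_lt_of_lt_pow (by omega) ?_).le
    have h3 : 2 ^ (2 * (Nat.log 2 n + 2)) =
        4 * (2 ^ (Nat.log 2 n + 1) * 2 ^ (Nat.log 2 n + 1)) := by ring
    omega
  have hK2 : π.K + 1 ≤ 2 * (Nat.log 2 n + 2) := by omega
  set L := Nat.log 2 n + 2 with hLe
  have hL1 : 1 ≤ L := by omega
  -- `X` and `Y` are the two terms of the target up to constants; every summand of the step bound is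
  -- compared with one of them.
  set X := L ^ 2 * (S * (t * n ^ 2)) with hX
  set Y := L ^ 2 * (S * m) with hY
  have hn1 : 1 ≤ n := by omega
  have hX1 : L ≤ X := calc
    L = L * 1 * (1 * (1 * 1 ^ 2)) := by ring
    _ ≤ L * L * (S * (t * n ^ 2)) := by gcongr
    _ = X := by rw [hX]; ring
  have hX2 : (f * π.D) ^ 2 ≤ X := calc
    (f * π.D) ^ 2 ≤ (n * L) ^ 2 := by gcongr; omega
    _ = L ^ 2 * (1 * (1 * n ^ 2)) := by ring
    _ ≤ X := by rw [hX]; gcongr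
  have hY1 : m ≤ Y := calc
    m = 1 ^ 2 * (1 * m) := by ring
    _ ≤ Y := by rw [hY]; gcongr
  have hY2 : m * L ≤ Y := calc
    m * L = L * 1 * (1 * m) := by ring
    _ ≤ L * L * (S * m) := by gcongr
    _ = Y := by rw [hY]; ring
  have hY3 : m * ((π.D + 1) * S) ≤ Y := calc
    m * ((π.D + 1) * S) ≤ m * (L * S) := by gcongr; omega
    _ = L * 1 * (S * m) := by ring
    _ ≤ L * L * (S * m) := by gcongr
    _ = Y := by rw [hY]; ring
  have hN : l * ((π.K + 1) * π.cap) ≤ 196 * (D₀ + 1) * X := calc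
    l * ((π.K + 1) * π.cap) ≤ t * (S * n * (49 * f * (D₀ + 1))) * (2 * L * π.cap) := by
      gcongr
      exact hl.trans (by gcongr)
    _ = 98 * (D₀ + 1) * (L * (S * (t * n))) * (f * π.cap) := by ring
    _ ≤ 98 * (D₀ + 1) * (L * (S * (t * n))) * (2 * n) := by gcongr
    _ = 196 * (D₀ + 1) * (L * 1 * (S * (t * n ^ 2))) := by ring
    _ ≤ 196 * (D₀ + 1) * (L * L * (S * (t * n ^ 2))) := by gcongr
    _ = 196 * (D₀ + 1) * X := by rw [hX]; ring
  have e1 : 1000000 * (D₀ + 1) * L ^ 2 * (S * (t * n ^ 2 + m)) =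
      1000000 * ((D₀ + 1) * X) + 1000000 * ((D₀ + 1) * Y) := by rw [hX, hY]; ring
  have e2 : 200 * (8 * l * ((π.K + 1) * (2 * π.cap))) = 3200 * (l * ((π.K + 1) * π.cap)) := by ring
  have e3 : 200 * (24 * f * π.D) ^ 2 = 115200 * (f * π.D) ^ 2 := by ring
  have e4 : m * (300 + 80 * Nat.log 2 (2 * m) + 5000 * (π.D + 1) * S) ≤
      300 * m + 160 * (m * L) + 5000 * (m * ((π.D + 1) * S)) := calc
    _ ≤ m * (300 + 80 * (2 * L) + 5000 * (π.D + 1) * S) := by gcongr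
    _ = _ := by ring
  have e5 : 1 * X ≤ (D₀ + 1) * X := Nat.mul_le_mul_right _ (by omega)
  have e6 : 1 * Y ≤ (D₀ + 1) * Y := Nat.mul_le_mul_right _ (by omega)
  have e7 : 196 * (D₀ + 1) * X = 196 * ((D₀ + 1) * X) := by ring
  rw [e1, e2, e3]
  omega

end

/-! ## The size and time bounds -/

/-- `(n/f)^(1/k)` -/
noncomputable def Input.ratio (I : Input) : ℝ := ((I.n : ℝ) / I.f) ^ (1 / (I.k : ℝ))

theorem Input.n_real_pos (I : Input) : (1 : ℝ) ≤ I.n := by exact_mod_cast I.n_pos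

theorem Input.f_real_pos (I : Input) : (1 : ℝ) ≤ I.f := by exact_mod_cast I.f_pos

/-- The two exponents `1/k` combine into `(n/f)^(1/k)`; all later estimates treat this ratio as a
single number. -/
theorem Input.rpow_mul_rpow (I : Input) (a b : ℕ) :
    (I.f : ℝ) ^ ((a : ℝ) - 1 / (I.k : ℝ)) * (I.n : ℝ) ^ ((b : ℝ) + 1 / (I.k : ℝ)) =
      (I.f : ℝ) ^ a * (I.n : ℝ) ^ b * I.ratio := by
  have hf := I.f_real_pos
  have hn := I.n_real_pos
  rw [Input.ratio, Real.div_rpow (by linarith) (by linarith), Real.rpow_sub (by linarith),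
    Real.rpow_add (by linarith), Real.rpow_natCast, Real.rpow_natCast]
  ring

theorem Input.sizeBound_eq (I : Input) : sizeBound I = I.f * I.n * I.ratio := by
  have := I.rpow_mul_rpow 1 1
  simpa [sizeBound] using this

theorem Input.timeBoundPoly_eq (I : Input) :
    timeBoundPoly I = I.f * I.n ^ 2 * I.ratio + I.m * I.f ^ 2 := by
  have := I.rpow_mul_rpow 1 2
  rw [timeBoundPoly, ← pow_one (I.f : ℝ), ← this]
  simp

theorem Input.timeBoundGeneral_eq (I : Input) :
    timeBoundGeneral I = I.f ^ 4 * I.n ^ 2 * I.ratio + I.m * I.f ^ 5 := by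
  have := I.rpow_mul_rpow 4 2
  rw [timeBoundGeneral, ← this]
  simp

theorem Input.ratio_nonneg (I : Input) : 0 ≤ I.ratio := Real.rpow_nonneg (by positivity) _

theorem Input.one_le_ratio (I : Input) (h : I.f ≤ I.n) : 1 ≤ I.ratio := by
  refine Real.one_le_rpow ?_ (by positivity)
  rw [one_le_div (by linarith [I.f_real_pos])]
  exact_mod_cast h

/-- A number `n/f ≤ 1` does not decrease when raised to the power `1/k ≤ 1`. Together with `m ≤ n²`
this allows all edges to be kept when `n ≤ f`. -/
theorem Input.n_le_mul_ratio (I : Input) (h : I.n ≤ I.f) : (I.n : ℝ) ≤ I.f * I.ratio := by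
  have hf := I.f_real_pos
  have hn := I.n_real_pos
  have h1 : (I.n : ℝ) / I.f ≤ I.ratio := by
    refine Real.self_le_rpow_of_le_one (by positivity) ?_ ?_
    · rw [div_le_one (by linarith)]; exact_mod_cast h
    · have : (1 : ℝ) ≤ I.k := by exact_mod_cast I.k_pos
      rw [div_le_one (by linarith)]; exact this
  rw [div_le_iff₀ (by linarith)] at h1
  linarith

theorem Input.one_le_mul_ratio (I : Input) : 1 ≤ I.f * I.ratio := by
  rcases le_total I.f I.n with h | h
  · exact one_le_mul_of_one_le_of_one_le I.f_real_pos (I.one_le_ratio h)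
  · exact I.n_real_pos.trans (I.n_le_mul_ratio h)

theorem Input.one_le_log (I : Input) : 1 ≤ Real.log ((I.n : ℝ) + 2) := by
  have hn := I.n_real_pos
  rw [Real.le_log_iff_exp_le (by linarith)]
  linarith [Real.exp_one_lt_d9]

theorem Input.natLog_le (I : Input) :
    ((Nat.log 2 I.n + 2 : ℕ) : ℝ) ≤ 4 * Real.log ((I.n : ℝ) + 2) := by
  have hn := I.n_real_pos
  have h1 : (2 : ℝ) ^ Nat.log 2 I.n ≤ I.n := by
    exact_mod_cast Nat.pow_log_le_self 2 (by have := I.n_pos; omega)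
  have h2 := Real.log_le_log (by positivity) (h1.trans (by linarith : (I.n : ℝ) ≤ I.n + 2))
  rw [Real.log_pow] at h2
  have h3 := Real.log_two_gt_d9
  have h4 := I.one_le_log
  have h5 : (0 : ℝ) ≤ Nat.log 2 I.n := by positivity
  push_cast
  nlinarith

/-- A natural number `t` close to the `min k L`-th root of `x`. -/
theorem Input.exists_root (I : Input) {x k' : ℕ} (hfn : I.f ≤ I.n)
    (hx : I.f * x ≤ 4 * I.n) (hk' : k' = min I.k (Nat.log 2 I.n + 2)) :
    ∃ t : ℕ, 1 ≤ t ∧ x < t ^ k' ∧ (t : ℝ) ≤ 5 * I.ratio := by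
  have hf := I.f_real_pos
  have hn := I.n_real_pos
  have hk0 := I.k_pos
  have hk1 : k' ≠ 0 := by omega
  have hr := I.one_le_ratio hfn
  have hxr : (x : ℝ) ≤ 4 * (I.n / I.f) := by
    rw [← mul_div_assoc, le_div_iff₀ (by linarith)]
    have : ((I.f * x : ℕ) : ℝ) ≤ ((4 * I.n : ℕ) : ℝ) := by exact_mod_cast hx
    push_cast at this
    linarith
  -- If `k` is not capped, this is the `k`-th root of `4n/f`. If it is capped by the logarithm, then
  -- `x ≤ 4 ^ k'`, so the root is at most `4`, and `ratio ≥ 1` suffices; capping costs only a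
  -- constant.
  have hroot : (x : ℝ) ^ (1 / (k' : ℝ)) ≤ 4 * I.ratio := by
    rcases le_total I.k (Nat.log 2 I.n + 2) with h | h
    · rw [min_eq_left h] at hk'
      subst hk'
      have hk2 : (1 : ℝ) ≤ I.k := by exact_mod_cast I.k_pos
      calc (x : ℝ) ^ (1 / (I.k : ℝ)) ≤ (4 * ((I.n : ℝ) / I.f)) ^ (1 / (I.k : ℝ)) :=
            Real.rpow_le_rpow (by positivity) hxr (by positivity)
        _ = 4 ^ (1 / (I.k : ℝ)) * I.ratio := by
            rw [Real.mul_rpow (by norm_num) (by positivity), Input.ratio]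
        _ ≤ 4 * I.ratio := by
            refine mul_le_mul_of_nonneg_right ?_ (by linarith)
            refine Real.rpow_le_self_of_one_le (by norm_num) ?_
            rw [div_le_one (by linarith)]; exact hk2
    · rw [min_eq_right h] at hk'
      have h1 : x ≤ 4 ^ k' := by
        have h2 : I.n < 2 ^ (Nat.log 2 I.n + 1) := Nat.lt_pow_succ_log_self (by norm_num) _
        have h3 : 1 * x ≤ I.f * x := Nat.mul_le_mul_right _ I.f_pos
        have h4 : 2 ^ (Nat.log 2 I.n + 1) * 4 = 2 ^ (k' + 1) := by rw [hk']; ring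
        have h5 : 2 ^ (k' + 1) ≤ 2 ^ (2 * k') := Nat.pow_le_pow_right (by norm_num) (by omega)
        rw [pow_mul] at h5
        norm_num at h5
        omega
      have h2 : (x : ℝ) ≤ 4 ^ k' := by exact_mod_cast h1
      calc (x : ℝ) ^ (1 / (k' : ℝ)) ≤ ((4 : ℝ) ^ k') ^ (1 / (k' : ℝ)) :=
            Real.rpow_le_rpow (by positivity) h2 (by positivity)
        _ = 4 := by rw [one_div, Real.pow_rpow_inv_natCast (by norm_num) hk1]
        _ ≤ 4 * I.ratio := by linarith
  -- Adding one after rounding down makes the power strictly exceed `x` and costs at most one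
  -- further `ratio`.
  refine ⟨⌊(x : ℝ) ^ (1 / (k' : ℝ))⌋₊ + 1, by omega, ?_, ?_⟩
  · have h1 := Nat.lt_floor_add_one ((x : ℝ) ^ (1 / (k' : ℝ)))
    have h2 := pow_lt_pow_left₀ h1 (by positivity) hk1
    rw [one_div, Real.rpow_inv_natCast_pow (by positivity) hk1, ← one_div] at h2
    exact_mod_cast h2
  · have h1 := Nat.floor_le (show (0 : ℝ) ≤ (x : ℝ) ^ (1 / (k' : ℝ)) by positivity)
    push_cast
    linarith

/-- The final guarantees: a spanner, its size, and the time. -/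
structure Input.Guarantee (I : Input) (D₀ t : ℕ) (out : List ℕ) : Prop where
  spanner : IsVFTSpanner I.f (2 * I.k - 1) I.G I.w (I.outGraph out)
  size : (out.length : ℝ) ≤ 1000 * (D₀ + 1) * sizeBound I
  general : (t : ℝ) ≤ 10 ^ 14 * (D₀ + 1) * polylog 4 I * timeBoundGeneral I
  poly : I.n ≤ I.f ^ D₀ → (t : ℝ) ≤ 10 ^ 14 * (D₀ + 1) * polylog 4 I * timeBoundPoly I

theorem Input.timeBoundPoly_le (I : Input) : timeBoundPoly I ≤ timeBoundGeneral I := by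
  have hf := I.f_real_pos
  have hr := I.ratio_nonneg
  rw [I.timeBoundPoly_eq, I.timeBoundGeneral_eq]
  have h1 : (I.f : ℝ) ≤ I.f ^ 4 := le_self_pow₀ hf (by norm_num)
  have h2 : (I.f : ℝ) ^ 2 ≤ I.f ^ 5 := pow_le_pow_right₀ hf (by norm_num)
  gcongr

theorem Input.one_le_polylog (I : Input) (d : ℕ) : 1 ≤ polylog d I := one_le_pow₀ I.one_le_log

theorem Input.isVFTSpanner_range (I : Input) :
    IsVFTSpanner I.f (2 * I.k - 1) I.G I.w (I.outGraph (List.range I.m)) := by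
  have hk := I.k_pos
  have h : I.outGraph (List.range I.m) = I.G := by
    rw [← SimpleGraph.edgeSet_inj, I.edgeSet_outGraph, ← I.e_range]
    ext x
    simp [eq_comm]
  refine ⟨I.outGraph_le _, fun u v F _ _ _ => ?_⟩
  rw [h]
  refine le_mul_of_one_le_left bot_le ?_
  exact_mod_cast (show 1 ≤ 2 * I.k - 1 by omega)

theorem Input.guarantee_range (I : Input) {D₀ t : ℕ} (h : I.m = 0 ∨ I.n ≤ I.f)
    (ht : t ≤ 100 * (I.m + 1)) : I.Guarantee D₀ t (List.range I.m) := by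
  have hf := I.f_real_pos
  have hn := I.n_real_pos
  have hr := I.ratio_nonneg
  have hfr := I.one_le_mul_ratio
  have hD : (0 : ℝ) ≤ D₀ := by positivity
  have hp := I.one_le_polylog 4
  have hpoly : (t : ℝ) ≤ 10 ^ 14 * (D₀ + 1) * polylog 4 I * timeBoundPoly I := by
    have h1 : (t : ℝ) ≤ 100 * (I.m + 1) := by exact_mod_cast ht
    have h2 : (I.m : ℝ) + 1 ≤ timeBoundPoly I := by
      rw [I.timeBoundPoly_eq]
      have h3 : (1 : ℝ) ≤ I.f ^ 2 := one_le_pow₀ hf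
      have h4 : (1 : ℝ) ≤ I.n ^ 2 := one_le_pow₀ hn
      have h5 : (I.m : ℝ) * 1 ≤ I.m * I.f ^ 2 := by gcongr
      have h6 := one_le_mul_of_one_le_of_one_le hfr h4
      linarith
    have h3 : (100 : ℝ) ≤ 10 ^ 14 * (D₀ + 1) * polylog 4 I := by
      have : (1 : ℝ) ≤ (D₀ + 1) * polylog 4 I :=
        one_le_mul_of_one_le_of_one_le (by linarith) hp
      nlinarith
    refine h1.trans ?_
    gcongr
  refine ⟨I.isVFTSpanner_range, ?_, hpoly.trans ?_, fun _ => hpoly⟩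
  · rw [List.length_range, I.sizeBound_eq]
    have h1 : (I.m : ℝ) ≤ I.f * I.n * I.ratio := by
      rcases h with h | h
      · rw [h]; push_cast; positivity
      · have h2 := I.n_le_mul_ratio h
        have h3 : (I.m : ℝ) ≤ I.n * I.n := by exact_mod_cast I.m_le
        nlinarith
    have h2 : (1 : ℝ) ≤ 1000 * (D₀ + 1) := by linarith
    exact h1.trans (le_mul_of_one_le_left (by positivity) h2)
  · have := I.timeBoundPoly_le
    gcongr

/-- All bounds pass through one natural number `r = O((n/f)^(1/k))` whose `k'`-th power exceeds the
class size. The size is then `O(r * n * buckets)`, and the time is `seeds * (r * n ^ 2 + m)` up to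
logarithms, so the two time bounds differ only in the estimate of `seeds`. -/
theorem Input.Result.guarantee {I : Input} {D₀ t : ℕ} {out : List ℕ} (hD₀ : 1 ≤ D₀)
    (h : I.Result D₀ t out) : I.Guarantee D₀ t out := by
  rcases h with ⟨h, rfl, ht⟩ | ⟨-, hfn, π, E, hπ, hgr, ht⟩
  · exact I.guarantee_range h ht
  have hf := I.f_pos
  have hG := hπ.good hf
  have hen := I.ends_spec hπ.n_eq hπ.m_eq
  obtain ⟨k', hK, hk'⟩ := hπ.K
  have hk0 := I.k_pos
  have hcap := hπ.mul_cap_le hf hfn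
  obtain ⟨r, hr1, hrk, hr⟩ := I.exists_root (x := 2 * π.cap) hfn.le
    (by have : I.f * (2 * π.cap) = 2 * (I.f * π.cap) := by ring
        omega) hk'
  have hE := hgr.length_pairs hG hen (by omega) hK hrk
  have hout := hgr.length_out_le hG hen (by omega) hK hrk
  have htS := (ht _ (fun b S hS => hgr.card_le hG hen b S hS)).trans
    (hπ.stepBound_le hf hfn I.m_le hr1 hE)
  rw [hπ.n_eq] at hout
  have hfR := I.f_real_pos
  have hnR := I.n_real_pos
  have hrat := I.ratio_nonneg
  have hlog := I.one_le_log
  have hL := I.natLog_le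
  have hbuck : (π.buckets : ℝ) ≤ 49 * I.f * (D₀ + 1) := by exact_mod_cast hπ.buckets_le hf
  have htR : (t : ℝ) ≤ 1000000 * (D₀ + 1) * ((Nat.log 2 I.n + 2 : ℕ) : ℝ) ^ 2 *
      (π.seeds * (r * I.n ^ 2 + I.m)) := by exact_mod_cast htS
  -- The exponent `i` is `1` when plain polynomials are used and `2` when a multiplier belongs to
  -- the seed. Two logarithms from the step bound and `i` from the seeds explain the power `4`.
  have hseeds : ∀ i : ℕ, i = 1 ∨ i = 2 → (π.seeds : ℝ) ≤
      (48 * (I.f * ((Nat.log 2 I.n + 2 : ℕ) : ℝ))) ^ i →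
      (t : ℝ) ≤ 10 ^ 14 * (D₀ + 1) * polylog 4 I *
        (I.f ^ i * I.n ^ 2 * I.ratio + I.m * I.f ^ i) := by
    intro i hi hs
    set l := Real.log ((I.n : ℝ) + 2) with hl
    have hli : l ^ (2 + i) ≤ polylog 4 I := pow_le_pow_right₀ hlog (by omega)
    have hci : (16 : ℝ) * 192 ^ i ≤ 16 * 192 ^ 2 := by
      gcongr
      · norm_num
      · omega
    calc (t : ℝ) ≤ 1000000 * (D₀ + 1) * ((Nat.log 2 I.n + 2 : ℕ) : ℝ) ^ 2 *
          (π.seeds * (r * I.n ^ 2 + I.m)) := htR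
      _ ≤ 1000000 * (D₀ + 1) * (4 * l) ^ 2 *
          ((48 * (I.f * (4 * l))) ^ i * (5 * I.ratio * I.n ^ 2 + 5 * I.m)) := by
        have hm : (I.m : ℝ) ≤ 5 * I.m := by
          have : (0 : ℝ) ≤ I.m := by positivity
          linarith
        gcongr
        exact hs.trans (by gcongr)
      _ = 5000000 * (D₀ + 1) * (16 * 192 ^ i) * l ^ (2 + i) *
          (I.f ^ i * I.n ^ 2 * I.ratio + I.m * I.f ^ i) := by
        rw [pow_add, show 48 * (I.f * (4 * l)) = 192 * (I.f * l) by ring, mul_pow, mul_pow, mul_pow]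
        ring
      _ ≤ 5000000 * (D₀ + 1) * (16 * 192 ^ 2) * polylog 4 I *
          (I.f ^ i * I.n ^ 2 * I.ratio + I.m * I.f ^ i) := by gcongr
      _ ≤ 10 ^ 14 * (D₀ + 1) * polylog 4 I *
          (I.f ^ i * I.n ^ 2 * I.ratio + I.m * I.f ^ i) := by
        have hp := I.one_le_polylog 4
        gcongr ?_ * polylog 4 I * _
        have : (0 : ℝ) ≤ D₀ := by positivity
        linarith
  refine ⟨?_, ?_, ?_, ?_⟩
  · refine hgr.isVFTSpanner hG hπ.n_eq hπ.m_eq hK (by omega) (fun x y hx hy hxy => ?_)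
      (hπ.coll_small hf)
    have hnq := hπ.le_pow
    exact Param.coll_le hG.prime hG.s1 hG.A1 hG.Aq (by omega) (by omega) hxy
  · rw [I.sizeBound_eq]
    have h1 : (out.length : ℝ) ≤ 4 * r * (I.n * π.buckets) := by exact_mod_cast hout
    calc (out.length : ℝ) ≤ 4 * r * (I.n * π.buckets) := h1
      _ ≤ 4 * (5 * I.ratio) * (I.n * (49 * I.f * (D₀ + 1))) := by gcongr
      _ = 980 * (D₀ + 1) * (I.f * I.n * I.ratio) := by ring
      _ ≤ 1000 * (D₀ + 1) * (I.f * I.n * I.ratio) := by gcongr; norm_num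
  · have h1 := hseeds 2 (Or.inr rfl) (by exact_mod_cast hπ.seeds_le hf)
    have h2 : (I.f : ℝ) ^ 2 ≤ I.f ^ 4 := pow_le_pow_right₀ hfR (by norm_num)
    have h3 : (I.f : ℝ) ^ 2 ≤ I.f ^ 5 := pow_le_pow_right₀ hfR (by norm_num)
    have hp := I.one_le_polylog 4
    rw [I.timeBoundGeneral_eq]
    refine h1.trans ?_
    gcongr
  · intro hnf
    -- Since `D` is the least degree with `(2f)^D ≥ n`, it cannot exceed an exponent that already
    -- works for `f` in place of `2f`.
    have hD : π.D ≤ D₀ := by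
      by_contra! hD
      rcases hπ.Dn with h1 | h1
      · omega
      · have h2 : I.f ^ D₀ ≤ (2 * I.f) ^ (π.D - 1) :=
          (Nat.pow_le_pow_left (by omega) _).trans (Nat.pow_le_pow_right (by omega) (by omega))
        omega
    have h1 := hseeds 1 (Or.inl rfl) (by
      rw [pow_one]; exact_mod_cast hπ.seeds_le_of_deg_le hf hD)
    have h3 : (I.f : ℝ) ≤ I.f ^ 2 := le_self_pow₀ hfR (by norm_num)
    have hp := I.one_le_polylog 4
    rw [pow_one] at h1
    rw [I.timeBoundPoly_eq]
    refine h1.trans ?_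
    gcongr

/-- The word length that the program for `D₀` asks for. -/
theorem Input.words_suffice (I : Input) (D₀ : ℕ) :
    64 * (2400 * (I.n * I.n)) ^ 12 ≤ (I.n + 2) ^ (D₀ + 200) ∧
      D₀ + 1 < (I.n + 2) ^ (D₀ + 200) := by
  have h2 : 2 ≤ I.n + 2 := by omega
  constructor
  · calc 64 * (2400 * (I.n * I.n)) ^ 12 ≤ 2 ^ 6 * (2 ^ 12 * ((I.n + 2) * (I.n + 2))) ^ 12 := by
          gcongr <;> norm_num
      _ = 2 ^ 150 * (I.n + 2) ^ 24 := by ring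
      _ ≤ (I.n + 2) ^ 150 * (I.n + 2) ^ 24 := by gcongr
      _ = (I.n + 2) ^ 174 := by rw [← pow_add]
      _ ≤ (I.n + 2) ^ (D₀ + 200) := Nat.pow_le_pow_right (by omega) (by omega)
  · calc D₀ + 1 < 2 ^ (D₀ + 1) := Nat.lt_two_pow_self
      _ ≤ 2 ^ (D₀ + 200) := Nat.pow_le_pow_right (by norm_num) (by omega)
      _ ≤ (I.n + 2) ^ (D₀ + 200) := Nat.pow_le_pow_left h2 _

-- With `D₀ = ⌈1/c⌉` the condition `n^c ≤ f` yields `n ≤ f^D₀`, so that plain polynomials are used.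
-- One program serves both regimes; `D₀` enters the required word length because the program
-- contains the constant `D₀ + 1`.
open Classical in
theorem spannerProg_constructs {c : ℝ} (hc : 0 < c) :
    ConstructsSpanners (spannerProg ⌈1 / c⌉₊) (⌈1 / c⌉₊ + 200)
      (fun I => 1000 * (⌈1 / c⌉₊ + 1) * sizeBound I)
      (fun I => 10 ^ 14 * (⌈1 / c⌉₊ + 1) * polylog 4 I *
        (if (I.n : ℝ) ^ c ≤ (I.f : ℝ) then timeBoundPoly I else timeBoundGeneral I)) := by
  intro I W hW hf hk
  set D₀ := ⌈1 / c⌉₊ with hD₀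
  have hD1 : 1 ≤ D₀ := Nat.one_le_ceil_iff.2 (by positivity)
  obtain ⟨hw1, hw2⟩ := I.words_suffice D₀
  obtain ⟨t, s, out, hex, hs0, hs1, hmem, t', htt, hres⟩ :=
    spannerProg_exec I (hw1.trans hW) (hw2.trans_le hW) hf hk
  have hlt : ∀ e ∈ out, e < I.m := by
    rcases hres with ⟨-, rfl, -⟩ | ⟨-, -, π, E, hπ, hgr, -⟩
    · exact fun e he => List.mem_range.1 he
    · exact fun e he => Finset.mem_range.1 (hgr.out_subset.1 e he)
  have hg := hres.guarantee hD1
  have htR : (t : ℝ) ≤ t' := by exact_mod_cast htt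
  refine ⟨t, s, I.outGraph out, hex, ⟨?_, ?_⟩, hg.spanner, ?_, ?_⟩
  · intro j hj
    rw [hs0] at hj
    rw [hs1, hmem j hj]
    exact hlt _ (List.getElem_mem hj)
  · rw [I.edgeSet_outGraph]
    ext x
    constructor
    · rintro ⟨i, hi, rfl⟩
      obtain ⟨j, hj, hji⟩ := List.getElem_of_mem hi
      exact ⟨j, by rw [hs0]; exact hj, i, by rw [hs1, hmem j hj, hji], rfl⟩
    · rintro ⟨j, hj, i, hji, rfl⟩
      rw [hs0] at hj
      rw [hs1, hmem j hj] at hji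
      exact ⟨i, hji ▸ List.getElem_mem hj, rfl⟩
  · refine le_trans ?_ hg.size
    exact_mod_cast I.ncard_outGraph_le out
  · refine htR.trans ?_
    dsimp only
    split_ifs with h
    · refine hg.poly ?_
      have hfR := I.f_real_pos
      have hnR := I.n_real_pos
      have h1 : (I.n : ℝ) ≤ (I.f : ℝ) ^ (1 / c) := by
        have hn0 : (0 : ℝ) ≤ I.n := Nat.cast_nonneg _
        have := Real.rpow_le_rpow (Real.rpow_nonneg hn0 c) h (one_div_pos.2 hc).le
        rwa [← Real.rpow_mul hn0, mul_one_div_cancel hc.ne', Real.rpow_one] at this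
      have h2 : (I.f : ℝ) ^ (1 / c) ≤ (I.f : ℝ) ^ ((D₀ : ℕ) : ℝ) :=
        Real.rpow_le_rpow_of_exponent_le hfR (Nat.le_ceil _)
      rw [Real.rpow_natCast] at h2
      exact_mod_cast h1.trans h2
    · exact hg.general

end VFTSpanner

open VFTSpanner in
theorem theorem2 :
    (∃ (P : Prog) (b d : ℕ) (C : ℝ),
      ConstructsSpanners P b (fun I => C * sizeBound I)
        (fun I => C * polylog d I * timeBoundGeneral I)) ∧
    (∃ d : ℕ, ∀ c : ℝ, 0 < c → ∃ (P : Prog) (b : ℕ) (C : ℝ),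
      ConstructsSpanners P b (fun I => C * sizeBound I)
        (fun I => C * polylog d I *
          (open Classical in
            if (I.n : ℝ) ^ c ≤ (I.f : ℝ) then timeBoundPoly I else timeBoundGeneral I))) := by
  -- The first claim is the instance `c = 1` of the second one, since `timeBoundPoly` never exceeds
  -- `timeBoundGeneral`; the sign of `C` is recorded for this comparison.
  have key : ∃ d : ℕ, ∀ c : ℝ, 0 < c → ∃ (P : Prog) (b : ℕ) (C : ℝ), 0 ≤ C ∧
      ConstructsSpanners P b (fun I => C * sizeBound I)
        (fun I => C * polylog d I *
          (open Classical in
            if (I.n : ℝ) ^ c ≤ (I.f : ℝ) then timeBoundPoly I else timeBoundGeneral I)) := by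
    refine ⟨4, fun c hc => ⟨spannerProg ⌈1 / c⌉₊, ⌈1 / c⌉₊ + 200,
      10 ^ 14 * (⌈1 / c⌉₊ + 1), by positivity, fun I W hW hf hk => ?_⟩⟩
    obtain ⟨t, s, H, h1, h2, h3, h4, h5⟩ := spannerProg_constructs hc I W hW hf hk
    refine ⟨t, s, H, h1, h2, h3, h4.trans ?_, h5⟩
    have hs : 0 ≤ sizeBound I := by unfold sizeBound; positivity
    dsimp only
    gcongr
    norm_num
  obtain ⟨d, h⟩ := key
  refine ⟨?_, d, fun c hc => ?_⟩
  · obtain ⟨P, b, C, hC, hP⟩ := h 1 one_pos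
    refine ⟨P, b, d, C, fun I W hW hf hk => ?_⟩
    obtain ⟨t, s, H, h1, h2, h3, h4, h5⟩ := hP I W hW hf hk
    refine ⟨t, s, H, h1, h2, h3, h4, h5.trans ?_⟩
    have hp := zero_le_one.trans (I.one_le_polylog d)
    dsimp only
    refine mul_le_mul_of_nonneg_left ?_ (mul_nonneg hC hp)
    split_ifs
    · exact I.timeBoundPoly_le
    · exact le_rfl
  · obtain ⟨P, b, C, -, hP⟩ := h c hc
    exact ⟨P, b, C, hP⟩
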